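/- Consider the following randomized backtracking procedure (DPLL-GUC) deciding whether a graph $G$ on $N$ vertices is properly 3-colorable. Initially every vertex has the list of all 3 colors. At each node of the search tree: if some remaining vertex has an empty list (contradiction), the node is a leaf and the procedure backtracks; if no vertex remains (a proper coloring is found), the node is a leaf and the procedure halts; otherwise a vertex $v$ is chosen uniformly at random among the remaining vertices with the smallest number $j$ of available colors, $v$ is removed, and the procedure branches successively, in any prescribed order, to the $j$ color assignments of $v$, where assigning a color to $v$ removes this color from the lists of the neighbors of $v$. The size of the search tree is the number of nodes built before the procedure stops. For $c>0$ and $0<t<1$ let $$h_c(t)=\frac c6t^2-\frac c3t-(1-t)\ln 2+\ln\left(3-e^{-2ct/3}\right),\qquad \omega^h(c)=\sup_{0<t<1}h_c(t).$$ The equation $\omega^h(c)+\frac c6=2\ln 3$ has exactly one root $c^h_u$ in $(0,\infty)$, and $c_u^h=13.1538\ldots$. For every $c>c^h_u$ the supremum is attained, i.e. $\omega^h(c)=\max_{0<t<1}h_c(t)$, and, whatever the order in which the colors are tried, the expected size of the DPLL-GUC search tree on a random graph drawn from $G(N,c/N)$ (each pair of the $N$ vertices is an edge independently with probability $c/N$)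 is $$e^{N\omega^h(c)+o(N)}\qquad(N\to\infty);$$ the same holds for the expected number of leaves of the tree. -/

import Mathlib

/-! Random 3-colouring solved by backtracking on lists of available colours. -/

namespace Dpll

open MeasureTheory Filter Asymptotics
open scoped ENNReal Topology

/-- The three colours. -/
abbrev Color : Type := Fin 3

/-- A residual instance of the 3-colouring problem for a graph on `Fin N`: the set of vertices
that have not been coloured (removed) yet, and the list of available colours of each vertex.
The lists of removed vertices play no role. -/
@[ext] structure Residual (N : ℕ) where
  /-- the vertices that are left -/
  left : Finset (Fin N)
  /-- the list of colours that are still available to a vertex -/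
  avail : Fin N → Finset Color

namespace Residual

variable {N : ℕ}

/-- The initial instance: no vertex is removed, every vertex has all three colours. -/
def initial (N : ℕ) : Residual N where
  left := Finset.univ
  avail := fun _ => Finset.univ

/-- A contradiction: some remaining vertex has no colour left. -/
def Contradiction (s : Residual N) : Prop :=
  ∃ v ∈ s.left, s.avail v = ∅

/-- The remaining vertices whose number of available colours is smallest. -/
def shortest (s : Residual N) : Finset (Fin N) :=
  s.left.filter fun v => ∀ w ∈ s.left, (s.avail v).card ≤ (s.avail w).card

open Classical in
/-- Give colour `k` to the vertex `v`: remove `v`, and remove `k` from the lists of the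
neighbours of `v`. -/
noncomputable def assign (G : SimpleGraph (Fin N)) (s : Residual N) (v : Fin N) (k : Color) :
    Residual N where
  left := s.left.erase v
  avail := fun w => if G.Adj v w then (s.avail w).erase k else s.avail w

theorem shortest_nonempty (s : Residual N) (h : s.left.Nonempty) : s.shortest.Nonempty := by
  obtain ⟨v, hv, hmin⟩ := s.left.exists_min_image (fun v => (s.avail v).card) h
  exact ⟨v, Finset.mem_filter.2 ⟨hv, hmin⟩⟩

theorem card_left_assign_lt (G : SimpleGraph (Fin N)) (s : Residual N) {v : Fin N}
    (hv : v ∈ s.shortest) (k : Color) : (s.assign G v k).left.card < s.left.card :=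
  Finset.card_erase_lt_of_mem (Finset.mem_filter.1 hv).1

end Residual

/-- A rule that fixes in which order the available colours of the selected vertex are tried.
It may depend on the graph, on the residual instance and on the vertex. -/
structure ColorOrder (N : ℕ) where
  /-- the colours of the list of `v`, in the order in which they are tried -/
  order : SimpleGraph (Fin N) → Residual N → Fin N → List Color
  /-- each available colour occurs exactly once, and no other colour occurs -/
  order_eq : ∀ G s v, (order G s v : Multiset Color) = (s.avail v).val

/-- What is recorded about a (sub)tree built by the procedure: whether a proper colouring was
found (and hence the procedure halted), the number of its nodes, the number of its leaves. -/
@[ext] structure Outcome where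
  /-- a proper colouring was found -/
  found : Bool
  /-- the number of nodes that were built -/
  nodes : ℕ
  /-- the number of leaves (contradictions, or the proper colouring) that were built -/
  leaves : ℕ

/-- Visit the branches in a given order, and stop after the first one in which a proper
colouring was found; `f k` builds the subtree of the branch `k`. -/
noncomputable def tryBranches (f : Color → PMF Outcome) : List Color → PMF Outcome
  | [] => PMF.pure ⟨false, 0, 0⟩
  | k :: ks => (f k).bind fun o =>
      if o.found then PMF.pure o
      else (tryBranches f ks).map fun r => ⟨r.found, o.nodes + r.nodes, o.leaves + r.leaves⟩

open Classical in
/-- The decision procedure DPLL-GUC, started on the residual instance `s` of the graph `G`: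
* a vertex without available colour is left: contradiction leaf, backtrack;
* no vertex is left: a proper colouring is found, halt;
* otherwise a vertex is drawn uniformly at random (afresh at every node of the tree) among those
  with the smallest number of available colours, and the procedure branches successively on its
  available colours. -/
noncomputable def dpll {N : ℕ} (G : SimpleGraph (Fin N)) (ord : ColorOrder N)
    (s : Residual N) : PMF Outcome :=
  if s.Contradiction then PMF.pure ⟨false, 1, 1⟩
  else if h : s.left.Nonempty then
    haveI : Nonempty {v // v ∈ s.shortest} := (s.shortest_nonempty h).to_subtype
    (PMF.uniformOfFintype {v // v ∈ s.shortest}).bind fun v =>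
      (tryBranches (fun k => dpll G ord (s.assign G v.1 k)) (ord.order G s v.1)).map
        fun o => ⟨o.found, o.nodes + 1, o.leaves⟩
  else PMF.pure ⟨true, 1, 1⟩
termination_by s.left.card
decreasing_by exact s.card_left_assign_lt G v.2 k

/-- The edge probability `c / N`, cut off at `0` and `1`. -/
noncomputable def edgeProb (c : ℝ) (N : ℕ) : unitInterval :=
  Set.projIcc 0 1 zero_le_one (c / N)

/-- The expectation of a quantity `X` of the search tree of DPLL-GUC, over the random graph
`G(N, c/N)` and over the random choices of the procedure. -/
noncomputable def expected (X : Outcome → ℕ) (c : ℝ) (N : ℕ) (ord : ColorOrder N) : ℝ≥0∞ :=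
  ∫⁻ G, ∑' o, dpll G ord (Residual.initial N) o * (X o : ℝ≥0∞)
    ∂(SimpleGraph.binomialRandom (Fin N) (edgeProb c N))

/-- `a N = exp (ω N + o(N))` as `N → ∞`. -/
def IsExpRate (a : ℕ → ℝ≥0∞) (ω : ℝ) : Prop :=
  ∃ r : ℕ → ℝ, r =o[atTop] (fun N : ℕ => (N : ℝ)) ∧
    ∀ᶠ N : ℕ in atTop, a N = ENNReal.ofReal (Real.exp (N * ω + r N))

/-- The function of the reduced height `t` that is maximized. -/
noncomputable def exponent (c t : ℝ) : ℝ :=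
  c / 6 * t ^ 2 - c / 3 * t - (1 - t) * Real.log 2 + Real.log (3 - Real.exp (-(2 * c * t / 3)))

/-- The supremum of `exponent c t` over `0 < t < 1`. -/
noncomputable def omegaH (c : ℝ) : ℝ :=
  sSup (exponent c '' Set.Ioo 0 1)

end Dpll

/-! By deferred decisions the tree can be averaged over the graph while it is built: when a vertex
is removed, its edges to the remaining vertices are independent of everything used later
(`sum_wt_cost`). What is left is the recursion `mean` on residual instances, in which one step hits
every remaining vertex independently with probability `p = c / N` and deletes the assigned colour
from the lists of the vertices that are hit.

The value of this recursion can be guessed. Looking `n` levels ahead and putting `θ = p * n / 3`, a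
colour-balanced instance should have about `2 ^ n * exp (p * n ^ 2 / 6)` times a product of list
weights many descendants; a list of two colours weighs `exp (-θ)`, a list of one colour half as
much, a full list `tripleWt θ`. For the initial instance and `n = t * N` this is `exp (N * exponent
c t)`. The tree is dominated by its most populated height, hence the supremum over `t`.

Upper bound. The supremum of `pot` over `θ` is, up to factors `exp (ε * N)`, a supersolution of the
recursion; this is `unitBound`, by induction on the number of remaining vertices. Four obstacles are
met. The optimal `θ` moves with the instance: `rate` has a quadratic maximum (`exists_max_rate`), so
near a reference instance its `θ` may be kept at a price exponential in the lost list length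
(`pot_le_of_below`, `form`). The colours may be unbalanced: unit lists get colour-dependent weights,
which must pay for unit propagation and still add up correctly over the branches (`exists_tilt`).
Phases of unit propagation may be long: many unit lists of one colour are unlikely to be free of
conflicts (`unitFactor`). Without short lists there are three branches instead of two: `shortFactor`
compensates. All this needs at least `9 * N / 20` remaining vertices; the decision nodes below are
few by a first-moment bound (`mean_decisionAt_le_sum`), and decision nodes control all nodes
(`mean_one_le`).

Lower bound. The same product with exact level weights bounds the number of alive nodes from below
(`aliveBound`). Jensen's inequality for suitably tilted hits moves the analysis into the exponent,
where the deviation from the balanced trajectory is measured by `energy`; the uniform choice of the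
vertex acts as negative feedback (`avg_cross_nonpos`), so the energy stays small. On a graph that is
not colourable the procedure never halts early and every alive node of a level has a leaf of its own
(`one_le_ev_leaves`). Colourable graphs are removed at the price of `3 ^ N` times the expected
number of colourings, about `9 ^ N * exp (-c * N / 6)` (`le_expected_leaves`). This is negligible if
`omegaH c + c / 6 > 2 * log 3`, the origin of the threshold; the left side is continuous and
strictly increasing, and two numerical evaluations enclose the root (`exists_threshold`). -/

namespace Dpll

open MeasureTheory Filter Asymptotics
open scoped ENNReal Topology

/-! ### Independent edges and the principle of deferred decisions. -/

variable {N : ℕ}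

/-- The weight of a graph in the binomial random graph model with edge probability `p`. -/
noncomputable def wt (p : ℝ) (G : SimpleGraph (Fin N)) : ℝ :=
  p ^ G.edgeSet.ncard * (1 - p) ^ (N.choose 2 - G.edgeSet.ncard)

theorem wt_nonneg {p : ℝ} (h0 : 0 ≤ p) (h1 : p ≤ 1) (G : SimpleGraph (Fin N)) : 0 ≤ wt p G :=
  mul_nonneg (pow_nonneg h0 _) (pow_nonneg (sub_nonneg.2 h1) _)

open Classical in
theorem ncard_edgeSet_le (G : SimpleGraph (Fin N)) : G.edgeSet.ncard ≤ N.choose 2 := by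
  have := G.card_edgeFinset_le_card_choose_two
  rw [Fintype.card_fin] at this
  rwa [Set.ncard_eq_toFinset_card', Set.toFinset_card, ← SimpleGraph.edgeFinset_card]

/-- The odds `p / (1 - p)` of an edge, multiplied out so that `p = 1` needs no separate treatment.
-/
theorem wt_sup_edge (p : ℝ) {G : SimpleGraph (Fin N)} {v w : Fin N} (hvw : v ≠ w)
    (hG : ¬ G.Adj v w) : (1 - p) * wt p (G ⊔ SimpleGraph.edge v w) = p * wt p G := by
  have hE : (G ⊔ SimpleGraph.edge v w).edgeSet = insert s(v, w) G.edgeSet := by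
    rw [SimpleGraph.edgeSet_sup, SimpleGraph.edgeSet_edge_of_ne hvw, Set.union_singleton]
  have hc : (G ⊔ SimpleGraph.edge v w).edgeSet.ncard = G.edgeSet.ncard + 1 := by
    rw [hE, Set.ncard_insert_of_notMem (by simpa using hG)]
  have hle := ncard_edgeSet_le (G ⊔ SimpleGraph.edge v w)
  rw [hc] at hle
  unfold wt
  rw [hc]
  obtain ⟨m, hm⟩ := Nat.exists_eq_add_of_le hle
  have h1 : N.choose 2 - (G.edgeSet.ncard + 1) = m := by omega
  have h2 : N.choose 2 - G.edgeSet.ncard = m + 1 := by omega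
  rw [h1, h2]; ring

open Classical in
/-- One edge of the random graph is independent of the others. -/
theorem sum_wt_edge (p : ℝ) {v w : Fin N} (hvw : v ≠ w) (H : SimpleGraph (Fin N) → ℝ)
    (hH : ∀ G G' : SimpleGraph (Fin N),
      (∀ a b, s(a, b) ≠ s(v, w) → (G.Adj a b ↔ G'.Adj a b)) → H G = H G') :
    ∑ G, wt p G * (if G.Adj v w then H G else 0) = p * ∑ G, wt p G * H G := by
  -- Deleting and inserting the edge `vw` is a bijection between the graphs with and without it; `H`
  -- does not see this edge and the weights change by the odds.
  have hbij : ∑ G with G.Adj v w, (1 - p) * (wt p G * H G) =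
      ∑ G with ¬ G.Adj v w, p * (wt p G * H G) := by
    refine Finset.sum_bij' (fun G _ => G.deleteEdges {s(v, w)})
      (fun G _ => G ⊔ SimpleGraph.edge v w) ?_ ?_ ?_ ?_ ?_
    · intro G hG
      simp
    · intro G hG
      simp [SimpleGraph.edge_adj, hvw]
    · intro G hG
      have hG' : G.Adj v w := by simpa using hG
      ext a b
      simp only [SimpleGraph.sup_adj, SimpleGraph.deleteEdges_adj, SimpleGraph.edge_adj,
        Set.mem_singleton_iff]
      constructor
      · rintro (h | ⟨h1, h2⟩)
        · exact h.1
        · rcases h1 with ⟨rfl, rfl⟩ | ⟨rfl, rfl⟩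
          · exact hG'
          · exact hG'.symm
      · intro h
        by_cases h2 : s(a, b) = s(v, w)
        · right
          refine ⟨?_, h.ne⟩
          rcases Sym2.eq_iff.1 h2 with ⟨rfl, rfl⟩ | ⟨rfl, rfl⟩ <;> simp
        · exact Or.inl ⟨h, h2⟩
    · intro G hG
      have hG' : ¬ G.Adj v w := by simpa using hG
      ext a b
      simp only [SimpleGraph.sup_adj, SimpleGraph.deleteEdges_adj, SimpleGraph.edge_adj,
        Set.mem_singleton_iff]
      constructor
      · rintro ⟨h | ⟨h1, h2⟩, h3⟩
        · exact h
        · exact absurd (by rcases h1 with ⟨rfl, rfl⟩ | ⟨rfl, rfl⟩ <;> simp [Sym2.eq_swap]) h3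
      · intro h
        refine ⟨Or.inl h, fun h2 => ?_⟩
        rcases Sym2.eq_iff.1 h2 with ⟨rfl, rfl⟩ | ⟨rfl, rfl⟩
        · exact hG' h
        · exact hG' h.symm
    · intro G hG
      have hG' : G.Adj v w := by simpa using hG
      have hdel : G.deleteEdges {s(v, w)} ⊔ SimpleGraph.edge v w = G := by
        ext a b
        simp only [SimpleGraph.sup_adj, SimpleGraph.deleteEdges_adj, SimpleGraph.edge_adj,
          Set.mem_singleton_iff]
        constructor
        · rintro (h | ⟨h1, h2⟩)
          · exact h.1
          · rcases h1 with ⟨rfl, rfl⟩ | ⟨rfl, rfl⟩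
            · exact hG'
            · exact hG'.symm
        · intro h
          by_cases h2 : s(a, b) = s(v, w)
          · right
            refine ⟨?_, h.ne⟩
            rcases Sym2.eq_iff.1 h2 with ⟨rfl, rfl⟩ | ⟨rfl, rfl⟩ <;> simp
          · exact Or.inl ⟨h, h2⟩
      have h1 := wt_sup_edge p (G := G.deleteEdges {s(v, w)}) hvw (by simp)
      rw [hdel] at h1
      rw [← mul_assoc, h1, mul_assoc, hH G (G.deleteEdges {s(v, w)})]
      intro a b hab
      simp [SimpleGraph.deleteEdges_adj, hab]
  have hsplit : ∑ G, wt p G * H G = ∑ G with G.Adj v w, wt p G * H G +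
      ∑ G with ¬ G.Adj v w, wt p G * H G :=
    (Finset.sum_filter_add_sum_filter_not _ _ _).symm
  have hl : ∑ G, wt p G * (if G.Adj v w then H G else 0) = ∑ G with G.Adj v w, wt p G * H G := by
    rw [Finset.sum_filter]
    exact Finset.sum_congr rfl fun G _ => by split_ifs <;> simp
  rw [← Finset.mul_sum, ← Finset.mul_sum] at hbij
  rw [hl, hsplit]
  linarith

open Classical in
/-- The neighbourhood of a vertex `v` in `B` is independent of the edges that avoid `v`. -/
theorem sum_wt_nbhd (p : ℝ) {v : Fin N} (B A : Finset (Fin N)) (hv : v ∉ B)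
    (H : SimpleGraph (Fin N) → ℝ)
    (hH : ∀ G G' : SimpleGraph (Fin N),
      (∀ a b, a ≠ v → b ≠ v → (G.Adj a b ↔ G'.Adj a b)) → H G = H G') :
    ∑ G, wt p G * (if ∀ w ∈ B, (G.Adj v w ↔ w ∈ A) then H G else 0) =
      (∏ w ∈ B, if w ∈ A then p else 1 - p) * ∑ G, wt p G * H G := by
  induction B using Finset.induction_on with
  | empty => simp
  | insert w B hw ih =>
    rw [Finset.mem_insert, not_or] at hv
    rw [Finset.prod_insert hw, mul_assoc, ← ih hv.2]
    set H' : SimpleGraph (Fin N) → ℝ := fun G =>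
      if ∀ w ∈ B, (G.Adj v w ↔ w ∈ A) then H G else 0 with hH'
    have hinv : ∀ G G' : SimpleGraph (Fin N),
        (∀ a b, s(a, b) ≠ s(v, w) → (G.Adj a b ↔ G'.Adj a b)) → H' G = H' G' := by
      intro G G' h
      have h1 : H G = H G' := hH G G' fun a b ha hb => h a b (by
        simp [ha, hb])
      have h2 : (∀ w ∈ B, (G.Adj v w ↔ w ∈ A)) ↔ (∀ w ∈ B, (G'.Adj v w ↔ w ∈ A)) := by
        refine forall₂_congr fun u hu => ?_
        have huw : u ≠ w := fun h => hw (h ▸ hu)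
        rw [h v u (by simp [huw, hv.1])]
      simp only [hH', h1, h2]
    have key := sum_wt_edge p hv.1 H' hinv
    by_cases hwA : w ∈ A
    · rw [if_pos hwA, ← key]
      refine Finset.sum_congr rfl fun G _ => ?_
      congr 1
      simp only [hH', Finset.forall_mem_insert, hwA, iff_true]
      by_cases h1 : G.Adj v w <;> simp [h1]
    -- Non-adjacency is the complement of adjacency, so `sum_wt_edge` serves here as well.
    · rw [if_neg hwA]
      have : (1 - p) * ∑ G, wt p G * H' G =
          ∑ G, wt p G * H' G - ∑ G, wt p G * (if G.Adj v w then H' G else 0) := by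
        rw [key]; ring
      rw [this, ← Finset.sum_sub_distrib]
      refine Finset.sum_congr rfl fun G _ => ?_
      rw [← mul_sub]
      congr 1
      simp only [hH', Finset.forall_mem_insert, hwA, iff_false]
      by_cases h1 : G.Adj v w <;> simp [h1]

namespace Residual

/-- Remove the vertex `v`, and remove the colour `k` from the lists of the vertices of `A`. -/
def hit (s : Residual N) (v : Fin N) (k : Color) (A : Finset (Fin N)) : Residual N where
  left := s.left.erase v
  avail := fun w => if w ∈ A then (s.avail w).erase k else s.avail w

/-- Equality of residual instances up to the lists of removed vertices. -/
def Agree (s s' : Residual N) : Prop :=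
  s.left = s'.left ∧ ∀ w ∈ s.left, s.avail w = s'.avail w

theorem card_left_hit_lt (s : Residual N) {v : Fin N} (hv : v ∈ s.shortest) (k : Color)
    (A : Finset (Fin N)) : (s.hit v k A).left.card < s.left.card :=
  Finset.card_erase_lt_of_mem (Finset.mem_filter.1 hv).1

theorem Agree.contradiction {s s' : Residual N} (h : Agree s s') :
    s.Contradiction ↔ s'.Contradiction := by
  unfold Contradiction
  rw [← h.1]
  exact exists_congr fun v => and_congr_right fun hv => by rw [h.2 v hv]

theorem Agree.shortest {s s' : Residual N} (h : Agree s s') : s.shortest = s'.shortest := by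
  unfold Residual.shortest
  rw [← h.1]
  refine Finset.filter_congr fun v hv => forall₂_congr fun w hw => ?_
  rw [h.2 v hv, h.2 w hw]

theorem shortest_subset (s : Residual N) : s.shortest ⊆ s.left := Finset.filter_subset _ _

end Residual

/-- A quantity attached to residual instances that ignores the lists of removed vertices. -/
def Local (f : Residual N → ℝ) : Prop := ∀ s s', Residual.Agree s s' → f s = f s'

open Classical in
/-- The sum of `f` over the nodes of the search tree that does not halt when a proper colouring is
found, averaged over the random choices of the vertices. -/
noncomputable def cost (G : SimpleGraph (Fin N)) (f : Residual N → ℝ) (s : Residual N) : ℝ :=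
  f s + if s.Contradiction then 0 else
    (∑ v : {v // v ∈ s.shortest}, ∑ k ∈ s.avail v.1, cost G f (s.assign G v.1 k)) /
      s.shortest.card
termination_by s.left.card
decreasing_by exact s.card_left_assign_lt G v.2 k

open Classical in
theorem cost_eq (G : SimpleGraph (Fin N)) (f : Residual N → ℝ) (s : Residual N) :
    cost G f s = f s + if s.Contradiction then 0 else
      (∑ v ∈ s.shortest, ∑ k ∈ s.avail v, cost G f (s.assign G v k)) / s.shortest.card := by
  rw [cost, Finset.sum_coe_sort s.shortest
    (fun v => ∑ k ∈ s.avail v, cost G f (s.assign G v k))]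

open Classical in
/-- The expectation of `cost` over the random graph with edge probability `p`. -/
noncomputable def mean (p : ℝ) (f : Residual N → ℝ) (s : Residual N) : ℝ :=
  f s + if s.Contradiction then 0 else
    (∑ v : {v // v ∈ s.shortest}, ∑ k ∈ s.avail v.1, ∑ A ∈ (s.left.erase v.1).powerset,
      (∏ w ∈ s.left.erase v.1, if w ∈ A then p else 1 - p) * mean p f (s.hit v.1 k A)) /
      s.shortest.card
termination_by s.left.card
decreasing_by exact s.card_left_hit_lt v.2 k A

/-- The average of `F` over the instances that arise when `v` receives the colour `k`. -/
noncomputable def step (p : ℝ) (s : Residual N) (v : Fin N) (k : Color)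
    (F : Residual N → ℝ) : ℝ :=
  ∑ A ∈ (s.left.erase v).powerset,
    (∏ w ∈ s.left.erase v, if w ∈ A then p else 1 - p) * F (s.hit v k A)

open Classical in
theorem mean_eq (p : ℝ) (f : Residual N → ℝ) (s : Residual N) :
    mean p f s = f s + if s.Contradiction then 0 else
      (∑ v ∈ s.shortest, ∑ k ∈ s.avail v, step p s v k (mean p f)) / s.shortest.card := by
  rw [mean, Finset.sum_coe_sort s.shortest
    (fun v => ∑ k ∈ s.avail v, ∑ A ∈ (s.left.erase v).powerset,
      (∏ w ∈ s.left.erase v, if w ∈ A then p else 1 - p) * mean p f (s.hit v k A))]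
  rfl

/-- The subtree never consults removed vertices. This is used twice in `sum_wt_cost`: to replace
`assign` by `hit`, and to see that the subtree after the removal of `v` is independent of the edges
at `v`. -/
theorem cost_congr {f : Residual N → ℝ} (hf : Local f) {G G' : SimpleGraph (Fin N)}
    {s s' : Residual N} (hs : s.Agree s')
    (hG : ∀ a ∈ s.left, ∀ b ∈ s.left, (G.Adj a b ↔ G'.Adj a b)) :
    cost G f s = cost G' f s' := by
  classical
  induction hn : s.left.card using Nat.strong_induction_on generalizing s s' with
  | _ n ih =>
    rw [cost_eq, cost_eq, hf s s' hs]
    simp only [hs.contradiction, hs.shortest]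
    congr 1
    split_ifs with hc
    · rfl
    congr 1
    refine Finset.sum_congr rfl fun v hv => ?_
    rw [← hs.shortest] at hv
    have hvl := s.shortest_subset hv
    rw [hs.2 v hvl]
    refine Finset.sum_congr rfl fun k _ => ?_
    refine ih _ (hn ▸ s.card_left_assign_lt G hv k) ⟨?_, ?_⟩ ?_ rfl
    · simp [Residual.assign, hs.1]
    · intro w hw
      have hw' : w ∈ s.left := Finset.mem_of_mem_erase hw
      simp only [Residual.assign, hG v hvl w hw', hs.2 w hw']
    · intro a ha b hb
      exact hG a (Finset.mem_of_mem_erase ha) b (Finset.mem_of_mem_erase hb)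

/-- The principle of deferred decisions. -/
theorem sum_wt_cost {p : ℝ} (hp : ∑ G : SimpleGraph (Fin N), wt p G = 1)
    {f : Residual N → ℝ} (hf : Local f) (s : Residual N) :
    ∑ G, wt p G * cost G f s = mean p f s := by
  classical
  induction hn : s.left.card using Nat.strong_induction_on generalizing s with
  | _ n ih =>
    rw [mean_eq]
    rw [Finset.sum_congr rfl fun G _ => by rw [cost_eq G f s, mul_add],
      Finset.sum_add_distrib, ← Finset.sum_mul, hp, one_mul]
    congr 1
    split_ifs with hc
    · simp
    simp_rw [mul_div_assoc', ← Finset.sum_div]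
    congr 1
    simp_rw [Finset.mul_sum]
    rw [Finset.sum_comm]
    refine Finset.sum_congr rfl fun v hv => ?_
    rw [Finset.sum_comm]
    refine Finset.sum_congr rfl fun k _ => ?_
    have hvB : v ∉ s.left.erase v := Finset.notMem_erase v _
    -- Case distinction by the set `A` of remaining neighbours of `v`; for each graph exactly one
    -- `A` contributes.
    have h1 : ∀ G : SimpleGraph (Fin N), wt p G * cost G f (s.assign G v k) =
        ∑ A ∈ (s.left.erase v).powerset, wt p G *
          (if ∀ w ∈ s.left.erase v, (G.Adj v w ↔ w ∈ A) then cost G f (s.hit v k A) else 0) := by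
      intro G
      rw [Finset.sum_eq_single ((s.left.erase v).filter fun w => G.Adj v w)]
      · rw [if_pos]
        · congr 1
          refine cost_congr hf ⟨rfl, fun w hw => ?_⟩ fun _ _ _ _ => Iff.rfl
          have hw' : w ∈ s.left.erase v := hw
          simp only [Residual.assign, Residual.hit, Finset.mem_filter, hw', true_and]
        · intro w hw
          simp only [Finset.mem_filter, hw, true_and]
      · intro A hA hne
        rw [if_neg, mul_zero]
        intro hall
        apply hne
        ext w
        simp only [Finset.mem_filter]
        constructor
        · intro hw
          have := Finset.mem_powerset.1 hA hw
          exact ⟨this, (hall w this).2 hw⟩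
        · rintro ⟨h1, h2⟩
          exact (hall w h1).1 h2
      · intro h
        exact absurd (Finset.mem_powerset.2 (Finset.filter_subset _ _)) h
    simp_rw [h1]
    rw [Finset.sum_comm]
    refine Finset.sum_congr rfl fun A hA => ?_
    -- The neighbourhood of `v` is revealed only now, and the subtree below `hit` does not depend on
    -- it.
    rw [sum_wt_nbhd p _ _ hvB]
    · rw [ih _ (hn ▸ s.card_left_hit_lt hv k A) _ rfl]
    · intro G G' h
      refine cost_congr hf ⟨rfl, fun _ _ => rfl⟩ fun a ha b hb => ?_
      exact h a b (Finset.ne_of_mem_erase ha) (Finset.ne_of_mem_erase hb)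

end Dpll

/-! ### Polynomial inequalities for unequal shares of the three colours. -/

namespace Dpll

/-- The quadratic and cubic part of the colour corrector. -/
noncomputable def bend (x : ℝ) : ℝ := 32 / 25 * x ^ 2 - 9 / 20 * x ^ 3

/-- The weight of a unit list of a colour whose share of the two-colour lists exceeds the average
by `x`, relative to the average unit list. -/
noncomputable def tilt (φ x : ℝ) : ℝ := 1 + φ * (-x + bend x)

/-- The largest contribution of the two other colours. -/
noncomputable def drag (x : ℝ) : ℝ :=
  107 / 150 * x ^ 2 + 143 / 400 * x ^ 3 + 9 / 160 * x ^ 4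

/-- The constant `1 / 2` makes a unit list weigh at least `1 / 4` in `localBound`; the factor `log
4` in the choice of `κ₁` compensates exactly this. -/
theorem tilt_pos {φ x : ℝ} (h0 : 0 ≤ φ) (h1 : φ ≤ 1) (hx : x ≤ 1 / 3) :
    1 / 2 ≤ tilt φ x := by
  unfold tilt bend
  have : -(1 / 2) ≤ -x + (32 / 25 * x ^ 2 - 9 / 20 * x ^ 3) := by
    nlinarith [sq_nonneg x, mul_nonneg (sq_nonneg x) (sub_nonneg.2 hx)]
  nlinarith

theorem tilt_le {φ x : ℝ} (h0 : 0 ≤ φ) (h1 : φ ≤ 1) (hx : x ≤ 1 / 3) (hx' : -(2 / 3) ≤ x) :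
    tilt φ x ≤ 3 := by
  unfold tilt bend
  have : -x + (32 / 25 * x ^ 2 - 9 / 20 * x ^ 3) ≤ 2 := by
    nlinarith [sq_nonneg x, mul_nonneg (sq_nonneg x) (sub_nonneg.2 hx),
      mul_nonneg (sub_nonneg.2 hx) (sub_nonneg.2 hx'),
      mul_nonneg (sq_nonneg x) (sub_nonneg.2 hx')]
  nlinarith

/-- The value `78 / 101` is `3 * κ / (3 + κ)` at the largest `κ = 26 / 25`. The difference of the
two sides vanishes at `0`, and its derivative is `x` times a nonnegative function, so `0` is its
minimum. -/
theorem log_tilt_extreme {x : ℝ} (hx : x ≤ 1 / 3) (hx' : -(2 / 3) ≤ x) :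
    78 / 101 * (-x + 26 / 25 * drag x) ≤ Real.log (tilt (78 / 101) x) := by
  set F : ℝ → ℝ := fun x => Real.log (tilt (78 / 101) x) - 78 / 101 * (-x + 26 / 25 * drag x)
    with hF
  have hder : ∀ x, x ≤ 1 / 3 → -(2 / 3) ≤ x → HasDerivAt F
      ((78 / 101 * (-1 + (64 / 25 * x - 27 / 20 * x ^ 2))) / tilt (78 / 101) x -
        78 / 101 * (-1 + 26 / 25 * (107 / 75 * x + 429 / 400 * x ^ 2 + 9 / 40 * x ^ 3))) x := by
    intro x h1 h2
    have ht : tilt (78 / 101) x ≠ 0 := by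
      have := tilt_pos (φ := 78 / 101) (by norm_num) (by norm_num) h1
      positivity
    have hd : HasDerivAt (tilt (78 / 101))
        (78 / 101 * (-1 + (64 / 25 * x - 27 / 20 * x ^ 2))) x := by
      unfold tilt bend
      have := ((((hasDerivAt_id x).neg).add ((((hasDerivAt_id x).pow 2).const_mul (32 / 25)).sub
        (((hasDerivAt_id x).pow 3).const_mul (9 / 20)))).const_mul (78 / 101)).const_add 1
      refine HasDerivAt.congr_deriv this ?_
      simp; ring
    have hg : HasDerivAt drag (107 / 75 * x + 429 / 400 * x ^ 2 + 9 / 40 * x ^ 3) x := by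
      unfold drag
      have := ((((hasDerivAt_id x).pow 2).const_mul (107 / 150)).add
        (((hasDerivAt_id x).pow 3).const_mul (143 / 400))).add
        (((hasDerivAt_id x).pow 4).const_mul (9 / 160))
      refine HasDerivAt.congr_deriv this ?_
      simp; ring
    refine HasDerivAt.congr_deriv
      ((hd.log ht).sub ((((hasDerivAt_id x).neg).add (hg.const_mul (26 / 25))).const_mul _)) ?_
    simp
  have hsign : ∀ x, x ≤ 1 / 3 → -(2 / 3) ≤ x → ∃ r, 0 ≤ r ∧
      deriv F x = x * r := by
    intro x h1 h2
    have ht := tilt_pos (φ := 78 / 101) (by norm_num) (by norm_num) h1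
    have ht' : tilt (78 / 101) x ≠ 0 := by positivity
    refine ⟨78 / 101 * ((64 / 25 - 27 / 20 * x) + 78 / 101 * (-1 + 32 / 25 * x - 9 / 20 * x ^ 2)
      - 26 / 25 * (107 / 75 + 429 / 400 * x + 9 / 40 * x ^ 2) * tilt (78 / 101) x) /
        tilt (78 / 101) x, ?_, ?_⟩
    · refine div_nonneg (mul_nonneg (by norm_num) ?_) (by linarith)
      unfold tilt bend
      have e1 : 0 ≤ 1 / 3 - x := by linarith
      have e2 : 0 ≤ x + 2 / 3 := by linarith
      nlinarith [mul_nonneg e1 e2, mul_nonneg (mul_nonneg e1 e2) (sq_nonneg x),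
        mul_nonneg (mul_nonneg e1 e2) e1, mul_nonneg (mul_nonneg e1 e2) e2,
        mul_nonneg e1 (sq_nonneg (x + 1/3)), mul_nonneg e2 (sq_nonneg x),
        mul_nonneg (mul_nonneg (mul_nonneg e1 e2) e1) (sq_nonneg x),
        mul_nonneg (mul_nonneg (mul_nonneg e1 e2) e2) (sq_nonneg x), sq_nonneg x,
        sq_nonneg (x ^ 2), sq_nonneg (x^2 + x/3)]
    · rw [(hder x h1 h2).deriv]
      field_simp
      unfold tilt bend
      ring
  have h0 : F 0 = 0 := by simp [hF, tilt, bend, drag]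
  have hc : ContinuousOn F (Set.Icc (-(2 / 3)) (1 / 3)) := fun x hx =>
    (hder x hx.2 hx.1).continuousAt.continuousWithinAt
  suffices 0 ≤ F x by simpa [hF] using this
  rw [← h0]
  rcases le_total x 0 with h | h
  · have := antitoneOn_of_deriv_nonpos (convex_Icc (-(2 / 3) : ℝ) 0)
      (hc.mono (Set.Icc_subset_Icc_right (by norm_num)))
      (fun y hy => by
        rw [interior_Icc] at hy
        exact (hder y (by linarith [hy.2]) hy.1.le).differentiableAt.differentiableWithinAt)
      (fun y hy => by
        rw [interior_Icc] at hy
        obtain ⟨r, hr, e⟩ := hsign y (by linarith [hy.2]) hy.1.le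
        rw [e]
        exact mul_nonpos_of_nonpos_of_nonneg hy.2.le hr)
    exact this ⟨hx', h⟩ ⟨by norm_num, le_rfl⟩ h
  · have := monotoneOn_of_deriv_nonneg (convex_Icc (0 : ℝ) (1 / 3))
      (hc.mono (Set.Icc_subset_Icc_left (by norm_num)))
      (fun y hy => by
        rw [interior_Icc] at hy
        exact (hder y hy.2.le (by linarith [hy.1])).differentiableAt.differentiableWithinAt)
      (fun y hy => by
        rw [interior_Icc] at hy
        obtain ⟨r, hr, e⟩ := hsign y hy.2.le (by linarith [hy.1])
        rw [e]
        exact mul_nonneg hy.1.le hr)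
    exact this ⟨le_rfl, by norm_num⟩ ⟨h, hx⟩ h

theorem drag_nonneg {x : ℝ} (hx' : -(2 / 3) ≤ x) : 0 ≤ drag x := by
  unfold drag
  have : 0 ≤ x ^ 2 * (107 / 150 + 143 / 400 * x + 9 / 160 * x ^ 2) :=
    mul_nonneg (sq_nonneg x) (by nlinarith [sq_nonneg x])
  nlinarith

/-- `tilt φ x` is a convex combination of `tilt (78 / 101) x` and `1`, so concavity of the logarithm
reduces the claim to the extreme parameter; since `drag` is nonnegative, its coefficient may be
lowered from `26 / 25` to `κ`. -/
theorem log_tilt_ge {κ x : ℝ} (h0 : 0 ≤ κ) (h1 : κ ≤ 26 / 25) (hx : x ≤ 1 / 3)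
    (hx' : -(2 / 3) ≤ x) :
    3 * κ / (3 + κ) * (-x + κ * drag x) ≤ Real.log (tilt (3 * κ / (3 + κ)) x) := by
  set φ := 3 * κ / (3 + κ) with hφ
  have hφ0 : 0 ≤ φ := by positivity
  have hφ1 : φ ≤ 78 / 101 := by
    rw [hφ, div_le_div_iff₀ (by linarith) (by norm_num)]; linarith
  have hm := log_tilt_extreme hx hx'
  have ht := tilt_pos (φ := 78 / 101) (by norm_num) (by norm_num) hx
  have hp1 : (tilt (78 / 101) x) ∈ Set.Ioi (0 : ℝ) := by simp only [Set.mem_Ioi]; linarith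
  have hp2 : (1 : ℝ) ∈ Set.Ioi (0 : ℝ) := by simp
  have hp3 : 0 ≤ φ / (78 / 101) := by positivity
  have hp4 : 0 ≤ 1 - φ / (78 / 101) := by
    rw [sub_nonneg, div_le_one (by norm_num)]; exact hφ1
  have hconc := strictConcaveOn_log_Ioi.concaveOn
  have hconc := hconc.2 hp1 hp2 hp3 hp4 (by ring)
  have e : (φ / (78 / 101)) • tilt (78 / 101) x + (1 - φ / (78 / 101)) • (1 : ℝ) = tilt φ x := by
    simp only [tilt, smul_eq_mul]; ring
  rw [e] at hconc
  simp only [smul_eq_mul, Real.log_one, mul_zero, add_zero] at hconc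
  have h2 : φ / (78 / 101) * (78 / 101 * (-x + 26 / 25 * drag x)) ≤
      φ / (78 / 101) * Real.log (tilt (78 / 101) x) :=
    mul_le_mul_of_nonneg_left hm (by positivity)
  have h3 : φ / (78 / 101) * (78 / 101 * (-x + 26 / 25 * drag x)) =
      φ * (-x + 26 / 25 * drag x) := by ring
  have h4 : φ * (-x + κ * drag x) ≤ φ * (-x + 26 / 25 * drag x) := by
    apply mul_le_mul_of_nonneg_left _ hφ0
    have := mul_le_mul_of_nonneg_right h1 (drag_nonneg hx')
    linarith
  linarith

/-- For fixed `x` the left side is largest at `b = c`, where equality holds: the difference is `(b -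
c) ^ 2` times a nonnegative factor. -/
theorem spread_le_drag {x b c : ℝ} (h : x + b + c = 0) (hx' : -(2 / 3) ≤ x) :
    (1 / 3 - c) * (-b + bend b) + (1 / 3 - b) * (-c + bend c) ≤ x / 3 + drag x := by
  have hc : c = -x - b := by linarith
  have key : x / 3 + drag x -
      ((1 / 3 - c) * (-b + bend b) + (1 / 3 - b) * (-c + bend c)) =
      (b - c) ^ 2 * ((86 / 75 + 83 / 100 * x + 9 / 20 * x ^ 2) / 4 - 9 / 10 *
        ((x ^ 2 / 4 + b * c) / 4)) := by
    subst hc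
    unfold drag bend
    ring
  have h2 : b * c ≤ x ^ 2 / 4 := by subst hc; nlinarith [sq_nonneg (b - (-x - b))]
  have : 0 ≤ (b - c) ^ 2 * ((86 / 75 + 83 / 100 * x + 9 / 20 * x ^ 2) / 4 - 9 / 10 *
        ((x ^ 2 / 4 + b * c) / 4)) := mul_nonneg (sq_nonneg _) (by nlinarith [sq_nonneg x])
  linarith

/-- The weight of a unit list must pay for the unit lists of the two other colours that its removal
creates. The linear terms, `-κ * x + κ * φ * x / 3 = -φ * x`, force `φ = 3 * κ / (3 + κ)`; `bend`
takes care of the higher orders. -/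
theorem log_tilt_ge_offspring {κ x b c : ℝ} (h0 : 0 ≤ κ) (h1 : κ ≤ 26 / 25)
    (h : x + b + c = 0) (hx : x ≤ 1 / 3) (hb : b ≤ 1 / 3) (hc : c ≤ 1 / 3) :
    2 * κ / 3 + κ * ((1 / 3 - c) * (tilt (3 * κ / (3 + κ)) b - 2) +
      (1 / 3 - b) * (tilt (3 * κ / (3 + κ)) c - 2)) ≤ Real.log (tilt (3 * κ / (3 + κ)) x) := by
  have hx' : -(2 / 3) ≤ x := by linarith
  refine le_trans ?_ (log_tilt_ge h0 h1 hx hx')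
  have h2 := spread_le_drag h hx'
  set φ := 3 * κ / (3 + κ) with hφ
  have hφ0 : 0 ≤ φ := by positivity
  have hφe : φ * (3 + κ) = 3 * κ := by rw [hφ]; field_simp
  have h3 := mul_le_mul_of_nonneg_left h2 (mul_nonneg h0 hφ0)
  unfold tilt
  have hc' : c = -x - b := by linarith
  have e : 2 * κ / 3 + κ * ((1 / 3 - c) * (1 + φ * (-b + bend b) - 2) +
      (1 / 3 - b) * (1 + φ * (-c + bend c) - 2)) = -κ * x +
      κ * φ * ((1 / 3 - c) * (-b + bend b) + (1 / 3 - b) * (-c + bend c)) := by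
    rw [hc']; ring
  rw [e]
  have e2 : -κ * x + κ * φ * (x / 3 + drag x) = φ * (-x + κ * drag x) := by
    linear_combination (x / 3) * hφe
  linarith

/-- The sign allows `exists_tilt` to replace the truncated `κ` by the true density `D / 2`. -/
theorem offspring_nonpos {φ x b c : ℝ} (h0 : 0 ≤ φ) (h1 : φ ≤ 1)
    (h : x + b + c = 0) (hx : x ≤ 1 / 3) (hb : b ≤ 1 / 3) (hc : c ≤ 1 / 3) :
    (1 / 3 - c) * (tilt φ b - 2) + (1 / 3 - b) * (tilt φ c - 2) ≤ 0 := by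
  have hx' : -(2 / 3) ≤ x := by linarith
  have h2 := spread_le_drag h hx'
  have h3 : x / 3 + drag x ≤ x + 2 / 3 := by
    unfold drag
    have e2 : 0 ≤ x + 2 / 3 := by linarith
    have e1 : 0 ≤ 1 / 3 - x := by linarith
    nlinarith [mul_nonneg e1 e2, mul_nonneg (mul_nonneg e1 e2) e1,
      mul_nonneg (mul_nonneg e1 e2) (sq_nonneg x), mul_nonneg e2 (sq_nonneg x)]
  have h4 : 0 ≤ x + 2 / 3 := by linarith
  have h5 := mul_le_mul_of_nonneg_left (h2.trans h3) h0
  have h6 : φ * (x + 2 / 3) ≤ x + 2 / 3 := by nlinarith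
  unfold tilt
  nlinarith

/-- The sum is a polynomial in `x` and `(b - c) ^ 2`. Only the cubic term has the wrong sign, and it
is dominated on the range at hand. -/
theorem sum_share_bend_nonpos {x b c : ℝ} (h : x + b + c = 0) (hx : x ≤ 1 / 3) (h0 : 0 ≤ x) :
    (x + 2 / 3) * (-x + bend x) + (b + 2 / 3) * (-b + bend b) +
      (c + 2 / 3) * (-c + bend c) ≤ 0 := by
  have hc' : c = -x - b := by linarith
  have e : (x + 2 / 3) * (-x + bend x) + (b + 2 / 3) * (-b + bend b) +
      (c + 2 / 3) * (-c + bend c) = -((11 / 75) * (3 / 2 * x ^ 2 + (b - c) ^ 2 / 2) +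
        9 / 40 * (3 / 2 * x ^ 2 + (b - c) ^ 2 / 2) ^ 2 -
        147 / 50 * x * (x ^ 2 / 4 - (b - c) ^ 2 / 4)) := by
    subst hc'
    unfold bend
    ring
  rw [e, neg_nonpos]
  have h1 : 0 ≤ (b - c) ^ 2 := sq_nonneg _
  generalize (b - c) ^ 2 = m at h1
  have h2 : 0 ≤ x ^ 2 * (11 / 50 + 81 / 160 * x ^ 2 - 147 / 200 * x) :=
    mul_nonneg (sq_nonneg x) (by nlinarith)
  nlinarith [mul_nonneg h0 h1, mul_nonneg h1 (sq_nonneg x), sq_nonneg m]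

/-- Here `x + 2 / 3` is the probability that a colour is available to a random vertex with two
colours, so the left side is the expected total weight of the branches before halving. One of the
three deviations is nonnegative because they add up to zero. -/
theorem sum_share_tilt_le {φ x b c : ℝ} (h0 : 0 ≤ φ)
    (h : x + b + c = 0) (hx : x ≤ 1 / 3) (hb : b ≤ 1 / 3) (hc : c ≤ 1 / 3) :
    (x + 2 / 3) * tilt φ x + (b + 2 / 3) * tilt φ b + (c + 2 / 3) * tilt φ c ≤ 2 := by
  have key : (x + 2 / 3) * (-x + bend x) + (b + 2 / 3) * (-b + bend b) +
      (c + 2 / 3) * (-c + bend c) ≤ 0 := by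
    rcases le_total 0 x with hx0 | hx0
    · exact sum_share_bend_nonpos h hx hx0
    rcases le_total 0 b with hb0 | hb0
    · linarith [sum_share_bend_nonpos (x := b) (b := x) (c := c) (by linarith) hb hb0]
    · linarith [sum_share_bend_nonpos (x := c) (b := x) (c := b) (by linarith) hc (by linarith)]
  have := mul_le_mul_of_nonneg_left key h0
  unfold tilt
  nlinarith

end Dpll

/-! ### The potential as a function of the densities of lists, and its maximum over `θ`. -/

namespace Dpll

/-- The weight of a list of three colours, when a list of two colours has weight `exp (-θ)`. -/
noncomputable def tripleWt (θ : ℝ) : ℝ := (3 * Real.exp (-θ) - Real.exp (-(3 * θ))) / 2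

/-- The loss rate of the weight of a list of three colours. -/
noncomputable def lossRate (θ : ℝ) : ℝ := 1 - 2 / (3 - Real.exp (-(2 * θ)))

theorem exp_neg_two_mul_le {θ : ℝ} (h : 0 ≤ θ) : Real.exp (-(2 * θ)) ≤ 1 :=
  Real.exp_le_one_iff.2 (by linarith)

theorem tripleWt_eq (θ : ℝ) :
    tripleWt θ = Real.exp (-θ) * ((3 - Real.exp (-(2 * θ))) / 2) := by
  have : Real.exp (-(3 * θ)) = Real.exp (-θ) * Real.exp (-(2 * θ)) := by
    rw [← Real.exp_add]; ring_nf
  rw [tripleWt, this]; ring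

theorem tripleWt_pos {θ : ℝ} (h : 0 ≤ θ) : 0 < tripleWt θ := by
  rw [tripleWt_eq]
  have := exp_neg_two_mul_le h
  exact mul_pos (Real.exp_pos _) (by linarith)

/-- A full list that is hit becomes a list of two colours; `lossRate` is the relative loss of
weight. -/
theorem exp_div_tripleWt {θ : ℝ} (h : 0 ≤ θ) :
    Real.exp (-θ) / tripleWt θ = 1 - lossRate θ := by
  have := exp_neg_two_mul_le h
  have h3 : 3 - Real.exp (-(2 * θ)) ≠ 0 := by linarith
  rw [tripleWt_eq, lossRate]
  field_simp
  ring

theorem hasDerivAt_exp_neg_mul (a θ : ℝ) :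
    HasDerivAt (fun θ : ℝ => Real.exp (-(a * θ))) (-a * Real.exp (-(a * θ))) θ := by
  have := (((hasDerivAt_id θ).const_mul a).neg).exp
  refine this.congr_deriv ?_
  simp; ring

theorem hasDerivAt_log_tripleWt {θ : ℝ} (h : 0 ≤ θ) :
    HasDerivAt (fun θ => Real.log (tripleWt θ)) (-(3 * lossRate θ)) θ := by
  have h1 : HasDerivAt tripleWt ((3 * -Real.exp (-θ) - -3 * Real.exp (-(3 * θ))) / 2) θ := by
    have a1 := hasDerivAt_exp_neg_mul 1 θ
    simp only [one_mul] at a1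
    exact (((a1.const_mul 3).sub (hasDerivAt_exp_neg_mul 3 θ)).div_const 2).congr_deriv (by ring)
  refine (h1.log (tripleWt_pos h).ne').congr_deriv ?_
  have := exp_neg_two_mul_le h
  have h3 : 3 - Real.exp (-(2 * θ)) ≠ 0 := by linarith
  have e3 : Real.exp (-(3 * θ)) = Real.exp (-θ) * Real.exp (-(2 * θ)) := by
    rw [← Real.exp_add]; ring_nf
  rw [tripleWt_eq, lossRate, e3]
  have := Real.exp_ne_zero (-θ)
  generalize Real.exp (-(2 * θ)) = e at *
  generalize Real.exp (-θ) = e' at *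
  field_simp
  ring

/-- This concavity makes `slope` convex, on which the quadratic estimate of `exists_max_rate` and
the location of the optimal height both rest. -/
theorem concaveOn_lossRate :
    ConcaveOn ℝ (Set.Ici 0) lossRate := by
  have hd : ∀ θ : ℝ, 0 ≤ θ → HasDerivAt lossRate
      (4 * Real.exp (-(2 * θ)) / (3 - Real.exp (-(2 * θ))) ^ 2) θ := by
    intro θ h
    have := exp_neg_two_mul_le h
    have h3 : 3 - Real.exp (-(2 * θ)) ≠ 0 := by linarith
    have a := (((hasDerivAt_exp_neg_mul 2 θ).const_sub 3).inv h3).const_mul 2 |>.const_sub 1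
    refine (a.congr_deriv ?_)
    field_simp
    ring
  refine AntitoneOn.concaveOn_of_deriv (convex_Ici 0)
    (fun x hx => (hd x hx).continuousAt.continuousWithinAt)
    (fun x hx => (hd x (interior_subset hx)).differentiableAt.differentiableWithinAt) ?_
  intro x hx y hy hxy
  have hx' : (0 : ℝ) ≤ x := by simpa using interior_subset hx
  have hy' : (0 : ℝ) ≤ y := by simpa using interior_subset hy
  rw [(hd x hx').deriv, (hd y hy').deriv]
  have e : Real.exp (-(2 * y)) ≤ Real.exp (-(2 * x)) := Real.exp_le_exp.2 (by linarith)
  have e1 := exp_neg_two_mul_le hx'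
  have e0 := Real.exp_pos (-(2 * y))
  have : 3 - Real.exp (-(2 * x)) ≤ 3 - Real.exp (-(2 * y)) := by linarith
  have hp : 0 < 3 - Real.exp (-(2 * x)) := by linarith
  gcongr

theorem lossRate_nonneg {θ : ℝ} (h : 0 ≤ θ) : 0 ≤ lossRate θ := by
  have := exp_neg_two_mul_le h
  rw [lossRate, sub_nonneg, div_le_one (by linarith)]
  linarith

/-- The second alternative is the meaningless range where the denominator is not positive; it is
excluded for `0 ≤ θ` in `lossRate_le_third`. -/
theorem lossRate_le {θ : ℝ} : lossRate θ ≤ 1 / 3 ∨ 3 ≤ Real.exp (-(2 * θ)) := by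
  rcases le_or_gt 3 (Real.exp (-(2 * θ))) with h | h
  · exact Or.inr h
  · left
    have := Real.exp_pos (-(2 * θ))
    have : 2 / 3 ≤ 2 / (3 - Real.exp (-(2 * θ))) := by
      apply div_le_div_of_nonneg_left <;> linarith
    unfold lossRate; linarith

/-- The logarithm of the potential, up to the scale factor `3 N / c`, when there are `D N / c`
lists of one or two colours and `B N / c` lists of three colours. -/
noncomputable def rate (D B θ : ℝ) : ℝ :=
  θ * Real.log 2 + θ ^ 2 / 2 - θ * D / 3 + B / 3 * Real.log (tripleWt θ)

/-- The derivative of `rate`. -/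
noncomputable def slope (D B θ : ℝ) : ℝ := Real.log 2 + θ - D / 3 - B * lossRate θ

theorem hasDerivAt_rate (D B : ℝ) {θ : ℝ} (h : 0 ≤ θ) :
    HasDerivAt (rate D B) (slope D B θ) θ := by
  unfold rate slope
  have := ((((hasDerivAt_id θ).mul_const (Real.log 2)).add
    (((hasDerivAt_id θ).pow 2).div_const 2)).sub
    (((hasDerivAt_id θ).mul_const D).div_const 3)).add
    ((hasDerivAt_log_tripleWt h).const_mul (B / 3))
  refine this.congr_deriv ?_
  simp; ring

theorem convexOn_slope (D : ℝ) {B : ℝ} (hB : 0 ≤ B) : ConvexOn ℝ (Set.Ici 0) (slope D B) := by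
  have h1 : ConvexOn ℝ (Set.Ici (0 : ℝ)) fun θ : ℝ => B * -lossRate θ :=
    concaveOn_lossRate.neg.smul hB
  have h2 : ConvexOn ℝ (Set.Ici (0 : ℝ)) fun θ : ℝ => θ := convexOn_id (convex_Ici 0)
  have h3 := (h2.add h1).add_const (Real.log 2 - D / 3)
  refine h3.congr fun θ _ => ?_
  simp [slope]; ring

/-- Since `lossRate (3 / 10)` lies between `0.184` and `1 / 3`, the slope is at most `log 2 + 0.3 -
0.184 * (D + B)`. The bound `59 / 10` is `(9 / 20) * (263 / 20)` rounded down, so it holds while at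
least `9 * N / 20` vertices remain. -/
theorem slope_end_le {D B : ℝ} (hB : 0 ≤ B) (hD : 0 ≤ D) (h : 59 / 10 ≤ D + B) :
    slope D B (3 / 10) ≤ -(9 / 100) := by
  have h1 : Real.exp (-(2 * (3 / 10) : ℝ)) ≤ 0.5489 := by
    have : Real.exp (-(2 * (3 / 10) : ℝ)) = (Real.exp (2 * (3 / 10)))⁻¹ := by rw [Real.exp_neg]
    rw [this]
    have h2 := Real.sum_le_exp_of_nonneg (x := 2 * (3 / 10)) (by norm_num) 7
    have h3 : (1.822 : ℝ) ≤ Real.exp (2 * (3 / 10)) := by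
      refine le_trans ?_ h2
      norm_num [Finset.sum_range_succ, Nat.factorial]
    rw [inv_le_comm₀ (Real.exp_pos _) (by norm_num)]
    exact le_trans (by norm_num) h3
  have h2 := Real.log_two_lt_d9
  have h3 : 0.184 ≤ lossRate (3 / 10) := by
    unfold lossRate
    have : 2 / (3 - Real.exp (-(2 * (3 / 10) : ℝ))) ≤ 2 / (3 - 0.5489) := by
      norm_num at h1
      apply div_le_div_of_nonneg_left <;> norm_num; linarith
    norm_num at this ⊢
    linarith
  unfold slope
  nlinarith

/-- Either the slope is not positive at `0` already, or it changes its sign before `3 / 10`. The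
final alternative records that a positive slope at `0` forces `D < 3 * log 2`; it yields the minimum
in `exists_max_rate`. -/
theorem exists_root_slope {D B : ℝ} (hB : 0 ≤ B) (hD : 0 ≤ D) (h : 59 / 10 ≤ D + B) :
    ∃ θ ∈ Set.Icc (0 : ℝ) (3 / 10), slope D B θ ≤ 0 ∧ (0 < θ → slope D B θ = 0) ∧
      (θ = 0 ∨ D < 3 * Real.log 2) := by
  rcases le_or_gt (slope D B 0) 0 with h0 | h0
  · exact ⟨0, by norm_num, h0, fun h => absurd h (lt_irrefl _), Or.inl rfl⟩
  · have hc : ContinuousOn (slope D B) (Set.Icc 0 (3 / 10)) := by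
      intro x hx
      have := exp_neg_two_mul_le hx.1
      have h3 : 3 - Real.exp (-(2 * x)) ≠ 0 := by linarith
      unfold slope lossRate
      exact ContinuousAt.continuousWithinAt (by fun_prop (disch := exact h3))
    have := intermediate_value_Icc' (by norm_num : (0 : ℝ) ≤ 3 / 10) hc
    obtain ⟨θ, hθ, e⟩ := this (show (0 : ℝ) ∈ _ from
      ⟨(slope_end_le hB hD h).trans (by norm_num), h0.le⟩)
    refine ⟨θ, hθ, e.le, fun _ => e, Or.inr ?_⟩
    have h4 := lossRate_nonneg le_rfl
    have := mul_nonneg hB h4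
    unfold slope at h0
    linarith

/-- The maximizer of `rate`. -/
theorem exists_max_rate {D B : ℝ} (hB : 0 ≤ B) (hD : 0 ≤ D) (h : 59 / 10 ≤ D + B) :
    ∃ θ₀ ∈ Set.Icc (0 : ℝ) (3 / 10),
      Real.log 2 + θ₀ - B * lossRate θ₀ ≤ min D (3 * Real.log 2) / 3 ∧
      ∀ θ ∈ Set.Icc (0 : ℝ) (3 / 10), rate D B θ ≤ rate D B θ₀ - 3 / 20 * (θ - θ₀) ^ 2 := by
  obtain ⟨θ₀, hθ, h1, h2, h3⟩ := exists_root_slope hB hD h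
  have hend := slope_end_le hB hD h
  have hcv := (convexOn_slope D hB).2
  have h310 : (3 / 10 : ℝ) ∈ Set.Ici 0 := by norm_num
  refine ⟨θ₀, hθ, ?_, ?_⟩
  · have hs : slope D B θ₀ = Real.log 2 + θ₀ - D / 3 - B * lossRate θ₀ := rfl
    rw [min_def]
    split_ifs with hle
    · linarith
    · rcases h3 with rfl | h3
      · have := mul_nonneg hB (lossRate_nonneg (le_refl (0 : ℝ)))
        linarith
      · linarith
  · have hlt : θ₀ < 3 / 10 := by
      refine lt_of_le_of_ne hθ.2 fun e => ?_
      rw [e] at h2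
      have := h2 (by norm_num)
      linarith
    -- The convex function `slope` lies below its chord from `θ₀` to `3 / 10`. The chord starts at
    -- most at `0` and falls to `-(9 / 100)` on a length of at most `3 / 10`, hence the rate `3 /
    -- 10`.
    have hright : ∀ θ, θ₀ ≤ θ → θ ≤ 3 / 10 → slope D B θ + 3 / 10 * (θ - θ₀) ≤ 0 := by
      intro θ a b
      have hl : 0 < 3 / 10 - θ₀ := by linarith
      have hcx := hcv (Set.mem_Ici.2 hθ.1) h310 (a := (3 / 10 - θ) / (3 / 10 - θ₀))
        (b := (θ - θ₀) / (3 / 10 - θ₀))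
        (div_nonneg (by linarith) hl.le) (div_nonneg (by linarith) hl.le)
        (by rw [← add_div, div_eq_one_iff_eq hl.ne']; ring)
      have e : ((3 / 10 - θ) / (3 / 10 - θ₀)) • θ₀ + ((θ - θ₀) / (3 / 10 - θ₀)) • (3 / 10 : ℝ)
          = θ := by
        simp only [smul_eq_mul]
        rw [div_mul_eq_mul_div, div_mul_eq_mul_div, ← add_div, div_eq_iff hl.ne']
        ring
      rw [e] at hcx
      simp only [smul_eq_mul] at hcx
      have k1 : (3 / 10 - θ) / (3 / 10 - θ₀) * slope D B θ₀ ≤ 0 :=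
        mul_nonpos_of_nonneg_of_nonpos (div_nonneg (by linarith) hl.le) h1
      have k2 : (θ - θ₀) / (3 / 10 - θ₀) * slope D B (3 / 10) ≤
          (θ - θ₀) / (3 / 10 - θ₀) * -(9 / 100) :=
        mul_le_mul_of_nonneg_left hend (div_nonneg (by linarith) hl.le)
      have k3 : (θ - θ₀) / (3 / 10) ≤ (θ - θ₀) / (3 / 10 - θ₀) :=
        div_le_div_of_nonneg_left (by linarith) hl (by linarith [hθ.1])
      linarith
    -- To the left of `θ₀` the root is genuine, and convexity on the interval from `θ` to `3 / 10`
    -- bounds `slope` at `θ` from below.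
    have hleft : ∀ θ, 0 ≤ θ → θ < θ₀ → 0 ≤ slope D B θ + 3 / 10 * (θ - θ₀) := by
      intro θ a b
      have hz := h2 (by linarith)
      have hl : 0 < 3 / 10 - θ := by linarith
      have hcx := hcv (Set.mem_Ici.2 a) h310
        (a := (3 / 10 - θ₀) / (3 / 10 - θ)) (b := (θ₀ - θ) / (3 / 10 - θ))
        (div_nonneg (by linarith) hl.le) (div_nonneg (by linarith) hl.le)
        (by rw [← add_div, div_eq_one_iff_eq hl.ne']; ring)
      have e : ((3 / 10 - θ₀) / (3 / 10 - θ)) • θ + ((θ₀ - θ) / (3 / 10 - θ)) • (3 / 10 : ℝ)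
          = θ₀ := by
        simp only [smul_eq_mul]
        rw [div_mul_eq_mul_div, div_mul_eq_mul_div, ← add_div, div_eq_iff hl.ne']
        ring
      rw [e, hz] at hcx
      simp only [smul_eq_mul] at hcx
      have hcx2 : 0 ≤ (3 / 10 - θ₀) * slope D B θ + (θ₀ - θ) * slope D B (3 / 10) := by
        have := mul_nonneg hl.le hcx
        have e2 : (3 / 10 - θ) * ((3 / 10 - θ₀) / (3 / 10 - θ) * slope D B θ +
          (θ₀ - θ) / (3 / 10 - θ) * slope D B (3 / 10)) =
          (3 / 10 - θ₀) * slope D B θ + (θ₀ - θ) * slope D B (3 / 10) := by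
            rw [div_mul_eq_mul_div, div_mul_eq_mul_div, ← add_div, mul_comm]
            exact div_mul_cancel₀ _ hl.ne'
        linarith
      have hpos : 0 < 3 / 10 - θ₀ := by linarith
      by_contra hcon
      push Not at hcon
      nlinarith [mul_pos hpos (neg_pos.2 hcon), hθ.1]
    set F : ℝ → ℝ := fun θ => rate D B θ + 3 / 20 * (θ - θ₀) ^ 2 with hF
    have hd : ∀ θ, 0 ≤ θ → HasDerivAt F (slope D B θ + 3 / 10 * (θ - θ₀)) θ := by
      intro θ a
      have := (hasDerivAt_rate D B a).add
        ((((hasDerivAt_id θ).sub_const θ₀).pow 2).const_mul (3 / 20))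
      refine this.congr_deriv ?_
      simp; ring
    intro θ hθ'
    suffices F θ ≤ F θ₀ by
      simp only [hF, sub_self] at this
      linarith
    rcases lt_or_ge θ θ₀ with hlt' | hge
    · have hm := monotoneOn_of_deriv_nonneg (f := F) (convex_Icc (0 : ℝ) θ₀)
        (fun x hx => (hd x hx.1).continuousAt.continuousWithinAt)
        (fun x hx => by
          rw [interior_Icc] at hx
          exact (hd x hx.1.le).differentiableAt.differentiableWithinAt)
        (fun x hx => by
          rw [interior_Icc] at hx
          rw [(hd x hx.1.le).deriv]
          exact hleft x hx.1.le hx.2)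
      exact hm ⟨hθ'.1, hlt'.le⟩ ⟨hθ.1, le_rfl⟩ hlt'.le
    · have hm := antitoneOn_of_deriv_nonpos (f := F) (convex_Icc θ₀ (3 / 10))
        (fun x hx => (hd x (hθ.1.trans hx.1)).continuousAt.continuousWithinAt)
        (fun x hx => by
          rw [interior_Icc] at hx
          exact (hd x (hθ.1.trans hx.1.le)).differentiableAt.differentiableWithinAt)
        (fun x hx => by
          rw [interior_Icc] at hx
          rw [(hd x (hθ.1.trans hx.1.le)).deriv]
          exact hright x hx.1.le hx.2.le)
      exact hm ⟨le_rfl, hθ.2⟩ ⟨hge, hθ'.2⟩ hge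

end Dpll

/-! ### Calculus of a single averaged step and of the recursion `mean`. -/

namespace Dpll

variable {N : ℕ}

open Classical in
theorem sum_powerset_prod_ite {ι : Type*} (S : Finset ι) (f g : ι → ℝ) :
    ∑ A ∈ S.powerset, ∏ w ∈ S, (if w ∈ A then f w else g w) = ∏ w ∈ S, (f w + g w) := by
  rw [Finset.prod_add]
  refine Finset.sum_congr rfl fun A hA => ?_
  rw [Finset.prod_ite, Finset.filter_mem_eq_inter, Finset.inter_eq_right.2 (Finset.mem_powerset.1 hA),
    Finset.filter_notMem_eq_sdiff]

/-- The product over the remaining vertices of a weight of their lists. -/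
noncomputable def listWt (y : Finset Color → ℝ) (s : Residual N) : ℝ :=
  ∏ w ∈ s.left, y (s.avail w)

theorem listWt_nonneg {y : Finset Color → ℝ} (hy : ∀ M, 0 ≤ y M) (s : Residual N) :
    0 ≤ listWt y s := Finset.prod_nonneg fun _ _ => hy _

/-- The vertices are hit independently, so the mean of a product factorizes. -/
theorem step_prod (p : ℝ) (s : Residual N) (v : Fin N) (k : Color)
    (y : Fin N → Finset Color → ℝ) :
    step p s v k (fun s' => ∏ w ∈ s'.left, y w (s'.avail w)) =
      ∏ w ∈ s.left.erase v, (p * y w ((s.avail w).erase k) + (1 - p) * y w (s.avail w)) := by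
  classical
  rw [← sum_powerset_prod_ite]
  refine Finset.sum_congr rfl fun A hA => ?_
  change _ * ∏ w ∈ s.left.erase v, y w ((s.hit v k A).avail w) = _
  rw [← Finset.prod_mul_distrib]
  refine Finset.prod_congr rfl fun w hw => ?_
  simp only [Residual.hit]
  split_ifs <;> rfl

theorem step_listWt (p : ℝ) (s : Residual N) (v : Fin N) (k : Color) (y : Finset Color → ℝ) :
    step p s v k (listWt y) =
      ∏ w ∈ s.left.erase v, (p * y ((s.avail w).erase k) + (1 - p) * y (s.avail w)) :=
  step_prod p s v k fun _ => y

theorem hitWt_nonneg {p : ℝ} (h0 : 0 ≤ p) (h1 : p ≤ 1) (S A : Finset (Fin N)) :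
    0 ≤ ∏ w ∈ S, (if w ∈ A then p else 1 - p) :=
  Finset.prod_nonneg fun w _ => by split_ifs <;> linarith

theorem step_le_step {p : ℝ} (h0 : 0 ≤ p) (h1 : p ≤ 1) {s : Residual N} {v : Fin N} {k : Color}
    {F G : Residual N → ℝ}
    (h : ∀ A ⊆ s.left.erase v, F (s.hit v k A) ≤ G (s.hit v k A)) :
    step p s v k F ≤ step p s v k G :=
  Finset.sum_le_sum fun A hA =>
    mul_le_mul_of_nonneg_left (h A (Finset.mem_powerset.1 hA)) (hitWt_nonneg h0 h1 _ _)

theorem step_congr {p : ℝ} {s : Residual N} {v : Fin N} {k : Color}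
    {F G : Residual N → ℝ}
    (h : ∀ A ⊆ s.left.erase v, F (s.hit v k A) = G (s.hit v k A)) :
    step p s v k F = step p s v k G :=
  Finset.sum_congr rfl fun A hA => by rw [h A (Finset.mem_powerset.1 hA)]

theorem step_nonneg {p : ℝ} (h0 : 0 ≤ p) (h1 : p ≤ 1) {s : Residual N} {v : Fin N} {k : Color}
    {F : Residual N → ℝ} (h : ∀ A ⊆ s.left.erase v, 0 ≤ F (s.hit v k A)) :
    0 ≤ step p s v k F :=
  Finset.sum_nonneg fun A hA =>
    mul_nonneg (hitWt_nonneg h0 h1 _ _) (h A (Finset.mem_powerset.1 hA))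

theorem step_const (p : ℝ) (s : Residual N) (v : Fin N) (k : Color) (a : ℝ) :
    step p s v k (fun _ => a) = a := by
  classical
  have : ∑ A ∈ (s.left.erase v).powerset, ∏ w ∈ s.left.erase v, (if w ∈ A then p else 1 - p) = 1 := by
    have := sum_powerset_prod_ite (s.left.erase v) (fun _ => p) (fun _ => 1 - p)
    rw [Finset.prod_eq_one fun _ _ => by ring] at this
    convert this
  rw [step, ← Finset.sum_mul, this, one_mul]

theorem step_const_mul (p : ℝ) (s : Residual N) (v : Fin N) (k : Color) (a : ℝ)
    (F : Residual N → ℝ) : step p s v k (fun s' => a * F s') = a * step p s v k F := by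
  rw [step, step, Finset.mul_sum]
  exact Finset.sum_congr rfl fun _ _ => by ring

theorem step_add (p : ℝ) (s : Residual N) (v : Fin N) (k : Color)
    (F G : Residual N → ℝ) :
    step p s v k (fun s' => F s' + G s') = step p s v k F + step p s v k G := by
  rw [step, step, step, ← Finset.sum_add_distrib]
  exact Finset.sum_congr rfl fun _ _ => by ring

theorem step_sum {ι : Type*} (I : Finset ι) (p : ℝ) (s : Residual N) (v : Fin N) (k : Color)
    (F : ι → Residual N → ℝ) :
    step p s v k (fun s' => ∑ i ∈ I, F i s') = ∑ i ∈ I, step p s v k (F i) := by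
  simp only [step, Finset.mul_sum]
  exact Finset.sum_comm

theorem Residual.hit_left (s : Residual N) (v : Fin N) (k : Color) (A : Finset (Fin N)) :
    (s.hit v k A).left = s.left.erase v := rfl

/-- Many vertices are hit with a very small probability only. -/
theorem step_le_add_tail {p : ℝ} (h0 : 0 ≤ p) (h1 : p ≤ 1) {s : Residual N} {v : Fin N}
    {k : Color} {F G : Residual N → ℝ} {M : ℝ} (hM : 0 ≤ M) (m : ℕ)
    (h : ∀ A ⊆ s.left.erase v, A.card ≤ m → F (s.hit v k A) ≤ G (s.hit v k A))
    (h' : ∀ A ⊆ s.left.erase v, F (s.hit v k A) ≤ G (s.hit v k A) + M) :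
    step p s v k F ≤ step p s v k G + 2 ^ N * p ^ m * M := by
  classical
  have key : ∀ A ∈ (s.left.erase v).powerset,
      (∏ w ∈ s.left.erase v, (if w ∈ A then p else 1 - p)) * F (s.hit v k A) ≤
      (∏ w ∈ s.left.erase v, (if w ∈ A then p else 1 - p)) * G (s.hit v k A) + p ^ m * M := by
    intro A hA
    have hA' := Finset.mem_powerset.1 hA
    have hw := hitWt_nonneg h0 h1 (s.left.erase v) A
    rcases le_or_gt A.card m with hm | hm
    · have := mul_le_mul_of_nonneg_left (h A hA' hm) hw
      have : 0 ≤ p ^ m * M := by positivity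
      linarith
    · have h2 := mul_le_mul_of_nonneg_left (h' A hA') hw
      rw [mul_add] at h2
      -- A set of more than `m` vertices is hit with probability at most `p ^ m`, and there are at
      -- most `2 ^ N` such sets.
      have h3 : ∏ w ∈ s.left.erase v, (if w ∈ A then p else 1 - p) ≤ p ^ m := by
        rw [Finset.prod_ite, Finset.filter_mem_eq_inter, Finset.inter_eq_right.2 hA',
          Finset.prod_const, Finset.prod_const]
        calc p ^ A.card * (1 - p) ^ _ ≤ p ^ A.card * 1 :=
              mul_le_mul_of_nonneg_left (pow_le_one₀ (by linarith) (by linarith)) (by positivity)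
          _ ≤ p ^ m := by rw [mul_one]; exact pow_le_pow_of_le_one h0 h1 hm.le
      have := mul_le_mul_of_nonneg_right h3 hM
      linarith
  refine (Finset.sum_le_sum key).trans ?_
  rw [Finset.sum_add_distrib, Finset.sum_const, Finset.card_powerset, nsmul_eq_mul]
  have hcard : (s.left.erase v).card ≤ N := by
    simpa using Finset.card_le_univ (s.left.erase v)
  have : ((2 ^ (s.left.erase v).card : ℕ) : ℝ) ≤ 2 ^ N := by
    push_cast
    exact pow_le_pow_right₀ (by norm_num) hcard
  have h4 : 0 ≤ p ^ m * M := by positivity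
  have := mul_le_mul_of_nonneg_right this h4
  unfold step
  linarith

theorem card_avail_le (s : Residual N) (v : Fin N) : (s.avail v).card ≤ 3 := by
  simpa using Finset.card_le_univ (s.avail v)

/-- The search tree is dominated by the branching into all branches of each selected vertex. -/
theorem average_le {s : Residual N} {f : Fin N → ℝ} {b : ℝ} (hb : 0 ≤ b)
    (h : ∀ v ∈ s.shortest, f v ≤ b) : (∑ v ∈ s.shortest, f v) / s.shortest.card ≤ b := by
  rcases s.shortest.eq_empty_or_nonempty with h0 | h0
  · simp [h0, hb]
  · rw [div_le_iff₀ (by exact_mod_cast h0.card_pos)]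
    calc ∑ v ∈ s.shortest, f v ≤ ∑ v ∈ s.shortest, b := Finset.sum_le_sum h
      _ = b * s.shortest.card := by rw [Finset.sum_const, nsmul_eq_mul]; ring

theorem le_average {s : Residual N} {f : Fin N → ℝ} {b : ℝ} (hs : s.left.Nonempty)
    (h : ∀ v ∈ s.shortest, b ≤ f v) : b ≤ (∑ v ∈ s.shortest, f v) / s.shortest.card := by
  rw [le_div_iff₀ (by exact_mod_cast (s.shortest_nonempty hs).card_pos)]
  calc b * s.shortest.card = ∑ v ∈ s.shortest, b := by rw [Finset.sum_const, nsmul_eq_mul]; ring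
    _ ≤ ∑ v ∈ s.shortest, f v := Finset.sum_le_sum h

theorem shortest_eq_empty_of_left {s : Residual N} (h : s.left = ∅) : s.shortest = ∅ :=
  Finset.subset_empty.1 (h ▸ s.shortest_subset)

open Classical in
theorem mean_of_contradiction {p : ℝ} {f : Residual N → ℝ} {s : Residual N}
    (h : s.Contradiction) : mean p f s = f s := by
  rw [mean_eq, if_pos h, add_zero]

open Classical in
theorem mean_of_left_eq_empty {p : ℝ} {f : Residual N → ℝ} {s : Residual N}
    (h : s.left = ∅) : mean p f s = f s := by
  rw [mean_eq, shortest_eq_empty_of_left h]; simp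

theorem mean_of_alive {p : ℝ} {f : Residual N → ℝ} {s : Residual N}
    (h : ¬ s.Contradiction) : mean p f s = f s +
      (∑ v ∈ s.shortest, ∑ k ∈ s.avail v, step p s v k (mean p f)) / s.shortest.card := by
  rw [mean_eq, if_neg h]

theorem mean_nonneg {p : ℝ} (h0 : 0 ≤ p) (h1 : p ≤ 1) {f : Residual N → ℝ} (hf : ∀ s, 0 ≤ f s)
    (s : Residual N) : 0 ≤ mean p f s := by
  classical
  induction hn : s.left.card using Nat.strong_induction_on generalizing s with
  | _ n ih =>
    rw [mean_eq]
    refine add_nonneg (hf s) ?_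
    split_ifs with hc
    · exact le_rfl
    · refine div_nonneg (Finset.sum_nonneg fun v hv => Finset.sum_nonneg fun k _ => ?_)
        (Nat.cast_nonneg _)
      exact step_nonneg h0 h1 fun A _ => ih _ (hn ▸ s.card_left_hit_lt hv k A) _ rfl

theorem mean_mono {p : ℝ} (h0 : 0 ≤ p) (h1 : p ≤ 1) {f g : Residual N → ℝ}
    (hfg : ∀ s, f s ≤ g s) (s : Residual N) : mean p f s ≤ mean p g s := by
  classical
  induction hn : s.left.card using Nat.strong_induction_on generalizing s with
  | _ n ih =>
    rw [mean_eq, mean_eq]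
    refine add_le_add (hfg s) ?_
    split_ifs with hc
    · exact le_rfl
    · refine div_le_div_of_nonneg_right ?_ (Nat.cast_nonneg _)
      refine Finset.sum_le_sum fun v hv => Finset.sum_le_sum fun k _ => ?_
      exact step_le_step h0 h1 fun A _ => ih _ (hn ▸ s.card_left_hit_lt hv k A) _ rfl

/-- A node has at most three children, and `1 + 3 * 4 ^ (n - 1) ≤ 4 ^ n` for `n ≥ 1`. This crude
bound is used when an exceptional number of vertices is hit. -/
theorem mean_le_four_pow {p : ℝ} (h0 : 0 ≤ p) (h1 : p ≤ 1) {f : Residual N → ℝ}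
    (hf : ∀ s, f s ≤ 1) (s : Residual N) : mean p f s ≤ 4 ^ s.left.card := by
  classical
  induction hn : s.left.card using Nat.strong_induction_on generalizing s with
  | _ n ih =>
    by_cases hc : s.Contradiction
    · rw [mean_of_contradiction hc]
      exact (hf s).trans (one_le_pow₀ (by norm_num))
    rcases Nat.eq_zero_or_pos n with h | hpos
    · rw [mean_of_left_eq_empty (Finset.card_eq_zero.1 (hn.trans h)), h, pow_zero]
      exact hf s
    · rw [mean_of_alive hc]
      have h2 : (∑ v ∈ s.shortest, ∑ k ∈ s.avail v, step p s v k (mean p f)) / s.shortest.card ≤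
          3 * 4 ^ (n - 1) := by
        refine average_le (by positivity) fun v hv => ?_
        calc ∑ k ∈ s.avail v, step p s v k (mean p f) ≤ ∑ k ∈ s.avail v, (4 : ℝ) ^ (n - 1) := by
              refine Finset.sum_le_sum fun k _ => ?_
              rw [← step_const p s v k ((4 : ℝ) ^ (n - 1))]
              refine step_le_step h0 h1 fun A _ => ?_
              have hlt := s.card_left_hit_lt hv k A
              refine (ih _ (hn ▸ hlt) _ rfl).trans ?_
              exact pow_le_pow_right₀ (by norm_num) (by omega)
          _ ≤ 3 * 4 ^ (n - 1) := by
              rw [Finset.sum_const, nsmul_eq_mul]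
              have : ((s.avail v).card : ℝ) ≤ 3 := by exact_mod_cast card_avail_le s v
              gcongr
      obtain ⟨m, rfl⟩ : ∃ m, n = m + 1 := ⟨n - 1, by omega⟩
      simp only [Nat.add_sub_cancel] at h2
      have h3 : (1 : ℝ) ≤ 4 ^ m := one_le_pow₀ (by norm_num)
      rw [pow_succ]
      linarith [hf s]

end Dpll

/-! ### From the randomized procedure to the averaged full tree. -/

namespace Dpll

open MeasureTheory Filter Asymptotics
open scoped ENNReal Topology

variable {N : ℕ}

/-- The expectation of `X` under `P`. -/
noncomputable def ev {α : Type*} (P : PMF α) (X : α → ℝ≥0∞) : ℝ≥0∞ := ∑' o, P o * X o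

theorem ev_pure {α : Type*} (a : α) (X : α → ℝ≥0∞) : ev (PMF.pure a) X = X a := by
  classical
  rw [ev, tsum_eq_single a]
  · simp
  · intro b hb
    simp [hb]

theorem ev_bind {α β : Type*} (P : PMF α) (f : α → PMF β) (X : β → ℝ≥0∞) :
    ev (P.bind f) X = ev P fun a => ev (f a) X := by
  simp only [ev, PMF.bind_apply, ← ENNReal.tsum_mul_right, ← ENNReal.tsum_mul_left]
  rw [ENNReal.tsum_comm]
  simp only [mul_assoc]

theorem ev_map {α β : Type*} (P : PMF α) (g : α → β) (X : β → ℝ≥0∞) :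
    ev (P.map g) X = ev P fun a => X (g a) := by
  rw [PMF.map, ev_bind]
  simp only [Function.comp, ev_pure]

theorem ev_const {α : Type*} (P : PMF α) (c : ℝ≥0∞) : ev P (fun _ => c) = c := by
  rw [ev, ENNReal.tsum_mul_right, P.tsum_coe, one_mul]

theorem ev_mono {α : Type*} (P : PMF α) {X Y : α → ℝ≥0∞} (h : ∀ o ∈ P.support, X o ≤ Y o) :
    ev P X ≤ ev P Y := by
  refine ENNReal.tsum_le_tsum fun o => ?_
  by_cases ho : o ∈ P.support
  · exact mul_le_mul_right (h o ho) _
  · rw [(PMF.apply_eq_zero_iff P o).2 ho, zero_mul, zero_mul]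

theorem ev_add {α : Type*} (P : PMF α) (X Y : α → ℝ≥0∞) :
    ev P (fun o => X o + Y o) = ev P X + ev P Y := by
  simp only [ev, mul_add]
  exact ENNReal.tsum_add

theorem ev_uniform {α : Type*} [Fintype α] [Nonempty α] (X : α → ℝ≥0∞) :
    ev (PMF.uniformOfFintype α) X = (∑ a, X a) / Fintype.card α := by
  rw [ev, tsum_fintype, Finset.sum_congr rfl fun a _ => by rw [PMF.uniformOfFintype_apply],
    ← Finset.mul_sum, div_eq_mul_inv, mul_comm]

open Classical in
theorem dpll_of_contradiction {G : SimpleGraph (Fin N)} {ord : ColorOrder N} {s : Residual N}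
    (h : s.Contradiction) : dpll G ord s = PMF.pure ⟨false, 1, 1⟩ := by
  rw [dpll, if_pos h]

open Classical in
theorem dpll_of_left_eq_empty {G : SimpleGraph (Fin N)} {ord : ColorOrder N} {s : Residual N}
    (h : s.left = ∅) : dpll G ord s = PMF.pure ⟨true, 1, 1⟩ := by
  have hc : ¬ s.Contradiction := by rintro ⟨v, hv, _⟩; simp [h] at hv
  rw [dpll, if_neg hc, dif_neg (by simp [h])]

/-- A branch that succeeds is returned unchanged, all others are combined; so a property that holds
for the empty outcome and is preserved by the combination is an invariant of the loop. -/
theorem mem_support_tryBranches {f : Color → PMF Outcome} {p : Outcome → Prop}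
    (h0 : p ⟨false, 0, 0⟩)
    (h1 : ∀ o r : Outcome, p o → p r → p ⟨r.found, o.nodes + r.nodes, o.leaves + r.leaves⟩)
    {ks : List Color} (hf : ∀ k ∈ ks, ∀ o ∈ (f k).support, p o) :
    ∀ o ∈ (tryBranches f ks).support, p o := by
  induction ks with
  | nil =>
    intro o ho
    rw [tryBranches, PMF.support_pure, Set.mem_singleton_iff] at ho
    exact ho ▸ h0
  | cons k ks ih =>
    intro o ho
    rw [tryBranches, PMF.mem_support_bind_iff] at ho
    obtain ⟨a, ha, hoa⟩ := ho
    have hpa := hf k (by simp) a ha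
    split_ifs at hoa
    · rw [PMF.support_pure, Set.mem_singleton_iff] at hoa
      exact hoa ▸ hpa
    · rw [PMF.mem_support_map_iff] at hoa
      obtain ⟨r, hr, rfl⟩ := hoa
      exact h1 _ _ hpa (ih (fun k hk => hf k (by simp [hk])) r hr)

theorem mem_order {ord : ColorOrder N} {G : SimpleGraph (Fin N)} {s : Residual N} {v : Fin N}
    {k : Color} : k ∈ ord.order G s v ↔ k ∈ s.avail v := by
  have := ord.order_eq G s v
  rw [← Multiset.mem_coe, this, Finset.mem_val]

theorem sum_order {ord : ColorOrder N} {G : SimpleGraph (Fin N)} {s : Residual N} {v : Fin N}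
    {M : Type*} [AddCommMonoid M] (g : Color → M) :
    ((ord.order G s v).map g).sum = ∑ k ∈ s.avail v, g k := by
  have := ord.order_eq G s v
  rw [Finset.sum, ← this, Multiset.map_coe, Multiset.sum_coe]

/-- The search tree of an alive instance in which a vertex is left. -/
theorem ev_dpll {G : SimpleGraph (Fin N)} {ord : ColorOrder N} {s : Residual N}
    (hc : ¬ s.Contradiction) (hl : s.left.Nonempty) (X : Outcome → ℝ≥0∞) :
    ev (dpll G ord s) X = (∑ v ∈ s.shortest,
      ev (tryBranches (fun k => dpll G ord (s.assign G v k)) (ord.order G s v))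
        fun o => X ⟨o.found, o.nodes + 1, o.leaves⟩) / s.shortest.card := by
  classical
  rw [dpll, if_neg hc, dif_pos hl]
  have : Nonempty {v // v ∈ s.shortest} := (s.shortest_nonempty hl).to_subtype
  rw [ev_bind, ev_uniform]
  simp only [ev_map, Fintype.card_coe]
  rw [Finset.sum_coe_sort s.shortest (fun v =>
    ev (tryBranches (fun k => dpll G ord (s.assign G v k)) (ord.order G s v))
        fun o => X ⟨o.found, o.nodes + 1, o.leaves⟩)]

theorem mem_support_dpll {G : SimpleGraph (Fin N)} {ord : ColorOrder N} {s : Residual N}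
    (hc : ¬ s.Contradiction) (hl : s.left.Nonempty) {o : Outcome}
    (ho : o ∈ (dpll G ord s).support) : ∃ v ∈ s.shortest,
      ∃ r ∈ (tryBranches (fun k => dpll G ord (s.assign G v k)) (ord.order G s v)).support,
        o = ⟨r.found, r.nodes + 1, r.leaves⟩ := by
  classical
  rw [dpll, if_neg hc, dif_pos hl, PMF.mem_support_bind_iff] at ho
  obtain ⟨v, -, hv⟩ := ho
  rw [PMF.mem_support_map_iff] at hv
  obtain ⟨r, hr, e⟩ := hv
  exact ⟨v.1, v.2, r, hr, e.symm⟩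

theorem leaves_le_nodes (G : SimpleGraph (Fin N)) (ord : ColorOrder N) (s : Residual N) :
    ∀ o ∈ (dpll G ord s).support, o.leaves ≤ o.nodes := by
  induction hn : s.left.card using Nat.strong_induction_on generalizing s with
  | _ n ih =>
    intro o ho
    by_cases hc : s.Contradiction
    · rw [dpll_of_contradiction hc, PMF.support_pure, Set.mem_singleton_iff] at ho
      rw [ho]
    rcases s.left.eq_empty_or_nonempty with hl | hl
    · rw [dpll_of_left_eq_empty hl, PMF.support_pure, Set.mem_singleton_iff] at ho
      rw [ho]
    obtain ⟨v, hv, r, hr, rfl⟩ := mem_support_dpll hc hl ho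
    have := mem_support_tryBranches (p := fun o : Outcome => o.leaves ≤ o.nodes) le_rfl
      (fun o r h1 h2 => add_le_add h1 h2)
      (fun k _ => ih _ (hn ▸ s.card_left_assign_lt G hv k) _ rfl) r hr
    exact this.trans (Nat.le_succ _)

/-- A proper colouring of the remaining vertices from their lists. -/
def Colorable (G : SimpleGraph (Fin N)) (s : Residual N) : Prop :=
  ∃ σ : Fin N → Color, (∀ w ∈ s.left, σ w ∈ s.avail w) ∧
    ∀ v ∈ s.left, ∀ w ∈ s.left, G.Adj v w → σ v ≠ σ w

theorem colorable_of_assign {G : SimpleGraph (Fin N)} {s : Residual N} {v : Fin N} {k : Color}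
    (hv : v ∈ s.left) (hk : k ∈ s.avail v) (h : Colorable G (s.assign G v k)) :
    Colorable G s := by
  classical
  obtain ⟨σ, h1, h2⟩ := h
  have hnb : ∀ w ∈ s.left, w ≠ v → σ w ∈ s.avail w ∧ (G.Adj v w → σ w ≠ k) := by
    intro w hw hne
    have := h1 w (Finset.mem_erase.2 ⟨hne, hw⟩)
    simp only [Residual.assign] at this
    split_ifs at this with ha
    · exact ⟨Finset.mem_of_mem_erase this, fun _ => Finset.ne_of_mem_erase this⟩
    · exact ⟨this, fun h => absurd h ha⟩
  refine ⟨Function.update σ v k, fun w hw => ?_, fun a ha b hb hab => ?_⟩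
  · by_cases hwv : w = v
    · subst hwv; simpa using hk
    · rw [Function.update_of_ne hwv]
      exact (hnb w hw hwv).1
  · by_cases hav : a = v
    · subst hav
      have hba : b ≠ a := hab.ne'
      rw [Function.update_self, Function.update_of_ne hba]
      exact ((hnb b hb hba).2 hab).symm
    · by_cases hbv : b = v
      · subst hbv
        rw [Function.update_self, Function.update_of_ne hav]
        exact (hnb a ha hav).2 hab.symm
      · rw [Function.update_of_ne hav, Function.update_of_ne hbv]
        exact h2 a (Finset.mem_erase.2 ⟨hav, ha⟩) b (Finset.mem_erase.2 ⟨hbv, hb⟩) hab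

theorem colorable_assign {G : SimpleGraph (Fin N)} {s : Residual N} {v : Fin N}
    (hv : v ∈ s.left) (h : Colorable G s) : ∃ k ∈ s.avail v, Colorable G (s.assign G v k) := by
  classical
  obtain ⟨σ, h1, h2⟩ := h
  refine ⟨σ v, h1 v hv, σ, fun w hw => ?_, fun a ha b hb hab => ?_⟩
  · have hw' := Finset.mem_of_mem_erase hw
    simp only [Residual.assign]
    split_ifs with ha
    · exact Finset.mem_erase.2 ⟨(h2 v hv w hw' ha).symm, h1 w hw'⟩
    · exact h1 w hw'
  · exact h2 a (Finset.mem_of_mem_erase ha) b (Finset.mem_of_mem_erase hb) hab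

theorem not_contradiction_of_colorable {G : SimpleGraph (Fin N)} {s : Residual N}
    (h : Colorable G s) : ¬ s.Contradiction := by
  rintro ⟨v, hv, h0⟩
  obtain ⟨σ, h1, -⟩ := h
  simpa [h0] using h1 v hv

theorem colorable_of_left_eq_empty (G : SimpleGraph (Fin N)) {s : Residual N} (h : s.left = ∅) :
    Colorable G s := ⟨fun _ => 0, by simp [h], by simp [h]⟩

/-- Success means that no vertex is left, which is colourable, and colourability passes from a child
to its parent. Hence without a colouring the tree is built completely. -/
theorem not_found (G : SimpleGraph (Fin N)) (ord : ColorOrder N) (s : Residual N)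
    (hs : ¬ Colorable G s) : ∀ o ∈ (dpll G ord s).support, o.found = false := by
  induction hn : s.left.card using Nat.strong_induction_on generalizing s with
  | _ n ih =>
    intro o ho
    by_cases hc : s.Contradiction
    · rw [dpll_of_contradiction hc, PMF.support_pure, Set.mem_singleton_iff] at ho
      rw [ho]
    rcases s.left.eq_empty_or_nonempty with hl | hl
    · exact absurd (colorable_of_left_eq_empty G hl) hs
    obtain ⟨v, hv, r, hr, rfl⟩ := mem_support_dpll hc hl ho
    exact mem_support_tryBranches (p := fun o : Outcome => o.found = false) rfl
      (fun o r _ h2 => h2)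
      (fun k hk => ih _ (hn ▸ s.card_left_assign_lt G hv k) _
        (fun h => hs (colorable_of_assign (s.shortest_subset hv) (mem_order.1 hk) h)) rfl) r hr

/-- Halting can only prune the tree. -/
theorem ev_tryBranches_nodes_le (f : Color → PMF Outcome) (ks : List Color) :
    ev (tryBranches f ks) (fun o => (o.nodes : ℝ≥0∞)) ≤
      (ks.map fun k => ev (f k) fun o => (o.nodes : ℝ≥0∞)).sum := by
  induction ks with
  | nil => simp [tryBranches, ev_pure]
  | cons k ks ih =>
    rw [tryBranches, ev_bind, List.map_cons, List.sum_cons]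
    calc _ ≤ ev (f k) (fun o => (o.nodes : ℝ≥0∞) +
            (ks.map fun k => ev (f k) fun o => (o.nodes : ℝ≥0∞)).sum) := by
          refine ev_mono _ fun o _ => ?_
          split_ifs
          · rw [ev_pure]; exact le_self_add
          · rw [ev_map]
            simp only [Nat.cast_add]
            rw [ev_add, ev_const]
            gcongr
      _ = _ := by rw [ev_add, ev_const]

/-- Without success in any branch nothing is pruned, so equality holds whatever the order of the
colours. -/
theorem ev_tryBranches_leaves (f : Color → PMF Outcome) (ks : List Color)
    (hf : ∀ k ∈ ks, ∀ o ∈ (f k).support, o.found = false) :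
    ev (tryBranches f ks) (fun o => (o.leaves : ℝ≥0∞)) =
      (ks.map fun k => ev (f k) fun o => (o.leaves : ℝ≥0∞)).sum := by
  induction ks with
  | nil => simp [tryBranches, ev_pure]
  | cons k ks ih =>
    rw [tryBranches, ev_bind, List.map_cons, List.sum_cons, ← ih fun k hk => hf k (by simp [hk])]
    have key : ∀ o ∈ (f k).support, ev (if o.found then PMF.pure o else
        (tryBranches f ks).map fun r => ⟨r.found, o.nodes + r.nodes, o.leaves + r.leaves⟩)
        (fun o => (o.leaves : ℝ≥0∞)) = (o.leaves : ℝ≥0∞) +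
          ev (tryBranches f ks) (fun o => (o.leaves : ℝ≥0∞)) := by
      intro o ho
      rw [if_neg (by simp [hf k (by simp) o ho]), ev_map]
      simp only [Nat.cast_add]
      rw [ev_add, ev_const]
    refine Eq.trans (le_antisymm (ev_mono _ fun o ho => (key o ho).le)
      (ev_mono _ fun o ho => (key o ho).ge)) ?_
    rw [ev_add, ev_const]

theorem cost_nonneg (G : SimpleGraph (Fin N)) {f : Residual N → ℝ} (hf : ∀ s, 0 ≤ f s)
    (s : Residual N) : 0 ≤ cost G f s := by
  classical
  induction hn : s.left.card using Nat.strong_induction_on generalizing s with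
  | _ n ih =>
    rw [cost_eq]
    refine add_nonneg (hf s) ?_
    split_ifs with hc
    · exact le_rfl
    · refine div_nonneg (Finset.sum_nonneg fun v hv => Finset.sum_nonneg fun k _ => ?_)
        (Nat.cast_nonneg _)
      exact ih _ (hn ▸ s.card_left_assign_lt G hv k) _ rfl

theorem ofReal_average {s : Residual N} (hl : s.left.Nonempty) {g : Fin N → ℝ}
    (hg : ∀ v ∈ s.shortest, 0 ≤ g v) :
    ENNReal.ofReal ((∑ v ∈ s.shortest, g v) / s.shortest.card) =
      (∑ v ∈ s.shortest, ENNReal.ofReal (g v)) / s.shortest.card := by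
  rw [ENNReal.ofReal_div_of_pos (by exact_mod_cast (s.shortest_nonempty hl).card_pos),
    ENNReal.ofReal_sum_of_nonneg hg, ENNReal.ofReal_natCast]

theorem ev_nodes_le_cost (G : SimpleGraph (Fin N)) (ord : ColorOrder N) (s : Residual N) :
    ev (dpll G ord s) (fun o => (o.nodes : ℝ≥0∞)) ≤ ENNReal.ofReal (cost G (fun _ => 1) s) := by
  classical
  induction hn : s.left.card using Nat.strong_induction_on generalizing s with
  | _ n ih =>
    have hpos : ∀ s : Residual N, 0 ≤ cost G (fun _ => 1) s := cost_nonneg G fun _ => zero_le_one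
    by_cases hc : s.Contradiction
    · rw [dpll_of_contradiction hc, ev_pure, cost_eq, if_pos hc]; simp
    rcases s.left.eq_empty_or_nonempty with hl | hl
    · rw [dpll_of_left_eq_empty hl, ev_pure, cost_eq, shortest_eq_empty_of_left hl]; simp
    rw [ev_dpll hc hl, cost_eq, if_neg hc]
    have hsum : ∀ v ∈ s.shortest, 0 ≤ ∑ k ∈ s.avail v, cost G (fun _ => 1) (s.assign G v k) :=
      fun v _ => Finset.sum_nonneg fun k _ => hpos _
    rw [ENNReal.ofReal_add zero_le_one
      (div_nonneg (Finset.sum_nonneg hsum) (Nat.cast_nonneg _)), ofReal_average hl hsum,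
      ENNReal.ofReal_one]
    have hcard : (s.shortest.card : ℝ≥0∞) ≠ 0 := by
      exact_mod_cast (s.shortest_nonempty hl).card_pos.ne'
    -- The node itself is written as an average of ones, so that both sides become averages over the
    -- selected vertices.
    have hone : (1 : ℝ≥0∞) = (∑ v ∈ s.shortest, 1) / s.shortest.card := by
      rw [Finset.sum_const, nsmul_eq_mul, mul_one, ENNReal.div_self hcard (ENNReal.natCast_ne_top _)]
    rw [hone, ← ENNReal.add_div, ← Finset.sum_add_distrib]
    refine ENNReal.div_le_div_right (Finset.sum_le_sum fun v hv => ?_) _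
    simp only [Nat.cast_add, Nat.cast_one]
    rw [ev_add, ev_const, add_comm]
    refine add_le_add le_rfl ((ev_tryBranches_nodes_le _ _).trans ?_)
    rw [sum_order, ENNReal.ofReal_sum_of_nonneg fun k _ => hpos _]
    exact Finset.sum_le_sum fun k _ => ih _ (hn ▸ s.card_left_assign_lt G hv k) _ rfl

open Classical in
/-- The indicator of the nodes without contradiction in which `m` vertices are left. -/
noncomputable def aliveAt (m : ℕ) (s : Residual N) : ℝ :=
  if s.left.card = m ∧ ¬ s.Contradiction then 1 else 0

theorem aliveAt_nonneg (m : ℕ) (s : Residual N) : 0 ≤ aliveAt m s := by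
  unfold aliveAt; split_ifs <;> norm_num

theorem aliveAt_le_one (m : ℕ) (s : Residual N) : aliveAt m s ≤ 1 := by
  unfold aliveAt; split_ifs <;> norm_num

open Classical in
theorem local_aliveAt (m : ℕ) : Local (aliveAt (N := N) m) := by
  intro s s' h
  exact if_congr (by rw [h.1, h.contradiction]) rfl rfl

theorem cost_aliveAt_of_lt (G : SimpleGraph (Fin N)) {m : ℕ} {s : Residual N}
    (h : s.left.card < m) : cost G (aliveAt m) s = 0 := by
  classical
  induction hn : s.left.card using Nat.strong_induction_on generalizing s with
  | _ n ih =>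
    rw [cost_eq, aliveAt, if_neg fun hh => h.ne hh.1, zero_add]
    split_ifs with hc
    · rfl
    · rw [Finset.sum_eq_zero fun v hv => Finset.sum_eq_zero fun k _ =>
        ih _ (hn ▸ s.card_left_assign_lt G hv k) ((s.card_left_assign_lt G hv k).trans h) rfl,
        zero_div]

theorem cost_aliveAt_of_eq (G : SimpleGraph (Fin N)) {m : ℕ} {s : Residual N}
    (h : s.left.card = m) : cost G (aliveAt m) s = aliveAt m s := by
  classical
  rw [cost_eq]
  split_ifs with hc
  · rw [add_zero]
  · rw [Finset.sum_eq_zero fun v hv => Finset.sum_eq_zero fun k _ =>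
      cost_aliveAt_of_lt G (h ▸ s.card_left_assign_lt G hv k), zero_div, add_zero]

/-- Nodes with the same number of remaining vertices have disjoint subtrees, and every subtree of
the full tree contains a leaf. The second inequality is what remains to be known when the level `m`
is reached. -/
theorem one_le_ev_leaves (G : SimpleGraph (Fin N)) (ord : ColorOrder N) {s : Residual N}
    (hs : ¬ Colorable G s) {m : ℕ} :
    ENNReal.ofReal (cost G (aliveAt m) s) ≤ ev (dpll G ord s) (fun o => (o.leaves : ℝ≥0∞)) ∧
      1 ≤ ev (dpll G ord s) (fun o => (o.leaves : ℝ≥0∞)) := by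
  classical
  induction hn : s.left.card using Nat.strong_induction_on generalizing s with
  | _ n ih =>
    by_cases hc : s.Contradiction
    · rw [dpll_of_contradiction hc, ev_pure, cost_eq, if_pos hc]
      simp [aliveAt_le_one]
    rcases s.left.eq_empty_or_nonempty with hl | hl
    · exact absurd (colorable_of_left_eq_empty G hl) hs
    have hnf : ∀ v ∈ s.shortest, ∀ k ∈ s.avail v, ¬ Colorable G (s.assign G v k) :=
      fun v hv k hk h => hs (colorable_of_assign (s.shortest_subset hv) hk h)
    have he : ev (dpll G ord s) (fun o => (o.leaves : ℝ≥0∞)) =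
        (∑ v ∈ s.shortest, ∑ k ∈ s.avail v,
          ev (dpll G ord (s.assign G v k)) (fun o => (o.leaves : ℝ≥0∞))) / s.shortest.card := by
      rw [ev_dpll hc hl]
      congr 1
      refine Finset.sum_congr rfl fun v hv => ?_
      rw [ev_tryBranches_leaves, sum_order]
      exact fun k hk => not_found G ord _ (hnf v hv k (mem_order.1 hk))
    have hcard : (s.shortest.card : ℝ≥0∞) ≠ 0 := by
      exact_mod_cast (s.shortest_nonempty hl).card_pos.ne'
    have hone : (1 : ℝ≥0∞) = (∑ v ∈ s.shortest, 1) / s.shortest.card := by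
      rw [Finset.sum_const, nsmul_eq_mul, mul_one, ENNReal.div_self hcard (ENNReal.natCast_ne_top _)]
    have h1 : 1 ≤ ev (dpll G ord s) (fun o => (o.leaves : ℝ≥0∞)) := by
      rw [he, hone]
      refine ENNReal.div_le_div_right (Finset.sum_le_sum fun v hv => ?_) _
      have hne : (s.avail v).Nonempty := by
        rw [Finset.nonempty_iff_ne_empty]
        exact fun h => hc ⟨v, s.shortest_subset hv, h⟩
      obtain ⟨k, hk⟩ := hne
      exact ((ih _ (hn ▸ s.card_left_assign_lt G hv k) (hnf v hv k hk) rfl).2).trans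
        (Finset.single_le_sum (f := fun k => ev (dpll G ord (s.assign G v k))
          (fun o => (o.leaves : ℝ≥0∞))) (fun _ _ => zero_le) hk)
    refine ⟨?_, h1⟩
    by_cases hm : s.left.card = m
    · rw [cost_aliveAt_of_eq G hm]
      exact (ENNReal.ofReal_le_one.2 (aliveAt_le_one m s)).trans h1
    · have hpos := cost_nonneg G (aliveAt_nonneg (N := N) m)
      rw [cost_eq, if_neg hc, he, aliveAt, if_neg fun hh => hm hh.1, zero_add,
        ofReal_average hl fun v _ => Finset.sum_nonneg fun k _ => hpos _]
      refine ENNReal.div_le_div_right (Finset.sum_le_sum fun v hv => ?_) _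
      rw [ENNReal.ofReal_sum_of_nonneg fun k _ => hpos _]
      exact Finset.sum_le_sum fun k hk =>
        (ih _ (hn ▸ s.card_left_assign_lt G hv k) (hnf v hv k hk) rfl).1

theorem cost_aliveAt_le (G : SimpleGraph (Fin N)) (m : ℕ) (s : Residual N) :
    cost G (aliveAt m) s ≤ 3 ^ s.left.card := by
  classical
  induction hn : s.left.card using Nat.strong_induction_on generalizing s with
  | _ n ih =>
    by_cases hm : s.left.card = m
    · rw [cost_aliveAt_of_eq G hm]
      exact (aliveAt_le_one m s).trans (one_le_pow₀ (by norm_num))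
    rw [cost_eq, aliveAt, if_neg fun hh => hm hh.1, zero_add]
    split_ifs with hc
    · positivity
    refine average_le (by positivity) fun v hv => ?_
    have hlt := s.card_left_assign_lt G hv 0
    calc ∑ k ∈ s.avail v, cost G (aliveAt m) (s.assign G v k) ≤
          ∑ k ∈ s.avail v, (3 : ℝ) ^ (n - 1) := by
          refine Finset.sum_le_sum fun k _ => ?_
          have hlt := s.card_left_assign_lt G hv k
          refine (ih _ (hn ▸ hlt) _ rfl).trans ?_
          exact pow_le_pow_right₀ (by norm_num) (by omega)
      _ ≤ 3 * 3 ^ (n - 1) := by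
          rw [Finset.sum_const, nsmul_eq_mul]
          have : ((s.avail v).card : ℝ) ≤ 3 := by exact_mod_cast card_avail_le s v
          gcongr
      _ = 3 ^ n := by rw [← pow_succ']; congr 1; omega

/-- Following a fixed colouring leads, whatever vertices are selected, to an alive node with no
vertex left. So the indicator of colourability is at most the number of such nodes. -/
theorem one_le_cost_of_colorable {G : SimpleGraph (Fin N)} {s : Residual N}
    (hs : Colorable G s) : 1 ≤ cost G (aliveAt 0) s := by
  classical
  induction hn : s.left.card using Nat.strong_induction_on generalizing s with
  | _ n ih =>
    have hc := not_contradiction_of_colorable hs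
    rcases s.left.eq_empty_or_nonempty with hl | hl
    · rw [cost_aliveAt_of_eq G (by simp [hl]), aliveAt, if_pos ⟨by simp [hl], hc⟩]
    rw [cost_eq, if_neg hc]
    refine le_add_of_nonneg_of_le (aliveAt_nonneg _ _) (le_average hl fun v hv => ?_)
    obtain ⟨k, hk, h⟩ := colorable_assign (s.shortest_subset hv) hs
    exact (ih _ (hn ▸ s.card_left_assign_lt G hv k) h rfl).trans
      (Finset.single_le_sum (f := fun k => cost G (aliveAt 0) (s.assign G v k))
        (fun _ _ => cost_nonneg G (aliveAt_nonneg 0) _) hk)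

instance measurableSingletonClass_graph : MeasurableSingletonClass (SimpleGraph (Fin N)) where
  measurableSet_singleton G := by
    have : ({G} : Set (SimpleGraph (Fin N))) = ⋂ u, ⋂ v, {G' | G'.Adj u v ↔ G.Adj u v} := by
      ext G'
      simp only [Set.mem_singleton_iff, Set.mem_iInter, Set.mem_ofPred_eq]
      exact ⟨fun h u v => by rw [h], fun h => by ext u v; exact h u v⟩
    rw [this]
    refine MeasurableSet.iInter fun u => MeasurableSet.iInter fun v => ?_
    have h : Measurable fun G' : SimpleGraph (Fin N) => G'.Adj u v :=
      SimpleGraph.measurable_iff_adj.1 measurable_id u v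
    exact h (MeasurableSet.of_discrete (s := {P : Prop | P ↔ G.Adj u v}))

theorem toNNReal_coe (p : unitInterval) :
    ((unitInterval.toNNReal p : NNReal) : ℝ≥0∞) = ENNReal.ofReal p := by
  rw [ENNReal.ofReal, Real.toNNReal_of_nonneg p.2.1]
  rfl

theorem measure_singleton (p : unitInterval) (G : SimpleGraph (Fin N)) :
    SimpleGraph.binomialRandom (Fin N) p {G} = ENNReal.ofReal (wt p G) := by
  rw [SimpleGraph.binomialRandom_singleton, wt, Nat.card_fin]
  rw [ENNReal.ofReal_mul (pow_nonneg p.2.1 _), ENNReal.ofReal_pow p.2.1,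
    ENNReal.ofReal_pow (sub_nonneg.2 p.2.2)]
  rw [toNNReal_coe, toNNReal_coe, unitInterval.coe_symm_eq]

theorem sum_wt (p : unitInterval) : ∑ G : SimpleGraph (Fin N), wt p G = 1 := by
  classical
  have h := measure_univ (μ := SimpleGraph.binomialRandom (Fin N) p)
  rw [← Finset.coe_univ, ← sum_measure_singleton] at h
  simp only [measure_singleton] at h
  rw [← ENNReal.ofReal_sum_of_nonneg fun G _ => wt_nonneg p.2.1 p.2.2 G] at h
  exact ENNReal.ofReal_eq_one.1 h

theorem expected_eq (X : Outcome → ℕ) (c : ℝ) (ord : ColorOrder N) :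
    expected X c N ord = ∑ G : SimpleGraph (Fin N),
      ENNReal.ofReal (wt (edgeProb c N) G) *
        ev (dpll G ord (Residual.initial N)) (fun o => (X o : ℝ≥0∞)) := by
  classical
  rw [expected, lintegral_fintype]
  refine Finset.sum_congr rfl fun G _ => ?_
  rw [measure_singleton, mul_comm]
  rfl

theorem expected_leaves_le_nodes (c : ℝ) (ord : ColorOrder N) :
    expected Outcome.leaves c N ord ≤ expected Outcome.nodes c N ord := by
  classical
  rw [expected_eq, expected_eq]
  refine Finset.sum_le_sum fun G _ => ?_
  gcongr
  refine ev_mono _ fun o ho => ?_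
  exact_mod_cast leaves_le_nodes G ord _ o ho

theorem expected_nodes_le (c : ℝ) (ord : ColorOrder N) :
    expected Outcome.nodes c N ord ≤
      ENNReal.ofReal (mean (edgeProb c N) (fun _ => 1) (Residual.initial N)) := by
  classical
  rw [expected_eq, ← sum_wt_cost (sum_wt _) (fun _ _ _ => rfl), ENNReal.ofReal_sum_of_nonneg
    fun G _ => mul_nonneg (wt_nonneg (edgeProb c N).2.1 (edgeProb c N).2.2 G)
      (cost_nonneg G (fun _ => zero_le_one) _)]
  refine Finset.sum_le_sum fun G _ => ?_
  rw [ENNReal.ofReal_mul (wt_nonneg (edgeProb c N).2.1 (edgeProb c N).2.2 G)]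
  gcongr
  exact ev_nodes_le_cost G ord _

/-- On colourable graphs nothing is claimed about the procedure: there the difference on the left is
not positive, since a level has at most `3 ^ N` nodes while at least one colouring exists. On all
other graphs `one_le_ev_leaves` applies. -/
theorem le_expected_leaves (c : ℝ) (ord : ColorOrder N) (m : ℕ) :
    ENNReal.ofReal (mean (edgeProb c N) (aliveAt m) (Residual.initial N) -
      3 ^ N * mean (edgeProb c N) (aliveAt 0) (Residual.initial N)) ≤
      expected Outcome.leaves c N ord := by
  classical
  set p : ℝ := (edgeProb c N : ℝ) with hp
  have hwt : ∀ G : SimpleGraph (Fin N), 0 ≤ wt p G :=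
    wt_nonneg (edgeProb c N).2.1 (edgeProb c N).2.2
  rw [expected_eq, ← sum_wt_cost (sum_wt _) (local_aliveAt m),
    ← sum_wt_cost (sum_wt _) (local_aliveAt 0), Finset.mul_sum, ← Finset.sum_sub_distrib]
  refine (ENNReal.ofReal_le_ofReal (q := ∑ G : SimpleGraph (Fin N), wt p G *
    (if Colorable G (Residual.initial N) then 0 else
      cost G (aliveAt m) (Residual.initial N))) ?_).trans ?_
  · refine Finset.sum_le_sum fun G _ => ?_
    rw [← mul_assoc, mul_comm ((3 : ℝ) ^ N), mul_assoc, ← mul_sub]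
    refine mul_le_mul_of_nonneg_left ?_ (hwt G)
    split_ifs with h
    · have h1 := cost_aliveAt_le G m (Residual.initial N)
      have h2 : (Residual.initial N).left.card = N := by simp [Residual.initial]
      rw [h2] at h1
      have h3 := one_le_cost_of_colorable h
      have h4 : (0 : ℝ) < 3 ^ N := by positivity
      nlinarith
    · have := cost_nonneg G (aliveAt_nonneg (N := N) 0) (Residual.initial N)
      have h4 : (0 : ℝ) < 3 ^ N := by positivity
      nlinarith
  · rw [ENNReal.ofReal_sum_of_nonneg fun G _ => mul_nonneg (hwt G) (by
      split_ifs
      · exact le_rfl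
      · exact cost_nonneg G (aliveAt_nonneg (N := N) m) _)]
    refine Finset.sum_le_sum fun G _ => ?_
    rw [ENNReal.ofReal_mul (hwt G)]
    gcongr
    split_ifs with h
    · simp
    · exact (one_le_ev_leaves G ord h).1

end Dpll

/-! ### First-moment bound for decision nodes with few remaining vertices. -/

namespace Dpll

variable {N : ℕ}

open Classical in
/-- The indicator of the nodes with `m` remaining vertices in which no list has less than two
colours. -/
noncomputable def decisionAt (m : ℕ) (s : Residual N) : ℝ :=
  if s.left.card = m ∧ ∀ w ∈ s.left, 2 ≤ (s.avail w).card then 1 else 0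

theorem not_contradiction_of_two_le {s : Residual N} (h : ∀ w ∈ s.left, 2 ≤ (s.avail w).card) :
    ¬ s.Contradiction := by
  rintro ⟨v, hv, h0⟩
  have := h v hv
  rw [h0] at this
  simp at this

theorem decisionAt_nonneg (m : ℕ) (s : Residual N) : 0 ≤ decisionAt m s := by
  unfold decisionAt; split_ifs <;> norm_num

/-- With no vertex left the condition on the lists is void, so the first-moment bound also controls
the number of proper colourings. -/
theorem aliveAt_zero_le (s : Residual N) : aliveAt 0 s ≤ decisionAt 0 s := by
  unfold aliveAt
  split_ifs with h
  · have h2 : ∀ w ∈ s.left, 2 ≤ (s.avail w).card := by simp [Finset.card_eq_zero.1 h.1]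
    rw [decisionAt, if_pos ⟨h.1, h2⟩]
  · exact decisionAt_nonneg _ _

theorem mean_eq_zero_of_lt {p : ℝ} {f : Residual N → ℝ} {m : ℕ}
    (hf : ∀ s : Residual N, s.left.card < m → f s = 0) {s : Residual N}
    (h : s.left.card < m) : mean p f s = 0 := by
  classical
  induction hn : s.left.card using Nat.strong_induction_on generalizing s with
  | _ n ih =>
    rw [mean_eq, hf s h, zero_add]
    split_ifs with hc
    · rfl
    · rw [Finset.sum_eq_zero fun v hv => Finset.sum_eq_zero fun k _ => ?_, zero_div]
      have : step p s v k (mean p f) = step p s v k (fun _ => 0) := step_congr fun A _ =>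
        ih _ (hn ▸ s.card_left_hit_lt hv k A) ((s.card_left_hit_lt hv k A).trans h) rfl
      rw [this, step_const]

theorem mean_eq_of_card_eq {p : ℝ} {f : Residual N → ℝ} {m : ℕ}
    (hf : ∀ s : Residual N, s.left.card < m → f s = 0) {s : Residual N}
    (h : s.left.card = m) : mean p f s = f s := by
  classical
  rw [mean_eq]
  split_ifs with hc
  · rw [add_zero]
  · rw [Finset.sum_eq_zero fun v hv => Finset.sum_eq_zero fun k _ => ?_, zero_div, add_zero]
    have : step p s v k (mean p f) = step p s v k (fun _ => 0) := step_congr fun A _ =>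
        mean_eq_zero_of_lt hf (h ▸ s.card_left_hit_lt hv k A)
    rw [this, step_const]

section Certificate

/-- The number of vertices of `S` outside `R` with colour `j`. -/
def classSize (R : Finset (Fin N)) (σ : Fin N → Color) (S : Finset (Fin N)) (j : Color) : ℕ :=
  ((S \ R).filter fun w => σ w = j).card

/-- The number of vertices of `R` with a colour other than `j`. -/
def awayCount (R : Finset (Fin N)) (σ : Fin N → Color) (j : Color) : ℕ :=
  (R.filter fun w => σ w ≠ j).card

/-- The number of pairs that cannot be edges when the vertices of `S` outside `R` receive the
colours `σ`, while the vertices of `R` keep all colours with the possible exception of `σ`. -/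
def forbidden (R : Finset (Fin N)) (σ : Fin N → Color) (S : Finset (Fin N)) : ℕ :=
  ∑ j, ((classSize R σ S j).choose 2 + classSize R σ S j * awayCount R σ j)

/-- The indicator that the list `M` of `w` is compatible with `R` and `σ`. -/
def fits (R : Finset (Fin N)) (σ : Fin N → Color) (w : Fin N) (M : Finset Color) : ℝ :=
  if w ∈ R then (if Finset.univ.erase (σ w) ⊆ M then 1 else 0) else (if σ w ∈ M then 1 else 0)

/-- The bound for the probability that the vertices outside `R` receive the colours `σ` and
that every vertex of `R` keeps two colours. -/
noncomputable def certWt (p : ℝ) (R : Finset (Fin N)) (σ : Fin N → Color) (s : Residual N) : ℝ :=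
  if R ⊆ s.left then (1 - p) ^ forbidden R σ s.left * ∏ w ∈ s.left, fits R σ w (s.avail w) else 0

theorem fits_nonneg (R : Finset (Fin N)) (σ : Fin N → Color) (w : Fin N) (M : Finset Color) :
    0 ≤ fits R σ w M := by
  unfold fits; split_ifs <;> norm_num

theorem certWt_nonneg {p : ℝ} (h1 : p ≤ 1) (R : Finset (Fin N)) (σ : Fin N → Color)
    (s : Residual N) : 0 ≤ certWt p R σ s := by
  unfold certWt
  split_ifs
  · exact mul_nonneg (pow_nonneg (sub_nonneg.2 h1) _)
      (Finset.prod_nonneg fun w _ => fits_nonneg R σ w _)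
  · exact le_rfl

theorem certWt_congr (p : ℝ) (R : Finset (Fin N)) {σ τ : Fin N → Color} {s : Residual N}
    (h : ∀ w ∈ s.left, σ w = τ w) : certWt p R σ s = certWt p R τ s := by
  unfold certWt
  split_ifs with hR
  · have hprod : ∏ w ∈ s.left, fits R σ w (s.avail w) = ∏ w ∈ s.left, fits R τ w (s.avail w) :=
      Finset.prod_congr rfl fun w hw => by unfold fits; rw [h w hw]
    have hforb : forbidden R σ s.left = forbidden R τ s.left := by
      refine Finset.sum_congr rfl fun j _ => ?_
      have h1 : classSize R σ s.left j = classSize R τ s.left j := by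
        unfold classSize
        congr 1
        exact Finset.filter_congr fun w hw => by rw [h w (Finset.sdiff_subset hw)]
      have h2 : awayCount R σ j = awayCount R τ j := by
        unfold awayCount
        congr 1
        exact Finset.filter_congr fun w hw => by rw [h w (hR hw)]
      rw [h1, h2]
    rw [hprod, hforb]
  · rfl

/-- When `v` receives `σ v`, it must not be adjacent to the remaining vertices of its class, nor to
the vertices of `R` whose exceptional colour is a different one. Each such pair costs `1 - p`, and
these are exactly the pairs by which `forbidden` decreases. So `certWt` is preserved in mean. -/
theorem step_certWt {p : ℝ} (R : Finset (Fin N)) (σ : Fin N → Color) {s : Residual N}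
    {v : Fin N} (hv : v ∈ s.left) (hk : σ v ∈ s.avail v) (hvR : v ∉ R) :
    step p s v (σ v) (certWt p R σ) = certWt p R σ s := by
  classical
  by_cases hR : R ⊆ s.left
  · have hR' : R ⊆ s.left.erase v := fun w hw => Finset.mem_erase.2 ⟨by
      rintro rfl; exact hvR hw, hR hw⟩
    have h1 : step p s v (σ v) (certWt p R σ) = (1 - p) ^ forbidden R σ (s.left.erase v) *
        step p s v (σ v) (fun s' => ∏ w ∈ s'.left, fits R σ w (s'.avail w)) := by
      rw [← step_const_mul]
      refine step_congr fun A _ => ?_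
      rw [certWt, Residual.hit_left, if_pos hR']
    rw [h1, step_prod, certWt, if_pos hR]
    have h2 : ∀ w ∈ s.left.erase v, p * fits R σ w ((s.avail w).erase (σ v)) +
        (1 - p) * fits R σ w (s.avail w) =
        (if (w ∉ R ∧ σ w = σ v) ∨ (w ∈ R ∧ σ w ≠ σ v) then 1 - p else 1) *
          fits R σ w (s.avail w) := by
      intro w _
      unfold fits
      by_cases hw : w ∈ R
      · simp only [hw, if_true, not_true, false_and, true_and, false_or]
        by_cases e : σ w = σ v
        · have : Finset.univ.erase (σ w) ⊆ (s.avail w).erase (σ v) ↔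
              Finset.univ.erase (σ w) ⊆ s.avail w := by
            rw [e]
            constructor
            · exact fun h => h.trans (Finset.erase_subset _ _)
            · exact fun h x hx => Finset.mem_erase.2 ⟨Finset.ne_of_mem_erase hx, h hx⟩
          rw [e] at this
          simp only [e, this, ne_eq, not_true, if_false]
          ring
        · have : ¬ Finset.univ.erase (σ w) ⊆ (s.avail w).erase (σ v) := fun h => by
            have := h (Finset.mem_erase.2 ⟨fun h => e h.symm, Finset.mem_univ (σ v)⟩)
            simp at this
          simp only [this, e, ne_eq, not_false_eq_true, if_true, if_false]
          ring
      · simp only [hw, if_false, not_false_eq_true, true_and, false_and, or_false]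
        by_cases e : σ w = σ v
        · simp [e]
        · simp only [Finset.mem_erase, ne_eq, e, not_false_eq_true, true_and, if_false]
          ring
    rw [Finset.prod_congr rfl h2, Finset.prod_mul_distrib, ← Finset.mul_prod_erase s.left _ hv]
    have h3 : fits R σ v (s.avail v) = 1 := by simp [fits, hvR, hk]
    rw [h3, one_mul, ← mul_assoc]
    congr 1
    rw [Finset.prod_ite, Finset.prod_const_one, mul_one, Finset.prod_const, ← pow_add]
    congr 1
    have hcard : ((s.left.erase v).filter fun w =>
        (w ∉ R ∧ σ w = σ v) ∨ (w ∈ R ∧ σ w ≠ σ v)).card =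
        classSize R σ (s.left.erase v) (σ v) + awayCount R σ (σ v) := by
      rw [classSize, awayCount, ← Finset.card_union_of_disjoint]
      · congr 1
        ext w
        simp only [Finset.mem_filter, Finset.mem_union, Finset.mem_sdiff]
        constructor
        · rintro ⟨h1, h2 | h2⟩
          · exact Or.inl ⟨⟨h1, h2.1⟩, h2.2⟩
          · exact Or.inr h2
        · rintro (h | h)
          · exact ⟨h.1.1, Or.inl ⟨h.1.2, h.2⟩⟩
          · exact ⟨hR' h.1, Or.inr h⟩
      · rw [Finset.disjoint_left]
        intro w h1 h2
        exact (Finset.mem_filter.1 h2).2 (Finset.mem_filter.1 h1).2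
    have hcs : ∀ j, classSize R σ s.left j =
        classSize R σ (s.left.erase v) j + if j = σ v then 1 else 0 := by
      intro j
      unfold classSize
      have : s.left \ R = insert v (s.left.erase v \ R) := by
        ext w
        simp only [Finset.mem_sdiff, Finset.mem_insert, Finset.mem_erase]
        by_cases h : w = v
        · subst h; simp [hv, hvR]
        · simp [h]
      rw [this, Finset.filter_insert]
      by_cases h : σ v = j
      · rw [if_pos h, Finset.card_insert_of_notMem (by simp), if_pos h.symm]
      · rw [if_neg h, if_neg (fun h' => h h'.symm), add_zero]
    rw [hcard]
    unfold forbidden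
    rw [← Finset.add_sum_erase _ _ (Finset.mem_univ (σ v)),
      ← Finset.add_sum_erase (s := Finset.univ) (a := σ v)
      (f := fun j => (classSize R σ s.left j).choose 2 + classSize R σ s.left j * awayCount R σ j)
      (Finset.mem_univ (σ v))]
    rw [Finset.sum_congr rfl fun j hj => by
      rw [← add_zero (classSize R σ (s.left.erase v) j),
        ← if_neg (c := j = σ v) (t := 1) (e := 0) (Finset.ne_of_mem_erase hj), ← hcs j]]
    simp only [hcs (σ v), if_true]
    rw [Nat.choose_succ_succ' _ 1, Nat.choose_one_right]
    ring
  · have hR' : ¬ R ⊆ s.left.erase v := fun h => hR (h.trans (Finset.erase_subset _ _))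
    rw [certWt, if_neg hR]
    have : step p s v (σ v) (certWt p R σ) = step p s v (σ v) (fun _ => 0) :=
      step_congr fun A _ => by rw [certWt, Residual.hit_left, if_neg hR']
    rw [this, step_const]

theorem step_certWt_le {p : ℝ} (h1 : p ≤ 1) (R : Finset (Fin N)) (σ : Fin N → Color)
    {s : Residual N} {v : Fin N} (hv : v ∈ s.left) (hk : σ v ∈ s.avail v) :
    step p s v (σ v) (certWt p R σ) ≤ certWt p R σ s := by
  by_cases hvR : v ∈ R
  · have : step p s v (σ v) (certWt p R σ) = step p s v (σ v) (fun _ => 0) :=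
      step_congr fun A _ => by
        rw [certWt, if_neg fun h => Finset.notMem_erase v s.left (h hvR)]
    rw [this, step_const]
    exact certWt_nonneg h1 R σ s
  · exact (step_certWt R σ hv hk hvR).le

/-- The colour of a removed vertex is free, and prescribing it leaves a third of the sum. This is
the origin of the power of three in `mean_decisionAt_le_sum`. -/
theorem three_mul_sum_eq (v : Fin N) (k : Color) (F : (Fin N → Color) → ℝ)
    (hF : ∀ σ τ : Fin N → Color, (∀ w, w ≠ v → σ w = τ w) → F σ = F τ) :
    3 * ∑ σ with σ v = k, F σ = ∑ σ, F σ := by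
  classical
  have h : ∀ j, ∑ σ with σ v = j, F σ = ∑ σ with σ v = k, F σ := by
    intro j
    refine Finset.sum_bij' (fun σ _ => Function.update σ v k) (fun σ _ => Function.update σ v j)
      ?_ ?_ ?_ ?_ ?_
    · intro σ _; simp
    · intro σ _; simp
    · intro σ hσ
      have : σ v = j := by simpa using hσ
      rw [Function.update_idem, ← this, Function.update_eq_self]
    · intro σ hσ
      have : σ v = k := by simpa using hσ
      rw [Function.update_idem, ← this, Function.update_eq_self]
    · intro σ _
      exact hF _ _ fun w hw => by rw [Function.update_of_ne hw]
  rw [← Finset.sum_fiberwise Finset.univ (fun σ : Fin N → Color => σ v) F,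
    Finset.sum_congr rfl fun j _ => h j]
  simp

/-- The first moment bound for the decision nodes of a given height. -/
theorem mean_decisionAt_le_sum {p : ℝ} (h0 : 0 ≤ p) (h1 : p ≤ 1) (m : ℕ) (s : Residual N) :
    3 ^ (N - s.left.card) * mean p (decisionAt m) s ≤
      ∑ R ∈ Finset.univ.powersetCard m, ∑ σ, certWt p R σ s := by
  classical
  have hnn : ∀ s : Residual N, 0 ≤ ∑ R ∈ Finset.univ.powersetCard m, ∑ σ, certWt p R σ s :=
    fun s => Finset.sum_nonneg fun R _ => Finset.sum_nonneg fun σ _ => certWt_nonneg h1 R σ s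
  have hzero : ∀ s : Residual N, s.left.card < m → decisionAt m s = 0 :=
    fun s h => if_neg fun hh => h.ne hh.1
  induction hn : s.left.card using Nat.strong_induction_on generalizing s with
  | _ n ih =>
    have hnN : n ≤ N := by rw [← hn]; simpa using Finset.card_le_univ s.left
    rcases lt_trichotomy n m with hlt | heq | hgt
    · rw [mean_eq_zero_of_lt hzero (hn ▸ hlt), mul_zero]; exact hnn s
    · rw [mean_eq_of_card_eq hzero (hn.trans heq)]
      by_cases hd : ∀ w ∈ s.left, 2 ≤ (s.avail w).card
      · rw [decisionAt, if_pos ⟨hn.trans heq, hd⟩, mul_one]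
        -- A list of at least two colours lacks at most one colour; `τ w` names it, with an
        -- arbitrary value if nothing is missing.
        have hcol : ∀ w : Fin N, ∃ j : Color, w ∈ s.left → Finset.univ.erase j ⊆ s.avail w := by
          intro w
          by_cases hw : w ∈ s.left
          · have h2 := hd w hw
            have h3 : ((s.avail w)ᶜ).card ≤ 1 := by
              rw [Finset.card_compl, Fintype.card_fin]; omega
            rcases (Finset.card_le_one_iff_subset_singleton.1 h3) with ⟨j, hj⟩
            refine ⟨j, fun _ x hx => ?_⟩
            by_contra hx'
            have := hj (Finset.mem_compl.2 hx')
            exact Finset.ne_of_mem_erase hx (Finset.mem_singleton.1 this)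
          · exact ⟨0, fun h => absurd h hw⟩
        choose τ hτ using hcol
        calc (3 : ℝ) ^ (N - n) = ∑ σ ∈ Fintype.piFinset
              (fun w => if w ∈ s.left then {τ w} else Finset.univ), (1 : ℝ) := by
              rw [Finset.sum_const, Fintype.card_piFinset, nsmul_eq_mul, mul_one]
              have : ∀ w, (if w ∈ s.left then ({τ w} : Finset Color) else Finset.univ).card =
                  if w ∈ s.left then 1 else 3 := by
                intro w; split_ifs <;> simp
              simp only [this]
              rw [Finset.prod_ite]
              simp only [Finset.prod_const_one, one_mul, Finset.prod_const, Nat.cast_pow,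
                Nat.cast_ofNat]
              congr 1
              rw [← hn, ← Finset.compl_filter, Finset.card_compl, Fintype.card_fin]
              simp
          _ ≤ ∑ σ ∈ Fintype.piFinset
              (fun w => if w ∈ s.left then {τ w} else Finset.univ), certWt p s.left σ s := by
              refine Finset.sum_le_sum fun σ hσ => ?_
              rw [Fintype.mem_piFinset] at hσ
              have hσ' : ∀ w ∈ s.left, σ w = τ w := fun w hw => by
                have := hσ w
                rw [if_pos hw] at this
                exact Finset.mem_singleton.1 this
              rw [certWt_congr p s.left hσ', certWt, if_pos subset_rfl]
              have hz : forbidden s.left τ s.left = 0 := by simp [forbidden, classSize]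
              rw [hz, pow_zero, one_mul, Finset.prod_eq_one]
              intro w hw
              simp [fits, hw, hτ w hw]
          _ ≤ ∑ σ, certWt p s.left σ s :=
              Finset.sum_le_sum_of_subset_of_nonneg (Finset.subset_univ _)
                fun σ _ _ => certWt_nonneg h1 _ σ s
          _ ≤ _ := Finset.single_le_sum (f := fun R => ∑ σ, certWt p R σ s)
                (fun R _ => Finset.sum_nonneg fun σ _ => certWt_nonneg h1 R σ s)
                (Finset.mem_powersetCard.2 ⟨Finset.subset_univ _, hn.trans heq⟩)
      · rw [decisionAt, if_neg fun h => hd h.2, mul_zero]; exact hnn s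
    · have hf : decisionAt m s = 0 := if_neg fun hh => hgt.ne' (hn.symm.trans hh.1)
      by_cases hc : s.Contradiction
      · rw [mean_of_contradiction hc, hf, mul_zero]; exact hnn s
      rw [mean_of_alive hc, hf, zero_add, ← mul_div_assoc, Finset.mul_sum]
      refine average_le (hnn s) fun v hv => ?_
      have hvl := s.shortest_subset hv
      have hk : ∀ k ∈ s.avail v, 3 ^ (N - n) * step p s v k (mean p (decisionAt m)) ≤
          ∑ R ∈ Finset.univ.powersetCard m, ∑ σ with σ v = k, certWt p R σ s := by
        intro k hk
        have hcl : (s.left.erase v).card = n - 1 := by rw [Finset.card_erase_of_mem hvl, hn]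
        have hpow : (3 : ℝ) ^ (N - (n - 1)) = 3 * 3 ^ (N - n) := by
          rw [← pow_succ']; congr 1; omega
        have hst : 3 ^ (N - (n - 1)) * step p s v k (mean p (decisionAt m)) ≤
            ∑ R ∈ Finset.univ.powersetCard m, ∑ σ, step p s v k (certWt p R σ) := by
          rw [← step_const_mul]
          have e : ∑ R ∈ Finset.univ.powersetCard m, ∑ σ, step p s v k (certWt p R σ) =
              step p s v k (fun s' => ∑ R ∈ Finset.univ.powersetCard m, ∑ σ, certWt p R σ s') := by
            rw [step_sum]
            exact Finset.sum_congr rfl fun R _ => (step_sum _ _ _ _ _ _).symm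
          rw [e]
          refine step_le_step h0 h1 fun A _ => ?_
          have := ih _ (hn ▸ s.card_left_hit_lt hv k A) (s.hit v k A) rfl
          have e2 : (s.hit v k A).left.card = n - 1 := hcl
          rw [e2] at this
          exact this
        rw [hpow] at hst
        have hinv : ∀ R, ∑ σ, step p s v k (certWt p R σ) =
            3 * ∑ σ with σ v = k, step p s v k (certWt p R σ) := by
          intro R
          rw [three_mul_sum_eq]
          intro σ τ h
          refine step_congr fun A _ => certWt_congr p R fun w hw => h w ?_
          exact Finset.ne_of_mem_erase hw
        simp only [hinv] at hst
        rw [← Finset.mul_sum] at hst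
        have h3 : ∑ R ∈ Finset.univ.powersetCard m, ∑ σ with σ v = k, step p s v k (certWt p R σ) ≤
            ∑ R ∈ Finset.univ.powersetCard m, ∑ σ with σ v = k, certWt p R σ s := by
          refine Finset.sum_le_sum fun R _ => Finset.sum_le_sum fun σ hσ => ?_
          have e : σ v = k := by simpa using hσ
          subst e
          exact step_certWt_le h1 R σ hvl hk
        linarith
      rw [Finset.mul_sum]
      refine (Finset.sum_le_sum hk).trans ?_
      rw [Finset.sum_comm]
      refine Finset.sum_le_sum fun R _ => ?_
      refine (Finset.sum_le_sum_of_subset_of_nonneg (Finset.subset_univ (s.avail v))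
        fun k _ _ => Finset.sum_nonneg fun σ _ => certWt_nonneg h1 R σ s).trans ?_
      rw [Finset.sum_fiberwise]

/-- An optimization over the class sizes. In the worst case every vertex of `R` lacks the colour of
the largest class; with `n = N - |R|`, the resulting quadratic is smallest when that class has size
`(n + 2 * |R|) / 3` and the two others are equal. -/
theorem forbidden_ge {R : Finset (Fin N)} (σ : Fin N → Color) :
    ((N - R.card : ℝ) ^ 2 / 6 + 2 / 3 * (N - R.card) * R.card - (R.card : ℝ) ^ 2 / 3 -
      (N - R.card) / 2) ≤ forbidden R σ Finset.univ := by
  classical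
  have hchoose : ∀ a : ℕ, ((a.choose 2 : ℕ) : ℝ) = (a : ℝ) * (a - 1) / 2 := fun a => by
    rw [Nat.cast_choose_two]
  have hsum : ∑ j, (classSize R σ Finset.univ j : ℝ) = N - R.card := by
    have h := Finset.card_eq_sum_card_fiberwise (s := Finset.univ \ R) (t := Finset.univ)
      (f := σ) (fun _ _ => by simp)
    rw [Finset.card_sdiff_of_subset (Finset.subset_univ R), Finset.card_univ,
      Fintype.card_fin] at h
    have hle : R.card ≤ N := by simpa using Finset.card_le_univ R
    rw [← Nat.cast_sub hle, h]
    push_cast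
    rfl
  have haway : ∀ j, (awayCount R σ j : ℝ) = R.card - ((R.filter fun w => σ w = j).card : ℝ) := by
    intro j
    have := Finset.card_filter_add_card_filter_not (s := R) (fun w => σ w = j)
    unfold awayCount
    rw [← this]
    push_cast
    ring
  have hb : ∑ j, ((R.filter fun w => σ w = j).card : ℝ) = R.card := by
    rw [Finset.card_eq_sum_card_fiberwise (s := R) (t := Finset.univ) (f := σ)
      (fun _ _ => by simp)]
    push_cast
    rfl
  unfold forbidden
  push_cast
  simp only [hchoose, haway]
  have ha0 : ∀ j, (0 : ℝ) ≤ classSize R σ Finset.univ j := fun j => Nat.cast_nonneg _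
  have hb0 : ∀ j, (0 : ℝ) ≤ (R.filter fun w => σ w = j).card := fun j => Nat.cast_nonneg _
  generalize hA : (fun j => (classSize R σ Finset.univ j : ℝ)) = a at *
  generalize hB : (fun j => ((R.filter fun w => σ w = j).card : ℝ)) = b at *
  have hA' : ∀ j, (classSize R σ Finset.univ j : ℝ) = a j := fun j => congrFun hA j
  have hB' : ∀ j, ((R.filter fun w => σ w = j).card : ℝ) = b j := fun j => congrFun hB j
  simp only [hA', hB'] at *
  generalize (R.card : ℝ) = m at *
  simp only [Fin.sum_univ_three] at *
  have a0 := ha0 0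
  have a1 := ha0 1
  have a2 := ha0 2
  have b0 := hb0 0
  have b1 := hb0 1
  have b2 := hb0 2
  -- With `x` the largest class, `x * u + y * v + z * w ≤ x * m`; two completed squares finish the
  -- estimate, and the cases below only sort the three classes.
  have key : ∀ x y z u v w : ℝ, 0 ≤ u → 0 ≤ v → 0 ≤ w → x + y + z = N - m → u + v + w = m →
      y ≤ x → z ≤ x → (N - m) ^ 2 / 6 + 2 / 3 * (N - m) * m - m ^ 2 / 3 - (N - m) / 2 ≤
      x * (x - 1) / 2 + x * (m - u) + (y * (y - 1) / 2 + y * (m - v)) +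
        (z * (z - 1) / 2 + z * (m - w)) := by
    intro x y z u v w hu hv hw h1 h2 h3 h4
    have h5 : x * u + y * v + z * w ≤ x * m := by
      rw [← h2]; nlinarith [mul_nonneg hv (sub_nonneg.2 h3), mul_nonneg hw (sub_nonneg.2 h4)]
    have h6 : (N : ℝ) = x + y + z + m := by linarith
    rw [h6]
    nlinarith [sq_nonneg (y - z), sq_nonneg (x - (x + y + z + 2 * m) / 3)]
  rcases le_total (a 0) (a 1) with h | h
  · rcases le_total (a 1) (a 2) with h' | h'
    · linarith [key (a 2) (a 1) (a 0) (b 2) (b 1) (b 0) b2 b1 b0 (by linarith) (by linarith)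
        h' (h.trans h')]
    · linarith [key (a 1) (a 2) (a 0) (b 1) (b 2) (b 0) b1 b2 b0 (by linarith) (by linarith) h' h]
  · rcases le_total (a 0) (a 2) with h' | h'
    · linarith [key (a 2) (a 1) (a 0) (b 2) (b 1) (b 0) b2 b1 b0 (by linarith) (by linarith)
        (h.trans h') h']
    · linarith [key (a 0) (a 1) (a 2) (b 0) (b 1) (b 2) b0 b1 b2 (by linarith) (by linarith) h h']

end Certificate

theorem one_sub_pow_le_exp {p : ℝ} (h1 : p ≤ 1) (n : ℕ) :
    (1 - p) ^ n ≤ Real.exp (-(p * n)) := by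
  have : 1 - p ≤ Real.exp (-p) := by linarith [Real.add_one_le_exp (-p)]
  calc (1 - p) ^ n ≤ Real.exp (-p) ^ n := pow_le_pow_left₀ (by linarith) this n
    _ = Real.exp (-(p * n)) := by rw [← Real.exp_nat_mul]; ring_nf

theorem mean_decisionAt_le {p : ℝ} (h0 : 0 ≤ p) (h1 : p ≤ 1) {m : ℕ} {e : ℝ}
    (he : e ≤ (N - m : ℝ) ^ 2 / 6 + 2 / 3 * (N - m) * m - (m : ℝ) ^ 2 / 3 - (N - m) / 2) :
    mean p (decisionAt m) (Residual.initial N) ≤ (N.choose m) * 3 ^ N * Real.exp (-(p * e)) := by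
  classical
  have h := mean_decisionAt_le_sum h0 h1 m (Residual.initial N)
  have hl : (Residual.initial N).left.card = N := by simp [Residual.initial]
  rw [hl, Nat.sub_self, pow_zero, one_mul] at h
  refine h.trans ?_
  have hR : ∀ R ∈ (Finset.univ : Finset (Fin N)).powersetCard m, ∀ σ : Fin N → Color,
      certWt p R σ (Residual.initial N) ≤ Real.exp (-(p * e)) := by
    intro R hR σ
    have hcard := (Finset.mem_powersetCard.1 hR).2
    have hf := forbidden_ge (R := R) σ
    rw [hcard] at hf
    have hfit : ∏ w ∈ (Residual.initial N).left, fits R σ w ((Residual.initial N).avail w) ≤ 1 :=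
      Finset.prod_le_one (fun w _ => fits_nonneg R σ w _) fun w _ => by
        unfold fits; split_ifs <;> norm_num
    unfold certWt
    split_ifs
    · calc _ ≤ (1 - p) ^ forbidden R σ (Residual.initial N).left * 1 :=
            mul_le_mul_of_nonneg_left hfit (pow_nonneg (sub_nonneg.2 h1) _)
        _ ≤ Real.exp (-(p * forbidden R σ Finset.univ)) := by
            rw [mul_one]; exact one_sub_pow_le_exp h1 _
        _ ≤ _ := by
            apply Real.exp_le_exp.2
            have := mul_le_mul_of_nonneg_left (he.trans hf) h0
            linarith
    · exact (Real.exp_pos _).le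
  calc _ ≤ ∑ R ∈ (Finset.univ : Finset (Fin N)).powersetCard m, ∑ σ : Fin N → Color,
        Real.exp (-(p * e)) :=
        Finset.sum_le_sum fun R hr => Finset.sum_le_sum fun σ _ => hR R hr σ
    _ = _ := by
        rw [Finset.sum_const, Finset.sum_const, Finset.card_powersetCard]
        simp
        ring

end Dpll

/-! ### Counts of lists, distance of instances, and the potential. -/

namespace Dpll

variable {N : ℕ}

/-- The number of remaining vertices with the list `M`. -/
def cnt (s : Residual N) (M : Finset Color) : ℕ := (s.left.filter fun w => s.avail w = M).card

/-- The number of remaining vertices with one or two colours. -/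
def shortCnt (s : Residual N) : ℕ := ∑ k, cnt s {k} + ∑ k, cnt s (Finset.univ.erase k)

/-- The total length of the lists of the remaining vertices. -/
def size (s : Residual N) : ℕ := ∑ w ∈ s.left, (s.avail w).card

/-- `s` arises from `s₀` by removing vertices and colours. -/
def Below (s₀ s : Residual N) : Prop := s.left ⊆ s₀.left ∧ ∀ w ∈ s.left, s.avail w ⊆ s₀.avail w

theorem Below.refl (s : Residual N) : Below s s := ⟨subset_rfl, fun _ _ => subset_rfl⟩

theorem Below.hit {s₀ s : Residual N} (h : Below s₀ s) (v : Fin N) (k : Color)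
    (A : Finset (Fin N)) : Below s₀ (s.hit v k A) := by
  refine ⟨(Finset.erase_subset _ _).trans h.1, fun w hw => ?_⟩
  have hw' := Finset.mem_of_mem_erase hw
  simp only [Residual.hit]
  split_ifs
  · exact (Finset.erase_subset _ _).trans (h.2 w hw')
  · exact h.2 w hw'

theorem sum_lists (F : Finset Color → ℝ) :
    ∑ M, F M = F ∅ + ∑ k : Color, F {k} + ∑ k : Color, F (Finset.univ.erase k) + F Finset.univ := by
  have h : (Finset.univ : Finset (Finset Color)) =
      {∅, {0}, {1}, {2}, Finset.univ.erase 0, Finset.univ.erase 1, Finset.univ.erase 2,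
        Finset.univ} := by decide
  rw [h, Finset.sum_insert (by decide), Finset.sum_insert (by decide),
    Finset.sum_insert (by decide), Finset.sum_insert (by decide), Finset.sum_insert (by decide),
    Finset.sum_insert (by decide), Finset.sum_insert (by decide), Finset.sum_singleton,
    Fin.sum_univ_three, Fin.sum_univ_three]
  ring

theorem list_cases (M : Finset Color) : M = ∅ ∨ (∃ j, M = {j}) ∨
    (∃ j, M = Finset.univ.erase j) ∨ M = Finset.univ := by
  revert M; decide

theorem sum_avail (s : Residual N) (f : Finset Color → ℝ) :
    ∑ w ∈ s.left, f (s.avail w) = ∑ M, cnt s M * f M := by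
  rw [← Finset.sum_fiberwise s.left (fun w => s.avail w)]
  refine Finset.sum_congr rfl fun M _ => ?_
  rw [Finset.sum_congr rfl fun w hw => by rw [(Finset.mem_filter.1 hw).2], Finset.sum_const,
    nsmul_eq_mul, cnt]

theorem cnt_empty {s : Residual N} (h : ¬ s.Contradiction) : cnt s ∅ = 0 := by
  rw [cnt, Finset.card_eq_zero, Finset.filter_eq_empty_iff]
  exact fun v hv h0 => h ⟨v, hv, h0⟩

theorem sum_avail_alive {s : Residual N} (h : ¬ s.Contradiction) (f : Finset Color → ℝ) :
    ∑ w ∈ s.left, f (s.avail w) = ∑ k : Color, cnt s {k} * f {k} +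
      ∑ k : Color, cnt s (Finset.univ.erase k) * f (Finset.univ.erase k) +
      cnt s Finset.univ * f Finset.univ := by
  rw [sum_avail, sum_lists, cnt_empty h]; simp

theorem card_left_eq {s : Residual N} (h : ¬ s.Contradiction) :
    (s.left.card : ℝ) = shortCnt s + cnt s Finset.univ := by
  have := sum_avail_alive h fun _ => 1
  simp only [mul_one, Finset.sum_const, nsmul_eq_mul] at this
  rw [this, shortCnt]
  push_cast
  ring

theorem card_avail_pos {s : Residual N} (h : ¬ s.Contradiction) {w : Fin N} (hw : w ∈ s.left) :
    0 < (s.avail w).card :=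
  Finset.card_pos.2 (Finset.nonempty_iff_ne_empty.2 fun h0 => h ⟨w, hw, h0⟩)

theorem size_eq_sum {s₀ s : Residual N} (h : Below s₀ s) :
    (size s : ℝ) = ∑ w ∈ s₀.left, if w ∈ s.left then ((s.avail w).card : ℝ) else 0 := by
  rw [← Finset.sum_filter, Finset.filter_mem_eq_inter, Finset.inter_eq_right.2 h.1, size]
  push_cast
  rfl

theorem size_le {s₀ s : Residual N} (h : Below s₀ s) : (size s : ℝ) ≤ size s₀ := by
  rw [size_eq_sum h, size]
  push_cast
  refine Finset.sum_le_sum fun w _ => ?_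
  split_ifs with hw
  · exact_mod_cast Finset.card_le_card (h.2 w hw)
  · positivity

/-- Counts of lists change by at most the total loss of list length. -/
theorem abs_sum_sub_le {s₀ s : Residual N} (h₀ : ¬ s₀.Contradiction) (h : Below s₀ s)
    (f : Finset Color → ℝ) (hf0 : ∀ M, 0 ≤ f M) (hf1 : ∀ M, f M ≤ 1) :
    |∑ w ∈ s₀.left, f (s₀.avail w) - ∑ w ∈ s.left, f (s.avail w)| ≤ size s₀ - size s := by
  have h1 : ∑ w ∈ s.left, f (s.avail w) = ∑ w ∈ s₀.left, if w ∈ s.left then f (s.avail w) else 0 := by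
    rw [← Finset.sum_filter, Finset.filter_mem_eq_inter, Finset.inter_eq_right.2 h.1]
  have h2 : (size s₀ : ℝ) = ∑ w ∈ s₀.left, ((s₀.avail w).card : ℝ) := by
    rw [size]; push_cast; rfl
  rw [h1, size_eq_sum h, h2, ← Finset.sum_sub_distrib, ← Finset.sum_sub_distrib]
  refine (Finset.abs_sum_le_sum_abs _ _).trans (Finset.sum_le_sum fun w hw => ?_)
  have hpos : (1 : ℝ) ≤ (s₀.avail w).card := by exact_mod_cast card_avail_pos h₀ hw
  split_ifs with hws
  · by_cases e : s.avail w = s₀.avail w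
    · rw [e]; simp
    · have hlt : (s.avail w).card + 1 ≤ (s₀.avail w).card :=
        Finset.card_lt_card ((h.2 w hws).ssubset_of_ne e)
      have hlt' : ((s.avail w).card : ℝ) + 1 ≤ (s₀.avail w).card := by exact_mod_cast hlt
      rw [abs_le]
      constructor <;> linarith [hf0 (s.avail w), hf0 (s₀.avail w), hf1 (s.avail w),
        hf1 (s₀.avail w)]
  · rw [sub_zero, sub_zero, abs_of_nonneg (hf0 _)]
    exact (hf1 _).trans hpos

theorem cnt_eq_sum (s : Residual N) (M : Finset Color) :
    (cnt s M : ℝ) = ∑ w ∈ s.left, if s.avail w = M then 1 else 0 := by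
  rw [cnt, Finset.card_filter]; push_cast; rfl

theorem abs_cnt_sub_le {s₀ s : Residual N} (h₀ : ¬ s₀.Contradiction) (h : Below s₀ s)
    (M : Finset Color) : |(cnt s₀ M : ℝ) - cnt s M| ≤ size s₀ - size s := by
  rw [cnt_eq_sum, cnt_eq_sum]
  exact abs_sum_sub_le h₀ h (fun L => if L = M then 1 else 0)
    (fun L => by split_ifs <;> norm_num) (fun L => by split_ifs <;> norm_num)

theorem shortCnt_eq_sum (s : Residual N) :
    (shortCnt s : ℝ) = ∑ w ∈ s.left, if (s.avail w).card = 1 ∨ (s.avail w).card = 2 then 1 else 0 := by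
  rw [sum_avail s fun M => if M.card = 1 ∨ M.card = 2 then 1 else 0, sum_lists, shortCnt]
  have h1 : ∀ k : Color, (Finset.univ.erase k).card = 2 := by decide
  simp [h1]

theorem abs_shortCnt_sub_le {s₀ s : Residual N} (h₀ : ¬ s₀.Contradiction) (h : Below s₀ s) :
    |(shortCnt s₀ : ℝ) - shortCnt s| ≤ size s₀ - size s := by
  rw [shortCnt_eq_sum, shortCnt_eq_sum]
  exact abs_sum_sub_le h₀ h (fun M => if M.card = 1 ∨ M.card = 2 then 1 else 0)
    (fun L => by split_ifs <;> norm_num) (fun L => by split_ifs <;> norm_num)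

/-- The removed list has at most three colours, and each vertex that is hit loses at most one. -/
theorem size_hit_ge (s : Residual N) {v : Fin N} (hv : v ∈ s.left) (k : Color)
    (A : Finset (Fin N)) : (size s : ℝ) ≤ size (s.hit v k A) + 3 + A.card := by
  have h1 : size s = (s.avail v).card + ∑ w ∈ s.left.erase v, (s.avail w).card := by
    exact (Finset.add_sum_erase s.left (fun w => (s.avail w).card) hv).symm
  have h2 : ∑ w ∈ s.left.erase v, (s.avail w).card ≤ size (s.hit v k A) + A.card := by
    rw [size, Residual.hit_left]
    calc ∑ w ∈ s.left.erase v, (s.avail w).card ≤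
          ∑ w ∈ s.left.erase v, (((s.hit v k A).avail w).card + if w ∈ A then 1 else 0) := by
          refine Finset.sum_le_sum fun w _ => ?_
          simp only [Residual.hit]
          split_ifs
          · have := Finset.pred_card_le_card_erase (s := s.avail w) (a := k)
            omega
          · simp
      _ ≤ _ := by
          rw [Finset.sum_add_distrib, ← Finset.card_filter]
          gcongr
          intro w hw
          exact (Finset.mem_filter.1 hw).2
  have h3 := card_avail_le s v
  have : size s ≤ size (s.hit v k A) + 3 + A.card := by omega
  exact_mod_cast this

/-- The step of a product of list weights. -/
theorem step_listWt_le {p : ℝ} (h0 : 0 ≤ p) (h1 : p ≤ 1) {y ρ : Finset Color → ℝ}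
    (hy : ∀ M, 0 ≤ y M) {k : Color}
    (h : ∀ M, p * y (M.erase k) + (1 - p) * y M ≤
      y M * (if M = {k} then 1 - p else 1) * Real.exp (p * ρ M))
    (s : Residual N) {v : Fin N} (hv : v ∈ s.left) :
    y (s.avail v) * step p s v k (listWt y) ≤ listWt y s *
      (1 - p) ^ ((s.left.erase v).filter fun w => s.avail w = {k}).card *
        Real.exp (p * (∑ w ∈ s.left, ρ (s.avail w) - ρ (s.avail v))) := by
  rw [step_listWt]
  calc _ ≤ y (s.avail v) * ∏ w ∈ s.left.erase v, (y (s.avail w) *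
        (if s.avail w = {k} then 1 - p else 1) * Real.exp (p * ρ (s.avail w))) := by
        refine mul_le_mul_of_nonneg_left (Finset.prod_le_prod (fun w _ => ?_) fun w _ => h _) (hy _)
        exact add_nonneg (mul_nonneg h0 (hy _)) (mul_nonneg (sub_nonneg.2 h1) (hy _))
    _ = _ := by
        rw [Finset.prod_mul_distrib, Finset.prod_mul_distrib, ← Real.exp_sum, ← Finset.mul_sum,
          ← mul_assoc, ← mul_assoc, listWt, Finset.mul_prod_erase s.left (fun w => y (s.avail w)) hv,
          ← Finset.add_sum_erase s.left (fun w => ρ (s.avail w)) hv, add_sub_cancel_left]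
        congr 2
        rw [Finset.prod_ite, Finset.prod_const, Finset.prod_const_one, mul_one]

/-- The weight of a list in the potential. -/
noncomputable def potWt (θ : ℝ) (M : Finset Color) : ℝ :=
  if M.card = 3 then tripleWt θ else if M = ∅ then 0 else Real.exp (-θ)

theorem potWt_nonneg {θ : ℝ} (h : 0 ≤ θ) (M : Finset Color) : 0 ≤ potWt θ M := by
  unfold potWt
  split_ifs
  · exact (tripleWt_pos h).le
  · exact le_rfl
  · exact (Real.exp_pos _).le

/-- The potential of an instance, for the parameter `θ`. -/
noncomputable def pot (c θ : ℝ) (s : Residual N) : ℝ :=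
  Real.exp (3 * N / c * (θ * Real.log 2 + θ ^ 2 / 2)) * listWt (potWt θ) s

theorem pot_nonneg {c θ : ℝ} (h : 0 ≤ θ) (s : Residual N) : 0 ≤ pot c θ s :=
  mul_nonneg (Real.exp_pos _).le (listWt_nonneg (potWt_nonneg h) s)

/-- One and two colours have the same weight `exp (-θ)`, so an alive instance enters only through
two densities, and `rate` is the logarithm up to the scale `3 * N / c`. -/
theorem pot_eq {c θ : ℝ} (hc : 0 < c) (hN : 0 < N) (h : 0 ≤ θ) {s : Residual N}
    (hs : ¬ s.Contradiction) : pot c θ s = Real.exp (3 * N / c *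
      rate (c / N * shortCnt s) (c / N * cnt s Finset.univ) θ) := by
  set lam : Finset Color → ℝ :=
    fun M => if M.card = 3 then Real.log (tripleWt θ) else -θ with hlam
  have h1 : listWt (potWt θ) s = Real.exp (∑ w ∈ s.left, lam (s.avail w)) := by
    rw [Real.exp_sum, listWt]
    refine Finset.prod_congr rfl fun w hw => ?_
    have := card_avail_pos hs hw
    simp only [potWt, hlam]
    split_ifs with h3 h4
    · rw [Real.exp_log (tripleWt_pos h)]
    · rw [h4] at this; simp at this
    · rfl
  have h2 : ∀ k : Color, lam (Finset.univ.erase k) = -θ := fun k => if_neg (by revert k; decide)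
  have h3 : ∀ k : Color, lam {k} = -θ := fun k => if_neg (by simp)
  have h4 : lam Finset.univ = Real.log (tripleWt θ) := if_pos (by simp)
  have hN' : (N : ℝ) ≠ 0 := by positivity
  rw [pot, h1, ← Real.exp_add, sum_avail_alive hs lam]
  simp only [h2, h3, h4]
  rw [← Finset.sum_mul, ← Finset.sum_mul, rate, shortCnt]
  push_cast
  congr 1
  field_simp
  ring

/-- This value keeps the supremum over `θ` at least `1`, so that additive errors can be absorbed
(`one_le_of_pot_le`). -/
theorem pot_zero {c : ℝ} {s : Residual N} (hs : ¬ s.Contradiction) : pot c 0 s = 1 := by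
  rw [pot, listWt, Finset.prod_eq_one]
  · simp
  · intro w hw
    have := card_avail_pos hs hw
    unfold potWt
    split_ifs with h3 h4
    · norm_num [tripleWt]
    · rw [h4] at this; simp at this
    · simp

end Dpll

/-! ### Linearized potentials and their change in one step. -/

namespace Dpll

variable {N : ℕ}

theorem listWt_eq_zero {y : Finset Color → ℝ} (hy : y ∅ = 0) {s : Residual N}
    (hs : s.Contradiction) : listWt y s = 0 := by
  obtain ⟨v, hv, h0⟩ := hs
  exact Finset.prod_eq_zero hv (by rw [h0, hy])

theorem potWt_empty (θ : ℝ) : potWt θ ∅ = 0 := by simp [potWt]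

theorem pot_eq_zero (c θ : ℝ) {s : Residual N} (hs : s.Contradiction) : pot c θ s = 0 := by
  rw [pot, listWt_eq_zero (potWt_empty θ) hs, mul_zero]

theorem lossRate_le_third {θ : ℝ} (h : 0 ≤ θ) : lossRate θ ≤ 1 / 3 := by
  rcases lossRate_le (θ := θ) with h1 | h1
  · exact h1
  · linarith [exp_neg_two_mul_le h]

/-- The derivative is `-3 * lossRate`, and `lossRate` lies between `0` and `1 / 3`. -/
theorem abs_log_tripleWt_sub_le {a b : ℝ} (ha : 0 ≤ a) (hb : 0 ≤ b) :
    |Real.log (tripleWt a) - Real.log (tripleWt b)| ≤ |a - b| := by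
  have := Convex.norm_image_sub_le_of_norm_hasDerivWithin_le (f := fun θ => Real.log (tripleWt θ))
    (f' := fun θ => -(3 * lossRate θ)) (s := Set.Ici 0) (C := 1) (x := b) (y := a)
    (fun x hx => (hasDerivAt_log_tripleWt hx).hasDerivWithinAt)
    (fun x hx => by
      have h1 := lossRate_le_third hx
      have h2 := lossRate_nonneg hx
      rw [Real.norm_eq_abs, abs_le]
      constructor <;> linarith) (convex_Ici 0) hb ha
  simpa [Real.norm_eq_abs] using this

/-- Near an instance, its optimal parameter is almost optimal. -/
theorem pot_le_of_below {c : ℝ} (hc : 0 < c) (hN : 0 < N) {s₀ s : Residual N}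
    (h₀ : ¬ s₀.Contradiction) (h : Below s₀ s) {θ₀ : ℝ} (hθ₀ : 0 ≤ θ₀)
    (hmax : ∀ θ ∈ Set.Icc (0 : ℝ) (3 / 10),
      rate (c / N * shortCnt s₀) (c / N * cnt s₀ Finset.univ) θ ≤
      rate (c / N * shortCnt s₀) (c / N * cnt s₀ Finset.univ) θ₀ - 3 / 20 * (θ - θ₀) ^ 2)
    {θ : ℝ} (hθ : θ ∈ Set.Icc (0 : ℝ) (3 / 10)) :
    pot c θ s ≤ pot c θ₀ s * Real.exp (20 / 9 * (c / N) * ((size s₀ : ℝ) - size s) ^ 2) := by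
  by_cases hs : s.Contradiction
  · rw [pot_eq_zero c θ hs, pot_eq_zero c θ₀ hs, zero_mul]
  rw [pot_eq hc hN hθ.1 hs, pot_eq hc hN hθ₀ hs, ← Real.exp_add]
  apply Real.exp_le_exp.2
  have h1 := hmax θ hθ
  have hN' : (0 : ℝ) < N := by exact_mod_cast hN
  have hp : 0 < c / N := by positivity
  have hD := abs_shortCnt_sub_le h₀ h
  have hB := abs_cnt_sub_le h₀ h Finset.univ
  have hL := abs_log_tripleWt_sub_le hθ.1 hθ₀
  set Q : ℝ := (size s₀ : ℝ) - size s with hQ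
  have hQ0 : 0 ≤ Q := (abs_nonneg _).trans hD
  set p := c / (N : ℝ) with hpdef
  have e : 3 * (N : ℝ) / c = 3 / p := by rw [hpdef]; field_simp
  rw [e]
  -- Both counts move by at most `Q`, which changes the comparison of `θ` with `θ₀` by at most `2 /
  -- 3 * (p * Q) * |θ - θ₀|`. Against the quadratic deficit `3 / 20 * (θ - θ₀) ^ 2` this gains at
  -- most `20 / 27 * (p * Q) ^ 2`.
  have key : rate (p * shortCnt s) (p * cnt s Finset.univ) θ ≤
      rate (p * shortCnt s) (p * cnt s Finset.univ) θ₀ + 20 / 27 * (p * Q) ^ 2 := by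
    have i1 : rate (p * shortCnt s) (p * cnt s Finset.univ) θ -
        rate (p * shortCnt s) (p * cnt s Finset.univ) θ₀ =
        rate (p * shortCnt s₀) (p * cnt s₀ Finset.univ) θ -
        rate (p * shortCnt s₀) (p * cnt s₀ Finset.univ) θ₀ +
        p / 3 * ((θ - θ₀) * (shortCnt s₀ - shortCnt s)) -
        p / 3 * ((cnt s₀ Finset.univ - cnt s Finset.univ) *
          (Real.log (tripleWt θ) - Real.log (tripleWt θ₀))) := by
      unfold rate; ring
    have i2 : (θ - θ₀) * ((shortCnt s₀ : ℝ) - shortCnt s) ≤ |θ - θ₀| * Q := by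
      refine (le_abs_self _).trans ?_
      rw [abs_mul]
      exact mul_le_mul_of_nonneg_left hD (abs_nonneg _)
    have i3 : -(((cnt s₀ Finset.univ : ℝ) - cnt s Finset.univ) *
          (Real.log (tripleWt θ) - Real.log (tripleWt θ₀))) ≤ Q * |θ - θ₀| := by
      refine (neg_le_abs _).trans ?_
      rw [abs_mul]
      exact mul_le_mul hB hL (abs_nonneg _) hQ0
    have i4 := mul_le_mul_of_nonneg_left i2 (by positivity : 0 ≤ p / 3)
    have i5 := mul_le_mul_of_nonneg_left i3 (by positivity : 0 ≤ p / 3)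
    have i6 : (θ - θ₀) ^ 2 = |θ - θ₀| ^ 2 := (sq_abs _).symm
    rw [i6] at h1
    generalize |θ - θ₀| = δ at *
    nlinarith [sq_nonneg (δ - 20 / 9 * (p * Q))]
  have := mul_le_mul_of_nonneg_left key (by positivity : 0 ≤ 3 / p)
  have e2 : 3 / p * (rate (p * shortCnt s) (p * cnt s Finset.univ) θ₀ + 20 / 27 * (p * Q) ^ 2) =
      3 / p * rate (p * shortCnt s) (p * cnt s Finset.univ) θ₀ + 20 / 9 * p * Q ^ 2 := by
    field_simp
    ring
  linarith

/-- The weight of a list in a linearized potential: `κ` measures the distance from the reference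
instance, `b` is an extra weight of the lists of less than three colours, and `a` are the weights
of the lists of a single colour. -/
noncomputable def formWt (θ κ b : ℝ) (a : Color → ℝ) (M : Finset Color) : ℝ :=
  potWt θ M * Real.exp (-(κ * M.card)) * (if M.card = 3 then 1 else b) *
    (if M.card = 1 then ∏ k ∈ M, a k else 1)

theorem formWt_nonneg {θ κ b : ℝ} {a : Color → ℝ} (hθ : 0 ≤ θ) (hb : 0 ≤ b) (ha : ∀ k, 0 ≤ a k)
    (M : Finset Color) : 0 ≤ formWt θ κ b a M := by
  unfold formWt
  refine mul_nonneg (mul_nonneg (mul_nonneg (potWt_nonneg hθ M) (Real.exp_pos _).le) ?_) ?_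
  · split_ifs <;> linarith
  · split_ifs
    · exact Finset.prod_nonneg fun k _ => ha k
    · norm_num

/-- A linearized potential; `Y` is the size of the reference instance. -/
noncomputable def form (c θ κ b : ℝ) (a : Color → ℝ) (Y : ℝ) (s : Residual N) : ℝ :=
  Real.exp (κ * Y) * Real.exp (3 * N / c * (θ * Real.log 2 + θ ^ 2 / 2)) *
    listWt (formWt θ κ b a) s

theorem form_nonneg {c θ κ b : ℝ} {a : Color → ℝ} {Y : ℝ} (hθ : 0 ≤ θ) (hb : 0 ≤ b)
    (ha : ∀ k, 0 ≤ a k) (s : Residual N) : 0 ≤ form c θ κ b a Y s :=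
  mul_nonneg (mul_nonneg (Real.exp_pos _).le (Real.exp_pos _).le)
    (listWt_nonneg (formWt_nonneg hθ hb ha) s)

theorem form_eq_zero {c θ κ b : ℝ} {a : Color → ℝ} {Y : ℝ} {s : Residual N}
    (hs : s.Contradiction) : form c θ κ b a Y s = 0 := by
  rw [form, listWt_eq_zero (by simp [formWt, potWt]) hs, mul_zero]

theorem form_eq (c θ κ b : ℝ) (a : Color → ℝ) (Y : ℝ) {s : Residual N} (hs : ¬ s.Contradiction) :
    form c θ κ b a Y s = pot c θ s * Real.exp (κ * (Y - size s)) * b ^ shortCnt s *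
      ∏ k, a k ^ cnt s {k} := by
  have h1 : listWt (formWt θ κ b a) s = listWt (potWt θ) s * Real.exp (-(κ * size s)) *
      (∏ w ∈ s.left, if (s.avail w).card = 3 then 1 else b) *
      (∏ w ∈ s.left, if (s.avail w).card = 1 then ∏ k ∈ s.avail w, a k else 1) := by
    unfold listWt formWt
    rw [Finset.prod_mul_distrib, Finset.prod_mul_distrib, Finset.prod_mul_distrib, ← Real.exp_sum,
      Finset.sum_neg_distrib, ← Finset.mul_sum, size]
    push_cast
    rfl
  have h2 : (∏ w ∈ s.left, if (s.avail w).card = 3 then 1 else b) = b ^ shortCnt s := by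
    rw [Finset.prod_ite, Finset.prod_const_one, one_mul, Finset.prod_const]
    congr 1
    have : (shortCnt s : ℝ) = ((s.left.filter fun w => ¬ (s.avail w).card = 3).card : ℝ) := by
      rw [shortCnt_eq_sum, Finset.card_filter]
      push_cast
      refine Finset.sum_congr rfl fun w hw => ?_
      have h1 := card_avail_pos hs hw
      have h3 := card_avail_le s w
      refine if_congr ?_ rfl rfl
      omega
    exact_mod_cast this.symm
  have h3 : (∏ w ∈ s.left, if (s.avail w).card = 1 then ∏ k ∈ s.avail w, a k else 1) =
      ∏ k, a k ^ cnt s {k} := by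
    have e : ∀ w ∈ s.left, (if (s.avail w).card = 1 then ∏ k ∈ s.avail w, a k else 1) =
        ∏ k, if s.avail w = {k} then a k else 1 := by
      intro w _
      split_ifs with h
      · obtain ⟨j, hj⟩ := Finset.card_eq_one.1 h
        rw [hj, Finset.prod_singleton]
        simp
      · rw [Finset.prod_eq_one]
        intro k _
        rw [if_neg]
        intro hk
        exact h (by rw [hk]; simp)
    rw [Finset.prod_congr rfl e, Finset.prod_comm]
    refine Finset.prod_congr rfl fun k _ => ?_
    rw [Finset.prod_ite, Finset.prod_const_one, mul_one, Finset.prod_const, cnt]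
  rw [form, h1, h2, h3, pot]
  have e : Real.exp (κ * (Y - size s)) = Real.exp (κ * Y) * Real.exp (-(κ * size s)) := by
    rw [← Real.exp_add]; ring_nf
  rw [e]
  ring

/-- The logarithmic change of the weight of a list that loses the colour `k`. -/
noncomputable def formRate (θ κ b : ℝ) (a : Color → ℝ) (k : Color) (M : Finset Color) : ℝ :=
  if M = Finset.univ then b * Real.exp κ * (1 - lossRate θ) - 1
  else if M = Finset.univ.erase (k + 1) then a (k + 2) * Real.exp κ - 1
  else if M = Finset.univ.erase (k + 2) then a (k + 1) * Real.exp κ - 1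
  else 0

theorem erase_erase_one (k : Color) : (Finset.univ.erase (k + 1)).erase k = {k + 2} := by
  revert k; decide

theorem erase_erase_two (k : Color) : (Finset.univ.erase (k + 2)).erase k = {k + 1} := by
  revert k; decide

theorem add_two_ne_add_one (k : Color) : k + 2 ≠ k + 1 := by
  revert k; decide

theorem erase_eq_iff_color (j k : Color) : (Finset.univ.erase j = Finset.univ.erase k) ↔ j = k := by
  revert j k; decide

theorem potWt_univ (θ : ℝ) : potWt θ Finset.univ = tripleWt θ := if_pos (by simp)

theorem potWt_erase (θ : ℝ) (j : Color) : potWt θ (Finset.univ.erase j) = Real.exp (-θ) := by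
  rw [potWt, if_neg (by revert j; decide), if_neg (by revert j; decide)]

theorem potWt_singleton (θ : ℝ) (j : Color) : potWt θ {j} = Real.exp (-θ) := by
  rw [potWt, if_neg (by simp), if_neg (by simp)]

theorem formWt_univ (θ κ b : ℝ) (a : Color → ℝ) :
    formWt θ κ b a Finset.univ = tripleWt θ * Real.exp (-(κ * 3)) := by
  rw [formWt, potWt_univ]; simp

theorem formWt_erase (θ κ b : ℝ) (a : Color → ℝ) (j : Color) :
    formWt θ κ b a (Finset.univ.erase j) = Real.exp (-θ) * Real.exp (-(κ * 2)) * b := by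
  have : (Finset.univ.erase j).card = 2 := by revert j; decide
  rw [formWt, potWt_erase, this]; simp

theorem formWt_singleton (θ κ b : ℝ) (a : Color → ℝ) (j : Color) :
    formWt θ κ b a {j} = Real.exp (-θ) * Real.exp (-κ) * b * a j := by
  rw [formWt, potWt_singleton]; simp

theorem formWt_empty (θ κ b : ℝ) (a : Color → ℝ) : formWt θ κ b a ∅ = 0 := by
  simp [formWt, potWt]

/-- For lists that survive a hit this is `1 + x ≤ exp x`. The list `{k}` would become empty, which
has weight zero; its factor `1 - p`, the probability to escape a contradiction, is kept exactly
because `unitFactor` is recovered from it. -/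
theorem formWt_erase_le {p θ κ b : ℝ} {a : Color → ℝ} (hθ : 0 ≤ θ)
    (hb : 0 ≤ b) (k : Color) (M : Finset Color) :
    p * formWt θ κ b a (M.erase k) + (1 - p) * formWt θ κ b a M ≤
      formWt θ κ b a M * (if M = {k} then 1 - p else 1) *
        Real.exp (p * formRate θ κ b a k M) := by
  rcases list_cases M with rfl | ⟨j, rfl⟩ | ⟨j, rfl⟩ | rfl
  · simp [formWt_empty]
  · have hr : formRate θ κ b a k {j} = 0 := by
      rw [formRate, if_neg (by revert j; decide), if_neg (by revert j k; decide),
        if_neg (by revert j k; decide)]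
    rw [hr, mul_zero, Real.exp_zero, mul_one]
    by_cases hjk : j = k
    · subst hjk
      rw [if_pos rfl, Finset.erase_singleton, formWt_empty]
      linarith
    · rw [if_neg (by simpa using hjk), Finset.erase_eq_of_notMem (by simpa using Ne.symm hjk)]
      linarith
  · have hne : (Finset.univ.erase j : Finset Color) ≠ {k} := by revert j k; decide
    rw [if_neg hne, mul_one]
    have hcase : j = k ∨ j = k + 1 ∨ j = k + 2 := by revert j k; decide
    rcases hcase with rfl | rfl | rfl
    · rw [Finset.erase_eq_of_notMem (Finset.notMem_erase _ _), formRate,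
        if_neg (by revert j; decide), if_neg (by revert j; decide), if_neg (by revert j; decide),
        mul_zero, Real.exp_zero, mul_one]
      linarith
    · rw [erase_erase_one, formWt_singleton, formWt_erase, formRate, if_neg (by revert k; decide),
        if_pos rfl]
      have h2 := Real.add_one_le_exp (p * (a (k + 2) * Real.exp κ - 1))
      have e : Real.exp (-κ) = Real.exp (-(κ * 2)) * Real.exp κ := by
        rw [← Real.exp_add]; ring_nf
      have h3 : 0 ≤ Real.exp (-θ) * Real.exp (-(κ * 2)) * b := by positivity
      have := mul_le_mul_of_nonneg_left h2 h3
      rw [e]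
      linarith
    · rw [erase_erase_two, formWt_singleton, formWt_erase, formRate, if_neg (by revert k; decide),
        if_neg (by revert k; decide), if_pos rfl]
      have h2 := Real.add_one_le_exp (p * (a (k + 1) * Real.exp κ - 1))
      have e : Real.exp (-κ) = Real.exp (-(κ * 2)) * Real.exp κ := by
        rw [← Real.exp_add]; ring_nf
      have h3 : 0 ≤ Real.exp (-θ) * Real.exp (-(κ * 2)) * b := by positivity
      have := mul_le_mul_of_nonneg_left h2 h3
      rw [e]
      linarith
  · rw [if_neg (by revert k; decide), mul_one, formWt_univ, formWt_erase, formRate, if_pos rfl]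
    have h2 := Real.add_one_le_exp (p * (b * Real.exp κ * (1 - lossRate θ) - 1))
    have hz := tripleWt_pos hθ
    have h3 : 0 ≤ tripleWt θ * Real.exp (-(κ * 3)) := by positivity
    have := mul_le_mul_of_nonneg_left h2 h3
    have e : Real.exp (-(κ * 2)) = Real.exp (-(κ * 3)) * Real.exp κ := by
      rw [← Real.exp_add]; ring_nf
    have e2 : tripleWt θ * (1 - lossRate θ) = Real.exp (-θ) := by
      rw [← exp_div_tripleWt hθ]; field_simp
    have e3 : tripleWt θ * Real.exp (-(κ * 3)) * (p * (b * Real.exp κ * (1 - lossRate θ) - 1) + 1)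
        = p * (Real.exp (-θ) * (Real.exp (-(κ * 3)) * Real.exp κ) * b) +
          (1 - p) * (tripleWt θ * Real.exp (-(κ * 3))) := by
      rw [← e2]; ring
    rw [e]
    linarith

/-- The exponent of the step of a linearized potential. -/
noncomputable def gain (θ κ b : ℝ) (a : Color → ℝ) (s : Residual N) (k : Color) : ℝ :=
  cnt s Finset.univ * (b * Real.exp κ * (1 - lossRate θ) - 1) +
    cnt s (Finset.univ.erase (k + 1)) * (a (k + 2) * Real.exp κ - 1) +
    cnt s (Finset.univ.erase (k + 2)) * (a (k + 1) * Real.exp κ - 1)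

theorem sum_formRate (θ κ b : ℝ) (a : Color → ℝ) {s : Residual N} (hs : ¬ s.Contradiction)
    (k : Color) : ∑ w ∈ s.left, formRate θ κ b a k (s.avail w) = gain θ κ b a s k := by
  rw [sum_avail_alive hs]
  have h1 : ∀ j, formRate θ κ b a k {j} = 0 := by
    intro j
    rw [formRate, if_neg (by revert j; decide), if_neg (by revert j k; decide),
      if_neg (by revert j k; decide)]
  have h2 : ∀ j, formRate θ κ b a k (Finset.univ.erase j) =
      if j = k + 1 then a (k + 2) * Real.exp κ - 1 else if j = k + 2 then
        a (k + 1) * Real.exp κ - 1 else 0 := by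
    intro j
    rw [formRate, if_neg (by revert j; decide)]
    simp only [erase_eq_iff_color]
  have h3 : formRate θ κ b a k Finset.univ = b * Real.exp κ * (1 - lossRate θ) - 1 := if_pos rfl
  simp only [h1, h2, h3, mul_zero, Finset.sum_const_zero, zero_add]
  have hne : k + 2 ≠ k + 1 := add_two_ne_add_one k
  have h4 : ∀ j : Color, (cnt s (Finset.univ.erase j) : ℝ) * (if j = k + 1 then
      a (k + 2) * Real.exp κ - 1 else if j = k + 2 then a (k + 1) * Real.exp κ - 1 else 0) =
      (if j = k + 1 then (cnt s (Finset.univ.erase j) : ℝ) * (a (k + 2) * Real.exp κ - 1) else 0) +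
      (if j = k + 2 then (cnt s (Finset.univ.erase j) : ℝ) * (a (k + 1) * Real.exp κ - 1)
        else 0) := by
    intro j
    by_cases e1 : j = k + 1
    · subst e1; simp [hne.symm]
    · simp [e1]
  simp only [h4, Finset.sum_add_distrib, Finset.sum_ite_eq', Finset.mem_univ, if_true]
  rw [gain]
  ring

/-- The removed vertex does not take part in the step; adding its term to the full sum costs at most
`p` in the exponent. -/
theorem neg_one_le_formRate {θ κ b : ℝ} {a : Color → ℝ} (hθ : 0 ≤ θ) (hb : 0 ≤ b)
    (ha : ∀ k, 0 ≤ a k) (k : Color) (M : Finset Color) : -1 ≤ formRate θ κ b a k M := by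
  have h1 : 0 ≤ 1 - lossRate θ := by linarith [lossRate_le_third hθ]
  have h2 := mul_nonneg (mul_nonneg hb (Real.exp_pos κ).le) h1
  have h3 := mul_nonneg (ha (k + 1)) (Real.exp_pos κ).le
  have h4 := mul_nonneg (ha (k + 2)) (Real.exp_pos κ).le
  unfold formRate
  split_ifs <;> linarith

/-- One step of the search process, evaluated with a linearized potential. -/
theorem step_form_le {p c θ κ b : ℝ} {a : Color → ℝ} {Y : ℝ} (h0 : 0 ≤ p) (h1 : p ≤ 1)
    (hθ : 0 ≤ θ) (hb : 0 ≤ b) (ha : ∀ k, 0 ≤ a k) {s : Residual N} (hs : ¬ s.Contradiction)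
    {v : Fin N} (hv : v ∈ s.left) (k : Color) :
    formWt θ κ b a (s.avail v) * step p s v k (form c θ κ b a Y) ≤ form c θ κ b a Y s *
      (1 - p) ^ ((s.left.erase v).filter fun w => s.avail w = {k}).card *
        Real.exp (p * (gain θ κ b a s k + 1)) := by
  have h := step_listWt_le h0 h1 (formWt_nonneg (κ := κ) hθ hb ha)
    (formWt_erase_le (κ := κ) (a := a) hθ hb k) s hv
  rw [sum_formRate θ κ b a hs] at h
  have e : step p s v k (form c θ κ b a Y) = Real.exp (κ * Y) *
      Real.exp (3 * N / c * (θ * Real.log 2 + θ ^ 2 / 2)) *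
      step p s v k (listWt (formWt θ κ b a)) := by
    rw [← step_const_mul]; rfl
  rw [e, form]
  have hK : 0 ≤ Real.exp (κ * Y) * Real.exp (3 * N / c * (θ * Real.log 2 + θ ^ 2 / 2)) := by
    positivity
  have h2 := mul_le_mul_of_nonneg_left h hK
  have h3 : Real.exp (p * (gain θ κ b a s k - formRate θ κ b a k (s.avail v))) ≤
      Real.exp (p * (gain θ κ b a s k + 1)) := by
    apply Real.exp_le_exp.2
    have := neg_one_le_formRate (κ := κ) hθ hb ha k (s.avail v)
    apply mul_le_mul_of_nonneg_left _ h0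
    linarith
  have h4 := mul_le_mul_of_nonneg_left h3 (mul_nonneg hK (mul_nonneg
    (listWt_nonneg (formWt_nonneg (κ := κ) hθ hb ha) s) (pow_nonneg (sub_nonneg.2 h1)
      ((s.left.erase v).filter fun w => s.avail w = {k}).card)))
  linarith

end Dpll

/-! ### Parameters of the upper bound; growth of a linearized potential near its reference. -/

namespace Dpll

variable {N : ℕ}

/-- The constants that are used in the upper bound. -/
structure UpperParams (c ε κ η κ₁ τ : ℝ) (N L m : ℕ) : Prop where
  c_pos : 0 < c
  N_pos : 0 < N
  p_le : c / N ≤ κ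
  κ_pos : 0 < κ
  κ_le : κ ≤ 1 / 4
  η_pos : 0 < η
  η_le : c * η ≤ 9 / 80 * κ
  ε_le : ε ≤ 1
  κ_small : (5 * c + 10) * κ ≤ ε / 8
  hL : 59 / 10 ≤ c / N * L
  hm : (m : ℝ) + 3 ≤ η * N
  κ₁_pos : 0 < κ₁
  κ₁_le : κ₁ * Real.log 4 ≤ κ * η / 2
  τ_pos : 0 < τ
  hτ : ∀ e : ℕ, κ₁ * N / 3 ≤ e → (1 - c / N) ^ e.choose 2 ≤ τ
  τ_le : τ ≤ ε / 16
  tail : 2 ^ N * (c / N) ^ m * 4 ^ N ≤ ε / 8 * (τ * Real.exp (-N))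
  tail' : 2 ^ N * (c / N) ^ m * 4 ^ N ≤ ε / 8 * (1 - c / N) ^ (N * N)
  big : 1 ≤ ε / 8 * Real.exp (ε * (L - 1))
  quarter : ∀ n : ℕ, N / c ≤ n → (1 / 4 : ℝ) ^ n ≤ ε / 8

/-- The indicator of the nodes with at least `L` remaining vertices in which no list has less than
two colours. -/
noncomputable def decisionAbove (L : ℕ) (s : Residual N) : ℝ :=
  open Classical in if L ≤ s.left.card ∧ ∀ w ∈ s.left, 2 ≤ (s.avail w).card then 1 else 0

/-- The factor that compensates the free choices in instances without short lists. -/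
noncomputable def shortFactor (s : Residual N) : ℝ := 1 + (1 / 4) ^ shortCnt s

/-- A bound for the probability that the unit lists do not lead to a contradiction. -/
noncomputable def unitFactor (p : ℝ) (s : Residual N) : ℝ :=
  ∏ k : Color, (1 - p) ^ (cnt s {k}).choose 2

theorem decisionAbove_le_one (L : ℕ) (s : Residual N) : decisionAbove L s ≤ 1 := by
  unfold decisionAbove; split_ifs <;> norm_num

theorem decisionAbove_of_contradiction {L : ℕ} {s : Residual N} (h : s.Contradiction) :
    decisionAbove L s = 0 := if_neg fun hh => not_contradiction_of_two_le hh.2 h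

theorem one_le_shortFactor (s : Residual N) : 1 ≤ shortFactor s := by
  unfold shortFactor
  have : (0 : ℝ) ≤ (1 / 4) ^ shortCnt s := by positivity
  linarith

theorem unitFactor_nonneg {p : ℝ} (h1 : p ≤ 1) (s : Residual N) : 0 ≤ unitFactor p s :=
  Finset.prod_nonneg fun _ _ => pow_nonneg (sub_nonneg.2 h1) _

theorem unitFactor_le_pow {p : ℝ} (h0 : 0 ≤ p) (h1 : p ≤ 1) (s : Residual N) (k : Color) :
    unitFactor p s ≤ (1 - p) ^ (cnt s {k}).choose 2 := by
  classical
  rw [unitFactor, ← Finset.mul_prod_erase Finset.univ _ (Finset.mem_univ k)]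
  refine mul_le_of_le_one_right (pow_nonneg (sub_nonneg.2 h1) _) (Finset.prod_le_one
    (fun _ _ => pow_nonneg (sub_nonneg.2 h1) _) fun _ _ =>
    pow_le_one₀ (sub_nonneg.2 h1) (by linarith))

theorem unitFactor_le_one {p : ℝ} (h0 : 0 ≤ p) (h1 : p ≤ 1) (s : Residual N) :
    unitFactor p s ≤ 1 :=
  (unitFactor_le_pow h0 h1 s 0).trans (pow_le_one₀ (sub_nonneg.2 h1) (by linarith))

/-- A crude bound, needed only to make the probability of exceptionally many hits negligible against
the potential. -/
theorem exp_neg_le_pot {c θ : ℝ} (hc : 0 < c) (hθ : 0 ≤ θ) (hθ1 : θ ≤ 1) {s : Residual N}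
    (hs : ¬ s.Contradiction) : Real.exp (-N) ≤ pot c θ s := by
  have h1 : 1 ≤ Real.exp (3 * N / c * (θ * Real.log 2 + θ ^ 2 / 2)) := by
    apply Real.one_le_exp
    have := Real.log_pos (by norm_num : (1 : ℝ) < 2)
    positivity
  have h2 : Real.exp (-N) ≤ listWt (potWt θ) s := by
    have hcard : (s.left.card : ℝ) ≤ N := by exact_mod_cast (by simpa using Finset.card_le_univ s.left)
    calc Real.exp (-N) ≤ Real.exp (-1) ^ s.left.card := by
          rw [← Real.exp_nat_mul]
          apply Real.exp_le_exp.2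
          linarith
      _ = ∏ w ∈ s.left, Real.exp (-1) := by rw [Finset.prod_const]
      _ ≤ _ := by
          refine Finset.prod_le_prod (fun _ _ => (Real.exp_pos _).le) fun w hw => ?_
          have := card_avail_pos hs hw
          have he : Real.exp (-1) ≤ Real.exp (-θ) := Real.exp_le_exp.2 (by linarith)
          unfold potWt
          split_ifs with h3 h4
          · rw [tripleWt_eq]
            have := exp_neg_two_mul_le hθ
            refine he.trans (le_mul_of_one_le_right (Real.exp_pos _).le (by linarith))
          · rw [h4] at this; simp at this
          · exact he
  calc Real.exp (-N) = 1 * Real.exp (-N) := (one_mul _).symm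
    _ ≤ _ := mul_le_mul h1 h2 (Real.exp_pos _).le (by positivity)

theorem exp_sub_one_le {x : ℝ} (h0 : 0 ≤ x) (h1 : x ≤ 1) : Real.exp x - 1 ≤ 2 * x := by
  have := Real.abs_exp_sub_one_le (x := x) (by rw [abs_of_nonneg h0]; exact h1)
  rw [abs_of_nonneg h0] at this
  exact (le_abs_self _).trans this

variable {c ε κ η κ₁ τ : ℝ} {L m : ℕ}

theorem UpperParams.p_nonneg (P : UpperParams c ε κ η κ₁ τ N L m) : 0 ≤ c / N :=
  div_nonneg P.c_pos.le (Nat.cast_nonneg _)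

theorem UpperParams.p_le_one (P : UpperParams c ε κ η κ₁ τ N L m) : c / N ≤ 1 :=
  P.p_le.trans (P.κ_le.trans (by norm_num))

theorem UpperParams.p_mul (P : UpperParams c ε κ η κ₁ τ N L m) : c / N * N = c := by
  have := P.N_pos
  field_simp

theorem UpperParams.ε_pos (P : UpperParams c ε κ η κ₁ τ N L m) : 0 < ε := by
  have := mul_pos (by linarith [P.c_pos] : 0 < 5 * c + 10) P.κ_pos
  linarith [P.κ_small]

theorem mul_le_of_abs_le {x y δ : ℝ} (hx : |x| ≤ δ) (hy : |y| ≤ 1) : x * y ≤ δ := by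
  refine (le_abs_self _).trans ?_
  rw [abs_mul]
  exact (mul_le_of_le_one_right (abs_nonneg _) hy).trans hx

theorem cnt_le_card (s : Residual N) (M : Finset Color) : cnt s M ≤ N := by
  unfold cnt
  simpa using Finset.card_le_univ (s.left.filter fun w => s.avail w = M)

/-- The gain of a linearized potential near its reference instance. -/
theorem UpperParams.gain_le (P : UpperParams c ε κ η κ₁ τ N L m) {s₀ s : Residual N}
    (h₀ : ¬ s₀.Contradiction) (h : Below s₀ s) (hQ : (size s₀ : ℝ) - size s ≤ η * N)
    {θ b : ℝ} (hθ : 0 ≤ θ) (hb0 : 0 ≤ b) (hb1 : b ≤ 1) {a : Color → ℝ}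
    (ha0 : ∀ k, 0 ≤ a k) (ha : ∀ k, a k ≤ 3 / 2) (k : Color) :
    c / N * (gain θ κ b a s k + 1) ≤ -(c / N * cnt s₀ Finset.univ * (1 - b * (1 - lossRate θ))) +
      c / N * (cnt s₀ (Finset.univ.erase (k + 1)) * (a (k + 2) - 1) +
        cnt s₀ (Finset.univ.erase (k + 2)) * (a (k + 1) - 1)) + (5 * c + 3) * κ := by
  have hp := P.p_nonneg
  have hQ0 := abs_cnt_sub_le h₀ h Finset.univ
  have hpQ : c / N * ((size s₀ : ℝ) - size s) ≤ 9 / 80 * κ := by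
    calc c / N * ((size s₀ : ℝ) - size s) ≤ c / N * (η * N) := mul_le_mul_of_nonneg_left hQ hp
      _ = c / N * N * η := by ring
      _ ≤ _ := by rw [P.p_mul]; exact P.η_le
  have hM : ∀ M, |c / N * cnt s₀ M - c / N * cnt s M| ≤ 9 / 80 * κ := by
    intro M
    rw [← mul_sub, abs_mul, abs_of_nonneg hp]
    exact (mul_le_mul_of_nonneg_left (abs_cnt_sub_le h₀ h M) hp).trans hpQ
  have hsum : ∀ M, 0 ≤ c / N * cnt s M := fun M => by positivity
  -- The three lists belong to disjoint sets of vertices, so replacing `exp κ` by `1` changes the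
  -- gain by at most a multiple of `c * κ`.
  have htot : c / N * cnt s (Finset.univ.erase (k + 1)) + c / N * cnt s (Finset.univ.erase (k + 2))
      + c / N * cnt s Finset.univ ≤ c := by
    have h1 : (cnt s (Finset.univ.erase (k + 1)) : ℝ) + cnt s (Finset.univ.erase (k + 2)) +
        cnt s Finset.univ ≤ N := by
      have hne1 := add_two_ne_add_one k
      have : cnt s (Finset.univ.erase (k + 1)) + cnt s (Finset.univ.erase (k + 2)) +
          cnt s Finset.univ ≤ s.left.card := by
        unfold cnt
        rw [← Finset.card_union_of_disjoint, ← Finset.card_union_of_disjoint]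
        · exact Finset.card_le_card (Finset.union_subset (Finset.union_subset
            (Finset.filter_subset _ _) (Finset.filter_subset _ _)) (Finset.filter_subset _ _))
        · rw [Finset.disjoint_union_left]
          constructor <;>
          · refine Finset.disjoint_filter.2 fun w _ h1 h2 => ?_
            rw [h1] at h2
            have : ∀ j : Color, Finset.univ.erase j ≠ Finset.univ := by decide
            exact this _ h2
        · refine Finset.disjoint_filter.2 fun w _ h1 h2 => ?_
          rw [h1, erase_eq_iff_color] at h2
          exact hne1 h2.symm
      have h2 : s.left.card ≤ N := by simpa using Finset.card_le_univ s.left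
      exact_mod_cast this.trans h2
    have := mul_le_mul_of_nonneg_left h1 hp
    rw [P.p_mul] at this
    linarith
  have hexp := exp_sub_one_le P.κ_pos.le (P.κ_le.trans (by norm_num))
  have hexp0 : 0 ≤ Real.exp κ - 1 := by linarith [Real.add_one_le_exp κ, P.κ_pos]
  have hl0 := lossRate_nonneg hθ
  have hl1 := lossRate_le_third hθ
  have hκ := P.κ_pos
  have hpκ := P.p_le
  have a0 := ha0 (k + 1)
  have a1 := ha0 (k + 2)
  have a2 := ha (k + 1)
  have a3 := ha (k + 2)
  have m0 := abs_le.1 (hM Finset.univ)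
  have m1 := abs_le.1 (hM (Finset.univ.erase (k + 1)))
  have m2 := abs_le.1 (hM (Finset.univ.erase (k + 2)))
  have n0 := hsum Finset.univ
  have n1 := hsum (Finset.univ.erase (k + 1))
  have n2 := hsum (Finset.univ.erase (k + 2))
  unfold gain
  generalize e0 : c / N * cnt s Finset.univ = x0 at *
  generalize e1 : c / N * cnt s (Finset.univ.erase (k + 1)) = x1 at *
  generalize e2 : c / N * cnt s (Finset.univ.erase (k + 2)) = x2 at *
  generalize f0 : c / N * cnt s₀ Finset.univ = y0 at *
  generalize f1 : c / N * cnt s₀ (Finset.univ.erase (k + 1)) = y1 at *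
  generalize f2 : c / N * cnt s₀ (Finset.univ.erase (k + 2)) = y2 at *
  have lhs : c / N * (cnt s Finset.univ * (b * Real.exp κ * (1 - lossRate θ) - 1) +
      cnt s (Finset.univ.erase (k + 1)) * (a (k + 2) * Real.exp κ - 1) +
      cnt s (Finset.univ.erase (k + 2)) * (a (k + 1) * Real.exp κ - 1) + 1) =
      x0 * (b * Real.exp κ * (1 - lossRate θ) - 1) + x1 * (a (k + 2) * Real.exp κ - 1) +
      x2 * (a (k + 1) * Real.exp κ - 1) + c / N := by
    rw [← e0, ← e1, ← e2]; ring
  have rhs : c / N * (cnt s₀ (Finset.univ.erase (k + 1)) * (a (k + 2) - 1) +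
        cnt s₀ (Finset.univ.erase (k + 2)) * (a (k + 1) - 1)) =
      y1 * (a (k + 2) - 1) + y2 * (a (k + 1) - 1) := by
    rw [← f1, ← f2]; ring
  rw [lhs, rhs]
  set u := Real.exp κ - 1 with hu
  have hexpκ : Real.exp κ = 1 + u := by rw [hu]; ring
  rw [hexpκ]
  set r := b * (1 - lossRate θ) with hr
  have hr0 : 0 ≤ r := mul_nonneg hb0 (by linarith)
  have hr1 : r ≤ 1 := mul_le_one₀ hb1 (by linarith) (by linarith)
  have t0 : x0 * (b * (1 + u) * (1 - lossRate θ) - 1) ≤ -(y0 * (1 - r)) + 9 / 80 * κ + x0 * u := by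
    have e : x0 * (b * (1 + u) * (1 - lossRate θ) - 1) = -(x0 * (1 - r)) + x0 * u * r := by
      rw [hr]; ring
    rw [e]
    have i1 : x0 * u * r ≤ x0 * u := mul_le_of_le_one_right (mul_nonneg n0 hexp0) hr1
    have i2 : (y0 - x0) * (1 - r) ≤ 9 / 80 * κ :=
      mul_le_of_abs_le (abs_le.2 m0) (abs_le.2 ⟨by linarith, by linarith⟩)
    linarith
  have tt : ∀ x y α : ℝ, 0 ≤ x → -(9 / 80 * κ) ≤ y - x → y - x ≤ 9 / 80 * κ → 0 ≤ α →
      α ≤ 3 / 2 → x * (α * (1 + u) - 1) ≤ y * (α - 1) + 9 / 80 * κ + 3 / 2 * (x * u) := by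
    intro x y α hx h1 h2 h3 h4
    have i1 : x * (α * u) ≤ 3 / 2 * (x * u) := by
      have := mul_le_mul_of_nonneg_right h4 (mul_nonneg hx hexp0)
      linarith
    have i2 : (x - y) * (α - 1) ≤ 9 / 80 * κ :=
      mul_le_of_abs_le (abs_le.2 ⟨by linarith, by linarith⟩) (abs_le.2 ⟨by linarith, by linarith⟩)
    linarith
  have t1 := tt x1 y1 (a (k + 2)) n1 m1.1 m1.2 a1 a3
  have t2 := tt x2 y2 (a (k + 1)) n2 m2.1 m2.2 a0 a2
  have t3 : (x1 + x2 + x0) * u ≤ c * (2 * κ) :=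
    mul_le_mul htot hexp hexp0 P.c_pos.le
  have t4 : 0 ≤ x0 * u := mul_nonneg n0 hexp0
  have hb' : -(y0 * (1 - b * (1 - lossRate θ))) = -(y0 * (1 - r)) := rfl
  rw [hb']
  have hcκ : 0 ≤ c * κ := mul_nonneg P.c_pos.le hκ.le
  linarith

/-- The step of a linearized potential in which a list with the colour `k` is removed. -/
theorem UpperParams.step_form_le_exp (P : UpperParams c ε κ η κ₁ τ N L m) {s₀ s : Residual N}
    (h₀ : ¬ s₀.Contradiction) (hs : ¬ s.Contradiction) (h : Below s₀ s)
    (hQ : (size s₀ : ℝ) - size s ≤ η * N)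
    {θ b : ℝ} (hθ : 0 ≤ θ) (hb0 : 0 < b) (hb1 : b ≤ 1) {a : Color → ℝ}
    (ha0 : ∀ k, 0 < a k) (ha : ∀ k, a k ≤ 3 / 2) {Y : ℝ} {v : Fin N} (hv : v ∈ s.left) (k : Color)
    {r x : ℝ} (hx : Real.exp (-x) ≤ formWt θ κ b a (s.avail v))
    (hr : x - c / N * cnt s₀ Finset.univ * (1 - b * (1 - lossRate θ)) +
      c / N * (cnt s₀ (Finset.univ.erase (k + 1)) * (a (k + 2) - 1) +
        cnt s₀ (Finset.univ.erase (k + 2)) * (a (k + 1) - 1)) ≤ r) :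
    step (c / N) s v k (form c θ κ b a Y) ≤ form c θ κ b a Y s *
      (1 - c / N) ^ ((s.left.erase v).filter fun w => s.avail w = {k}).card *
        Real.exp (r + (5 * c + 3) * κ) := by
  have h1 := step_form_le (c := c) (κ := κ) (Y := Y) P.p_nonneg P.p_le_one hθ hb0.le
    (fun k => (ha0 k).le) hs hv k
  have h2 := P.gain_le h₀ h hQ hθ hb0.le hb1 (fun k => (ha0 k).le) ha k
  have hst : 0 ≤ step (c / N) s v k (form c θ κ b a Y) :=
    step_nonneg P.p_nonneg P.p_le_one fun A _ => form_nonneg hθ hb0.le (fun k => (ha0 k).le) _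
  have h3 : Real.exp (-x) * step (c / N) s v k (form c θ κ b a Y) ≤ form c θ κ b a Y s *
      (1 - c / N) ^ ((s.left.erase v).filter fun w => s.avail w = {k}).card *
        Real.exp (c / N * (gain θ κ b a s k + 1)) :=
    (mul_le_mul_of_nonneg_right hx hst).trans h1
  have h4 : Real.exp x * Real.exp (-x) = 1 := by rw [← Real.exp_add]; simp
  have h5 := mul_le_mul_of_nonneg_left h3 (Real.exp_pos x).le
  rw [← mul_assoc, h4, one_mul] at h5
  refine h5.trans ?_
  have h6 : Real.exp x * Real.exp (c / N * (gain θ κ b a s k + 1)) ≤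
      Real.exp (r + (5 * c + 3) * κ) := by
    rw [← Real.exp_add]
    exact Real.exp_le_exp.2 (by linarith)
  have h7 : 0 ≤ form c θ κ b a Y s *
      (1 - c / N) ^ ((s.left.erase v).filter fun w => s.avail w = {k}).card :=
    mul_nonneg (form_nonneg hθ hb0.le (fun k => (ha0 k).le) s)
      (pow_nonneg (sub_nonneg.2 P.p_le_one) _)
  calc _ = form c θ κ b a Y s *
      (1 - c / N) ^ ((s.left.erase v).filter fun w => s.avail w = {k}).card *
      (Real.exp x * Real.exp (c / N * (gain θ κ b a s k + 1))) := by ring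
    _ ≤ _ := mul_le_mul_of_nonneg_left h6 h7

end Dpll

/-! ### Unit propagation below a reference instance. -/

namespace Dpll

variable {N : ℕ}

/-- The bound for the number of decision nodes below an instance. -/
def UnitBound (c ε : ℝ) (L : ℕ) (s : Residual N) : Prop :=
  ∀ K, (∀ θ ∈ Set.Icc (0 : ℝ) (3 / 10), pot c θ s ≤ K) →
    mean (c / N) (decisionAbove L) s ≤
      Real.exp (ε * s.left.card) * shortFactor s * K * unitFactor (c / N) s

/-- An instance together with its optimal parameter and suitable weights of the unit lists. -/
structure Reference (c η : ℝ) (s₀ : Residual N) (θ : ℝ) (α : Color → ℝ) (G χ : ℝ) : Prop where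
  alive : ¬ s₀.Contradiction
  θ_mem : θ ∈ Set.Icc (0 : ℝ) (3 / 10)
  hmax : ∀ θ' ∈ Set.Icc (0 : ℝ) (3 / 10),
      rate (c / N * shortCnt s₀) (c / N * cnt s₀ Finset.univ) θ' ≤
      rate (c / N * shortCnt s₀) (c / N * cnt s₀ Finset.univ) θ - 3 / 20 * (θ' - θ) ^ 2
  θ_le : θ ≤ c / N * cnt s₀ Finset.univ * lossRate θ
  α_ge : ∀ k, 1 / 2 ≤ α k
  α_le : ∀ k, α k ≤ 3
  hα : ∀ k, Real.log 2 + θ - c / N * cnt s₀ Finset.univ * lossRate θ +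
      c / N * (cnt s₀ (Finset.univ.erase (k + 1)) * (α (k + 2) / 2 - 1) +
        cnt s₀ (Finset.univ.erase (k + 2)) * (α (k + 1) / 2 - 1)) ≤ Real.log (α k)
  G_ge : 1 ≤ G
  hχ : χ = 0 ∨ χ = 1 ∧ Real.log 4 ≤ 3 / 4 * (c / N * cnt s₀ Finset.univ * (1 - lossRate θ))
  hG : ∀ s, Below s₀ s → (size s₀ : ℝ) - size s ≤ 2 * η * N →
    shortFactor s ≤ G + χ * (1 / 4) ^ shortCnt s

/-- The upper function for the instances that are close to a reference instance. -/
noncomputable def localBound (c κ τ θ : ℝ) (α : Color → ℝ) (G χ Y : ℝ) (s : Residual N) : ℝ :=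
  G * (form c θ κ 1 (fun k => α k / 2) Y s + τ * form c θ κ 1 (fun _ => 1) Y s) +
    χ * (form c θ κ (1 / 4) (fun k => α k / 2) Y s + τ * form c θ κ (1 / 4) (fun _ => 1) Y s)

variable {c ε κ η κ₁ τ : ℝ} {L m : ℕ} {s₀ : Residual N} {θ : ℝ} {α : Color → ℝ} {G χ : ℝ}

theorem Reference.χ_nonneg (R : Reference c η s₀ θ α G χ) : 0 ≤ χ := by
  rcases R.hχ with h | ⟨h, -⟩ <;> rw [h]; norm_num

/-- The quadratic error of `pot_le_of_below` is at most `κ * Q / 2` while the lost length `Q` is at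
most `2 * η * N`. Since `form` carries `exp (κ * Q)`, the other half stays in reserve for long
phases. -/
theorem Reference.pot_le (R : Reference c η s₀ θ α G χ)
    (P : UpperParams c ε κ η κ₁ τ N L m) {s : Residual N} (h : Below s₀ s)
    (hQ : (size s₀ : ℝ) - size s ≤ 2 * η * N) {θ' : ℝ} (hθ' : θ' ∈ Set.Icc (0 : ℝ) (3 / 10)) :
    pot c θ' s ≤ pot c θ s * Real.exp (κ / 2 * ((size s₀ : ℝ) - size s)) := by
  refine (pot_le_of_below P.c_pos P.N_pos R.alive h R.θ_mem.1 R.hmax hθ').trans ?_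
  refine mul_le_mul_of_nonneg_left (Real.exp_le_exp.2 ?_) (pot_nonneg R.θ_mem.1 s)
  have hQ0 : 0 ≤ (size s₀ : ℝ) - size s := by linarith [size_le h]
  calc 20 / 9 * (c / N) * ((size s₀ : ℝ) - size s) ^ 2
      = 20 / 9 * (c / N) * ((size s₀ : ℝ) - size s) * ((size s₀ : ℝ) - size s) := by ring
    _ ≤ 20 / 9 * (c / N) * (2 * η * N) * ((size s₀ : ℝ) - size s) := by
        have := P.p_nonneg
        gcongr
    _ = 40 / 9 * (c / N * N * η) * ((size s₀ : ℝ) - size s) := by ring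
    _ ≤ 40 / 9 * (9 / 80 * κ) * ((size s₀ : ℝ) - size s) := by
        rw [P.p_mul]
        have := P.η_le
        gcongr
    _ = _ := by ring

theorem card_pos_left_of_params (P : UpperParams c ε κ η κ₁ τ N L m) : 1 ≤ L := by
  rcases Nat.eq_zero_or_pos L with h | h
  · have := P.hL
    rw [h] at this
    norm_num at this
  · exact h

theorem mean_decisionAbove_of_lt {p : ℝ} {s : Residual N} (h : s.left.card < L) :
    mean p (decisionAbove L) s = 0 :=
  mean_eq_zero_of_lt (fun _ h => if_neg fun hh => absurd hh.1 (by omega)) h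

/-- The part with the factor `τ` gives unit lists the weight `1` and therefore does not decay with
their number; it keeps the bound above the tail error. -/
theorem localBound_ge (R : Reference c η s₀ θ α G χ) (P : UpperParams c ε κ η κ₁ τ N L m)
    {s : Residual N} (hs : ¬ s.Contradiction) (h : Below s₀ s) :
    τ * Real.exp (-N) ≤ localBound c κ τ θ α G χ (size s₀) s := by
  have hα0 : ∀ k, 0 ≤ α k / 2 := fun k => by linarith [R.α_ge k]
  have f1 := form_nonneg (c := c) (κ := κ) (b := 1) (Y := size s₀) R.θ_mem.1 (by norm_num) hα0 s
  have f2 := form_nonneg (c := c) (κ := κ) (b := 1 / 4) (Y := size s₀) R.θ_mem.1 (by norm_num) hα0 s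
  have f3 := form_nonneg (c := c) (κ := κ) (b := 1 / 4) (Y := size s₀) (a := fun _ => 1) R.θ_mem.1
    (by norm_num) (fun _ => zero_le_one) s
  have f4 : Real.exp (-N) ≤ form c θ κ 1 (fun _ => 1) (size s₀) s := by
    rw [form_eq _ _ _ _ _ _ hs]
    simp only [one_pow, mul_one, Finset.prod_const_one]
    refine (exp_neg_le_pot P.c_pos R.θ_mem.1 (R.θ_mem.2.trans (by norm_num)) hs).trans ?_
    refine le_mul_of_one_le_right (pot_nonneg R.θ_mem.1 s) (Real.one_le_exp ?_)
    exact mul_nonneg P.κ_pos.le (by linarith [size_le h])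
  have hτ := P.τ_pos
  unfold localBound
  have h1 : 0 ≤ χ * (form c θ κ (1 / 4) (fun k => α k / 2) (size s₀) s +
      τ * form c θ κ (1 / 4) (fun _ => 1) (size s₀) s) :=
    mul_nonneg R.χ_nonneg (add_nonneg f2 (mul_nonneg hτ.le f3))
  have h2 := mul_le_mul_of_nonneg_left f4 hτ.le
  have h3 : form c θ κ 1 (fun k => α k / 2) (size s₀) s + τ * form c θ κ 1 (fun _ => 1) (size s₀) s
      ≤ G * (form c θ κ 1 (fun k => α k / 2) (size s₀) s +
        τ * form c θ κ 1 (fun _ => 1) (size s₀) s) :=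
    le_mul_of_one_le_left (add_nonneg f1 (mul_nonneg hτ.le ((Real.exp_pos _).le.trans f4))) R.G_ge
  linarith

theorem localBound_nonneg (R : Reference c η s₀ θ α G χ) (P : UpperParams c ε κ η κ₁ τ N L m)
    {s : Residual N} (h : Below s₀ s) : 0 ≤ localBound c κ τ θ α G χ (size s₀) s := by
  by_cases hs : s.Contradiction
  · simp [localBound, form_eq_zero hs]
  · exact (mul_nonneg P.τ_pos.le (Real.exp_pos _).le).trans (localBound_ge R P hs h)

/-- At the end of a phase of unit propagation, or when this phase is too long, the upper function
dominates the general bound. -/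
theorem UnitBound.le_localBound {s : Residual N} (hU : UnitBound c ε L s)
    (R : Reference c η s₀ θ α G χ) (P : UpperParams c ε κ η κ₁ τ N L m)
    (hs : ¬ s.Contradiction) (h : Below s₀ s) (hQ : (size s₀ : ℝ) - size s ≤ 2 * η * N)
    (hend : (∀ k, cnt s {k} = 0) ∨ η * N ≤ (size s₀ : ℝ) - size s) :
    mean (c / N) (decisionAbove L) s ≤
      Real.exp (ε * s.left.card) * localBound c κ τ θ α G χ (size s₀) s := by
  have h1 := hU _ fun θ' hθ' => R.pot_le P h hQ hθ'
  refine h1.trans ?_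
  rw [mul_assoc, mul_assoc]
  refine mul_le_mul_of_nonneg_left ?_ (Real.exp_pos _).le
  set Q : ℝ := (size s₀ : ℝ) - size s with hQdef
  have hQ0 : 0 ≤ Q := by linarith [size_le h]
  have hp0 := pot_nonneg (c := c) R.θ_mem.1 s
  have hu0 := unitFactor_nonneg P.p_le_one s
  have hu1 := unitFactor_le_one P.p_nonneg P.p_le_one s
  have hκ := P.κ_pos
  set u : ℝ := ∏ k, (α k / 2) ^ cnt s {k} with hu
  have hupos : 0 ≤ u := Finset.prod_nonneg fun k _ => pow_nonneg (by linarith [R.α_ge k]) _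
  -- Three cases. No unit list is left and `u = 1`. The phase was long but few unit lists remain;
  -- each weighs at least `1 / 4`, and the reserve `exp (κ * Q / 2)` pays for them. Or some colour
  -- has so many unit lists that `unitFactor` is at most `τ`.
  have key : Real.exp (κ / 2 * Q) * unitFactor (c / N) s ≤ Real.exp (κ * Q) * (u + τ) := by
    rcases hend with h0 | h0
    · have : u = 1 := by rw [hu]; exact Finset.prod_eq_one fun k _ => by rw [h0 k, pow_zero]
      rw [this]
      calc _ ≤ Real.exp (κ * Q) * 1 := by
            refine mul_le_mul (Real.exp_le_exp.2 (by nlinarith)) hu1 hu0 (Real.exp_pos _).le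
        _ ≤ _ := mul_le_mul_of_nonneg_left (by linarith [P.τ_pos]) (Real.exp_pos _).le
    · by_cases hsmall : ((∑ k, cnt s {k} : ℕ) : ℝ) ≤ κ₁ * N
      · have e1 : Real.exp (κ / 2 * Q) ≤ Real.exp (κ * Q) * u := by
          have e2 : Real.exp (-(κ / 2 * Q)) ≤ u := by
            calc Real.exp (-(κ / 2 * Q)) ≤ Real.exp (-(Real.log 4 * (∑ k, cnt s {k} : ℕ))) := by
                  apply Real.exp_le_exp.2
                  have i1 : Real.log 4 * (∑ k, cnt s {k} : ℕ) ≤ Real.log 4 * (κ₁ * N) :=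
                    mul_le_mul_of_nonneg_left hsmall (Real.log_nonneg (by norm_num))
                  have i2 := mul_le_mul_of_nonneg_right P.κ₁_le (Nat.cast_nonneg (α := ℝ) N)
                  have i3 : κ / 2 * (η * N) ≤ κ / 2 * Q :=
                    mul_le_mul_of_nonneg_left h0 (by linarith)
                  linarith
              _ = (1 / 4 : ℝ) ^ (∑ k, cnt s {k}) := by
                  rw [mul_comm, ← mul_neg, Real.exp_nat_mul, Real.exp_neg,
                    Real.exp_log (by norm_num)]
                  norm_num
              _ = ∏ k : Color, (1 / 4 : ℝ) ^ cnt s {k} := (Finset.prod_pow_eq_pow_sum _ _ _).symm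
              _ ≤ u := Finset.prod_le_prod (fun k _ => by positivity) fun k _ =>
                  pow_le_pow_left₀ (by norm_num) (by linarith [R.α_ge k]) _
          calc Real.exp (κ / 2 * Q) = Real.exp (κ * Q) * Real.exp (-(κ / 2 * Q)) := by
                rw [← Real.exp_add]; ring_nf
            _ ≤ _ := mul_le_mul_of_nonneg_left e2 (Real.exp_pos _).le
        calc _ ≤ Real.exp (κ / 2 * Q) * 1 := mul_le_mul_of_nonneg_left hu1 (Real.exp_pos _).le
          _ ≤ Real.exp (κ * Q) * u := by rw [mul_one]; exact e1
          _ ≤ _ := mul_le_mul_of_nonneg_left (by linarith [P.τ_pos]) (Real.exp_pos _).le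
      · have : ∃ k, κ₁ * N / 3 ≤ cnt s {k} := by
          by_contra hcon
          push Not at hcon
          apply hsmall
          push_cast
          rw [Fin.sum_univ_three]
          linarith [hcon 0, hcon 1, hcon 2]
        obtain ⟨k, hk⟩ := this
        have e1 : unitFactor (c / N) s ≤ τ :=
          (unitFactor_le_pow P.p_nonneg P.p_le_one s k).trans (P.hτ _ hk)
        calc _ ≤ Real.exp (κ * Q) * τ :=
              mul_le_mul (Real.exp_le_exp.2 (by nlinarith)) e1 hu0 (Real.exp_pos _).le
          _ ≤ _ := mul_le_mul_of_nonneg_left (by linarith) (Real.exp_pos _).le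
  have hform : localBound c κ τ θ α G χ (size s₀) s =
      (G + χ * (1 / 4) ^ shortCnt s) * (pot c θ s * (Real.exp (κ * Q) * (u + τ))) := by
    unfold localBound
    rw [form_eq _ _ _ _ _ _ hs, form_eq _ _ _ _ _ _ hs, form_eq _ _ _ _ _ _ hs,
      form_eq _ _ _ _ _ _ hs, ← hQdef, ← hu]
    simp only [one_pow, mul_one, Finset.prod_const_one]
    ring
  rw [hform]
  have hsf := R.hG s h hQ
  calc shortFactor s * (pot c θ s * Real.exp (κ / 2 * Q) * unitFactor (c / N) s)
      = shortFactor s * (pot c θ s * (Real.exp (κ / 2 * Q) * unitFactor (c / N) s)) := by ring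
    _ ≤ _ := by
        refine mul_le_mul hsf (mul_le_mul_of_nonneg_left key hp0) ?_ ?_
        · exact mul_nonneg hp0 (mul_nonneg (Real.exp_pos _).le hu0)
        · exact (zero_le_one.trans (one_le_shortFactor s)).trans hsf

theorem log_four : Real.log 4 = 2 * Real.log 2 := by
  rw [show (4 : ℝ) = 2 ^ 2 by norm_num, Real.log_pow]; norm_num

/-- In the phase of unit propagation the upper function grows slowly. -/
theorem Reference.step_localBound_unit (R : Reference c η s₀ θ α G χ)
    (P : UpperParams c ε κ η κ₁ τ N L m) {s : Residual N}
    (hs : ¬ s.Contradiction) (h : Below s₀ s) (hQ : (size s₀ : ℝ) - size s ≤ η * N)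
    {v : Fin N} (hv : v ∈ s.left) {k : Color} (hk : s.avail v = {k}) :
    step (c / N) s v k (localBound c κ τ θ α G χ (size s₀)) ≤
      Real.exp (ε / 2) * localBound c κ τ θ α G χ (size s₀) s := by
  have hθ := R.θ_mem.1
  have hα0 : ∀ k, 0 < α k / 2 := fun k => by linarith [R.α_ge k]
  have hα1 : ∀ k, α k / 2 ≤ 3 / 2 := fun k => by linarith [R.α_le k]
  have hκs : (5 * c + 4) * κ ≤ ε / 2 := by nlinarith [P.κ_small, P.κ_pos, P.ε_pos]
  -- Removing the list `{k}` divides by its weight `exp (-θ - κ) * b * a k`. The hypothesis says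
  -- that the expected loss of the remaining lists outweighs this.
  have gen : ∀ (b : ℝ) (a : Color → ℝ), 0 < b → b ≤ 1 → (∀ k, 0 < a k) → (∀ k, a k ≤ 3 / 2) →
      θ - Real.log b - Real.log (a k) - c / N * cnt s₀ Finset.univ * (1 - b * (1 - lossRate θ)) +
      c / N * (cnt s₀ (Finset.univ.erase (k + 1)) * (a (k + 2) - 1) +
        cnt s₀ (Finset.univ.erase (k + 2)) * (a (k + 1) - 1)) ≤ 0 →
      step (c / N) s v k (form c θ κ b a (size s₀)) ≤
        Real.exp (ε / 2) * form c θ κ b a (size s₀) s := by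
    intro b a hb0 hb1 ha0 ha1 hle
    have h1 := P.step_form_le_exp (Y := size s₀) R.alive hs h hQ hθ hb0 hb1 ha0 ha1 hv k (r := κ)
      (x := θ + κ - Real.log b - Real.log (a k)) (by
        rw [hk, formWt_singleton]
        have : Real.exp (-(θ + κ - Real.log b - Real.log (a k))) =
            Real.exp (-θ) * Real.exp (-κ) * b * a k := by
          rw [show -(θ + κ - Real.log b - Real.log (a k)) =
            -θ + -κ + Real.log b + Real.log (a k) by ring, Real.exp_add, Real.exp_add,
            Real.exp_add, Real.exp_log hb0, Real.exp_log (ha0 k)]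
        rw [this]) (by linarith)
    have hf := form_nonneg (c := c) (κ := κ) (Y := size s₀) hθ hb0.le (fun k => (ha0 k).le) s
    refine h1.trans ?_
    have e1 : (1 - c / N) ^ ((s.left.erase v).filter fun w => s.avail w = {k}).card ≤ 1 :=
      pow_le_one₀ (sub_nonneg.2 P.p_le_one) (by linarith [P.p_nonneg])
    have e0 : 0 ≤ (1 - c / N) ^ ((s.left.erase v).filter fun w => s.avail w = {k}).card :=
      pow_nonneg (sub_nonneg.2 P.p_le_one) _
    calc _ ≤ form c θ κ b a (size s₀) s * 1 * Real.exp (κ + (5 * c + 3) * κ) := by gcongr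
      _ ≤ form c θ κ b a (size s₀) s * 1 * Real.exp (ε / 2) := by
          refine mul_le_mul_of_nonneg_left (Real.exp_le_exp.2 (by linarith)) (by linarith)
      _ = _ := by ring
  have hlog2 : ∀ k, Real.log (α k / 2) = Real.log (α k) - Real.log 2 := fun k =>
    Real.log_div (by linarith [R.α_ge k]) (by norm_num)
  have hq : χ ≠ 0 → Real.log (1 / 4) = -Real.log 4 ∧
      Real.log 4 ≤ 3 / 4 * (c / N * cnt s₀ Finset.univ * (1 - lossRate θ)) := by
    intro hne
    refine ⟨by rw [one_div, Real.log_inv], ?_⟩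
    rcases R.hχ with h | h
    · exact absurd h hne
    · exact h.2
  have g1 := gen 1 (fun k => α k / 2) one_pos le_rfl hα0 hα1 (by
    rw [hlog2, Real.log_one]; linarith [R.hα k])
  have g2 := gen 1 (fun _ => 1) one_pos le_rfl (fun _ => one_pos) (fun _ => by norm_num) (by
    simp only [Real.log_one]; linarith [R.θ_le])
  have g3 : χ * step (c / N) s v k (form c θ κ (1 / 4) (fun k => α k / 2) (size s₀)) ≤
      χ * (Real.exp (ε / 2) * form c θ κ (1 / 4) (fun k => α k / 2) (size s₀) s) := by
    by_cases hne : χ = 0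
    · simp [hne]
    · obtain ⟨q1, q2⟩ := hq hne
      exact mul_le_mul_of_nonneg_left (gen (1 / 4) (fun k => α k / 2) (by norm_num) (by norm_num)
        hα0 hα1 (by rw [hlog2, q1]; linarith [R.hα k])) R.χ_nonneg
  have g4 : χ * step (c / N) s v k (form c θ κ (1 / 4) (fun _ => 1) (size s₀)) ≤
      χ * (Real.exp (ε / 2) * form c θ κ (1 / 4) (fun _ => 1) (size s₀) s) := by
    by_cases hne : χ = 0
    · simp [hne]
    · obtain ⟨q1, q2⟩ := hq hne
      exact mul_le_mul_of_nonneg_left (gen (1 / 4) (fun _ => 1) (by norm_num) (by norm_num)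
        (fun _ => one_pos) (fun _ => by norm_num)
        (by rw [Real.log_one, q1]; linarith [R.θ_le])) R.χ_nonneg
  have e : step (c / N) s v k (localBound c κ τ θ α G χ (size s₀)) =
      G * (step (c / N) s v k (form c θ κ 1 (fun k => α k / 2) (size s₀)) +
        τ * step (c / N) s v k (form c θ κ 1 (fun _ => 1) (size s₀))) +
      (χ * step (c / N) s v k (form c θ κ (1 / 4) (fun k => α k / 2) (size s₀)) +
        τ * (χ * step (c / N) s v k (form c θ κ (1 / 4) (fun _ => 1) (size s₀)))) := by
    rw [← step_const_mul _ _ _ _ τ, ← step_const_mul _ _ _ _ χ, ← step_const_mul _ _ _ _ χ,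
      ← step_const_mul _ _ _ _ τ, ← step_add, ← step_add, ← step_const_mul, ← step_add]
    refine step_congr fun A _ => ?_
    unfold localBound
    ring
  rw [e]
  have hτ := P.τ_pos.le
  have i1 := mul_le_mul_of_nonneg_left (add_le_add g1 (mul_le_mul_of_nonneg_left g2 hτ))
    (zero_le_one.trans R.G_ge)
  have i2 := add_le_add g3 (mul_le_mul_of_nonneg_left g4 hτ)
  refine (add_le_add i1 i2).trans (le_of_eq ?_)
  unfold localBound
  ring

theorem mem_shortest_iff {s : Residual N} {v : Fin N} : v ∈ s.shortest ↔
    v ∈ s.left ∧ ∀ w ∈ s.left, (s.avail v).card ≤ (s.avail w).card := Finset.mem_filter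

theorem cnt_ne_zero {s : Residual N} {M : Finset Color} (h : cnt s M ≠ 0) :
    ∃ w ∈ s.left, s.avail w = M := by
  obtain ⟨w, hw⟩ := Finset.card_ne_zero.1 h
  exact ⟨w, (Finset.mem_filter.1 hw).1, (Finset.mem_filter.1 hw).2⟩

theorem avail_of_mem_shortest {s : Residual N} (hs : ¬ s.Contradiction)
    (hu : ¬ ∀ k, cnt s {k} = 0) {v : Fin N} (hv : v ∈ s.shortest) : ∃ k, s.avail v = {k} := by
  push Not at hu
  obtain ⟨k, hk⟩ := hu
  obtain ⟨w, hw, e⟩ := cnt_ne_zero hk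
  obtain ⟨h1, h2⟩ := mem_shortest_iff.1 hv
  have h3 := h2 w hw
  rw [e, Finset.card_singleton] at h3
  exact Finset.card_eq_one.1 (le_antisymm h3 (card_avail_pos hs h1))

theorem decisionAbove_of_unit {s : Residual N} (hu : ¬ ∀ k, cnt s {k} = 0) :
    decisionAbove L s = 0 := by
  push Not at hu
  obtain ⟨k, hk⟩ := hu
  obtain ⟨w, hw, e⟩ := cnt_ne_zero hk
  refine if_neg fun hh => ?_
  have := hh.2 w hw
  rw [e] at this
  simp at this

/-- A level provides the factor `exp ε`, of which the step uses `exp (ε / 2)`; the rest absorbs an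
additive error. -/
theorem exp_growth {ε : ℝ} (h0 : 0 ≤ ε) (l : ℕ) (hl : 1 ≤ l) :
    Real.exp (ε * ((l - 1 : ℕ) : ℝ)) * Real.exp (ε / 2) + ε / 8 ≤ Real.exp (ε * l) := by
  have e1 : Real.exp (ε * l) = Real.exp (ε * ((l - 1 : ℕ) : ℝ)) * Real.exp ε := by
    rw [← Real.exp_add, Nat.cast_sub hl]
    ring_nf
  have e2 : Real.exp ε = Real.exp (ε / 2) * Real.exp (ε / 2) := by
    rw [← Real.exp_add]; ring_nf
  have e3 := Real.add_one_le_exp (ε / 2)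
  have e4 : 1 ≤ Real.exp (ε * ((l - 1 : ℕ) : ℝ)) := Real.one_le_exp (by positivity)
  have e5 : ε / 8 ≤ Real.exp ε - Real.exp (ε / 2) := by rw [e2]; nlinarith
  rw [e1]
  nlinarith

theorem left_card_hit {s : Residual N} {v : Fin N} (hv : v ∈ s.left) (k : Color)
    (A : Finset (Fin N)) : (s.hit v k A).left.card = s.left.card - 1 :=
  Finset.card_erase_of_mem hv

theorem mean_decisionAbove_le_four_pow {p : ℝ} (h0 : 0 ≤ p) (h1 : p ≤ 1) (s : Residual N) :
    mean p (decisionAbove L) s ≤ 4 ^ N := by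
  refine (mean_le_four_pow h0 h1 (decisionAbove_le_one L) s).trans ?_
  exact pow_le_pow_right₀ (by norm_num) (by simpa using Finset.card_le_univ s.left)

/-- The bound for the instances that arise in a phase of unit propagation. -/
theorem Reference.mean_le (R : Reference c η s₀ θ α G χ) (P : UpperParams c ε κ η κ₁ τ N L m)
    (hIH : ∀ s : Residual N, s.left.card < s₀.left.card → UnitBound c ε L s) (s : Residual N)
    (h : Below s₀ s) (hl : s.left.card < s₀.left.card)
    (hQ : (size s₀ : ℝ) - size s ≤ 2 * η * N) :
    mean (c / N) (decisionAbove L) s ≤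
      Real.exp (ε * s.left.card) * localBound c κ τ θ α G χ (size s₀) s := by
  induction hn : s.left.card using Nat.strong_induction_on generalizing s with
  | _ n ih =>
    by_cases hs : s.Contradiction
    · rw [mean_of_contradiction hs, decisionAbove_of_contradiction hs]
      exact mul_nonneg (Real.exp_pos _).le (localBound_nonneg R P h)
    -- The phase is over when no unit list is left, and it is cut off when the length `η * N` has
    -- been lost. In both cases the general bound for smaller instances takes over.
    by_cases hend : (∀ k, cnt s {k} = 0) ∨ η * N ≤ (size s₀ : ℝ) - size s
    · rw [← hn]
      exact (hIH s hl).le_localBound R P hs h hQ hend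
    push Not at hend
    obtain ⟨hu, hQ'⟩ := hend
    have hu' : ¬ ∀ k, cnt s {k} = 0 := fun hh => by
      obtain ⟨k, hk⟩ := hu
      exact hk (hh k)
    have hΦ := localBound_nonneg R P h
    have hε := P.ε_pos
    rw [mean_of_alive hs, decisionAbove_of_unit hu', zero_add]
    refine average_le (mul_nonneg (Real.exp_pos _).le hΦ) fun v hv => ?_
    obtain ⟨k, hk⟩ := avail_of_mem_shortest hs hu' hv
    have hvl := s.shortest_subset hv
    rw [hk, Finset.sum_singleton]
    have hn1 : 1 ≤ n := by rw [← hn]; exact Finset.card_pos.2 ⟨v, hvl⟩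
    have hst : step (c / N) s v k (mean (c / N) (decisionAbove L)) ≤
        step (c / N) s v k (fun s' => Real.exp (ε * ((n - 1 : ℕ) : ℝ)) *
          localBound c κ τ θ α G χ (size s₀) s') + 2 ^ N * (c / N) ^ m * 4 ^ N := by
      refine step_le_add_tail P.p_nonneg P.p_le_one (by positivity) m (fun A _ hA => ?_)
        fun A _ => ?_
      -- Before the cut the loss is below `η * N`, and a step with at most `m` hits loses at most `m
      -- + 3 ≤ η * N` more; hence the range `2 * η * N`.
      · have hcl := left_card_hit hvl k A
        rw [hn] at hcl
        have hsz := size_hit_ge s hvl k A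
        have hAm : (A.card : ℝ) ≤ m := by exact_mod_cast hA
        have := ih (n - 1) (by omega) (s.hit v k A) (h.hit v k A) (by omega)
          (by linarith [P.hm]) hcl
        exact this
      · refine (mean_decisionAbove_le_four_pow P.p_nonneg P.p_le_one _).trans ?_
        exact le_add_of_nonneg_left (mul_nonneg (Real.exp_pos _).le
          (localBound_nonneg R P (h.hit v k A)))
    refine hst.trans ?_
    rw [step_const_mul]
    have h1 := R.step_localBound_unit P hs h hQ'.le hvl hk
    have h2 := mul_le_mul_of_nonneg_left h1 (Real.exp_pos (ε * ((n - 1 : ℕ) : ℝ))).le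
    have h3 := (P.tail).trans (mul_le_mul_of_nonneg_left (localBound_ge R P hs h)
      (by linarith : 0 ≤ ε / 8))
    have h4 := mul_le_mul_of_nonneg_right (exp_growth hε.le n hn1) hΦ
    linarith

end Dpll

/-! ### Existence of references; instances that contain unit lists. -/

namespace Dpll

variable {N : ℕ}
variable {c ε κ η κ₁ τ : ℝ} {L m : ℕ} {s₀ : Residual N} {θ : ℝ} {α : Color → ℝ} {G χ : ℝ}

/-- One inequality for all linearized potentials in use. For `b = 1 / 4` the term `log 4` is paid by
the full lists that become short, as recorded in `hχ`. -/
theorem Reference.drift_le (R : Reference c η s₀ θ α G χ) {b : ℝ} (hb : b = 1 ∨ b = 1 / 4 ∧ χ ≠ 0)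
    {a : Color → ℝ} (ha : (a = fun k => α k / 2) ∨ a = fun _ => 1) (k : Color) :
    θ - Real.log b - Real.log (a k) - c / N * cnt s₀ Finset.univ * (1 - b * (1 - lossRate θ)) +
      c / N * (cnt s₀ (Finset.univ.erase (k + 1)) * (a (k + 2) - 1) +
        cnt s₀ (Finset.univ.erase (k + 2)) * (a (k + 1) - 1)) ≤ 0 := by
  have hlog2 : Real.log (α k / 2) = Real.log (α k) - Real.log 2 :=
    Real.log_div (by linarith [R.α_ge k]) (by norm_num)
  have hb' : -Real.log b - c / N * cnt s₀ Finset.univ * (1 - b * (1 - lossRate θ)) ≤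
      -(c / N * cnt s₀ Finset.univ * lossRate θ) := by
    rcases hb with rfl | ⟨rfl, hne⟩
    · rw [Real.log_one]; linarith
    · have h2 := (R.hχ.resolve_left hne).2
      rw [one_div, Real.log_inv]
      linarith
  rcases ha with rfl | rfl
  · simp only [hlog2]
    linarith [R.hα k]
  · simp only [Real.log_one]
    linarith [R.θ_le]

/-- The instances with many vertices are reference instances. -/
theorem exists_reference (P : UpperParams c ε κ η κ₁ τ N L m) {s : Residual N}
    (hs : ¬ s.Contradiction) (hl : L ≤ s.left.card) :
    ∃ θ G χ, Real.log 2 + θ - c / N * cnt s Finset.univ * lossRate θ ≤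
        min (c / N * shortCnt s) (3 * Real.log 2) / 3 ∧
      G + χ * (1 / 4) ^ shortCnt s ≤ (1 + ε / 8) * shortFactor s ∧
      (c / N * shortCnt s ≤ 3 → G = 1 ∧ χ = 1) ∧
      ∀ α : Color → ℝ, (∀ k, 1 / 2 ≤ α k) → (∀ k, α k ≤ 3) →
        (∀ k, Real.log 2 + θ - c / N * cnt s Finset.univ * lossRate θ +
          c / N * (cnt s (Finset.univ.erase (k + 1)) * (α (k + 2) / 2 - 1) +
            cnt s (Finset.univ.erase (k + 2)) * (α (k + 1) / 2 - 1)) ≤ Real.log (α k)) →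
        Reference c η s θ α G χ := by
  have hp := P.p_nonneg
  have hε := P.ε_pos
  have hκ := P.κ_pos
  have hcard := card_left_eq hs
  have hDB : 59 / 10 ≤ c / N * shortCnt s + c / N * cnt s Finset.univ := by
    rw [← mul_add]
    have : (shortCnt s : ℝ) + cnt s Finset.univ = s.left.card := by
      rw [hcard]
    rw [this]
    exact P.hL.trans (mul_le_mul_of_nonneg_left (by exact_mod_cast hl) hp)
  obtain ⟨θ, hθ, hE, hmax⟩ := exists_max_rate (by positivity) (by positivity) hDB
  have hsf := one_le_shortFactor s
  have hθle : θ ≤ c / N * cnt s Finset.univ * lossRate θ := by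
    have : min (c / N * shortCnt s) (3 * Real.log 2) / 3 ≤ Real.log 2 := by
      have := min_le_right (c / N * shortCnt s) (3 * Real.log 2)
      linarith
    linarith
  -- If the density of short lists is at most `3`, full lists have density at least `29 / 10` and `3
  -- / 4 * (29 / 10) * (2 / 3) > log 4`, so `b = 1 / 4` is affordable. Otherwise at least `N / c`
  -- short lists persist in the whole neighbourhood, and `shortFactor` is at most `1 + ε / 8`.
  by_cases hD : c / N * shortCnt s ≤ 3
  · refine ⟨θ, 1, 1, hE, ?_, fun _ => ⟨rfl, rfl⟩, fun α h1 h2 h3 =>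
      ⟨hs, hθ, hmax, hθle, h1, h2, h3, le_rfl, Or.inr ⟨rfl, ?_⟩, fun s' _ _ => ?_⟩⟩
    · rw [one_mul]
      change shortFactor s ≤ _
      exact le_mul_of_one_le_left (by linarith) (by linarith)
    · have h4 : (29 / 10 : ℝ) * (2 / 3) ≤ c / N * cnt s Finset.univ * (1 - lossRate θ) :=
        mul_le_mul (by linarith) (by linarith [lossRate_le_third hθ.1]) (by norm_num) (by positivity)
      rw [log_four]
      linarith [Real.log_two_lt_d9]
    · rw [one_mul]; exact le_rfl
  · refine ⟨θ, 1 + ε / 8, 0, hE, ?_, fun h => absurd h hD, fun α h1 h2 h3 =>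
      ⟨hs, hθ, hmax, hθle, h1, h2, h3, by linarith, Or.inl rfl, fun s' hb hQ => ?_⟩⟩
    · rw [zero_mul, add_zero]
      exact le_mul_of_one_le_right (by linarith) hsf
    · have h4 := (abs_le.1 (abs_shortCnt_sub_le hs hb)).2
      have h5 : c / N * (shortCnt s - shortCnt s') ≤ c / N * (2 * η * N) :=
        mul_le_mul_of_nonneg_left (h4.trans hQ) hp
      have h6 : c / N * (2 * η * N) = 2 * (c * η) := by
        rw [show c / N * (2 * η * N) = 2 * (c / N * N * η) by ring, P.p_mul]
      have h7 := P.η_le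
      have h8 := P.κ_le
      have h9 : 1 ≤ c / N * shortCnt s' := by
        push Not at hD
        rw [mul_sub] at h5
        linarith
      have h10 : N / c ≤ (shortCnt s' : ℝ) := by
        have hN : (0 : ℝ) < N := by exact_mod_cast P.N_pos
        have hc := P.c_pos
        rw [div_le_iff₀ hc]
        rw [div_mul_eq_mul_div, le_div_iff₀ hN] at h9
        linarith
      unfold shortFactor
      linarith [P.quarter _ h10]

theorem one_le_of_pot_le {K : ℝ} {s : Residual N} (hs : ¬ s.Contradiction)
    (hK : ∀ θ ∈ Set.Icc (0 : ℝ) (3 / 10), pot c θ s ≤ K) : 1 ≤ K := by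
  rw [← pot_zero (c := c) hs]
  exact hK 0 ⟨le_rfl, by norm_num⟩

theorem cnt_hit_of_ne {s : Residual N} {v : Fin N} {k j : Color} (hv : s.avail v = {k})
    (hj : j ≠ k) (A : Finset (Fin N)) : cnt s {j} ≤ cnt (s.hit v k A) {j} := by
  refine Finset.card_le_card fun w hw => ?_
  obtain ⟨h1, h2⟩ := Finset.mem_filter.1 hw
  refine Finset.mem_filter.2 ⟨Finset.mem_erase.2 ⟨?_, h1⟩, ?_⟩
  · rintro rfl
    rw [hv] at h2
    exact hj (Finset.singleton_injective h2).symm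
  · simp only [Residual.hit]
    rw [h2, Finset.erase_eq_of_notMem (by simpa using hj.symm), ite_self]

theorem cnt_hit_same {s : Residual N} {v : Fin N} {k : Color} (A : Finset (Fin N))
    (hs : ¬ (s.hit v k A).Contradiction) : 
    ((s.left.erase v).filter fun w => s.avail w = {k}).card ≤ cnt (s.hit v k A) {k} := by
  refine Finset.card_le_card fun w hw => ?_
  obtain ⟨h1, h2⟩ := Finset.mem_filter.1 hw
  refine Finset.mem_filter.2 ⟨h1, ?_⟩
  by_contra h3
  apply hs
  refine ⟨w, h1, ?_⟩
  simp only [Residual.hit] at h3 ⊢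
  split_ifs at h3 ⊢ with h4
  · rw [h2]; simp
  · exact absurd h2 h3

theorem card_filter_erase {s : Residual N} {v : Fin N} {k : Color} (hvl : v ∈ s.left)
    (hv : s.avail v = {k}) :
    ((s.left.erase v).filter fun w => s.avail w = {k}).card + 1 = cnt s {k} := by
  have : (s.left.erase v).filter (fun w => s.avail w = {k}) =
      (s.left.filter fun w => s.avail w = {k}).erase v := Finset.filter_erase _ _ _
  rw [this, Finset.card_erase_of_mem (Finset.mem_filter.2 ⟨hvl, hv⟩)]
  have : 0 < cnt s {k} := Finset.card_pos.2 ⟨v, Finset.mem_filter.2 ⟨hvl, hv⟩⟩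
  unfold cnt at *
  omega

/-- The factor `unitFactor` decreases by a power of `1 - p` when a vertex with a unit list is
removed. -/
theorem exists_unitFactor_split {p : ℝ} (h0 : 0 ≤ p) (h1 : p ≤ 1) {s : Residual N} {v : Fin N}
    {k : Color} (hvl : v ∈ s.left) (hv : s.avail v = {k}) : ∃ U : ℝ, 0 ≤ U ∧
      U * (1 - p) ^ ((s.left.erase v).filter fun w => s.avail w = {k}).card = unitFactor p s ∧
      ∀ A, ¬ (s.hit v k A).Contradiction → unitFactor p (s.hit v k A) ≤ U := by
  classical
  have hq0 : 0 ≤ 1 - p := sub_nonneg.2 h1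
  have hq1 : 1 - p ≤ 1 := by linarith
  set e := ((s.left.erase v).filter fun w => s.avail w = {k}).card with he
  have hcard := card_filter_erase hvl hv
  rw [← he] at hcard
  refine ⟨(1 - p) ^ e.choose 2 * ∏ j ∈ Finset.univ.erase k, (1 - p) ^ (cnt s {j}).choose 2,
    mul_nonneg (pow_nonneg hq0 _) (Finset.prod_nonneg fun _ _ => pow_nonneg hq0 _), ?_, ?_⟩
  · rw [unitFactor, ← Finset.mul_prod_erase Finset.univ _ (Finset.mem_univ k), ← hcard,
      show (e + 1).choose 2 = e.choose 2 + e by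
        rw [Nat.choose_succ_succ' e 1, Nat.choose_one_right, add_comm], pow_add]
    ring
  · intro A hA
    rw [unitFactor, ← Finset.mul_prod_erase Finset.univ _ (Finset.mem_univ k)]
    refine mul_le_mul ?_ ?_ (Finset.prod_nonneg fun _ _ => pow_nonneg hq0 _) (pow_nonneg hq0 _)
    · exact pow_le_pow_of_le_one hq0 hq1 (Nat.choose_le_choose 2 (cnt_hit_same A hA))
    · refine Finset.prod_le_prod (fun _ _ => pow_nonneg hq0 _) fun j hj => ?_
      exact pow_le_pow_of_le_one hq0 hq1 (Nat.choose_le_choose 2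
        (cnt_hit_of_ne hv (Finset.ne_of_mem_erase hj) A))

/-- A floor for `unitFactor`, against which the probability of too many hits is still negligible. -/
theorem pow_le_unitFactor {p : ℝ} (h0 : 0 ≤ p) (h1 : p ≤ 1) (s : Residual N) :
    (1 - p) ^ (N * N) ≤ unitFactor p s := by
  have hq0 : 0 ≤ 1 - p := sub_nonneg.2 h1
  have hq1 : 1 - p ≤ 1 := by linarith
  rw [unitFactor, Finset.prod_pow_eq_pow_sum]
  refine pow_le_pow_of_le_one hq0 hq1 ?_
  have h3 : ∀ k : Color, (cnt s {k}).choose 2 ≤ N * cnt s {k} := fun k => by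
    rw [Nat.choose_two_right]
    refine (Nat.div_le_self _ _).trans ?_
    rw [mul_comm]
    exact Nat.mul_le_mul_right _ ((Nat.sub_le _ _).trans (by exact_mod_cast cnt_le_card s {k}))
  have h4 : ∑ k : Color, cnt s {k} ≤ N := by
    have : ∑ k : Color, cnt s {k} ≤ s.left.card := by
      unfold cnt
      rw [← Finset.card_biUnion]
      · exact Finset.card_le_card (Finset.biUnion_subset.2 fun _ _ => Finset.filter_subset _ _)
      · intro i _ j _ hij
        refine Finset.disjoint_filter.2 fun w _ h1 h2 => hij ?_
        exact Finset.singleton_injective (h1.symm.trans h2)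
    exact this.trans (by simpa using Finset.card_le_univ s.left)
  calc ∑ k : Color, (cnt s {k}).choose 2 ≤ ∑ k : Color, N * cnt s {k} :=
        Finset.sum_le_sum fun k _ => h3 k
    _ = N * ∑ k : Color, cnt s {k} := by rw [Finset.mul_sum]
    _ ≤ _ := Nat.mul_le_mul_left _ h4

/-- The bound for the instances with unit lists. -/
theorem unitBound_of_unit (P : UpperParams c ε κ η κ₁ τ N L m) {s : Residual N}
    (hs : ¬ s.Contradiction) (hl : L ≤ s.left.card) (hu : ¬ ∀ k, cnt s {k} = 0)
    (hIH : ∀ s' : Residual N, s'.left.card < s.left.card → UnitBound c ε L s') :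
    UnitBound c ε L s := by
  intro K hK
  have hε := P.ε_pos
  have hp := P.p_nonneg
  have hκ := P.κ_pos
  have hK1 := one_le_of_pot_le hs hK
  have hsf := one_le_shortFactor s
  have hU0 := unitFactor_nonneg P.p_le_one s
  obtain ⟨θ, G, χ, hE, hGle, -, hR⟩ := exists_reference P hs hl
  -- All unit lists weigh `1` here: a unit list has a single branch, so no colour weights are
  -- needed, and the condition reduces to `log 2 + θ - B * lossRate θ ≤ log 2` with `B` the density
  -- of full lists.
  have R : Reference c η s θ (fun _ => 2) G χ := hR _ (fun _ => by norm_num) (fun _ => by norm_num)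
    fun k => by
      have := min_le_right (c / N * shortCnt s) (3 * Real.log 2)
      linarith
  rw [mean_of_alive hs, decisionAbove_of_unit hu, zero_add]
  refine average_le (by positivity) fun v hv => ?_
  obtain ⟨k, hk⟩ := avail_of_mem_shortest hs hu hv
  have hvl := s.shortest_subset hv
  rw [hk, Finset.sum_singleton]
  obtain ⟨U, hU, hUs, hUA⟩ := exists_unitFactor_split hp P.p_le_one hvl hk
  set n := s.left.card with hn
  have hn1 : 1 ≤ n := Finset.card_pos.2 ⟨v, hvl⟩
  set f1 := form (N := N) c θ κ 1 (fun _ => 1) (size s) with hf1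
  set f2 := form (N := N) c θ κ (1 / 4) (fun _ => 1) (size s) with hf2
  have f10 : ∀ s', 0 ≤ f1 s' := fun s' =>
    form_nonneg R.θ_mem.1 (by norm_num) (fun _ => zero_le_one) s'
  have f20 : ∀ s', 0 ≤ f2 s' := fun s' =>
    form_nonneg R.θ_mem.1 (by norm_num) (fun _ => zero_le_one) s'
  -- The induction hypothesis is applied to the children themselves and not through `localBound`,
  -- because `unitFactor` has to be preserved: it is at most `U` at a child, and the power of `1 -
  -- p` from the step completes `U` to `unitFactor` at `s`.
  have hst : step (c / N) s v k (mean (c / N) (decisionAbove L)) ≤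
      step (c / N) s v k (fun s' => Real.exp (ε * ((n - 1 : ℕ) : ℝ)) * U *
        (G * f1 s' + χ * f2 s')) + 2 ^ N * (c / N) ^ m * 4 ^ N := by
    refine step_le_add_tail hp P.p_le_one (by positivity) m (fun A _ hA => ?_) fun A _ => ?_
    · by_cases hd : (s.hit v k A).Contradiction
      · rw [mean_of_contradiction hd, decisionAbove_of_contradiction hd, hf1, hf2,
          form_eq_zero hd, form_eq_zero hd]
        simp
      have hcl := left_card_hit hvl k A
      rw [← hn] at hcl
      have hsz := size_hit_ge s hvl k A
      have hAm : (A.card : ℝ) ≤ m := by exact_mod_cast hA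
      have hb := (Below.refl s).hit v k A
      have hηN : 0 ≤ η * N := mul_nonneg P.η_pos.le (Nat.cast_nonneg _)
      have hQ : (size s : ℝ) - size (s.hit v k A) ≤ 2 * η * N := by linarith [P.hm]
      have hQ0 : 0 ≤ (size s : ℝ) - size (s.hit v k A) := by linarith [size_le hb]
      have h1 := hIH (s.hit v k A) (by omega) _ fun θ' hθ' => R.pot_le P hb hQ hθ'
      rw [hcl] at h1
      refine h1.trans ?_
      have h2 := R.hG _ hb hQ
      have h3 := hUA A hd
      have hp0 := pot_nonneg (c := c) R.θ_mem.1 (s.hit v k A)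
      have h4 : G * f1 (s.hit v k A) + χ * f2 (s.hit v k A) =
          (G + χ * (1 / 4) ^ shortCnt (s.hit v k A)) *
          (pot c θ (s.hit v k A) * Real.exp (κ * ((size s : ℝ) - size (s.hit v k A)))) := by
        rw [hf1, hf2, form_eq _ _ _ _ _ _ hd, form_eq _ _ _ _ _ _ hd]
        simp only [one_pow, mul_one, Finset.prod_const_one]
        ring
      rw [h4]
      have h5 : Real.exp (κ / 2 * ((size s : ℝ) - size (s.hit v k A))) ≤
          Real.exp (κ * ((size s : ℝ) - size (s.hit v k A))) :=
        Real.exp_le_exp.2 (by nlinarith)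
      have hsf' := one_le_shortFactor (s.hit v k A)
      calc _ ≤ Real.exp (ε * ((n - 1 : ℕ) : ℝ)) * (G + χ * (1 / 4) ^ shortCnt (s.hit v k A)) *
            (pot c θ (s.hit v k A) * Real.exp (κ * ((size s : ℝ) - size (s.hit v k A)))) * U := by
            have := unitFactor_nonneg P.p_le_one (s.hit v k A)
            have h0 : 0 ≤ G + χ * (1 / 4) ^ shortCnt (s.hit v k A) := by linarith
            gcongr
        _ = _ := by ring
    · refine (mean_decisionAbove_le_four_pow hp P.p_le_one _).trans ?_
      refine le_add_of_nonneg_left (mul_nonneg (mul_nonneg (Real.exp_pos _).le hU) ?_)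
      exact add_nonneg (mul_nonneg (zero_le_one.trans R.G_ge) (f10 _))
        (mul_nonneg R.χ_nonneg (f20 _))
  refine hst.trans ?_
  set q := (1 - c / N) ^ ((s.left.erase v).filter fun w => s.avail w = {k}).card with hq
  have hq0 : 0 ≤ q := pow_nonneg (sub_nonneg.2 P.p_le_one) _
  have hstep : ∀ b : ℝ, b = 1 ∨ b = 1 / 4 ∧ χ ≠ 0 →
      step (c / N) s v k (form c θ κ b (fun _ => 1) (size s)) ≤
      pot c θ s * b ^ shortCnt s * q * Real.exp (ε / 8) := by
    intro b hb
    have hb0 : 0 < b := by rcases hb with rfl | ⟨rfl, -⟩ <;> norm_num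
    have hb1 : b ≤ 1 := by rcases hb with rfl | ⟨rfl, -⟩ <;> norm_num
    have hdr := R.drift_le hb (Or.inr rfl) k
    have h1 := P.step_form_le_exp (Y := size s) hs hs (Below.refl s)
      (by rw [sub_self]; exact mul_nonneg P.η_pos.le (Nat.cast_nonneg _)) R.θ_mem.1 hb0 hb1
      (a := fun _ => 1) (fun _ => one_pos) (fun _ => by norm_num) hvl k (r := κ)
      (x := θ + κ - Real.log b) (by
        rw [hk, formWt_singleton]
        have : Real.exp (-(θ + κ - Real.log b)) = Real.exp (-θ) * Real.exp (-κ) * b * 1 := by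
          rw [show -(θ + κ - Real.log b) = -θ + -κ + Real.log b by ring, Real.exp_add,
            Real.exp_add, Real.exp_log hb0, mul_one]
        rw [this]) (by rw [Real.log_one] at hdr; linarith)
    refine h1.trans ?_
    rw [form_eq _ _ _ _ _ _ hs]
    simp only [one_pow, mul_one, Finset.prod_const_one, sub_self, mul_zero, Real.exp_zero]
    rw [← hq]
    refine mul_le_mul_of_nonneg_left (Real.exp_le_exp.2 ?_)
      (mul_nonneg (mul_nonneg (pot_nonneg R.θ_mem.1 s) (pow_nonneg hb0.le _)) hq0)
    linarith [P.κ_small]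
  have hs1 := hstep 1 (Or.inl rfl)
  have hs2 : χ * step (c / N) s v k f2 ≤
      χ * (pot c θ s * (1 / 4) ^ shortCnt s * q * Real.exp (ε / 8)) := by
    by_cases hne : χ = 0
    · rw [hne, zero_mul, zero_mul]
    · exact mul_le_mul_of_nonneg_left (hstep (1 / 4) (Or.inr ⟨rfl, hne⟩)) R.χ_nonneg
  have hpK := hK θ R.θ_mem
  have hp0 := pot_nonneg (c := c) R.θ_mem.1 s
  have htail := P.tail'.trans (mul_le_mul_of_nonneg_left (pow_le_unitFactor hp P.p_le_one s)
    (by linarith : 0 ≤ ε / 8))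
  have htail2 : 2 ^ N * (c / N) ^ m * 4 ^ N ≤ ε / 8 * (shortFactor s * K * unitFactor (c / N) s) := by
    refine htail.trans (mul_le_mul_of_nonneg_left ?_ (by linarith))
    refine le_mul_of_one_le_left hU0 ?_
    exact one_le_mul_of_one_le_of_one_le hsf hK1
  rw [step_const_mul]
  have e1 : step (c / N) s v k (fun s' => G * f1 s' + χ * f2 s') ≤
      (1 + ε / 8) * shortFactor s * (K * q * Real.exp (ε / 8)) := by
    rw [step_add, step_const_mul, step_const_mul]
    rw [one_pow, mul_one] at hs1
    have := mul_le_mul_of_nonneg_left hs1 (zero_le_one.trans R.G_ge)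
    calc _ ≤ G * (pot c θ s * q * Real.exp (ε / 8)) +
          χ * (pot c θ s * (1 / 4) ^ shortCnt s * q * Real.exp (ε / 8)) := add_le_add this hs2
      _ = (G + χ * (1 / 4) ^ shortCnt s) * (pot c θ s * q * Real.exp (ε / 8)) := by ring
      _ ≤ _ := by gcongr
  have e2 : Real.exp (ε * ((n - 1 : ℕ) : ℝ)) * U *
      step (c / N) s v k (fun s' => G * f1 s' + χ * f2 s') ≤
      Real.exp (ε * ((n - 1 : ℕ) : ℝ)) * Real.exp (ε / 2) *
        (shortFactor s * K * unitFactor (c / N) s) := by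
    calc _ ≤ Real.exp (ε * ((n - 1 : ℕ) : ℝ)) * U *
          ((1 + ε / 8) * shortFactor s * (K * q * Real.exp (ε / 8))) :=
          mul_le_mul_of_nonneg_left e1 (mul_nonneg (Real.exp_pos _).le hU)
      _ = Real.exp (ε * ((n - 1 : ℕ) : ℝ)) * ((1 + ε / 8) * Real.exp (ε / 8)) *
          (shortFactor s * K * (U * q)) := by ring
      _ ≤ _ := by
          rw [hUs]
          gcongr
          calc (1 + ε / 8) * Real.exp (ε / 8) ≤ Real.exp (ε / 8) * Real.exp (ε / 8) := by
                gcongr; linarith [Real.add_one_le_exp (ε / 8)]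
            _ ≤ Real.exp (ε / 2) := by rw [← Real.exp_add]; exact Real.exp_le_exp.2 (by linarith)
  have h4 := mul_le_mul_of_nonneg_right (exp_growth hε.le n hn1)
    (by positivity : 0 ≤ shortFactor s * K * unitFactor (c / N) s)
  linarith

end Dpll

/-! ### Steps that branch at a vertex with two colours. -/

namespace Dpll

variable {N : ℕ}
variable {c ε κ η κ₁ τ : ℝ} {L m : ℕ} {s₀ : Residual N} {θ : ℝ} {α : Color → ℝ} {G χ : ℝ}

/-- A step from a reference instance without unit lists. -/
theorem Reference.step_mean_le (R : Reference c η s₀ θ α G χ) (P : UpperParams c ε κ η κ₁ τ N L m)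
    (hIH : ∀ s : Residual N, s.left.card < s₀.left.card → UnitBound c ε L s)
    {K : ℝ} (hK : 1 ≤ K) {v : Fin N} (hv : v ∈ s₀.left) (k : Color) {S : ℝ}
    (h : step (c / N) s₀ v k (localBound c κ τ θ α G χ (size s₀)) ≤ S) :
    step (c / N) s₀ v k (mean (c / N) (decisionAbove L)) ≤
      Real.exp (ε * ((s₀.left.card - 1 : ℕ) : ℝ)) * (S + ε / 8 * K) := by
  have hε := P.ε_pos
  have hp := P.p_nonneg
  have hst : step (c / N) s₀ v k (mean (c / N) (decisionAbove L)) ≤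
      step (c / N) s₀ v k (fun s' => Real.exp (ε * ((s₀.left.card - 1 : ℕ) : ℝ)) *
        localBound c κ τ θ α G χ (size s₀) s') + 2 ^ N * (c / N) ^ m * 4 ^ N := by
    refine step_le_add_tail hp P.p_le_one (by positivity) m (fun A _ hA => ?_) fun A _ => ?_
    · have hcl := left_card_hit hv k A
      have hsz := size_hit_ge s₀ hv k A
      have hAm : (A.card : ℝ) ≤ m := by exact_mod_cast hA
      have hηN : 0 ≤ η * N := mul_nonneg P.η_pos.le (Nat.cast_nonneg _)
      have hpos : 0 < s₀.left.card := Finset.card_pos.2 ⟨v, hv⟩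
      have := R.mean_le P hIH (s₀.hit v k A) ((Below.refl s₀).hit v k A) (by omega)
        (by linarith [P.hm])
      rwa [hcl] at this
    · refine (mean_decisionAbove_le_four_pow hp P.p_le_one _).trans ?_
      exact le_add_of_nonneg_left (mul_nonneg (Real.exp_pos _).le
        (localBound_nonneg R P ((Below.refl s₀).hit v k A)))
  refine hst.trans ?_
  rw [step_const_mul, mul_add]
  have h1 := mul_le_mul_of_nonneg_left h (Real.exp_pos (ε * ((s₀.left.card - 1 : ℕ) : ℝ))).le
  have h2 : (1 - c / N) ^ (N * N) ≤ 1 :=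
    pow_le_one₀ (sub_nonneg.2 P.p_le_one) (by linarith)
  have h3 := P.tail'.trans (mul_le_mul_of_nonneg_left h2 (by linarith : 0 ≤ ε / 8))
  have h4 : 1 ≤ Real.exp (ε * ((s₀.left.card - 1 : ℕ) : ℝ)) := Real.one_le_exp (by positivity)
  have h5 : ε / 8 * 1 ≤ Real.exp (ε * ((s₀.left.card - 1 : ℕ) : ℝ)) * (ε / 8 * K) := by
    refine (mul_le_mul_of_nonneg_left hK (by linarith)).trans ?_
    exact le_mul_of_one_le_left (by positivity) h4
  linarith

/-- The step of the upper function in which a list with weight `exp (-θ)` is removed. -/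
theorem Reference.step_localBound_le (R : Reference c η s₀ θ α G χ)
    (P : UpperParams c ε κ η κ₁ τ N L m) (hu : ∀ k, cnt s₀ {k} = 0) {v : Fin N}
    (hv : v ∈ s₀.left) (k : Color) {j : Color} (hj : s₀.avail v = Finset.univ.erase j) :
    step (c / N) s₀ v k (localBound c κ τ θ α G χ (size s₀)) ≤
      (G + χ * (1 / 4) ^ shortCnt s₀) * pot c θ s₀ * Real.exp (ε / 8) * (α k / 2 + τ) := by
  have hα0 : ∀ k, 0 < α k / 2 := fun k => by linarith [R.α_ge k]
  have hα1 : ∀ k, α k / 2 ≤ 3 / 2 := fun k => by linarith [R.α_le k]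
  have hp0 := pot_nonneg (c := c) R.θ_mem.1 s₀
  have gen : ∀ b : ℝ, b = 1 ∨ b = 1 / 4 ∧ χ ≠ 0 → ∀ a : Color → ℝ,
      ((a = fun k => α k / 2) ∨ a = fun _ => 1) →
      step (c / N) s₀ v k (form c θ κ b a (size s₀)) ≤
        b ^ shortCnt s₀ * pot c θ s₀ * Real.exp (ε / 8) * a k := by
    intro b hb a ha
    have hb0 : 0 < b := by rcases hb with rfl | ⟨rfl, -⟩ <;> norm_num
    have hb1 : b ≤ 1 := by rcases hb with rfl | ⟨rfl, -⟩ <;> norm_num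
    have ha0 : ∀ k, 0 < a k := by
      rcases ha with rfl | rfl
      · exact hα0
      · exact fun _ => one_pos
    have ha1 : ∀ k, a k ≤ 3 / 2 := by
      rcases ha with rfl | rfl
      · exact hα1
      · exact fun _ => by norm_num
    have hdr := R.drift_le hb ha k
    have h1 := P.step_form_le_exp (Y := size s₀) R.alive R.alive (Below.refl s₀)
      (by rw [sub_self]; exact mul_nonneg P.η_pos.le (Nat.cast_nonneg _)) R.θ_mem.1 hb0 hb1
      ha0 ha1 hv k (r := 2 * κ + Real.log (a k)) (x := θ + κ * 2 - Real.log b) (by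
        rw [hj, formWt_erase]
        have : Real.exp (-(θ + κ * 2 - Real.log b)) = Real.exp (-θ) * Real.exp (-(κ * 2)) * b := by
          rw [show -(θ + κ * 2 - Real.log b) = -θ + -(κ * 2) + Real.log b by ring, Real.exp_add,
            Real.exp_add, Real.exp_log hb0]
        rw [this]) (by linarith)
    refine h1.trans ?_
    rw [form_eq _ _ _ _ _ _ R.alive]
    simp only [hu, pow_zero, mul_one, Finset.prod_const_one, sub_self, mul_zero, Real.exp_zero]
    have e1 : (1 - c / N) ^ ((s₀.left.erase v).filter fun w => s₀.avail w = {k}).card ≤ 1 :=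
      pow_le_one₀ (sub_nonneg.2 P.p_le_one) (by linarith [P.p_nonneg])
    have e0 : 0 ≤ (1 - c / N) ^ ((s₀.left.erase v).filter fun w => s₀.avail w = {k}).card :=
      pow_nonneg (sub_nonneg.2 P.p_le_one) _
    have e2 : Real.exp (2 * κ + Real.log (a k) + (5 * c + 3) * κ) ≤ Real.exp (ε / 8) * a k := by
      rw [show 2 * κ + Real.log (a k) + (5 * c + 3) * κ = (5 * c + 5) * κ + Real.log (a k) by ring,
        Real.exp_add, Real.exp_log (ha0 k)]
      refine mul_le_mul_of_nonneg_right (Real.exp_le_exp.2 ?_) (ha0 k).le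
      linarith [P.κ_small, P.κ_pos]
    have hb0' : 0 ≤ b ^ shortCnt s₀ := pow_nonneg hb0.le _
    calc _ ≤ pot c θ s₀ * b ^ shortCnt s₀ * 1 * (Real.exp (ε / 8) * a k) := by gcongr
      _ = _ := by ring
  have hτ := P.τ_pos.le
  have e : step (c / N) s₀ v k (localBound c κ τ θ α G χ (size s₀)) =
      G * (step (c / N) s₀ v k (form c θ κ 1 (fun k => α k / 2) (size s₀)) +
        τ * step (c / N) s₀ v k (form c θ κ 1 (fun _ => 1) (size s₀))) +
      χ * (step (c / N) s₀ v k (form c θ κ (1 / 4) (fun k => α k / 2) (size s₀)) +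
        τ * step (c / N) s₀ v k (form c θ κ (1 / 4) (fun _ => 1) (size s₀))) := by
    rw [← step_const_mul _ _ _ _ τ, ← step_const_mul _ _ _ _ τ, ← step_add, ← step_add,
      ← step_const_mul, ← step_const_mul, ← step_add]
    rfl
  rw [e]
  have g1 := gen 1 (Or.inl rfl) _ (Or.inl rfl)
  have g2 := gen 1 (Or.inl rfl) _ (Or.inr rfl)
  simp only [one_pow, one_mul, mul_one] at g1 g2
  have i1 := mul_le_mul_of_nonneg_left (add_le_add g1 (mul_le_mul_of_nonneg_left g2 hτ))
    (zero_le_one.trans R.G_ge)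
  have i2 : χ * (step (c / N) s₀ v k (form c θ κ (1 / 4) (fun k => α k / 2) (size s₀)) +
        τ * step (c / N) s₀ v k (form c θ κ (1 / 4) (fun _ => 1) (size s₀))) ≤
      χ * ((1 / 4) ^ shortCnt s₀ * pot c θ s₀ * Real.exp (ε / 8) * (α k / 2) +
        τ * ((1 / 4) ^ shortCnt s₀ * pot c θ s₀ * Real.exp (ε / 8) * 1)) := by
    by_cases hne : χ = 0
    · rw [hne, zero_mul, zero_mul]
    · exact mul_le_mul_of_nonneg_left (add_le_add (gen _ (Or.inr ⟨rfl, hne⟩) _ (Or.inl rfl))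
        (mul_le_mul_of_nonneg_left (gen _ (Or.inr ⟨rfl, hne⟩) _ (Or.inr rfl)) hτ)) R.χ_nonneg
  refine (add_le_add i1 i2).trans (le_of_eq ?_)
  ring

/-- In the absence of unit lists, but not of short lists, the selected vertices are exactly those
with two colours. -/
theorem sum_shortest {s : Residual N} (hs : ¬ s.Contradiction) (hu : ∀ k, cnt s {k} = 0)
    (h2 : shortCnt s ≠ 0) (f : Finset Color → ℝ) : ∑ v ∈ s.shortest, f (s.avail v) =
      ∑ k, cnt s (Finset.univ.erase k) * f (Finset.univ.erase k) ∧
      (∀ v ∈ s.shortest, ∃ j, s.avail v = Finset.univ.erase j) := by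
  have hex : ∃ j, cnt s (Finset.univ.erase j) ≠ 0 := by
    by_contra hcon
    push Not at hcon
    apply h2
    simp [shortCnt, hu, hcon]
  obtain ⟨j, hj⟩ := hex
  obtain ⟨w, hw, hwj⟩ := cnt_ne_zero hj
  have hc2 : ∀ j : Color, (Finset.univ.erase j).card = 2 := by decide
  have hge : ∀ v ∈ s.left, 2 ≤ (s.avail v).card := by
    intro v hv
    have h1 := card_avail_pos hs hv
    by_contra hcon
    obtain ⟨k, hk⟩ := Finset.card_eq_one.1 (by omega : (s.avail v).card = 1)
    have := hu k
    rw [cnt, Finset.card_eq_zero, Finset.filter_eq_empty_iff] at this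
    exact this hv hk
  have hshort : s.shortest = s.left.filter fun v => (s.avail v).card = 2 := by
    ext v
    rw [mem_shortest_iff, Finset.mem_filter]
    refine and_congr_right fun hv => ⟨fun h => ?_, fun h w' hw' => h ▸ hge w' hw'⟩
    have h3 := h w hw
    rw [hwj, hc2] at h3
    exact le_antisymm h3 (hge v hv)
  refine ⟨?_, fun v hv => ?_⟩
  · rw [hshort, Finset.sum_filter,
      sum_avail_alive hs fun M => if M.card = 2 then f M else 0]
    simp [hc2]
  · rw [hshort] at hv
    have h3 := (Finset.mem_filter.1 hv).2
    rcases list_cases (s.avail v) with h | ⟨j, h⟩ | h | h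
    · rw [h] at h3; simp at h3
    · rw [h] at h3; simp at h3
    · exact h
    · rw [h] at h3; simp at h3

theorem sum_erase_color (j : Color) (α : Color → ℝ) :
    ∑ k ∈ Finset.univ.erase j, α k = α (j + 1) + α (j + 2) := by
  have h : ∀ j : Color, Finset.univ.erase j = {j + 1, j + 2} := by decide
  rw [h, Finset.sum_pair]
  revert j; decide

end Dpll

/-! ### The induction for the upper bound at decision nodes. -/

namespace Dpll

variable {N : ℕ}
variable {c ε κ η κ₁ τ : ℝ} {L m : ℕ}

/-- Here the node itself has to be counted too, so the surplus of `exp ε` over `exp (ε / 2)` is used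
for a larger additive error. -/
theorem exp_growth_decision {ε : ℝ} (h0 : 0 ≤ ε) {l : ℕ} (hl : 1 ≤ l) {X : ℝ}
    (hX : X ≤ Real.exp (ε / 2)) :
    Real.exp (ε * ((l - 1 : ℕ) : ℝ)) * (X + ε / 2) ≤ Real.exp (ε * l) := by
  have e1 : Real.exp (ε * l) = Real.exp (ε * ((l - 1 : ℕ) : ℝ)) * Real.exp ε := by
    rw [← Real.exp_add, Nat.cast_sub hl]
    ring_nf
  rw [e1]
  refine mul_le_mul_of_nonneg_left ?_ (Real.exp_pos _).le
  have e2 : Real.exp ε = Real.exp (ε / 2) * Real.exp (ε / 2) := by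
    rw [← Real.exp_add]; ring_nf
  have e3 := Real.add_one_le_exp (ε / 2)
  rw [e2]
  nlinarith

theorem UpperParams.one_le_big (P : UpperParams c ε κ η κ₁ τ N L m) {l : ℕ} (hl : L ≤ l) :
    1 ≤ ε / 8 * Real.exp (ε * ((l - 1 : ℕ) : ℝ)) := by
  have hε := P.ε_pos
  have h1 := card_pos_left_of_params P
  refine P.big.trans (mul_le_mul_of_nonneg_left (Real.exp_le_exp.2
    (mul_le_mul_of_nonneg_left ?_ hε.le)) (by linarith))
  rw [Nat.cast_sub (by omega), Nat.cast_one]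
  have : (L : ℝ) ≤ l := by exact_mod_cast hl
  linarith

theorem unitFactor_of_no_unit {p : ℝ} {s : Residual N} (hu : ∀ k, cnt s {k} = 0) :
    unitFactor p s = 1 := by simp [unitFactor, hu]

/-- Suitable weights of the unit lists that arise from lists of two colours. -/
theorem exists_tilt {D E : ℝ} (hD : 0 ≤ D) (hE : E ≤ min D (3 * Real.log 2) / 3)
    {x : Color → ℝ} (hx : ∀ k, x k ≤ 1 / 3) (hsum : ∀ k, x k + x (k + 1) + x (k + 2) = 0) :
    ∃ α : Color → ℝ, (∀ k, 1 / 2 ≤ α k) ∧ (∀ k, α k ≤ 3) ∧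
      (∀ k, E + D / 2 * ((1 / 3 - x (k + 1)) * (α (k + 2) - 2) +
        (1 / 3 - x (k + 2)) * (α (k + 1) - 2)) ≤ Real.log (α k)) ∧
      ∑ k, (x k + 2 / 3) * α k ≤ 2 := by
  -- The truncation at `3 * log 2` reflects the bound on `E`, and `3 / 2 * log 2 ≤ 26 / 25` is the
  -- reason for the extreme parameter in `log_tilt_extreme`.
  set κ := min D (3 * Real.log 2) / 2 with hκ
  have hl := Real.log_two_lt_d9
  have hl0 := Real.log_pos (by norm_num : (1 : ℝ) < 2)
  have h0 : 0 ≤ κ := by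
    have : 0 ≤ min D (3 * Real.log 2) := le_min hD (by linarith)
    linarith
  have h1 : κ ≤ 26 / 25 := by
    have := min_le_right D (3 * Real.log 2)
    linarith
  have hφ0 : 0 ≤ 3 * κ / (3 + κ) := by positivity
  have hφ1 : 3 * κ / (3 + κ) ≤ 1 := by rw [div_le_one (by linarith)]; linarith
  have hx' : ∀ k, -(2 / 3) ≤ x k := fun k => by linarith [hsum k, hx (k + 1), hx (k + 2)]
  refine ⟨fun k => tilt (3 * κ / (3 + κ)) (x k), fun k => tilt_pos hφ0 hφ1 (hx k),
    fun k => tilt_le hφ0 hφ1 (hx k) (hx' k), fun k => ?_, ?_⟩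
  · have hs' : x k + x (k + 2) + x (k + 1) = 0 := by linarith [hsum k]
    have h2 := log_tilt_ge_offspring h0 h1 hs' (hx k) (hx (k + 2)) (hx (k + 1))
    have h3 := offspring_nonpos hφ0 hφ1 hs' (hx k) (hx (k + 2)) (hx (k + 1))
    have h4 : κ ≤ D / 2 := by
      have := min_le_left D (3 * Real.log 2)
      linarith
    have h5 := mul_nonneg (sub_nonneg.2 h4) (neg_nonneg.2 h3)
    linarith
  · rw [Fin.sum_univ_three]
    refine sum_share_tilt_le hφ0 ?_ (hx 0) (hx 1) (hx 2)
    simpa using hsum 0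

/-- The branch `k` is worth `α k / 2` times the potential. The deviation `x k` is the amount by
which the share of two-colour lists without `k` falls short of `1 / 3`; by the choice of the tilt
the two branches of a random selected vertex are together worth at most the potential on average, up
to errors of order `ε`. -/
theorem unitBound_of_pair (P : UpperParams c ε κ η κ₁ τ N L m) {s : Residual N}
    (hs : ¬ s.Contradiction) (hl : L ≤ s.left.card) (hu : ∀ k, cnt s {k} = 0)
    (h2 : shortCnt s ≠ 0)
    (hIH : ∀ s' : Residual N, s'.left.card < s.left.card → UnitBound c ε L s') :
    UnitBound c ε L s := by
  intro K hK
  have hε := P.ε_pos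
  have hε1 := P.ε_le
  have hτ0 := P.τ_pos
  have hp := P.p_nonneg
  have hK1 := one_le_of_pot_le hs hK
  have hsf := one_le_shortFactor s
  rw [unitFactor_of_no_unit hu, mul_one]
  obtain ⟨θ, G, χ, hE, hGle, -, hR⟩ := exists_reference P hs hl
  have hS0 : (shortCnt s : ℝ) ≠ 0 := by exact_mod_cast h2
  have hSpos : (0 : ℝ) < shortCnt s := by positivity
  have hSsum : (shortCnt s : ℝ) = ∑ k, (cnt s (Finset.univ.erase k) : ℝ) := by
    simp [shortCnt, hu]
  have hshift : ∀ (f : Color → ℝ) (k : Color), f k + f (k + 1) + f (k + 2) = ∑ j, f j := by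
    intro f k
    rw [Fin.sum_univ_three]
    fin_cases k
    · rfl
    · change f 1 + f 2 + f 0 = _; ring
    · change f 2 + f 0 + f 1 = _; ring
  obtain ⟨α, hα1, hα2, hα3, hα4⟩ := exists_tilt (by positivity : 0 ≤ c / N * shortCnt s) hE
    (x := fun k => 1 / 3 - cnt s (Finset.univ.erase k) / shortCnt s)
    (fun k => by
      have : (0 : ℝ) ≤ cnt s (Finset.univ.erase k) / shortCnt s := by positivity
      linarith)
    (fun k => by
      have h := hshift (fun k => (cnt s (Finset.univ.erase k) : ℝ)) k
      rw [← hSsum] at h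
      have : (cnt s (Finset.univ.erase k) : ℝ) / shortCnt s +
        cnt s (Finset.univ.erase (k + 1)) / shortCnt s +
        cnt s (Finset.univ.erase (k + 2)) / shortCnt s = 1 := by
        rw [← add_div, ← add_div, h, div_self hS0]
      linarith)
  have R : Reference c η s θ α G χ := hR α hα1 hα2 fun k => by
    refine le_trans (le_of_eq ?_) (hα3 k)
    field_simp
    ring
  have hpK := hK θ R.θ_mem
  have hp0 := pot_nonneg (c := c) R.θ_mem.1 s
  set n := s.left.card with hn
  set E := Real.exp (ε * ((n - 1 : ℕ) : ℝ)) with hEdef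
  have hE0 : 0 < E := Real.exp_pos _
  set W := (1 + ε / 8) * shortFactor s * K * Real.exp (ε / 8) with hW
  have hW0 : 0 ≤ W := by positivity
  obtain ⟨hsum, hpair⟩ := sum_shortest hs hu h2 fun M => ∑ k ∈ M, α k
  have hcard : (s.shortest.card : ℝ) = shortCnt s := by
    have := (sum_shortest hs hu h2 fun _ => 1).1
    simp only [Finset.sum_const, nsmul_eq_mul, mul_one] at this
    rw [this, hSsum]
  have hstep : ∀ v ∈ s.shortest, ∑ k ∈ s.avail v, step (c / N) s v k (mean (c / N) (decisionAbove L))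
      ≤ E * (W / 2 * ∑ k ∈ s.avail v, α k + 2 * (W * τ + ε / 8 * K)) := by
    intro v hv
    obtain ⟨j, hj⟩ := hpair v hv
    have hvl := s.shortest_subset hv
    have h2c : (s.avail v).card = 2 := by
      rw [hj]
      exact (by decide : ∀ j : Color, (Finset.univ.erase j).card = 2) j
    calc _ ≤ ∑ k ∈ s.avail v, E * (W * (α k / 2 + τ) + ε / 8 * K) := by
          refine Finset.sum_le_sum fun k _ => R.step_mean_le P hIH hK1 hvl k ?_
          refine (R.step_localBound_le P hu hvl k hj).trans ?_
          have : 0 ≤ α k / 2 + τ := by linarith [hα1 k]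
          rw [hW]
          gcongr
      _ = _ := by
          rw [← Finset.mul_sum, Finset.sum_add_distrib, ← Finset.mul_sum, Finset.sum_add_distrib,
            ← Finset.sum_div, Finset.sum_const, Finset.sum_const, h2c]
          simp only [nsmul_eq_mul]
          push_cast
          ring
  -- A colour is available to all two-colour vertices except those whose list lacks it, whence the
  -- share `x k + 2 / 3`.
  have hαsum : ∑ v ∈ s.shortest, ∑ k ∈ s.avail v, α k ≤ 2 * shortCnt s := by
    rw [hsum]
    simp only [sum_erase_color]
    have e1 : ∑ k, (cnt s (Finset.univ.erase k) : ℝ) * (α (k + 1) + α (k + 2)) =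
        ∑ k, (shortCnt s - cnt s (Finset.univ.erase k)) * α k := by
      rw [hSsum]
      simp only [Fin.sum_univ_three]
      change _ * (α 1 + α 2) + _ * (α 2 + α 0) + _ * (α 0 + α 1) = _
      ring
    rw [e1]
    have e2 : ∑ k, (shortCnt s - cnt s (Finset.univ.erase k)) * α k =
        shortCnt s * ∑ k, (1 / 3 - cnt s (Finset.univ.erase k) / shortCnt s + 2 / 3) * α k := by
      rw [Finset.mul_sum]
      refine Finset.sum_congr rfl fun k _ => ?_
      field_simp
      ring
    rw [e2, mul_comm 2]
    exact mul_le_mul_of_nonneg_left hα4 hSpos.le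
  have havg : (∑ v ∈ s.shortest, ∑ k ∈ s.avail v,
      step (c / N) s v k (mean (c / N) (decisionAbove L))) / s.shortest.card ≤
      E * (W + 2 * (W * τ + ε / 8 * K)) := by
    rw [div_le_iff₀ (by rw [hcard]; exact hSpos)]
    refine (Finset.sum_le_sum hstep).trans ?_
    rw [← Finset.mul_sum, Finset.sum_add_distrib, ← Finset.mul_sum, Finset.sum_const, nsmul_eq_mul,
      hcard, mul_assoc E]
    refine mul_le_mul_of_nonneg_left ?_ hE0.le
    have := mul_le_mul_of_nonneg_left hαsum (by linarith : 0 ≤ W / 2)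
    linarith
  have hn1 : 1 ≤ n := (card_pos_left_of_params P).trans hl
  rw [mean_of_alive hs]
  have hone : decisionAbove L s ≤ E * (ε / 8 * (shortFactor s * K)) := by
    have h3 := P.one_le_big hl
    have h4 : 1 ≤ shortFactor s * K := one_le_mul_of_one_le_of_one_le hsf hK1
    calc _ ≤ 1 := decisionAbove_le_one L s
      _ ≤ ε / 8 * E * 1 := by rw [mul_one]; exact h3
      _ ≤ ε / 8 * E * (shortFactor s * K) := mul_le_mul_of_nonneg_left h4 (by positivity)
      _ = _ := by ring
  have hgr := exp_growth_decision hε.le hn1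
    (X := (1 + ε / 8) * Real.exp (ε / 8) * (1 + ε / 8)) (by
      have h5 := Real.add_one_le_exp (ε / 8)
      calc _ ≤ Real.exp (ε / 8) * Real.exp (ε / 8) * Real.exp (ε / 8) := by
            gcongr <;> linarith
        _ ≤ Real.exp (ε / 2) := by
            rw [← Real.exp_add, ← Real.exp_add]
            exact Real.exp_le_exp.2 (by linarith))
  have hgr2 := mul_le_mul_of_nonneg_right hgr (by positivity : 0 ≤ shortFactor s * K)
  have hKs : K ≤ shortFactor s * K := le_mul_of_one_le_left (by linarith) hsf
  have hWτ : W * τ ≤ W * (ε / 16) := mul_le_mul_of_nonneg_left P.τ_le hW0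
  calc _ ≤ E * (ε / 8 * (shortFactor s * K)) + E * (W + 2 * (W * τ + ε / 8 * K)) :=
        add_le_add hone havg
    _ ≤ E * (ε / 8 * (shortFactor s * K)) +
        E * (W + 2 * (W * (ε / 16) + ε / 8 * (shortFactor s * K))) := by gcongr
    _ = E * (((1 + ε / 8) * Real.exp (ε / 8) * (1 + ε / 8) + 3 * ε / 8) * (shortFactor s * K)) := by
        rw [hW]; ring
    _ ≤ E * (((1 + ε / 8) * Real.exp (ε / 8) * (1 + ε / 8) + ε / 2) * (shortFactor s * K)) := by
        have : 3 * ε / 8 ≤ ε / 2 := by linarith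
        gcongr
    _ ≤ _ := by rw [← mul_assoc]; refine hgr2.trans (le_of_eq (by ring))

/-- Each of the three branches gains only the factor `1 / 2`, which alone would give `3 / 2`. The
component with `b = 1 / 4` starts at the same value but drops to `1 / 8`, because the step creates
short lists. So the branches total `3 * (1 / 2 + 1 / 8) = 15 / 8`, less than `shortFactor s = 2`. -/
theorem unitBound_of_triple (P : UpperParams c ε κ η κ₁ τ N L m) {s : Residual N}
    (hs : ¬ s.Contradiction) (hl : L ≤ s.left.card) (h2 : shortCnt s = 0)
    (hIH : ∀ s' : Residual N, s'.left.card < s.left.card → UnitBound c ε L s') :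
    UnitBound c ε L s := by
  intro K hK
  have hε := P.ε_pos
  have hε1 := P.ε_le
  have hτ0 := P.τ_pos
  have hp := P.p_nonneg
  have hκ := P.κ_pos
  have hK1 := one_le_of_pot_le hs hK
  have hu : ∀ k, cnt s {k} = 0 := by
    have : ∑ k : Color, cnt s {k} = 0 := by unfold shortCnt at h2; omega
    exact fun k => Finset.sum_eq_zero_iff.1 this k (Finset.mem_univ k)
  have he : ∀ k, cnt s (Finset.univ.erase k) = 0 := by
    have : ∑ k : Color, cnt s (Finset.univ.erase k) = 0 := by unfold shortCnt at h2; omega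
    exact fun k => Finset.sum_eq_zero_iff.1 this k (Finset.mem_univ k)
  have hsf : shortFactor s = 2 := by rw [shortFactor, h2]; norm_num
  rw [unitFactor_of_no_unit hu, mul_one, hsf]
  obtain ⟨θ, G, χ, hE, -, hGχ, hR⟩ := exists_reference P hs hl
  have hlog2 := Real.log_pos (by norm_num : (1 : ℝ) < 2)
  rw [h2, Nat.cast_zero, mul_zero, min_eq_left (by linarith), zero_div] at hE
  obtain ⟨rfl, rfl⟩ := hGχ (by rw [h2]; norm_num)
  have R : Reference c η s θ (fun _ => 2) 1 1 := hR _ (fun _ => by norm_num)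
    (fun _ => by norm_num) fun k => by rw [he, he]; norm_num; linarith
  have hB := (R.hχ.resolve_left one_ne_zero).2
  have hpK := hK θ R.θ_mem
  have hp0 := pot_nonneg (c := c) R.θ_mem.1 s
  have hθ := R.θ_mem.1
  set n := s.left.card with hn
  set E := Real.exp (ε * ((n - 1 : ℕ) : ℝ)) with hEdef
  have hE0 : 0 < E := Real.exp_pos _
  have hz := tripleWt_pos hθ
  have hlogz : -Real.log (tripleWt θ) ≤ θ := by
    have h1 : Real.exp (-θ) ≤ tripleWt θ := by
      have := exp_div_tripleWt hθ
      rw [div_eq_iff hz.ne'] at this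
      rw [this]
      exact mul_le_of_le_one_left hz.le (by linarith [lossRate_nonneg hθ])
    have := Real.log_le_log (Real.exp_pos _) h1
    rw [Real.log_exp] at this
    linarith
  have hf : ∀ b : ℝ, 0 < b → b ≤ 1 → ∀ r : ℝ, θ - c / N * cnt s Finset.univ *
      (1 - b * (1 - lossRate θ)) ≤ r → ∀ v ∈ s.left, ∀ k,
      step (c / N) s v k (form c θ κ b (fun _ => 1) (size s)) ≤
        pot c θ s * (Real.exp r * Real.exp (ε / 8)) := by
    intro b hb0 hb1 r hr v hv k
    have hav : s.avail v = Finset.univ := by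
      have hne : ∀ M, cnt s M = 0 → s.avail v ≠ M := fun M hM hh => by
        rw [cnt, Finset.card_eq_zero, Finset.filter_eq_empty_iff] at hM
        exact hM hv hh
      rcases list_cases (s.avail v) with h | ⟨j, h⟩ | ⟨j, h⟩ | h
      · exact absurd h (hne _ (cnt_empty hs))
      · exact absurd h (hne _ (hu j))
      · exact absurd h (hne _ (he j))
      · exact h
    have h1 := P.step_form_le_exp (Y := size s) hs hs (Below.refl s)
      (by rw [sub_self]; exact mul_nonneg P.η_pos.le (Nat.cast_nonneg _)) hθ hb0 hb1
      (a := fun _ => 1) (fun _ => one_pos) (fun _ => by norm_num) hv k (r := r + 3 * κ)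
      (x := κ * 3 - Real.log (tripleWt θ)) (by
        rw [hav, formWt_univ]
        rw [show -(κ * 3 - Real.log (tripleWt θ)) = Real.log (tripleWt θ) + -(κ * 3) by ring,
          Real.exp_add, Real.exp_log hz]) (by rw [he, he]; norm_num; linarith)
    refine h1.trans ?_
    rw [form_eq _ _ _ _ _ _ hs]
    simp only [h2, hu, pow_zero, mul_one, Finset.prod_const_one, sub_self, mul_zero, Real.exp_zero]
    have e1 : (1 - c / N) ^ ((s.left.erase v).filter fun w => s.avail w = {k}).card ≤ 1 :=
      pow_le_one₀ (sub_nonneg.2 P.p_le_one) (by linarith)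
    have e0 : 0 ≤ (1 - c / N) ^ ((s.left.erase v).filter fun w => s.avail w = {k}).card :=
      pow_nonneg (sub_nonneg.2 P.p_le_one) _
    have e2 : Real.exp (r + 3 * κ + (5 * c + 3) * κ) ≤ Real.exp r * Real.exp (ε / 8) := by
      rw [← Real.exp_add]
      exact Real.exp_le_exp.2 (by linarith [P.κ_small])
    calc _ ≤ pot c θ s * 1 * (Real.exp r * Real.exp (ε / 8)) := by gcongr
      _ = _ := by ring
  have h12 : Real.exp (-Real.log 2) = 1 / 2 := by
    rw [Real.exp_neg, Real.exp_log (by norm_num)]; norm_num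
  have h18 : Real.exp (-(3 * Real.log 2)) = 1 / 8 := by
    rw [Real.exp_neg, show 3 * Real.log 2 = Real.log 2 + Real.log 2 + Real.log 2 by ring,
      Real.exp_add, Real.exp_add, Real.exp_log (by norm_num)]
    norm_num
  have hstep : ∀ v ∈ s.shortest, ∑ k ∈ s.avail v, step (c / N) s v k (mean (c / N) (decisionAbove L))
      ≤ E * (3 * (5 / 8 * (1 + τ) * Real.exp (ε / 8) * K + ε / 8 * K)) := by
    intro v hv
    have hvl := s.shortest_subset hv
    have hX : 0 ≤ E * (5 / 8 * (1 + τ) * Real.exp (ε / 8) * K + ε / 8 * K) := by positivity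
    calc _ ≤ ∑ k ∈ s.avail v, E * (5 / 8 * (1 + τ) * Real.exp (ε / 8) * K + ε / 8 * K) := by
          refine Finset.sum_le_sum fun k _ => R.step_mean_le P hIH hK1 hvl k ?_
          have g1 := hf 1 one_pos le_rfl (-Real.log 2) (by linarith) v hvl k
          have g2 := hf (1 / 4) (by norm_num) (by norm_num) (-(3 * Real.log 2))
            (by rw [log_four] at hB; linarith) v hvl k
          rw [h12] at g1
          rw [h18] at g2
          have e : step (c / N) s v k (localBound c κ τ θ (fun _ => 2) 1 1 (size s)) =
              (1 + τ) * (step (c / N) s v k (form c θ κ 1 (fun _ => 1) (size s)) +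
                step (c / N) s v k (form c θ κ (1 / 4) (fun _ => 1) (size s))) := by
            rw [← step_add, ← step_const_mul]
            refine step_congr fun A _ => ?_
            simp only [localBound, div_self (two_ne_zero (α := ℝ))]
            ring
          rw [e]
          calc _ ≤ (1 + τ) * (pot c θ s * (1 / 2 * Real.exp (ε / 8)) +
                pot c θ s * (1 / 8 * Real.exp (ε / 8))) := by gcongr
            _ = 5 / 8 * (1 + τ) * Real.exp (ε / 8) * pot c θ s := by ring
            _ ≤ _ := by gcongr
      _ = (s.avail v).card * (E * (5 / 8 * (1 + τ) * Real.exp (ε / 8) * K + ε / 8 * K)) := by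
          rw [Finset.sum_const, nsmul_eq_mul]
      _ ≤ 3 * (E * (5 / 8 * (1 + τ) * Real.exp (ε / 8) * K + ε / 8 * K)) := by
          refine mul_le_mul_of_nonneg_right ?_ hX
          exact_mod_cast card_avail_le s v
      _ = _ := by ring
  have havg := average_le (by positivity) hstep
  have hn1 : 1 ≤ n := (card_pos_left_of_params P).trans hl
  rw [mean_of_alive hs]
  have hone : decisionAbove L s ≤ E * (ε / 8 * K) := by
    have h3 := P.one_le_big hl
    calc _ ≤ 1 := decisionAbove_le_one L s
      _ ≤ ε / 8 * E * 1 := by rw [mul_one]; exact h3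
      _ ≤ ε / 8 * E * K := mul_le_mul_of_nonneg_left hK1 (by positivity)
      _ = _ := by ring
  have hgr := exp_growth_decision hε.le hn1
    (X := Real.exp (ε / 8) * (1 + ε / 8)) (by
      have h5 := Real.add_one_le_exp (ε / 8)
      calc _ ≤ Real.exp (ε / 8) * Real.exp (ε / 8) := by
            gcongr; linarith
        _ ≤ Real.exp (ε / 2) := by
            rw [← Real.exp_add]
            exact Real.exp_le_exp.2 (by linarith))
  have hgr2 := mul_le_mul_of_nonneg_right hgr (by linarith : 0 ≤ 2 * K)
  have hτ1 := P.τ_le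
  calc _ ≤ E * (ε / 8 * K) +
        E * (3 * (5 / 8 * (1 + τ) * Real.exp (ε / 8) * K + ε / 8 * K)) := add_le_add hone havg
    _ = E * ((15 / 16 * (Real.exp (ε / 8) * (1 + τ)) + ε / 4) * (2 * K)) := by ring
    _ ≤ E * ((1 * (Real.exp (ε / 8) * (1 + ε / 8)) + ε / 2) * (2 * K)) := by
        gcongr <;> linarith
    _ ≤ _ := by rw [one_mul, ← mul_assoc]; refine hgr2.trans (le_of_eq (by ring))

/-- The bound for the number of decision nodes holds for all instances. -/
theorem unitBound (P : UpperParams c ε κ η κ₁ τ N L m) (s : Residual N) : UnitBound c ε L s := by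
  induction hn : s.left.card using Nat.strong_induction_on generalizing s with
  | _ n ih =>
    have hIH : ∀ s' : Residual N, s'.left.card < s.left.card → UnitBound c ε L s' :=
      fun s' hs' => ih _ (hn ▸ hs') s' rfl
    by_cases hdead : s.Contradiction ∨ s.left.card < L
    · intro K hK
      have hK0 : 0 ≤ K := (pot_nonneg le_rfl s).trans (hK 0 ⟨le_rfl, by norm_num⟩)
      have h0 : mean (c / N) (decisionAbove L) s = 0 := by
        rcases hdead with h | h
        · rw [mean_of_contradiction h, decisionAbove_of_contradiction h]
        · exact mean_decisionAbove_of_lt h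
      rw [h0]
      have := unitFactor_nonneg P.p_le_one s
      have := one_le_shortFactor s
      positivity
    · push Not at hdead
      obtain ⟨hs, hl⟩ := hdead
      by_cases hu : ∀ k, cnt s {k} = 0
      · by_cases h2 : shortCnt s = 0
        · exact unitBound_of_triple P hs hl h2 hIH
        · exact unitBound_of_pair P hs hl hu h2 hIH
      · exact unitBound_of_unit P hs hl hu hIH

end Dpll

/-! ### All nodes against decision nodes; the value of the potential at the start. -/

namespace Dpll

open MeasureTheory Filter Asymptotics
open scoped ENNReal Topology

variable {N : ℕ}

theorem mean_add (p : ℝ) (f g : Residual N → ℝ) (s : Residual N) :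
    mean p (fun s => f s + g s) s = mean p f s + mean p g s := by
  classical
  induction hn : s.left.card using Nat.strong_induction_on generalizing s with
  | _ n ih =>
    rw [mean_eq p f, mean_eq p g, mean_eq]
    split_ifs with hc
    · ring
    · have : ∀ v ∈ s.shortest, ∑ k ∈ s.avail v, step p s v k (mean p fun s => f s + g s) =
          ∑ k ∈ s.avail v, step p s v k (mean p f) + ∑ k ∈ s.avail v, step p s v k (mean p g) := by
        intro v hv
        rw [← Finset.sum_add_distrib]
        refine Finset.sum_congr rfl fun k _ => ?_
        rw [← step_add]
        exact step_congr fun A _ => ih _ (hn ▸ s.card_left_hit_lt hv k A) _ rfl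
      rw [Finset.sum_congr rfl this, Finset.sum_add_distrib, add_div]
      ring

theorem mean_zero (p : ℝ) (s : Residual N) : mean p (fun _ => 0) s = 0 := by
  have := mean_add p (fun _ => 0) (fun _ => 0) s
  simp only [add_zero] at this
  linarith

theorem mean_sum {ι : Type*} (I : Finset ι) (p : ℝ) (f : ι → Residual N → ℝ) (s : Residual N) :
    mean p (fun s => ∑ i ∈ I, f i s) s = ∑ i ∈ I, mean p (f i) s := by
  classical
  induction I using Finset.induction_on with
  | empty => simp [mean_zero]
  | insert a J ha ih =>
    simp only [Finset.sum_insert ha]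
    rw [mean_add, ih]

open Classical in
/-- The indicator of the nodes in which no list has less than two colours. -/
noncomputable def decision (s : Residual N) : ℝ :=
  if ∀ w ∈ s.left, 2 ≤ (s.avail w).card then 1 else 0

theorem decision_nonneg (s : Residual N) : 0 ≤ decision s := by
  unfold decision; split_ifs <;> norm_num

theorem decision_eq (L : ℕ) (s : Residual N) :
    decision s = decisionAbove L s + ∑ m ∈ Finset.range L, decisionAt m s := by
  classical
  unfold decision decisionAbove decisionAt
  by_cases h : ∀ w ∈ s.left, 2 ≤ (s.avail w).card
  · have h' : (∀ w ∈ s.left, 2 ≤ (s.avail w).card) = True := eq_true h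
    simp only [h', and_true, if_true]
    rw [Finset.sum_ite_eq]
    simp only [Finset.mem_range]
    by_cases hl : L ≤ s.left.card
    · rw [if_pos hl, if_neg (by omega)]; norm_num
    · rw [if_neg hl, if_pos (by omega)]; norm_num
  · simp [h]

/-- The number of nodes is controlled by the number of decision nodes. -/
theorem mean_one_le {p : ℝ} (h0 : 0 ≤ p) (h1 : p ≤ 1) (s : Residual N) :
    mean p (fun _ => 1) s ≤ s.left.card + 1 + 2 * N * mean p decision s := by
  induction hn : s.left.card using Nat.strong_induction_on generalizing s with
  | _ n ih =>
    have hd0 := mean_nonneg h0 h1 (decision_nonneg (N := N)) s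
    by_cases hc : s.Contradiction
    · rw [mean_of_contradiction hc]
      have : 0 ≤ 2 * N * mean p decision s := by positivity
      have : (0 : ℝ) ≤ n := Nat.cast_nonneg n
      linarith
    rcases Nat.eq_zero_or_pos n with h | hpos
    · rw [mean_of_left_eq_empty (Finset.card_eq_zero.1 (hn.trans h))]
      have : 0 ≤ 2 * N * mean p decision s := by positivity
      have : (0 : ℝ) ≤ n := Nat.cast_nonneg n
      linarith
    have hne : s.left.Nonempty := Finset.card_pos.1 (hn ▸ hpos)
    have hcardpos : (0 : ℝ) < s.shortest.card := by
      exact_mod_cast (s.shortest_nonempty hne).card_pos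
    have hstep : ∀ v ∈ s.shortest, ∀ k, step p s v k (mean p fun _ => 1) ≤
        n + 2 * N * step p s v k (mean p decision) := by
      intro v hv k
      have h2 : step p s v k (mean p fun _ => 1) ≤
          step p s v k (fun s' => n + 2 * N * mean p decision s') := by
        refine step_le_step h0 h1 fun A _ => ?_
        have hlt := s.card_left_hit_lt hv k A
        have hcl := left_card_hit (s.shortest_subset hv) k A
        refine (ih _ (hn ▸ hlt) _ rfl).trans ?_
        have : ((s.hit v k A).left.card : ℝ) + 1 = n := by
          rw [hcl, hn, Nat.cast_sub hpos]; simp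
        linarith
      rwa [step_add, step_const, step_const_mul] at h2
    have hsplit : (∑ v ∈ s.shortest, ∑ k ∈ s.avail v, step p s v k (mean p fun _ => 1)) ≤
        (∑ v ∈ s.shortest, ((s.avail v).card : ℝ)) * n +
          2 * N * ∑ v ∈ s.shortest, ∑ k ∈ s.avail v, step p s v k (mean p decision) := by
      rw [Finset.sum_mul, Finset.mul_sum, ← Finset.sum_add_distrib]
      refine Finset.sum_le_sum fun v hv => ?_
      calc _ ≤ ∑ k ∈ s.avail v, (n + 2 * N * step p s v k (mean p decision)) :=
            Finset.sum_le_sum fun k _ => hstep v hv k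
        _ = _ := by
            rw [Finset.sum_add_distrib, ← Finset.mul_sum, Finset.sum_const, nsmul_eq_mul]
    have hnN : (n : ℝ) ≤ N := by
      rw [← hn]; exact_mod_cast (by simpa using Finset.card_le_univ s.left)
    rw [mean_of_alive hc, mean_of_alive hc (f := decision)]
    have key : ∀ q : ℝ, (∑ v ∈ s.shortest, ((s.avail v).card : ℝ)) ≤ q * s.shortest.card →
        (∑ v ∈ s.shortest, ∑ k ∈ s.avail v, step p s v k (mean p fun _ => 1)) / s.shortest.card ≤
        q * n + 2 * N * ((∑ v ∈ s.shortest, ∑ k ∈ s.avail v, step p s v k (mean p decision)) /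
          s.shortest.card) := by
      intro q hq
      rw [div_le_iff₀ hcardpos]
      refine hsplit.trans ?_
      have := mul_le_mul_of_nonneg_right hq (Nat.cast_nonneg (α := ℝ) n)
      have e : (∑ v ∈ s.shortest, ∑ k ∈ s.avail v, step p s v k (mean p decision)) /
          s.shortest.card * s.shortest.card =
          ∑ v ∈ s.shortest, ∑ k ∈ s.avail v, step p s v k (mean p decision) :=
        div_mul_cancel₀ _ hcardpos.ne'
      rw [add_mul, mul_assoc (2 * (N : ℝ)), e]
      linarith
    have hsum : ∀ q : ℕ, (∀ v ∈ s.shortest, (s.avail v).card ≤ q) →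
        (∑ v ∈ s.shortest, ((s.avail v).card : ℝ)) ≤ q * s.shortest.card := by
      intro q hq
      calc _ ≤ ∑ v ∈ s.shortest, (q : ℝ) := Finset.sum_le_sum fun v hv => by
            exact_mod_cast hq v hv
        _ = _ := by rw [Finset.sum_const, nsmul_eq_mul, mul_comm]
    -- At a decision node there are at most two additional branches, and their offsets `n` are paid
    -- by the summand `2 * N` of that node. At any other alive node the selected list has a single
    -- colour and the offset does not grow.
    by_cases hd : ∀ w ∈ s.left, 2 ≤ (s.avail w).card
    · have h3 := key 3 (by exact_mod_cast hsum 3 fun v _ => card_avail_le s v)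
      rw [decision, if_pos hd, mul_add]
      linarith
    · have h3 := key 1 (by
        refine (hsum 1 fun v hv => ?_).trans (by simp)
        push Not at hd
        obtain ⟨w, hw, h4⟩ := hd
        have := (mem_shortest_iff.1 hv).2 w hw
        omega)
      rw [decision, if_neg hd, zero_add]
      linarith

/-- The quadratic of `forbidden_ge` is concave in `m`; at `m = 9 * N / 20` it is about `0.1479 * N ^
2`, and at `m = 0` it is larger. As `0.1479 * 13.15 > log 6`, this beats the `2 ^ N * 3 ^ N`
choices. -/
theorem mean_decisionAt_le_exp {c : ℝ} (hc : 263 / 20 ≤ c) (hN : c ≤ N) {m : ℕ}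
    (hm : m ≤ 9 / 20 * (N : ℝ)) :
    mean (c / N) (decisionAt m) (Residual.initial N) ≤ Real.exp (c / 2) := by
  have hN0 : (0 : ℝ) < N := by linarith
  have h1 := mean_decisionAt_le (N := N) (p := c / N) (m := m)
    (e := 1479 / 10000 * (N : ℝ) ^ 2 - N / 2) (by positivity)
    (by rw [div_le_one hN0]; exact hN) (by
      have hm0 : (0 : ℝ) ≤ m := Nat.cast_nonneg m
      nlinarith [mul_nonneg hm0 (sub_nonneg.2 hm)])
  refine h1.trans ?_
  have h2 : (N.choose m : ℝ) ≤ 2 ^ N := by exact_mod_cast Nat.choose_le_two_pow N m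
  have h3 : (2 : ℝ) ^ N * 3 ^ N ≤ Real.exp (c / N * (1479 / 10000 * (N : ℝ) ^ 2)) := by
    have e6 : (6 : ℝ) ≤ Real.exp (1479 / 10000 * (263 / 20)) := by
      have h1 := Real.exp_one_gt_d9
      have h2 : Real.exp (1479 / 10000 * (263 / 20)) ≥ Real.exp (1 + 9 / 10) :=
        Real.exp_le_exp.2 (by norm_num)
      rw [Real.exp_add] at h2
      have h3 := Real.quadratic_le_exp_of_nonneg (x := 9 / 10) (by norm_num)
      nlinarith
    rw [← mul_pow]
    calc ((2 : ℝ) * 3) ^ N ≤ Real.exp (1479 / 10000 * (263 / 20)) ^ N :=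
          pow_le_pow_left₀ (by norm_num) (by linarith) N
      _ = Real.exp (N * (1479 / 10000 * (263 / 20))) := by rw [← Real.exp_nat_mul]
      _ ≤ _ := by
          apply Real.exp_le_exp.2
          have : c / N * (1479 / 10000 * (N : ℝ) ^ 2) = N * (1479 / 10000 * c) := by
            field_simp
          rw [this]
          gcongr
  calc _ ≤ (2 : ℝ) ^ N * 3 ^ N * Real.exp (-(c / N * (1479 / 10000 * (N : ℝ) ^ 2 - N / 2))) := by
        gcongr
    _ ≤ Real.exp (c / N * (1479 / 10000 * (N : ℝ) ^ 2)) *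
        Real.exp (-(c / N * (1479 / 10000 * (N : ℝ) ^ 2 - N / 2))) := by gcongr
    _ = _ := by
        rw [← Real.exp_add]
        congr 1
        field_simp
        ring

theorem exponent_continuousOn (c : ℝ) (hc : 0 < c) : ContinuousOn (exponent c) (Set.Icc 0 1) := by
  unfold exponent
  refine ContinuousOn.add (by fun_prop) (ContinuousOn.log (by fun_prop) fun t ht => ?_)
  have : Real.exp (-(2 * c * t / 3)) ≤ 1 := by
    apply Real.exp_le_one_iff.2
    have := ht.1
    have : 0 ≤ 2 * c * t / 3 := by positivity
    linarith
  linarith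

theorem bddAbove_exponent {c : ℝ} (hc : 0 < c) : BddAbove (exponent c '' Set.Ioo 0 1) :=
  (isCompact_Icc.bddAbove_image (exponent_continuousOn c hc)).mono
    (Set.image_mono Set.Ioo_subset_Icc_self)

/-- The endpoints, which the supremum omits, are covered by continuity. -/
theorem exponent_le_omegaH {c : ℝ} (hc : 0 < c) {t : ℝ} (h : t ∈ Set.Icc (0 : ℝ) 1) :
    exponent c t ≤ omegaH c := by
  have hcl : closure (Set.Ioo (0 : ℝ) 1) = Set.Icc 0 1 := closure_Ioo zero_ne_one
  have hclosed := (exponent_continuousOn c hc).preimage_isClosed_of_isClosed isClosed_Icc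
    (isClosed_Iic (a := omegaH c))
  have hsub : Set.Ioo (0 : ℝ) 1 ⊆ Set.Icc 0 1 ∩ exponent c ⁻¹' Set.Iic (omegaH c) := fun s hs =>
    ⟨Set.Ioo_subset_Icc_self hs, le_csSup (bddAbove_exponent hc) (Set.mem_image_of_mem _ hs)⟩
  exact (closure_minimal hsub hclosed (hcl ▸ h)).2

theorem exponent_zero (c : ℝ) : exponent c 0 = 0 := by
  unfold exponent; norm_num

theorem omegaH_nonneg {c : ℝ} (hc : 0 < c) : 0 ≤ omegaH c := by
  have := exponent_le_omegaH hc (t := 0) ⟨le_rfl, zero_le_one⟩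
  rwa [exponent_zero] at this

theorem not_contradiction_initial : ¬ (Residual.initial N).Contradiction := by
  rintro ⟨v, -, h⟩
  exact Finset.univ_nonempty.ne_empty h

theorem cnt_initial (M : Finset Color) : cnt (Residual.initial N) M =
    if M = Finset.univ then N else 0 := by
  unfold cnt Residual.initial
  split_ifs with h
  · simp [h]
  · simp [Ne.symm h]

theorem shortCnt_initial : shortCnt (Residual.initial N) = 0 := by
  have h1 : ∀ k : Color, ({k} : Finset Color) ≠ Finset.univ := by decide
  have h2 : ∀ k : Color, Finset.univ.erase k ≠ Finset.univ := by decide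
  simp [shortCnt, cnt_initial, h1, h2]

/-- With `t = 3 * θ / c` the logarithm of the initial potential is `N * exponent c t`. -/
theorem pot_initial_le {c : ℝ} (hc : 1 ≤ c) (hN : 0 < N) {θ : ℝ}
    (hθ : θ ∈ Set.Icc (0 : ℝ) (3 / 10)) :
    pot c θ (Residual.initial N) ≤ Real.exp (N * omegaH c) := by
  have hc0 : 0 < c := by linarith
  have hN' : (0 : ℝ) < N := by exact_mod_cast hN
  rw [pot_eq hc0 hN hθ.1 not_contradiction_initial, shortCnt_initial, cnt_initial, if_pos rfl]
  apply Real.exp_le_exp.2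
  have h1 := exponent_le_omegaH hc0 (t := 3 * θ / c)
    ⟨by have := hθ.1; positivity, by rw [div_le_one hc0]; linarith [hθ.2]⟩
  refine le_trans (le_of_eq ?_) (mul_le_mul_of_nonneg_left h1 hN'.le)
  unfold rate exponent
  have h2 : 2 * c * (3 * θ / c) / 3 = 2 * θ := by field_simp
  have h3 : 0 < (3 - Real.exp (-(2 * θ))) / 2 := by linarith [exp_neg_two_mul_le hθ.1]
  rw [h2, tripleWt_eq, Real.log_mul (Real.exp_pos _).ne' h3.ne', Real.log_exp,
    Real.log_div (by linarith) (by norm_num)]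
  field_simp
  push_cast
  ring

end Dpll

/-! ### Choice of the constants and the upper bound for the number of nodes. -/

namespace Dpll

open MeasureTheory Filter Asymptotics
open scoped ENNReal Topology

variable {N : ℕ}

theorem eventually_natCast_ge (x : ℝ) : ∀ᶠ N : ℕ in atTop, x ≤ N :=
  tendsto_natCast_atTop_atTop.eventually_ge_atTop x

theorem exp_neg_two_mul_le_one_sub {x : ℝ} (h0 : 0 ≤ x) (h1 : x ≤ 1 / 2) :
    Real.exp (-(2 * x)) ≤ 1 - x := by
  have h2 : 1 + 2 * x ≤ Real.exp (2 * x) := by linarith [Real.add_one_le_exp (2 * x)]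
  rw [Real.exp_neg, inv_le_comm₀ (Real.exp_pos _) (by linarith)]
  refine le_trans ?_ h2
  rw [inv_le_iff_one_le_mul₀ (by linarith)]
  nlinarith

/-- The number of factors is linear in `N` while the base `c / N` tends to zero, so the decay beats
every exponential. -/
theorem eventually_pow_le {c η : ℝ} (hc : 0 < c) (hη : 0 < η) (A : ℝ) :
    ∀ᶠ N : ℕ in atTop, (2 : ℝ) ^ N * (c / N) ^ ⌊η * N - 3⌋₊ * 4 ^ N ≤ Real.exp (-(A * N)) := by
  set B := max (A + 3) 0 with hB
  have hB0 : 0 ≤ B := le_max_right _ _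
  have hBA : A + 3 ≤ B := le_max_left _ _
  set δ := Real.exp (-(2 * B / η)) with hδ
  filter_upwards [eventually_natCast_ge 1, eventually_natCast_ge (c / δ),
    eventually_natCast_ge (8 / η)] with N h1 h2 h3
  have hδ0 : 0 < δ := Real.exp_pos _
  have hN : (0 : ℝ) < N := by linarith
  have e1 : c / N ≤ δ := by
    rw [div_le_iff₀ hδ0] at h2
    rw [div_le_iff₀ hN]
    linarith
  have e2 : η * N / 2 ≤ ⌊η * N - 3⌋₊ := by
    have := Nat.sub_one_lt_floor (η * N - 3)
    rw [div_le_iff₀ hη] at h3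
    linarith
  have e3 : (c / N) ^ ⌊η * N - 3⌋₊ ≤ Real.exp (-(B * N)) := by
    calc (c / N) ^ ⌊η * N - 3⌋₊ ≤ δ ^ ⌊η * N - 3⌋₊ := pow_le_pow_left₀ (by positivity) e1 _
      _ = Real.exp (-(⌊η * N - 3⌋₊ * (2 * B / η))) := by
          rw [hδ, ← Real.exp_nat_mul]; ring_nf
      _ ≤ _ := by
          apply Real.exp_le_exp.2
          have h4 := mul_le_mul_of_nonneg_right e2 (by positivity : 0 ≤ 2 * B / η)
          have h5 : η * N / 2 * (2 * B / η) = B * N := by field_simp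
          linarith
  have e4 : (2 : ℝ) ^ N * 4 ^ N ≤ Real.exp (3 * N) := by
    rw [← mul_pow]
    have : (2 : ℝ) * 4 ≤ Real.exp 3 := by
      have h1 := Real.exp_one_gt_d9
      rw [show (3 : ℝ) = 1 + 1 + 1 by norm_num, Real.exp_add, Real.exp_add]
      nlinarith
    calc ((2 : ℝ) * 4) ^ N ≤ Real.exp 3 ^ N := pow_le_pow_left₀ (by norm_num) this N
      _ = _ := by rw [← Real.exp_nat_mul]; ring_nf
  calc _ = ((2 : ℝ) ^ N * 4 ^ N) * (c / N) ^ ⌊η * N - 3⌋₊ := by ring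
    _ ≤ Real.exp (3 * N) * Real.exp (-(B * N)) := by gcongr
    _ ≤ _ := by
        rw [← Real.exp_add]
        apply Real.exp_le_exp.2
        nlinarith

/-- The constants are chosen in order: `κ` proportional to `ε`, `η` to `κ`, `κ₁` to `κ * η`, then `m
= ⌊η * N - 3⌋` and `τ = exp (-(β * N))`. The value `β = c * κ₁ ^ 2 / 20` works because `e * (e - 1)
/ 2 ≥ (κ₁ * N) ^ 2 / 20` as soon as `e ≥ κ₁ * N / 3 ≥ 10`. -/
theorem eventually_upperParams {c ε : ℝ} (hc : 263 / 20 ≤ c) (hε : 0 < ε) (hε1 : ε ≤ 1) :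
    ∀ᶠ N : ℕ in atTop, ∃ κ η κ₁ τ m, UpperParams c ε κ η κ₁ τ N ⌈9 / 20 * (N : ℝ)⌉₊ m := by
  have hc0 : 0 < c := by linarith
  set κ := ε / (8 * (5 * c + 10)) with hκ
  have hκ0 : 0 < κ := by positivity
  have hκe : (5 * c + 10) * κ = ε / 8 := by rw [hκ]; field_simp
  set η := 9 * κ / (80 * c) with hη
  have hη0 : 0 < η := by positivity
  have hηe : c * η = 9 / 80 * κ := by rw [hη]; field_simp
  have hl4 : 0 < Real.log 4 := Real.log_pos (by norm_num)
  set κ₁ := κ * η / (2 * Real.log 4) with hκ₁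
  have hκ₁0 : 0 < κ₁ := by positivity
  have hκ₁e : κ₁ * Real.log 4 = κ * η / 2 := by rw [hκ₁]; field_simp
  set β := c * κ₁ ^ 2 / 20 with hβ
  have hβ0 : 0 < β := by positivity
  set l := Real.log (16 / ε) with hl
  have hl0 : Real.exp l = 16 / ε := Real.exp_log (by positivity)
  have small : ∀ y, l ≤ y → Real.exp (-y) ≤ ε / 16 := by
    intro y hy
    rw [Real.exp_neg, inv_le_comm₀ (Real.exp_pos _) (by positivity), inv_div, ← hl0]
    exact Real.exp_le_exp.2 hy
  filter_upwards [eventually_natCast_ge 1, eventually_natCast_ge (c / κ),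
    eventually_natCast_ge (2 * c), eventually_natCast_ge (3 / η), eventually_natCast_ge (30 / κ₁),
    eventually_natCast_ge (l / β), eventually_natCast_ge l, eventually_natCast_ge (c * l),
    eventually_natCast_ge ((l / ε + 1) * (20 / 9)),
    eventually_pow_le hc0 hη0 (2 + β), eventually_pow_le hc0 hη0 (1 + 2 * c)]
    with N h1 h2 h3 h4 h5 h6 h7 h8 h9 h10 h11
  have hN : (0 : ℝ) < N := by linarith
  have hp0 : 0 ≤ c / N := by positivity
  have hp2 : c / N ≤ 1 / 2 := by rw [div_le_iff₀ hN]; linarith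
  have hsm := small N h7
  refine ⟨κ, η, κ₁, Real.exp (-(β * N)), ⌊η * N - 3⌋₊, hc0, by exact_mod_cast hN, ?_, hκ0, ?_,
    hη0, hηe.le, hε1, hκe.le, ?_, ?_, hκ₁0, hκ₁e.le, Real.exp_pos _, ?_, ?_, ?_, ?_, ?_, ?_⟩
  · rw [div_le_iff₀ hκ0] at h2
    rw [div_le_iff₀ hN]; linarith
  · nlinarith
  · have h := Nat.le_ceil (9 / 20 * (N : ℝ))
    have h' := mul_le_mul_of_nonneg_left h hp0
    have e : c / N * (9 / 20 * N) = 9 / 20 * c := by field_simp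
    linarith
  · rw [div_le_iff₀ hη0] at h4
    have := Nat.floor_le (a := η * N - 3) (by linarith)
    linarith
  · intro e he
    refine (one_sub_pow_le_exp (by linarith) _).trans (Real.exp_le_exp.2 (neg_le_neg ?_))
    rw [div_le_iff₀ hκ₁0] at h5
    have he0 : (10 : ℝ) ≤ κ₁ * N / 3 := by linarith
    rw [Nat.cast_choose_two]
    have i1 : (κ₁ * N) ^ 2 / 20 ≤ (e : ℝ) * (e - 1) / 2 := by
      have i2 : κ₁ * N / 3 * (κ₁ * N / 3 - 1) ≤ (e : ℝ) * (e - 1) :=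
        mul_le_mul he (by linarith) (by linarith) (by positivity)
      nlinarith
    calc β * N = c / N * ((κ₁ * N) ^ 2 / 20) := by rw [hβ]; field_simp
      _ ≤ _ := mul_le_mul_of_nonneg_left i1 hp0
  · refine small _ ?_
    rwa [div_le_iff₀ hβ0, mul_comm] at h6
  · refine h10.trans ?_
    calc Real.exp (-((2 + β) * N)) = Real.exp (-N) * (Real.exp (-(β * N)) * Real.exp (-N)) := by
          rw [← Real.exp_add, ← Real.exp_add]; ring_nf
      _ ≤ _ := mul_le_mul_of_nonneg_right (by linarith) (by positivity)
  · refine h11.trans ?_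
    have i1 : Real.exp (-(2 * c * N)) ≤ (1 - c / N) ^ (N * N) := by
      calc Real.exp (-(2 * c * N)) = Real.exp (-(2 * (c / N))) ^ (N * N) := by
            rw [← Real.exp_nat_mul]
            congr 1
            push_cast
            field_simp
        _ ≤ _ := pow_le_pow_left₀ (Real.exp_pos _).le (exp_neg_two_mul_le_one_sub hp0 hp2) _
    calc Real.exp (-((1 + 2 * c) * N)) = Real.exp (-N) * Real.exp (-(2 * c * N)) := by
          rw [← Real.exp_add]; ring_nf
      _ ≤ _ := mul_le_mul (by linarith) i1 (Real.exp_pos _).le (by positivity)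
  · have h := Nat.le_ceil (9 / 20 * (N : ℝ))
    have i1 : l / ε ≤ (⌈9 / 20 * (N : ℝ)⌉₊ : ℝ) - 1 := by linarith
    rw [div_le_iff₀ hε] at i1
    have i2 : Real.exp l ≤ Real.exp (ε * ((⌈9 / 20 * (N : ℝ)⌉₊ : ℝ) - 1)) :=
      Real.exp_le_exp.2 (by linarith)
    rw [hl0] at i2
    calc (1 : ℝ) ≤ ε / 8 * (16 / ε) := by
          rw [show ε / 8 * (16 / ε) = 2 by field_simp; norm_num]; norm_num
      _ ≤ _ := by gcongr
  · intro n hn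
    have i1 : l ≤ n := by
      refine le_trans ?_ hn
      rw [le_div_iff₀ hc0]; linarith
    have i2 : (1 / 4 : ℝ) ≤ Real.exp (-1) := by
      rw [Real.exp_neg, one_div, inv_le_inv₀ (by norm_num) (Real.exp_pos _)]
      linarith [Real.exp_one_lt_d9]
    calc (1 / 4 : ℝ) ^ n ≤ Real.exp (-1) ^ n := pow_le_pow_left₀ (by norm_num) i2 n
      _ = Real.exp (-n) := by rw [← Real.exp_nat_mul]; ring_nf
      _ ≤ _ := by linarith [small n i1]

theorem edgeProb_eq {c : ℝ} (hc : 0 ≤ c) (hN : 0 < N) (h : c ≤ N) :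
    (edgeProb c N : ℝ) = c / N := by
  have hN' : (0 : ℝ) < N := by exact_mod_cast hN
  unfold edgeProb
  rw [Set.projIcc_of_mem zero_le_one ⟨by positivity, by rw [div_le_one hN']; exact h⟩]

/-- The upper bound for the expected size of the search tree. -/
theorem expected_nodes_upper {c : ℝ} (hc : 263 / 20 ≤ c) {ε : ℝ} (hε : 0 < ε) :
    ∀ᶠ N : ℕ in atTop, ∀ ord : ColorOrder N, expected Outcome.nodes c N ord ≤
      ENNReal.ofReal (Real.exp (N * (omegaH c + ε))) := by
  have hc0 : 0 < c := by linarith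
  have hω := omegaH_nonneg hc0
  set δ := min (ε / 2) 1 with hδ
  have hδ0 : 0 < δ := lt_min (by linarith) one_pos
  have hδ1 : δ ≤ 1 := min_le_right _ _
  have hδε : δ ≤ ε / 2 := min_le_left _ _
  have hpoly : ∀ᶠ N : ℕ in atTop, (N : ℝ) + 1 + 2 * N * (2 + N * Real.exp (c / 2)) ≤
      Real.exp (ε / 2 * N) := by
    have h1 : (fun x : ℝ => x + 1 + 2 * x * (2 + x * Real.exp (c / 2))) =o[atTop]
        fun x => Real.exp (ε / 2 * x) := by
      have h2 := isLittleO_pow_exp_pos_mul_atTop 2 (by linarith : 0 < ε / 2)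
      have h3 := isLittleO_pow_exp_pos_mul_atTop 1 (by linarith : 0 < ε / 2)
      have h4 := isLittleO_pow_exp_pos_mul_atTop 0 (by linarith : 0 < ε / 2)
      have := ((h2.const_mul_left (2 * Real.exp (c / 2))).add (h3.const_mul_left 5)).add h4
      refine this.congr_left fun x => ?_
      ring
    have h5 := tendsto_natCast_atTop_atTop.eventually (h1.bound one_pos)
    filter_upwards [h5] with N hN
    rw [one_mul, Real.norm_eq_abs, Real.norm_eq_abs, abs_of_pos (Real.exp_pos _)] at hN
    exact (le_abs_self _).trans hN
  filter_upwards [eventually_upperParams hc hδ0 hδ1, hpoly, eventually_natCast_ge 1,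
    eventually_natCast_ge c] with N hP hpoly hN1 hNc ord
  obtain ⟨κ, η, κ₁, τ, m, P⟩ := hP
  have hN0 : 0 < N := P.N_pos
  refine (expected_nodes_le c ord).trans (ENNReal.ofReal_le_ofReal ?_)
  rw [edgeProb_eq hc0.le hN0 hNc]
  set s := Residual.initial N with hs
  have hcard : s.left.card = N := by simp [hs, Residual.initial]
  have h1 := mean_one_le P.p_nonneg P.p_le_one s
  rw [hcard] at h1
  have h2 := unitBound P s _ fun θ hθ => pot_initial_le (by linarith) hN0 hθ
  have hu : ∀ k, cnt s {k} = 0 := fun k => by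
    rw [hs, cnt_initial, if_neg]
    revert k; decide
  rw [unitFactor_of_no_unit hu, mul_one, hcard, shortFactor, shortCnt_initial, pow_zero] at h2
  have h3 : mean (c / N) decision s = mean (c / N) (decisionAbove ⌈9 / 20 * (N : ℝ)⌉₊) s +
      ∑ m ∈ Finset.range ⌈9 / 20 * (N : ℝ)⌉₊, mean (c / N) (decisionAt m) s := by
    rw [← mean_sum, ← mean_add]
    congr 1
    funext s'
    exact decision_eq _ s'
  have h4 : ∑ m ∈ Finset.range ⌈9 / 20 * (N : ℝ)⌉₊, mean (c / N) (decisionAt m) s ≤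
      N * Real.exp (c / 2) := by
    calc _ ≤ ∑ m ∈ Finset.range ⌈9 / 20 * (N : ℝ)⌉₊, Real.exp (c / 2) :=
          Finset.sum_le_sum fun m hm => mean_decisionAt_le_exp hc hNc
            (Nat.lt_ceil.1 (Finset.mem_range.1 hm)).le
      _ = ⌈9 / 20 * (N : ℝ)⌉₊ * Real.exp (c / 2) := by
          rw [Finset.sum_const, Finset.card_range, nsmul_eq_mul]
      _ ≤ _ := by
          refine mul_le_mul_of_nonneg_right ?_ (Real.exp_pos _).le
          exact_mod_cast Nat.ceil_le.2 (by linarith)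
  have h5 : mean (c / N) decision s ≤ (2 + N * Real.exp (c / 2)) *
      Real.exp (δ * N + N * omegaH c) := by
    rw [h3]
    have e1 : 1 ≤ Real.exp (δ * N + N * omegaH c) := Real.one_le_exp (by positivity)
    have e2 : N * Real.exp (c / 2) ≤ N * Real.exp (c / 2) * Real.exp (δ * N + N * omegaH c) :=
      le_mul_of_one_le_right (by positivity) e1
    have e3 : Real.exp (δ * N) * (1 + 1) * Real.exp (N * omegaH c) =
        2 * Real.exp (δ * N + N * omegaH c) := by rw [Real.exp_add]; ring
    rw [e3] at h2
    linarith
  have e1 : 1 ≤ Real.exp (δ * N + N * omegaH c) := Real.one_le_exp (by positivity)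
  calc _ ≤ (N : ℝ) + 1 + 2 * N * ((2 + N * Real.exp (c / 2)) *
        Real.exp (δ * N + N * omegaH c)) := by
        refine h1.trans ?_
        gcongr
    _ ≤ ((N : ℝ) + 1 + 2 * N * (2 + N * Real.exp (c / 2))) * Real.exp (δ * N + N * omegaH c) := by
        have : (N : ℝ) + 1 ≤ (N + 1) * Real.exp (δ * N + N * omegaH c) :=
          le_mul_of_one_le_right (by positivity) e1
        linarith
    _ ≤ Real.exp (ε / 2 * N) * Real.exp (ε / 2 * N + N * omegaH c) := by gcongr
    _ = _ := by rw [← Real.exp_add]; ring_nf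

end Dpll

/-! ### The threshold: monotonicity, attainment and numerical enclosure. -/

namespace Dpll

open MeasureTheory Filter Asymptotics
open scoped ENNReal Topology

theorem three_sub_exp_pos {x : ℝ} (h : 0 ≤ x) : 2 ≤ 3 - Real.exp (-x) := by
  have : Real.exp (-x) ≤ 1 := Real.exp_le_one_iff.2 (by linarith)
  linarith

theorem exponent_le_linear {c t : ℝ} (hc : 0 ≤ c) (h0 : 0 ≤ t) :
    exponent c t ≤ c / 6 * t ^ 2 - c / 3 * t - (1 - t) * Real.log 2 + Real.log 3 := by
  unfold exponent
  have h1 := three_sub_exp_pos (by positivity : 0 ≤ 2 * c * t / 3)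
  have := Real.log_le_log (by linarith : 0 < 3 - Real.exp (-(2 * c * t / 3)))
    (by linarith [Real.exp_pos (-(2 * c * t / 3))] : 3 - Real.exp (-(2 * c * t / 3)) ≤ 3)
  linarith

theorem exists_exponent_eq_omegaH {c : ℝ} (hc : 0 < c) :
    ∃ t ∈ Set.Icc (0 : ℝ) 1, exponent c t = omegaH c := by
  obtain ⟨t, ht, hmax⟩ := isCompact_Icc.exists_isMaxOn (Set.nonempty_Icc.2 zero_le_one)
    (exponent_continuousOn c hc)
  refine ⟨t, ht, le_antisymm (exponent_le_omegaH hc ht) ?_⟩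
  refine csSup_le ((Set.nonempty_Ioo.2 zero_lt_one).image _) ?_
  rintro _ ⟨x, hx, rfl⟩
  exact hmax (Set.Ioo_subset_Icc_self hx)

/-- Adding `c / 6` turns the quadratic part into `c / 6 * (1 - t) ^ 2`, which is nondecreasing in
`c`, as is the logarithm. At `t = 0` the former increases strictly, for `t > 0` the latter. -/
theorem exponent_add_strictMono {c c' t : ℝ} (hc : 0 < c) (h : c < c') (ht : t ∈ Set.Icc (0 : ℝ) 1) :
    exponent c t + c / 6 < exponent c' t + c' / 6 := by
  unfold exponent
  have h2 : c / 6 * (1 - t) ^ 2 ≤ c' / 6 * (1 - t) ^ 2 := by gcongr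
  have h1 := three_sub_exp_pos (x := 2 * c * t / 3) (by have := ht.1; positivity)
  rcases ht.1.eq_or_lt with h0 | h0
  · rw [← h0]; simp; linarith
  · have h3 : Real.exp (-(2 * c' * t / 3)) < Real.exp (-(2 * c * t / 3)) :=
      Real.exp_lt_exp.2 (by nlinarith)
    have h4 := Real.log_lt_log (by linarith : 0 < 3 - Real.exp (-(2 * c * t / 3)))
      (by linarith : 3 - Real.exp (-(2 * c * t / 3)) < 3 - Real.exp (-(2 * c' * t / 3)))
    linarith

/-- The square contributes at most `1 / 6` to the Lipschitz constant and the logarithm at most `2 /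
3`. -/
theorem exponent_add_le {c c' t : ℝ} (hc : 0 < c) (h : c ≤ c') (ht : t ∈ Set.Icc (0 : ℝ) 1) :
    exponent c' t + c' / 6 ≤ exponent c t + c / 6 + (c' - c) := by
  unfold exponent
  have h2 : (c' - c) / 6 * (1 - t) ^ 2 ≤ (c' - c) / 6 * 1 := by
    have := ht.1
    have := ht.2
    refine mul_le_mul_of_nonneg_left ?_ (by linarith)
    nlinarith
  have ht0 := ht.1
  have hc' : 0 < c' := by linarith
  have h1 := three_sub_exp_pos (x := 2 * c * t / 3) (by positivity)
  have h1' := three_sub_exp_pos (x := 2 * c' * t / 3) (by positivity)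
  set y := 3 - Real.exp (-(2 * c * t / 3)) with hy
  set y' := 3 - Real.exp (-(2 * c' * t / 3)) with hy'
  have h3 : Real.log y' - Real.log y ≤ y' / y - 1 := by
    rw [← Real.log_div (by linarith) (by linarith)]
    exact Real.log_le_sub_one_of_pos (by positivity)
  have h4 : y' - y ≤ 2 * (c' - c) / 3 := by
    have e : y' - y = Real.exp (-(2 * c * t / 3)) * (1 - Real.exp (-(2 * (c' - c) * t / 3))) := by
      rw [mul_sub, ← Real.exp_add, hy, hy']; ring_nf
    rw [e]
    have e1 : Real.exp (-(2 * c * t / 3)) ≤ 1 := by linarith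
    have e2 := Real.add_one_le_exp (-(2 * (c' - c) * t / 3))
    have e3 : Real.exp (-(2 * (c' - c) * t / 3)) ≤ 1 := by
      apply Real.exp_le_one_iff.2
      have : 0 ≤ (c' - c) * t := mul_nonneg (by linarith) ht0
      linarith
    have e4 : (c' - c) * t ≤ c' - c := mul_le_of_le_one_right (by linarith) ht.2
    calc _ ≤ 1 * (1 - Real.exp (-(2 * (c' - c) * t / 3))) :=
          mul_le_mul_of_nonneg_right e1 (by linarith)
      _ ≤ _ := by linarith
  have h5 : y' / y - 1 ≤ 2 * (c' - c) / 3 := by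
    rw [div_sub_one (by linarith), div_le_iff₀ (by linarith)]
    nlinarith
  linarith

theorem omegaH_strictMonoOn : StrictMonoOn (fun c => omegaH c + c / 6) (Set.Ioi 0) := by
  intro c hc c' hc' h
  obtain ⟨t, ht, e⟩ := exists_exponent_eq_omegaH hc
  have h1 := exponent_add_strictMono hc h ht
  have h2 := exponent_le_omegaH hc' ht
  simp only
  linarith

theorem omegaH_continuousOn : ContinuousOn (fun c => omegaH c + c / 6) (Set.Ioi 0) := by
  have key : ∀ c : ℝ, 0 < c → ∀ c', c ≤ c' →
      |omegaH c + c / 6 - (omegaH c' + c' / 6)| ≤ |c - c'| := by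
    intro c hc c' h
    obtain ⟨t, ht, e⟩ := exists_exponent_eq_omegaH (hc.trans_le h)
    have h1 := exponent_add_le hc h ht
    have h2 := exponent_le_omegaH hc ht
    have h3 := omegaH_strictMonoOn.monotoneOn hc (hc.trans_le h : 0 < c') h
    rw [abs_of_nonpos (by linarith), abs_of_nonpos (by linarith)]
    linarith
  have : LipschitzOnWith 1 (fun c => omegaH c + c / 6) (Set.Ioi 0) := by
    refine LipschitzOnWith.of_dist_le_mul fun c hc c' hc' => ?_
    rw [NNReal.coe_one, one_mul, Real.dist_eq, Real.dist_eq]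
    rcases le_total c c' with h | h
    · exact key c hc c' h
    · rw [abs_sub_comm, abs_sub_comm c]
      exact key c' hc' c h
  exact this.continuousOn

/-- At `t = 1 / c ^ 2`, that is `θ = 1 / (3 * c)`, the terms of first order in `θ` cancel; the
branching term `9 * θ ^ 2 * log 2` exceeds the remaining loss `2 * θ ^ 2`. -/
theorem exponent_pos_of_small {c : ℝ} (hc : 1 ≤ c) : 0 < exponent c (1 / c ^ 2) := by
  have hc0 : 0 < c := by linarith
  set θ := 1 / (3 * c) with hθ
  have hθ0 : 0 < θ := by positivity
  have hθ1 : θ ≤ 1 / 3 := by rw [hθ, div_le_div_iff₀ (by positivity) (by norm_num)]; linarith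
  have e0 : 1 / c ^ 2 = 9 * θ ^ 2 := by rw [hθ]; field_simp; norm_num
  have e1 : 2 * c * (1 / c ^ 2) / 3 = 2 * θ := by rw [hθ]; field_simp
  have e2 : c / 3 * (1 / c ^ 2) = θ := by rw [hθ]; field_simp
  have e3 : 0 ≤ c / 6 * (1 / c ^ 2) ^ 2 := by positivity
  unfold exponent
  rw [e1, e2]
  have h1 : Real.exp (-(2 * θ)) ≤ 1 - 2 * θ + 2 * θ ^ 2 := by
    have := Real.exp_bound' (x := 2 * θ) (by linarith) (by linarith) (n := 1) one_pos
    rw [Real.exp_neg]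
    have h2 := Real.quadratic_le_exp_of_nonneg (x := 2 * θ) (by linarith)
    rw [inv_le_iff_one_le_mul₀ (Real.exp_pos _)]
    have h3 : 0 < 1 - 2 * θ + 2 * θ ^ 2 := by nlinarith [sq_nonneg (1 - θ)]
    calc (1 : ℝ) ≤ (1 - 2 * θ + 2 * θ ^ 2) * (1 + 2 * θ + (2 * θ) ^ 2 / 2) := by
          nlinarith [sq_nonneg (θ ^ 2)]
      _ ≤ _ := mul_le_mul_of_nonneg_left h2 h3.le
  set y := (3 - Real.exp (-(2 * θ))) / 2 with hy
  have hy1 : 1 + θ - θ ^ 2 ≤ y := by rw [hy]; linarith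
  have hy0 : 0 < y := by nlinarith
  have h4 : Real.log (3 - Real.exp (-(2 * θ))) = Real.log 2 + Real.log y := by
    rw [← Real.log_mul (by norm_num) hy0.ne', hy]; congr 1; ring
  have h5 := Real.one_sub_inv_le_log_of_pos hy0
  have h6 : θ - 2 * θ ^ 2 ≤ 1 - y⁻¹ := by
    have : y⁻¹ ≤ 1 - θ + 2 * θ ^ 2 := by
      rw [inv_le_iff_one_le_mul₀ hy0]
      have h3 : 0 < 1 - θ + 2 * θ ^ 2 := by nlinarith [sq_nonneg θ]
      calc (1 : ℝ) ≤ (1 - θ + 2 * θ ^ 2) * (1 + θ - θ ^ 2) := by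
            have : (1 - θ + 2 * θ ^ 2) * (1 + θ - θ ^ 2) = 1 + θ ^ 3 * (3 - 2 * θ) := by ring
            rw [this]
            have : 0 ≤ θ ^ 3 * (3 - 2 * θ) := mul_nonneg (by positivity) (by linarith)
            linarith
        _ ≤ _ := mul_le_mul_of_nonneg_left hy1 h3.le
    linarith
  rw [h4, e0]
  rw [e0] at e3
  have := Real.log_two_gt_d9
  nlinarith [mul_pos hθ0 hθ0]

/-- The maximum over the closed interval is positive, whereas `exponent` is `0` at `0` and at most
`log 3 - c / 6 < 0` at `1`. -/
theorem isGreatest_omegaH {c : ℝ} (hc : 263 / 20 ≤ c) :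
    IsGreatest (exponent c '' Set.Ioo 0 1) (omegaH c) := by
  have hc0 : 0 < c := by linarith
  obtain ⟨t, ht, e⟩ := exists_exponent_eq_omegaH hc0
  have hpos : 0 < omegaH c := (exponent_pos_of_small (by linarith)).trans_le
    (exponent_le_omegaH hc0 ⟨by positivity, by
      rw [div_le_one (by positivity)]; nlinarith⟩)
  refine ⟨⟨t, ⟨ht.1.lt_of_ne ?_, ht.2.lt_of_ne ?_⟩, e⟩, fun y hy => le_csSup
    (bddAbove_exponent hc0) hy⟩
  · rintro rfl
    rw [exponent_zero] at e
    linarith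
  · rintro rfl
    have := exponent_le_linear hc0.le (zero_le_one (α := ℝ))
    have := Real.log_three_lt_d9
    linarith

/-- Squaring `1 - x / 2 ≤ exp (-(x / 2))` gives a quadratic lower bound that is tangent at `x = 0`,
accurate enough for a numerical maximum. -/
theorem exp_tangent (z x : ℝ) (hx : x ≤ 2) : Real.exp (-z) * (1 - x / 2) ^ 2 ≤
    Real.exp (-(z + x)) := by
  have h1 : 1 - x / 2 ≤ Real.exp (-(x / 2)) := by linarith [Real.add_one_le_exp (-(x / 2))]
  have h2 : (1 - x / 2) ^ 2 ≤ Real.exp (-(x / 2)) ^ 2 := pow_le_pow_left₀ (by linarith) h1 2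
  rw [← Real.exp_nat_mul] at h2
  calc _ ≤ Real.exp (-z) * Real.exp ((2 : ℕ) * -(x / 2)) :=
        mul_le_mul_of_nonneg_left h2 (Real.exp_pos _).le
    _ = _ := by rw [← Real.exp_add]; push_cast; ring_nf

/-- Here `c = 13.1538`. Up to `t = 6 / 25` the exponential is bounded by `exp_tangent` at `t =
0.014885` and the logarithm by its tangent at `2.122369435`; a quadratic polynomial in `t` with
maximum near that point remains. Beyond `6 / 25` the bound of `exponent_le_linear` is convex in `t`,
so its endpoints suffice. -/
theorem omegaH_lower_end : omegaH (65769 / 5000) + (65769 / 5000) / 6 < 2 * Real.log 3 := by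
  obtain ⟨t, ht, e⟩ := exists_exponent_eq_omegaH (c := 65769 / 5000) (by norm_num)
  have hl3 := abs_le.1 Real.log_three_near_10
  have hl2 := abs_le.1 Real.log_two_near_10
  rw [← e]
  rcases le_total t (6 / 25) with h | h
  · unfold exponent
    have hz : (877630565 / 1000000000 : ℝ) ≤ Real.exp (-(130529542 / 1000000000)) := by
      rw [Real.exp_neg, le_inv_comm₀ (by norm_num) (Real.exp_pos _)]
      refine (Real.exp_bound' (by norm_num) (by norm_num) (n := 8) (by norm_num)).trans ?_
      norm_num [Finset.sum_range_succ, Nat.factorial]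
    have hx := exp_tangent (130529542 / 1000000000)
      (2 * (65769 / 5000) * (t - 14885 / 1000000) / 3) (by linarith)
    have hexp : 130529542 / 1000000000 + 2 * (65769 / 5000) * (t - 14885 / 1000000) / 3 =
        2 * (65769 / 5000) * t / 3 := by ring
    rw [hexp] at hx
    have hx2 := (mul_le_mul_of_nonneg_right hz (sq_nonneg
      (1 - 2 * (65769 / 5000) * (t - 14885 / 1000000) / 3 / 2))).trans hx
    set w := Real.exp (-(2 * (65769 / 5000) * t / 3)) with hw
    have hw1 : 2 ≤ 3 - w := three_sub_exp_pos (by have := ht.1; positivity)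
    have hlog : Real.log (3 - w) ≤ Real.log (2122369435 / 1000000000) +
        ((3 - w) / (2122369435 / 1000000000) - 1) := by
      have := Real.log_le_sub_one_of_pos (x := (3 - w) / (2122369435 / 1000000000))
        (by positivity)
      rw [Real.log_div (by linarith) (by norm_num)] at this
      linarith
    have hlog2 : Real.log (2122369435 / 1000000000) ≤ Real.log 2 + 593859421 / 10000000000 := by
      rw [show (2122369435 / 1000000000 : ℝ) = 2 * (2122369435 / 2000000000) by norm_num,
        Real.log_mul (by norm_num) (by norm_num)]
      have : Real.log (2122369435 / 2000000000) ≤ 593859421 / 10000000000 := by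
        rw [Real.log_le_iff_le_exp (by norm_num)]
        refine le_trans ?_ (Real.sum_le_exp_of_nonneg (by norm_num) 8)
        norm_num [Finset.sum_range_succ, Nat.factorial]
      linarith
    have ht0 := ht.1
    have hlt : t * Real.log 2 ≤ t * (287209 / 414355 + 1 / 10 ^ 10) :=
      mul_le_mul_of_nonneg_left (by linarith) ht0
    nlinarith [sq_nonneg (t - 14885085 / 1000000000)]
  · have h1 := exponent_le_linear (c := 65769 / 5000) (by norm_num) ht.1
    have h2 : 0 ≤ (t - 6 / 25) * (1 - t) := mul_nonneg (by linarith) (by linarith [ht.2])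
    nlinarith

/-- Here `c = 13.1539`, and the single test point `t = 0.014885` is close enough to the maximizer.
-/
theorem omegaH_upper_end : 2 * Real.log 3 < omegaH (131539 / 10000) + (131539 / 10000) / 6 := by
  have hl3 := abs_le.1 Real.log_three_near_10
  have hl2 := abs_le.1 Real.log_two_near_10
  have h := exponent_le_omegaH (c := 131539 / 10000) (t := 14885 / 1000000) (by norm_num)
    ⟨by norm_num, by norm_num⟩
  unfold exponent at h
  set w := Real.exp (-(2 * (131539 / 10000) * (14885 / 1000000) / 3)) with hw
  have hw1 : w ≤ 877630 / 1000000 := by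
    rw [hw, Real.exp_neg, inv_le_comm₀ (Real.exp_pos _) (by norm_num)]
    refine le_trans ?_ (Real.sum_le_exp_of_nonneg (by norm_num) 7)
    norm_num [Finset.sum_range_succ, Nat.factorial]
  have h2 : Real.log 2 + 593855 / 10000000 ≤ Real.log (3 - w) := by
    have h3 : Real.log (2 * (1061185 / 1000000)) ≤ Real.log (3 - w) :=
      Real.log_le_log (by norm_num) (by linarith)
    rw [Real.log_mul (by norm_num) (by norm_num)] at h3
    have h4 : 593855 / 10000000 ≤ Real.log (1061185 / 1000000) := by
      rw [Real.le_log_iff_exp_le (by norm_num)]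
      refine (Real.exp_bound' (by norm_num) (by norm_num) (n := 6) (by norm_num)).trans ?_
      norm_num [Finset.sum_range_succ, Nat.factorial]
    linarith
  nlinarith

/-- The threshold density. -/
theorem exists_threshold : ∃ cu : ℝ, 13.1538 ≤ cu ∧ cu < 13.1539 ∧
    (∀ c : ℝ, 0 < c → (omegaH c + c / 6 = 2 * Real.log 3 ↔ c = cu)) ∧
    ∀ c, cu < c → 2 * Real.log 3 < omegaH c + c / 6 := by
  have hcont : ContinuousOn (fun c => omegaH c + c / 6) (Set.Icc (65769 / 5000) (131539 / 10000)) :=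
    omegaH_continuousOn.mono fun c hc => lt_of_lt_of_le (by norm_num) hc.1
  obtain ⟨cu, hcu, e⟩ := intermediate_value_Icc (by norm_num) hcont
    ⟨omegaH_lower_end.le, omegaH_upper_end.le⟩
  have hpos : 0 < cu := lt_of_lt_of_le (by norm_num) hcu.1
  simp only at e
  refine ⟨cu, by norm_num; linarith [hcu.1], ?_, fun c hc => ⟨fun h => ?_, ?_⟩, fun c hc => ?_⟩
  · have : cu ≠ 131539 / 10000 := by
      rintro rfl
      linarith [omegaH_upper_end]
    have := lt_of_le_of_ne hcu.2 this
    norm_num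
    linarith
  · exact omegaH_strictMonoOn.injOn hc hpos (h.trans e.symm)
  · rintro rfl
    exact e
  · have := omegaH_strictMonoOn hpos (hpos.trans hc : 0 < c) hc
    simp only at this
    linarith

end Dpll

/-! ### Averages, independent hits and Jensen's inequality. -/

namespace Dpll

variable {N : ℕ}

/-- The arithmetic mean of a function over a finite set. -/
noncomputable def avg {α : Type*} (S : Finset α) (f : α → ℝ) : ℝ := (∑ x ∈ S, f x) / S.card

section avg

variable {α : Type*} {S : Finset α}

theorem avg_mono {f g : α → ℝ} (h : ∀ x ∈ S, f x ≤ g x) : avg S f ≤ avg S g :=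
  div_le_div_of_nonneg_right (Finset.sum_le_sum h) (Nat.cast_nonneg _)

theorem avg_const (hS : S.Nonempty) (b : ℝ) : avg S (fun _ => b) = b := by
  have : (S.card : ℝ) ≠ 0 := by exact_mod_cast hS.card_pos.ne'
  rw [avg, Finset.sum_const, nsmul_eq_mul]
  field_simp

theorem avg_add (f g : α → ℝ) : avg S (fun x => f x + g x) = avg S f + avg S g := by
  rw [avg, Finset.sum_add_distrib, add_div]; rfl

theorem avg_const_mul (b : ℝ) (f : α → ℝ) : avg S (fun x => b * f x) = b * avg S f := by
  rw [avg, ← Finset.mul_sum, mul_div_assoc]; rfl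

theorem exp_avg_le (hS : S.Nonempty) (f : α → ℝ) :
    Real.exp (avg S f) ≤ avg S fun x => Real.exp (f x) := by
  have h0 : (S.card : ℝ) ≠ 0 := by exact_mod_cast hS.card_pos.ne'
  have := convexOn_exp.map_sum_le (t := S) (w := fun _ => (S.card : ℝ)⁻¹) (p := f)
    (fun _ _ => by positivity) (by rw [Finset.sum_const, nsmul_eq_mul, mul_inv_cancel₀ h0])
    (fun _ _ => Set.mem_univ _)
  simp only [smul_eq_mul, ← Finset.mul_sum] at this
  unfold avg
  rwa [div_eq_inv_mul, div_eq_inv_mul]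

end avg

open Classical in
/-- The expectation of `f`, if each element `w` of `S` is drawn with probability `r w`. -/
noncomputable def bmean {ι : Type*} (r : ι → ℝ) (S : Finset ι) (f : Finset ι → ℝ) : ℝ :=
  ∑ A ∈ S.powerset, (∏ w ∈ S, if w ∈ A then r w else 1 - r w) * f A

section bmean

variable {ι : Type*} {r : ι → ℝ} {S : Finset ι}

theorem bmean_const (r : ι → ℝ) (S : Finset ι) (b : ℝ) : bmean r S (fun _ => b) = b := by
  rw [bmean, ← Finset.sum_mul, sum_powerset_prod_ite]
  simp

theorem bmean_congr {f g : Finset ι → ℝ} (h : ∀ A ⊆ S, f A = g A) : bmean r S f = bmean r S g :=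
  Finset.sum_congr rfl fun A hA => by rw [h A (Finset.mem_powerset.1 hA)]

theorem bmean_add (f g : Finset ι → ℝ) :
    bmean r S (fun A => f A + g A) = bmean r S f + bmean r S g := by
  simp only [bmean, mul_add, Finset.sum_add_distrib]

theorem bmean_const_mul (b : ℝ) (f : Finset ι → ℝ) :
    bmean r S (fun A => b * f A) = b * bmean r S f := by
  rw [bmean, bmean, Finset.mul_sum]
  exact Finset.sum_congr rfl fun A _ => by ring

open Classical in
theorem bmean_insert {x : ι} (hx : x ∉ S) (f : Finset ι → ℝ) :
    bmean r (insert x S) f = (1 - r x) * bmean r S f + r x * bmean r S fun A => f (insert x A) := by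
  rw [bmean, Finset.sum_powerset_insert hx, bmean, bmean, Finset.mul_sum, Finset.mul_sum]
  congr 1
  · refine Finset.sum_congr rfl fun A hA => ?_
    rw [Finset.prod_insert hx, if_neg fun h => hx (Finset.mem_powerset.1 hA h), mul_assoc]
  · refine Finset.sum_congr rfl fun A hA => ?_
    rw [Finset.prod_insert hx, if_pos (Finset.mem_insert_self _ _), mul_assoc]
    congr 2
    refine Finset.prod_congr rfl fun w hw => ?_
    have hwx : w ≠ x := fun h => hx (h ▸ hw)
    simp [Finset.mem_insert, hwx]

open Classical in
-- Square of the mean plus variance of a sum of independent terms; the offset `b` carries the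
-- induction.
theorem bmean_sq (r : ι → ℝ) (S : Finset ι) (g : ι → ℝ) (b : ℝ) :
    bmean r S (fun A => (b + ∑ w ∈ S, if w ∈ A then g w else 0) ^ 2) =
      (b + ∑ w ∈ S, r w * g w) ^ 2 + ∑ w ∈ S, r w * (1 - r w) * g w ^ 2 := by
  induction S using Finset.induction_on generalizing b with
  | empty => simp [bmean]
  | insert x S hx ih =>
    rw [bmean_insert hx, Finset.sum_insert hx, Finset.sum_insert hx]
    have e1 : bmean r S (fun A => (b + ∑ w ∈ insert x S, if w ∈ A then g w else 0) ^ 2) =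
        bmean r S (fun A => (b + ∑ w ∈ S, if w ∈ A then g w else 0) ^ 2) := by
      refine bmean_congr fun A hA => ?_
      rw [Finset.sum_insert hx, if_neg fun h => hx (hA h), zero_add]
    have e2 : bmean r S (fun A => (b + ∑ w ∈ insert x S, if w ∈ insert x A then g w else 0) ^ 2) =
        bmean r S (fun A => (b + g x + ∑ w ∈ S, if w ∈ A then g w else 0) ^ 2) := by
      refine bmean_congr fun A hA => ?_
      have e3 : (∑ w ∈ S, if w ∈ insert x A then g w else 0) = ∑ w ∈ S, if w ∈ A then g w else 0 := by
        refine Finset.sum_congr rfl fun w hw => ?_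
        have hwx : w ≠ x := fun h => hx (h ▸ hw)
        simp [Finset.mem_insert, hwx]
      rw [Finset.sum_insert hx, if_pos (Finset.mem_insert_self _ _), e3, add_assoc]
    rw [e1, e2, ih, ih]
    ring

theorem exp_bmean_le (h0 : ∀ w, 0 ≤ r w) (h1 : ∀ w, r w ≤ 1) (f : Finset ι → ℝ) :
    Real.exp (bmean r S f) ≤ bmean r S fun A => Real.exp (f A) := by
  classical
  have := convexOn_exp.map_sum_le (t := S.powerset)
    (w := fun A => ∏ w ∈ S, if w ∈ A then r w else 1 - r w) (p := f)
    (fun A _ => Finset.prod_nonneg fun w _ => by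
      split_ifs
      · exact h0 w
      · linarith [h1 w])
    (by rw [sum_powerset_prod_ite]; simp) (fun _ _ => Set.mem_univ _)
  simp only [smul_eq_mul] at this
  exact this

end bmean

/-- The probability that a list is hit, if the hits are weighted with `x`. -/
noncomputable def tiltProb (p : ℝ) (x : Finset Color → ℝ) (k : Color) (M : Finset Color) : ℝ :=
  p * x (M.erase k) / (p * x (M.erase k) + (1 - p) * x M)

/-- Jensen's inequality for the weighted step. -/
theorem le_step_listWt_exp {p : ℝ} (h0 : 0 ≤ p) (h1 : p < 1) {x : Finset Color → ℝ}
    (hx0 : ∀ M, 0 ≤ x M) (hx : ∀ M, M ≠ ∅ → 0 < x M) {s : Residual N} (hs : ¬ s.Contradiction)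
    (v : Fin N) (k : Color) (f : Residual N → ℝ) :
    (∏ w ∈ s.left.erase v, (p * x ((s.avail w).erase k) + (1 - p) * x (s.avail w))) *
      Real.exp (bmean (fun w => tiltProb p x k (s.avail w)) (s.left.erase v)
        fun A => f (s.hit v k A)) ≤
      step p s v k (fun s' => listWt x s' * Real.exp (f s')) := by
  classical
  set r : Fin N → ℝ := fun w => tiltProb p x k (s.avail w) with hr
  set F : Fin N → ℝ := fun w => p * x ((s.avail w).erase k) + (1 - p) * x (s.avail w) with hF
  have hq : 0 < 1 - p := by linarith
  have hn1 : ∀ w, 0 ≤ p * x ((s.avail w).erase k) := fun w => mul_nonneg h0 (hx0 _)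
  have hn2 : ∀ w, 0 ≤ (1 - p) * x (s.avail w) := fun w => mul_nonneg hq.le (hx0 _)
  have hr0 : ∀ w, 0 ≤ r w := fun w => div_nonneg (hn1 w) (add_nonneg (hn1 w) (hn2 w))
  have hr1 : ∀ w, r w ≤ 1 := fun w => div_le_one_of_le₀ (by linarith [hn2 w])
    (add_nonneg (hn1 w) (hn2 w))
  have hFpos : ∀ w ∈ s.left, 0 < F w := fun w hw =>
    add_pos_of_nonneg_of_pos (hn1 w) (mul_pos hq (hx _ fun h => hs ⟨w, hw, h⟩))
  -- Weighting the lists by `x` and normalizing vertex by vertex leaves the hits independent, now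
  -- with probability `tiltProb`; Jensen's inequality is applied under this law, which is exact for
  -- the product of weights.
  refine (mul_le_mul_of_nonneg_left (exp_bmean_le hr0 hr1 _)
    (Finset.prod_nonneg fun w _ => add_nonneg (hn1 w) (hn2 w))).trans (le_of_eq ?_)
  rw [bmean, Finset.mul_sum, step]
  refine Finset.sum_congr rfl fun A hA => ?_
  rw [← mul_assoc, ← mul_assoc, ← Finset.prod_mul_distrib, listWt]
  congr 1
  rw [Residual.hit_left, ← Finset.prod_mul_distrib]
  refine Finset.prod_congr rfl fun w hw => ?_
  have hne := (hFpos w (Finset.mem_of_mem_erase hw)).ne'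
  simp only [Residual.hit, hr, tiltProb]
  change F w * (if w ∈ A then _ / F w else 1 - _ / F w) = _
  split_ifs
  · rw [mul_div_cancel₀ _ hne]
  · rw [mul_sub, mul_div_cancel₀ _ hne, mul_one]
    simp only [hF]
    ring

/-- The sum over the remaining vertices of a function of their lists. -/
noncomputable def stat (φ : Finset Color → ℝ) (s : Residual N) : ℝ := ∑ w ∈ s.left, φ (s.avail w)

/-- Mean and variance from `bmean_sq`; the terms of the removed vertex `v` are subtracted from the
full sums. -/
theorem bmean_stat_sq_le {p D : ℝ} {hr φ : Finset Color → ℝ} {k : Color} (hp : 0 ≤ p)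
    (hD : ∀ M, hr M * (1 - hr M) * (φ (M.erase k) - φ M) ^ 2 ≤ p * D)
    (hD0 : 0 ≤ D) (s : Residual N) {v : Fin N} (hv : v ∈ s.left) (b : ℝ) :
    bmean (fun w => hr (s.avail w)) (s.left.erase v)
        (fun A => (stat φ (s.hit v k A) - b) ^ 2) ≤
      (stat φ s + stat (fun M => hr M * (φ (M.erase k) - φ M)) s - φ (s.avail v) -
        hr (s.avail v) * (φ ((s.avail v).erase k) - φ (s.avail v)) - b) ^ 2 + p * N * D := by
  classical
  have h2 := bmean_sq (fun w => hr (s.avail w)) (s.left.erase v)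
    (fun w => φ ((s.avail w).erase k) - φ (s.avail w)) (∑ w ∈ s.left.erase v, φ (s.avail w) - b)
  refine (Eq.trans (bmean_congr fun A _ => ?_) h2).trans_le ?_
  · congr 1
    rw [stat, Residual.hit_left, sub_add_eq_add_sub, ← Finset.sum_add_distrib]
    congr 1
    refine Finset.sum_congr rfl fun w _ => ?_
    simp only [Residual.hit]
    split_ifs <;> ring
  refine add_le_add (le_of_eq ?_) ?_
  · congr 1
    rw [stat, stat, ← Finset.add_sum_erase _ _ hv, ← Finset.add_sum_erase s.left
      (fun w => hr (s.avail w) * (φ ((s.avail w).erase k) - φ (s.avail w))) hv]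
    ring
  · calc _ ≤ ∑ w ∈ s.left.erase v, p * D := Finset.sum_le_sum fun w _ => hD _
      _ = (s.left.erase v).card * (p * D) := by rw [Finset.sum_const, nsmul_eq_mul]
      _ ≤ N * (p * D) := by
          refine mul_le_mul_of_nonneg_right ?_ (mul_nonneg hp hD0)
          exact_mod_cast (by simpa using Finset.card_le_univ (s.left.erase v))
      _ = _ := by ring

/-- The sum over the lists, arranged relative to a colour. -/
theorem stat_eq {s : Residual N} (hs : ¬ s.Contradiction) (φ : Finset Color → ℝ) (k : Color) :
    stat φ s = cnt s {k} * φ {k} + cnt s {k + 1} * φ {k + 1} + cnt s {k + 2} * φ {k + 2} +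
      (cnt s (Finset.univ.erase k) * φ (Finset.univ.erase k) +
        cnt s (Finset.univ.erase (k + 1)) * φ (Finset.univ.erase (k + 1)) +
        cnt s (Finset.univ.erase (k + 2)) * φ (Finset.univ.erase (k + 2))) +
      cnt s Finset.univ * φ Finset.univ := by
  rw [stat, sum_avail_alive hs φ, Fin.sum_univ_three, Fin.sum_univ_three]
  fin_cases k
  · rfl
  · change _ = cnt s {1} * φ {1} + cnt s {2} * φ {2} + cnt s {0} * φ {0} +
      (cnt s (Finset.univ.erase 1) * φ (Finset.univ.erase 1) +
        cnt s (Finset.univ.erase 2) * φ (Finset.univ.erase 2) +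
        cnt s (Finset.univ.erase 0) * φ (Finset.univ.erase 0)) + cnt s Finset.univ * φ Finset.univ
    ring
  · change _ = cnt s {2} * φ {2} + cnt s {0} * φ {0} + cnt s {1} * φ {1} +
      (cnt s (Finset.univ.erase 2) * φ (Finset.univ.erase 2) +
        cnt s (Finset.univ.erase 0) * φ (Finset.univ.erase 0) +
        cnt s (Finset.univ.erase 1) * φ (Finset.univ.erase 1)) + cnt s Finset.univ * φ Finset.univ
    ring

end Dpll

/-! ### The energy of an instance and the constants of the balanced trajectory. -/

namespace Dpll

variable {N : ℕ}

/-- The deviation of the lists without the colour `j` from the balanced case; the lists of a single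
colour are counted with the weight `R`. -/
noncomputable def dirWt (R : ℝ) (j : Color) (M : Finset Color) : ℝ :=
  if M.card = 1 then R * ((if j ∈ M then 1 else 0) - 1 / 3)
  else if M.card = 2 then (if j ∈ M then 0 else 1) - 1 / 3 else 0

/-- The indicator of the lists of `i` colours. -/
noncomputable def cardWt (i : ℕ) (M : Finset Color) : ℝ := if M.card = i then 1 else 0

/-- The share of the colour `j`. -/
noncomputable def share (j l : Color) : ℝ := (if j = l then 1 else 0) - 1 / 3

theorem dirWt_singleton (R : ℝ) (j l : Color) : dirWt R j {l} = R * share j l := by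
  simp [dirWt, share]

theorem card_erase_color (l : Color) : (Finset.univ.erase l).card = 2 := by revert l; decide

theorem dirWt_erase (R : ℝ) (j l : Color) : dirWt R j (Finset.univ.erase l) = share j l := by
  rw [dirWt, card_erase_color, if_neg (by norm_num), if_pos rfl, share]
  by_cases h : j = l
  · simp [h]
  · simp [h]

theorem dirWt_univ (R : ℝ) (j : Color) : dirWt R j Finset.univ = 0 := by simp [dirWt]

theorem cardWt_singleton (i : ℕ) (l : Color) : cardWt i {l} = if 1 = i then 1 else 0 := by
  simp [cardWt]

theorem cardWt_erase (i : ℕ) (l : Color) :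
    cardWt i (Finset.univ.erase l) = if 2 = i then 1 else 0 := by
  rw [cardWt, card_erase_color]

theorem cardWt_univ (i : ℕ) : cardWt i Finset.univ = if 3 = i then 1 else 0 := by
  simp [cardWt]

theorem share_sum (j k : Color) : share j k + share j (k + 1) + share j (k + 2) = 0 := by
  have h : ∀ j k : Color, (j = k ∧ ¬ j = k + 1 ∧ ¬ j = k + 2) ∨
    (¬ j = k ∧ j = k + 1 ∧ ¬ j = k + 2) ∨ (¬ j = k ∧ ¬ j = k + 1 ∧ j = k + 2) := by decide
  unfold share
  rcases h j k with ⟨h1, h2, h3⟩ | ⟨h1, h2, h3⟩ | ⟨h1, h2, h3⟩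
  · rw [if_pos h1, if_neg h2, if_neg h3]; norm_num
  · rw [if_neg h1, if_pos h2, if_neg h3]; norm_num
  · rw [if_neg h1, if_neg h2, if_pos h3]; norm_num

theorem abs_share_le (j l : Color) : |share j l| ≤ 2 / 3 := by
  unfold share
  split_ifs <;> norm_num [abs_le]

/-- The squared distance of an instance from the balanced one. -/
noncomputable def energy (R Cb : ℝ) (s : Residual N) : ℝ :=
  ∑ j, stat (dirWt R j) s ^ 2 + stat (cardWt 1) s ^ 2 + (stat (cardWt 3) s - Cb) ^ 2

theorem energy_nonneg (R Cb : ℝ) (s : Residual N) : 0 ≤ energy R Cb s := by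
  unfold energy; positivity

/-- The probabilities `hr k M` that a list `M` is hit, if a vertex receives the colour `k`. -/
structure HitProb (r₂ r₃ : ℝ) (hr : Color → Finset Color → ℝ) : Prop where
  nonneg : ∀ k M, 0 ≤ hr k M
  le_one : ∀ k M, hr k M ≤ 1
  unit : ∀ k, hr k {k} = 0
  pair : ∀ k j, j ≠ k → hr k (Finset.univ.erase j) = r₂
  triple : ∀ k, hr k Finset.univ = r₃

/-- The constants at two consecutive levels. -/
structure LevelStep (p ρ r₂ r₃ R R' μ lam Cb Cb' : ℝ) (N l : ℕ) : Prop where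
  p_nonneg : 0 ≤ p
  p_le : p ≤ 1
  ρ_ge : 1 ≤ ρ
  pN : p * N ≤ ρ
  r₂_nonneg : 0 ≤ r₂
  r₂_le : r₂ ≤ p
  r₃_nonneg : 0 ≤ r₃
  r₃_le : r₃ ≤ p
  R_nonneg : 0 ≤ R
  R_le : R ≤ ρ
  R'_nonneg : 0 ≤ R'
  R'_le : R' ≤ ρ
  hR : |R' - R| ≤ p * ρ ^ 2
  balance : R * (1 + lam) = μ + lam
  lam_eq : lam = r₂ * ((l - Cb) / 3)
  lam_nonneg : 0 ≤ lam
  lam_le : lam ≤ 1 / 2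
  μ_eq : μ = r₃ * Cb
  Cb'_eq : Cb' = (1 - r₃) * Cb
  Cb_le : Cb ≤ l

/-- The expected change of a linear statistic by the hits. -/
theorem stat_hitProb {r₂ r₃ : ℝ} {hr : Color → Finset Color → ℝ} (H : HitProb r₂ r₃ hr)
    {s : Residual N} (hs : ¬ s.Contradiction) (φ : Finset Color → ℝ) (k : Color) :
    stat (fun M => hr k M * (φ (M.erase k) - φ M)) s =
      r₂ * (cnt s (Finset.univ.erase (k + 1)) * (φ {k + 2} - φ (Finset.univ.erase (k + 1))) +
        cnt s (Finset.univ.erase (k + 2)) * (φ {k + 1} - φ (Finset.univ.erase (k + 2)))) +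
      r₃ * cnt s Finset.univ * (φ (Finset.univ.erase k) - φ Finset.univ) := by
  have h1 : ∀ k : Color, k + 1 ≠ k := by decide
  have h2 : ∀ k : Color, k + 2 ≠ k := by decide
  have e1 : ({k + 1} : Finset Color).erase k = {k + 1} :=
    Finset.erase_eq_of_notMem (by simp)
  have e2 : ({k + 2} : Finset Color).erase k = {k + 2} :=
    Finset.erase_eq_of_notMem (by simp)
  rw [stat_eq hs _ k, H.unit, e1, e2, H.pair k _ (h1 k), H.pair k _ (h2 k), H.triple,
    erase_erase_one, erase_erase_two, Finset.erase_idem]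
  ring

variable {p ρ r₂ r₃ R R' μ lam Cb Cb' : ℝ} {l : ℕ} {hr : Color → Finset Color → ℝ} {s : Residual N}

theorem hitProb_var_le (H : HitProb r₂ r₃ hr) (Q : LevelStep p ρ r₂ r₃ R R' μ lam Cb Cb' N l)
    {φ : Finset Color → ℝ} {k : Color} {D : ℝ} (hD0 : 0 ≤ D)
    (h2 : ∀ j, j ≠ k →
      (φ ((Finset.univ.erase j).erase k) - φ (Finset.univ.erase j)) ^ 2 ≤ D)
    (h3 : (φ (Finset.univ.erase k) - φ Finset.univ) ^ 2 ≤ D) (M : Finset Color) :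
    hr k M * (1 - hr k M) * (φ (M.erase k) - φ M) ^ 2 ≤ p * D := by
  have hp := Q.p_nonneg
  have hpD : 0 ≤ p * D := mul_nonneg hp hD0
  have gen : ∀ r x : ℝ, 0 ≤ r → r ≤ p → x ^ 2 ≤ D → r * (1 - r) * x ^ 2 ≤ p * D := by
    intro r x h0 h1 hx
    have h4 : r * (1 - r) ≤ p := (mul_le_of_le_one_right h0 (by linarith)).trans h1
    exact mul_le_mul h4 hx (sq_nonneg _) hp
  rcases list_cases M with rfl | ⟨j, rfl⟩ | ⟨j, rfl⟩ | rfl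
  · simpa using hpD
  · by_cases hj : j = k
    · rw [hj, H.unit]; simpa using hpD
    · rw [Finset.erase_eq_of_notMem (by simpa using Ne.symm hj)]; simpa using hpD
  · by_cases hj : j = k
    · rw [hj, Finset.erase_idem]; simpa using hpD
    · rw [H.pair k j hj]
      exact gen _ _ Q.r₂_nonneg Q.r₂_le (h2 j hj)
  · rw [H.triple]
    exact gen _ _ Q.r₃_nonneg Q.r₃_le h3

theorem stat_dirWt (hs : ¬ s.Contradiction) (R : ℝ) (j k : Color) : stat (dirWt R j) s =
    R * (cnt s {k} * share j k + cnt s {k + 1} * share j (k + 1) + cnt s {k + 2} * share j (k + 2)) +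
    (cnt s (Finset.univ.erase k) * share j k +
      cnt s (Finset.univ.erase (k + 1)) * share j (k + 1) +
      cnt s (Finset.univ.erase (k + 2)) * share j (k + 2)) := by
  rw [stat_eq hs _ k]
  simp only [dirWt_singleton, dirWt_erase, dirWt_univ]
  ring

theorem stat_cardWt_one (hs : ¬ s.Contradiction) (k : Color) :
    stat (cardWt 1) s = cnt s {k} + cnt s {k + 1} + cnt s {k + 2} := by
  rw [stat_eq hs _ k]
  simp only [cardWt_singleton, cardWt_erase, cardWt_univ]
  norm_num

theorem stat_cardWt_three (hs : ¬ s.Contradiction) : stat (cardWt 3) s = cnt s Finset.univ := by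
  rw [stat_eq hs _ 0]
  simp only [cardWt_singleton, cardWt_erase, cardWt_univ]
  norm_num

theorem card_left_eq_cnt (hs : ¬ s.Contradiction) (k : Color) : (s.left.card : ℝ) =
    cnt s {k} + cnt s {k + 1} + cnt s {k + 2} + (cnt s (Finset.univ.erase k) +
      cnt s (Finset.univ.erase (k + 1)) + cnt s (Finset.univ.erase (k + 2))) +
      cnt s Finset.univ := by
  have := stat_eq hs (fun _ => 1) k
  simp only [stat, Finset.sum_const, nsmul_eq_mul, mul_one] at this
  exact this

theorem abs_le_of_sq_le {x G F : ℝ} (hG : 0 ≤ G) (hF : G ^ 2 = F) (h : x ^ 2 ≤ F) : |x| ≤ G :=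
  abs_le_of_sq_le_sq (hF ▸ h) hG

theorem energy_bounds (R Cb : ℝ) (s : Residual N) {G : ℝ} (hG : 0 ≤ G)
    (hF : G ^ 2 = energy R Cb s) : (∀ j, |stat (dirWt R j) s| ≤ G) ∧ |stat (cardWt 1) s| ≤ G ∧
      |stat (cardWt 3) s - Cb| ≤ G := by
  have h0 : ∀ j, 0 ≤ stat (dirWt R j) s ^ 2 := fun j => sq_nonneg _
  have h1 := sq_nonneg (stat (cardWt 1) s)
  have h2 := sq_nonneg (stat (cardWt 3) s - Cb)
  have h3 : ∀ j, stat (dirWt R j) s ^ 2 ≤ ∑ j, stat (dirWt R j) s ^ 2 := fun j =>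
    Finset.single_le_sum (f := fun j => stat (dirWt R j) s ^ 2) (fun j _ => h0 j) (Finset.mem_univ j)
  have h4 : 0 ≤ ∑ j, stat (dirWt R j) s ^ 2 := Finset.sum_nonneg fun j _ => h0 j
  refine ⟨fun j => abs_le_of_sq_le hG hF ?_, abs_le_of_sq_le hG hF ?_, abs_le_of_sq_le hG hF ?_⟩
  · unfold energy; linarith [h3 j]
  · unfold energy; linarith
  · unfold energy; linarith

/-- The number of lists without the colour `j` is close to its balanced value. -/
theorem abs_cnt_erase_sub_le (Q : LevelStep p ρ r₂ r₃ R R' μ lam Cb Cb' N l)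
    (hs : ¬ s.Contradiction) (hl : s.left.card = l) {G : ℝ} (hG : 0 ≤ G)
    (hF : G ^ 2 = energy R Cb s) (j : Color) :
    |(cnt s (Finset.univ.erase j) : ℝ) - (l - Cb) / 3| ≤ (ρ + 2) * G := by
  obtain ⟨h1, h2, h3⟩ := energy_bounds R Cb s hG hF
  have hW := h1 j
  rw [stat_dirWt hs R j j] at hW
  rw [stat_cardWt_one hs j] at h2
  rw [stat_cardWt_three hs] at h3
  have hc := card_left_eq_cnt hs j
  rw [hl] at hc
  have s1 : share j j = 2 / 3 := by rw [share, if_pos rfl]; norm_num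
  have s2 : share j (j + 1) = -(1 / 3) := by
    rw [share, if_neg ((by decide : ∀ j : Color, ¬ j = j + 1) j)]; norm_num
  have s3 : share j (j + 2) = -(1 / 3) := by
    rw [share, if_neg ((by decide : ∀ j : Color, ¬ j = j + 2) j)]; norm_num
  rw [s1, s2, s3] at hW
  have n0 : (0 : ℝ) ≤ cnt s {j} := Nat.cast_nonneg _
  have n1 : (0 : ℝ) ≤ cnt s {j + 1} := Nat.cast_nonneg _
  have n2 : (0 : ℝ) ≤ cnt s {j + 2} := Nat.cast_nonneg _
  set x := (cnt s {j} : ℝ) * (2 / 3) + cnt s {j + 1} * -(1 / 3) + cnt s {j + 2} * -(1 / 3) with hx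
  rw [abs_of_nonneg (by linarith)] at h2
  have hxG : |x| ≤ G := abs_le.2 ⟨by linarith, by linarith⟩
  have hRx : |R * x| ≤ ρ * G := by
    rw [abs_mul, abs_of_nonneg Q.R_nonneg]
    exact mul_le_mul Q.R_le hxG (abs_nonneg _) (by linarith [Q.ρ_ge])
  have i1 := abs_le.1 hW
  have i2 := abs_le.1 hRx
  have i3 := abs_le.1 h3
  refine abs_le.2 ⟨?_, ?_⟩ <;> linarith

end Dpll

/-! ### Expected change of the energy by one step. -/

namespace Dpll

variable {N : ℕ}

variable {p ρ r₂ r₃ R R' μ lam Cb Cb' : ℝ} {l : ℕ} {hr : Color → Finset Color → ℝ} {s : Residual N}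

theorem dirWt_change (R R' : ℝ) (j : Color) (M : Finset Color) :
    ∃ e, |e| ≤ 2 / 3 ∧ dirWt R' j M = dirWt R j M + (R' - R) * e := by
  rcases list_cases M with rfl | ⟨i, rfl⟩ | ⟨i, rfl⟩ | rfl
  · exact ⟨0, by norm_num, by simp [dirWt]⟩
  · exact ⟨share j i, abs_share_le j i, by rw [dirWt_singleton, dirWt_singleton]; ring⟩
  · exact ⟨0, by norm_num, by rw [dirWt_erase, dirWt_erase]; ring⟩
  · exact ⟨0, by norm_num, by rw [dirWt_univ, dirWt_univ]; ring⟩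

theorem exists_erase_erase {i k : Color} (h : i ≠ k) :
    ∃ i', (Finset.univ.erase i).erase k = {i'} := by
  revert i k; decide

theorem abs_dirWt_le (Q : LevelStep p ρ r₂ r₃ R R' μ lam Cb Cb' N l) (j : Color)
    (M : Finset Color) : |dirWt R j M| ≤ 2 / 3 * ρ := by
  have hρ := Q.ρ_ge
  rcases list_cases M with rfl | ⟨i, rfl⟩ | ⟨i, rfl⟩ | rfl
  · simp only [dirWt, Finset.card_empty]; norm_num; linarith
  · rw [dirWt_singleton, abs_mul, abs_of_nonneg Q.R_nonneg, mul_comm]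
    exact mul_le_mul (abs_share_le _ _) Q.R_le Q.R_nonneg (by norm_num)
  · rw [dirWt_erase]; linarith [abs_share_le j i]
  · rw [dirWt_univ, abs_zero]; linarith

theorem dirWt_erase_sub (Q : LevelStep p ρ r₂ r₃ R R' μ lam Cb Cb' N l) {i k : Color} (j : Color)
    (h : i ≠ k) : |dirWt R' j ((Finset.univ.erase i).erase k) - dirWt R' j (Finset.univ.erase i)| ≤
      ρ + 1 := by
  obtain ⟨i', hi⟩ := exists_erase_erase h
  rw [hi, dirWt_singleton, dirWt_erase]
  have h1 : |R' * share j i'| ≤ ρ * (2 / 3) := by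
    rw [abs_mul, abs_of_nonneg Q.R'_nonneg]
    exact mul_le_mul Q.R'_le (abs_share_le _ _) (abs_nonneg _) (by linarith [Q.ρ_ge])
  have := Q.ρ_ge
  exact (abs_sub _ _).trans (by linarith [abs_share_le j i])

theorem abs_hit_dirWt_le (H : HitProb r₂ r₃ hr) (Q : LevelStep p ρ r₂ r₃ R R' μ lam Cb Cb' N l)
    (j k : Color) (M : Finset Color) :
    |hr k M * (dirWt R' j (M.erase k) - dirWt R' j M)| ≤ p * (ρ + 1) := by
  have hρ := Q.ρ_ge
  have hp := Q.p_nonneg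
  have h0 : 0 ≤ p * (ρ + 1) := mul_nonneg hp (by linarith)
  rcases list_cases M with rfl | ⟨i, rfl⟩ | ⟨i, rfl⟩ | rfl
  · simpa using h0
  · by_cases h : k = i
    · rw [← h, H.unit]; simpa using h0
    · rw [Finset.erase_eq_of_notMem (by simpa using h)]; simpa using h0
  · by_cases h : i = k
    · rw [h, Finset.erase_idem]; simpa using h0
    · rw [H.pair k i h, abs_mul, abs_of_nonneg Q.r₂_nonneg]
      exact mul_le_mul Q.r₂_le (dirWt_erase_sub Q j h) (abs_nonneg _) hp
  · rw [H.triple, dirWt_erase, dirWt_univ, sub_zero, abs_mul, abs_of_nonneg Q.r₃_nonneg]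
    exact mul_le_mul Q.r₃_le ((abs_share_le j k).trans (by linarith)) (abs_nonneg _) hp

theorem abs_mul_three_le {x y z a b d : ℝ} (hx : |x| ≤ a) (hy : |y| ≤ b) (hz : |z| ≤ d) :
    |x * y * z| ≤ a * b * d := by
  have ha := (abs_nonneg x).trans hx
  have hb := (abs_nonneg y).trans hy
  rw [abs_mul, abs_mul]
  exact mul_le_mul (mul_le_mul hx hy (abs_nonneg _) ha) hz (abs_nonneg _) (mul_nonneg ha hb)

/-- The terms are the deviations of the counts from their balanced values (each at most a multiple
of `G`, and multiplied by a hit probability), the change from `R` to `R'`, and the possible hit of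
the removed vertex. -/
theorem abs_drift_error_le (Q : LevelStep p ρ r₂ r₃ R R' μ lam Cb Cb' N l) {G d₁ d₂ u E e T σ σ₁ σ₂ : ℝ}
    (hG : 0 ≤ G) (i1 : |d₁| ≤ (ρ + 2) * G) (i2 : |d₂| ≤ (ρ + 2) * G) (g3 : |u| ≤ G)
    (hEG : |E| ≤ G) (he : |e| ≤ 2 / 3) (a0 : |σ| ≤ 2 / 3) (a1 : |σ₁| ≤ 2 / 3) (a2 : |σ₂| ≤ 2 / 3)
    (h1 : |T| ≤ p * (ρ + 1)) :
    |r₂ * d₁ * (R' * σ₂ - σ₁) + r₂ * d₂ * (R' * σ₁ - σ₂) + r₃ * u * σ + (R' - R) * E -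
      (R' - R) * e - lam * (R' - R) * σ - T| ≤ 12 * ρ ^ 2 * p * (G + 1) := by
  have hρ := Q.ρ_ge
  have hp := Q.p_nonneg
  have hr₂ : |r₂| ≤ p := by rw [abs_of_nonneg Q.r₂_nonneg]; exact Q.r₂_le
  have hr₃ : |r₃| ≤ p := by rw [abs_of_nonneg Q.r₃_nonneg]; exact Q.r₃_le
  have hlam : |lam| ≤ 1 := by rw [abs_of_nonneg Q.lam_nonneg]; linarith [Q.lam_le]
  have hRσ : ∀ x y : ℝ, |x| ≤ 2 / 3 → |y| ≤ 2 / 3 → |R' * x - y| ≤ 4 / 3 * ρ := by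
    intro x y hx hy
    have : |R' * x| ≤ ρ * (2 / 3) := by
      rw [abs_mul, abs_of_nonneg Q.R'_nonneg]
      exact mul_le_mul Q.R'_le hx (abs_nonneg _) (by linarith)
    exact (abs_sub _ _).trans (by linarith)
  have hpG : 0 ≤ p * G := mul_nonneg hp hG
  have hb : p * ((ρ + 2) * G) * (4 / 3 * ρ) ≤ 4 * ρ ^ 2 * (p * G) := by
    have : (ρ + 2) * (4 / 3 * ρ) ≤ 4 * ρ ^ 2 := by nlinarith
    calc _ = ((ρ + 2) * (4 / 3 * ρ)) * (p * G) := by ring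
      _ ≤ _ := mul_le_mul_of_nonneg_right this hpG
  have b1 := (abs_mul_three_le hr₂ i1 (hRσ _ _ a2 a1)).trans hb
  have b2 := (abs_mul_three_le hr₂ i2 (hRσ _ _ a1 a2)).trans hb
  have hρ2 : ρ ≤ ρ ^ 2 := by nlinarith
  have hX : p * G ≤ ρ ^ 2 * (p * G) := le_mul_of_one_le_left hpG (by linarith)
  have hY : p * ρ ≤ p * ρ ^ 2 := mul_le_mul_of_nonneg_left hρ2 hp
  have hY' : p ≤ p * ρ := le_mul_of_one_le_right hp hρ
  have b3 := abs_mul_three_le hr₃ g3 a0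
  have b4 : |(R' - R) * E| ≤ ρ ^ 2 * (p * G) := by
    rw [abs_mul]
    calc |R' - R| * |E| ≤ (p * ρ ^ 2) * G :=
          mul_le_mul Q.hR hEG (abs_nonneg _) (mul_nonneg hp (sq_nonneg _))
      _ = _ := by ring
  have b5 : |(R' - R) * e| ≤ p * ρ ^ 2 * (2 / 3) := by
    rw [abs_mul]
    exact mul_le_mul Q.hR he (abs_nonneg _) (mul_nonneg hp (sq_nonneg _))
  have b6 := abs_mul_three_le hlam Q.hR a0
  have e7 : 12 * ρ ^ 2 * p * (G + 1) = 12 * (ρ ^ 2 * (p * G)) + 12 * (p * ρ ^ 2) := by ring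
  have e8 : p * (ρ + 1) = p * ρ + p := by ring
  rw [e8] at h1
  rw [e7]
  have t1 := abs_add_le (r₂ * d₁ * (R' * σ₂ - σ₁)) (r₂ * d₂ * (R' * σ₁ - σ₂))
  have t2 := abs_add_le (r₂ * d₁ * (R' * σ₂ - σ₁) + r₂ * d₂ * (R' * σ₁ - σ₂)) (r₃ * u * σ)
  have t3 := abs_add_le (r₂ * d₁ * (R' * σ₂ - σ₁) + r₂ * d₂ * (R' * σ₁ - σ₂) + r₃ * u * σ)
    ((R' - R) * E)
  have t4 := abs_sub (r₂ * d₁ * (R' * σ₂ - σ₁) + r₂ * d₂ * (R' * σ₁ - σ₂) + r₃ * u * σ +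
    (R' - R) * E) ((R' - R) * e)
  have t5 := abs_sub (r₂ * d₁ * (R' * σ₂ - σ₁) + r₂ * d₂ * (R' * σ₁ - σ₂) + r₃ * u * σ +
    (R' - R) * E - (R' - R) * e) (lam * (R' - R) * σ)
  have t6 := abs_sub (r₂ * d₁ * (R' * σ₂ - σ₁) + r₂ * d₂ * (R' * σ₁ - σ₂) + r₃ * u * σ +
    (R' - R) * E - (R' - R) * e - lam * (R' - R) * σ) T
  linarith

theorem abs_weighted_share_le {x y z G σ σ₁ σ₂ : ℝ} (hx : 0 ≤ x) (hy : 0 ≤ y) (hz : 0 ≤ z)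
    (hG : |x + y + z| ≤ G) (a0 : |σ| ≤ 2 / 3) (a1 : |σ₁| ≤ 2 / 3) (a2 : |σ₂| ≤ 2 / 3) :
    |x * σ + y * σ₁ + z * σ₂| ≤ G := by
  rw [abs_of_nonneg (by positivity)] at hG
  have a0 := abs_le.1 a0
  have a1 := abs_le.1 a1
  have a2 := abs_le.1 a2
  refine abs_le.2 ⟨?_, ?_⟩ <;> nlinarith

/-- With colour `k`, about `μ` full lists become lists without `k`, and `lam` lists of each of the
two other two-colour kinds become unit lists. The main terms add up to `(μ + lam - lam * R) * share
j k`, and `balance` says that this is `R * share j k`. A removed unit list `{k}` cancels it, so unit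
propagation has no first-order drift. -/
theorem dirWt_mean (H : HitProb r₂ r₃ hr) (Q : LevelStep p ρ r₂ r₃ R R' μ lam Cb Cb' N l)
    (hs : ¬ s.Contradiction) (hl : s.left.card = l) {G : ℝ} (hG : 0 ≤ G)
    (hF : G ^ 2 = energy R Cb s) (v : Fin N) (k j : Color) :
    ∃ τ, |τ| ≤ 12 * ρ ^ 2 * p * (G + 1) ∧
      stat (dirWt R' j) s + stat (fun M => hr k M * (dirWt R' j (M.erase k) - dirWt R' j M)) s -
        dirWt R' j (s.avail v) -
        hr k (s.avail v) * (dirWt R' j ((s.avail v).erase k) - dirWt R' j (s.avail v)) =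
      stat (dirWt R j) s + (R * share j k - dirWt R j (s.avail v)) + τ := by
  obtain ⟨g1, g2, g3⟩ := energy_bounds R Cb s hG hF
  have hρ := Q.ρ_ge
  have hp := Q.p_nonneg
  obtain ⟨e, he, hee⟩ := dirWt_change R R' j (s.avail v)
  have h1 := abs_hit_dirWt_le H Q j k (s.avail v)
  set T := hr k (s.avail v) * (dirWt R' j ((s.avail v).erase k) - dirWt R' j (s.avail v)) with hT
  have i1 := abs_cnt_erase_sub_le Q hs hl hG hF (k + 1)
  have i2 := abs_cnt_erase_sub_le Q hs hl hG hF (k + 2)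
  rw [hee, stat_hitProb H hs, stat_dirWt hs R' j k, stat_dirWt hs R j k]
  rw [stat_cardWt_one hs k] at g2
  rw [stat_cardWt_three hs] at g3
  simp only [dirWt_singleton, dirWt_erase, dirWt_univ]
  set m₁ : ℝ := (cnt s (Finset.univ.erase (k + 1)) : ℝ) with hm₁
  set m₂ : ℝ := (cnt s (Finset.univ.erase (k + 2)) : ℝ) with hm₂
  set C : ℝ := (cnt s Finset.univ : ℝ) with hC
  set E := (cnt s {k} : ℝ) * share j k + cnt s {k + 1} * share j (k + 1) +
    cnt s {k + 2} * share j (k + 2) with hE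
  have hEG : |E| ≤ G := abs_weighted_share_le (Nat.cast_nonneg _) (Nat.cast_nonneg _)
    (Nat.cast_nonneg _) g2 (abs_share_le _ _) (abs_share_le _ _) (abs_share_le _ _)
  set σ := share j k
  set σ₁ := share j (k + 1)
  set σ₂ := share j (k + 2)
  have hσ : σ + σ₁ + σ₂ = 0 := share_sum j k
  have a0 : |σ| ≤ 2 / 3 := abs_share_le j k
  have a1 : |σ₁| ≤ 2 / 3 := abs_share_le j (k + 1)
  have a2 : |σ₂| ≤ 2 / 3 := abs_share_le j (k + 2)
  set d₁ := m₁ - (l - Cb) / 3 with hd₁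
  set d₂ := m₂ - (l - Cb) / 3 with hd₂
  set u := C - Cb with hu
  refine ⟨r₂ * d₁ * (R' * σ₂ - σ₁) + r₂ * d₂ * (R' * σ₁ - σ₂) + r₃ * u * σ + (R' - R) * E -
    (R' - R) * e - lam * (R' - R) * σ - T, ?_, ?_⟩
  · exact abs_drift_error_le Q hG i1 i2 g3 hEG he a0 a1 a2 h1
  · have hb := Q.balance
    have hle := Q.lam_eq
    have hμ := Q.μ_eq
    have e1 : m₁ = d₁ + (l - Cb) / 3 := by rw [hd₁]; ring
    have e2 : m₂ = d₂ + (l - Cb) / 3 := by rw [hd₂]; ring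
    have e3 : C = u + Cb := by rw [hu]; ring
    rw [e1, e2, e3]
    linear_combination -σ * hb + (R' - 1) * σ * hle - σ * hμ + r₂ * ((l - Cb) / 3) * (R' - 1) * hσ

/-- The product `2 * W * b` is kept exactly: it is of the order of the energy's square root and
becomes harmless only after averaging over the branches (`avg_cross_nonpos`). -/
theorem dir_sq_bound {W b τ ρ p G F v : ℝ} (hρ : 1 ≤ ρ) (hp : 0 ≤ p) (hp1 : p ≤ 1) (hG : 0 ≤ G)
    (hF : G ^ 2 = F) (hW : |W| ≤ G) (hb : |b| ≤ 4 / 3 * ρ) (hτ : |τ| ≤ 12 * ρ ^ 2 * p * (G + 1))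
    (hv : v ≤ 4 * ρ ^ 3) :
    (W + b + τ) ^ 2 + v ≤ W ^ 2 + 2 * (W * b) + p * (400 * ρ ^ 4) * (F + 1) + 8 * ρ ^ 4 := by
  have h1 : (W + b) * τ ≤ (2 * ρ * (G + 1)) * (12 * ρ ^ 2 * p * (G + 1)) := by
    refine (le_abs_self _).trans ?_
    rw [abs_mul]
    refine mul_le_mul ((abs_add_le _ _).trans ?_) hτ (abs_nonneg _) (by positivity)
    nlinarith
  have hρ34 : ρ ^ 3 ≤ ρ ^ 4 := pow_le_pow_right₀ hρ (by norm_num)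
  have hρ24 : ρ ^ 2 ≤ ρ ^ 4 := pow_le_pow_right₀ hρ (by norm_num)
  have hG1 : (G + 1) ^ 2 ≤ 2 * (F + 1) := by nlinarith [sq_nonneg (G - 1)]
  have hF0 : 0 ≤ F := hF ▸ sq_nonneg G
  have h2 : (2 * ρ * (G + 1)) * (12 * ρ ^ 2 * p * (G + 1)) ≤ 48 * (p * ρ ^ 4 * (F + 1)) := by
    calc _ = 24 * p * ρ ^ 3 * (G + 1) ^ 2 := by ring
      _ ≤ 24 * p * ρ ^ 4 * (2 * (F + 1)) := by gcongr
      _ = _ := by ring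
  have h3 : τ ^ 2 ≤ 288 * (p * ρ ^ 4 * (F + 1)) := by
    calc τ ^ 2 = |τ| ^ 2 := (sq_abs _).symm
      _ ≤ (12 * ρ ^ 2 * p * (G + 1)) ^ 2 := pow_le_pow_left₀ (abs_nonneg _) hτ 2
      _ = 144 * (p * p) * ρ ^ 4 * (G + 1) ^ 2 := by ring
      _ ≤ 144 * (p * 1) * ρ ^ 4 * (2 * (F + 1)) := by gcongr
      _ = _ := by ring
  have h4 : b ^ 2 ≤ 16 / 9 * ρ ^ 2 := by
    calc b ^ 2 = |b| ^ 2 := (sq_abs _).symm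
      _ ≤ (4 / 3 * ρ) ^ 2 := pow_le_pow_left₀ (abs_nonneg _) hb 2
      _ = _ := by ring
  have h5 : 0 ≤ p * ρ ^ 4 * (F + 1) := by positivity
  nlinarith

theorem bmean_dir_le (H : HitProb r₂ r₃ hr) (Q : LevelStep p ρ r₂ r₃ R R' μ lam Cb Cb' N l)
    (hs : ¬ s.Contradiction) (hl : s.left.card = l) {v : Fin N} (hv : v ∈ s.left) (k j : Color) :
    bmean (fun w => hr k (s.avail w)) (s.left.erase v)
        (fun A => stat (dirWt R' j) (s.hit v k A) ^ 2) ≤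
      stat (dirWt R j) s ^ 2 + 2 * (stat (dirWt R j) s * (R * share j k - dirWt R j (s.avail v))) +
        p * (400 * ρ ^ 4) * (energy R Cb s + 1) + 8 * ρ ^ 4 := by
  have hρ := Q.ρ_ge
  have hp := Q.p_nonneg
  have hF : Real.sqrt (energy R Cb s) ^ 2 = energy R Cb s := Real.sq_sqrt (energy_nonneg _ _ _)
  obtain ⟨τ, h1, h2⟩ := dirWt_mean H Q hs hl (Real.sqrt_nonneg _) hF v k j
  have hvar := bmean_stat_sq_le (hr := hr k) (k := k) (φ := dirWt R' j) (D := (ρ + 1) ^ 2) hp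
    (hitProb_var_le H Q (sq_nonneg _) (fun i hi => ?_) ?_) (sq_nonneg _) s hv 0
  · simp only [sub_zero] at hvar
    rw [h2] at hvar
    refine hvar.trans (dir_sq_bound hρ hp Q.p_le (Real.sqrt_nonneg _) hF
      ((energy_bounds R Cb s (Real.sqrt_nonneg _) hF).1 j) ?_ h1 ?_)
    · have b1 : |R * share j k| ≤ ρ * (2 / 3) := by
        rw [abs_mul, abs_of_nonneg Q.R_nonneg]
        exact mul_le_mul Q.R_le (abs_share_le _ _) (abs_nonneg _) (by linarith)
      exact (abs_sub _ _).trans (by linarith [abs_dirWt_le Q j (s.avail v)])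
    · calc p * N * (ρ + 1) ^ 2 ≤ ρ * (2 * ρ) ^ 2 := by
            refine mul_le_mul Q.pN ?_ (sq_nonneg _) (by linarith)
            exact pow_le_pow_left₀ (by linarith) (by linarith) 2
        _ = 4 * ρ ^ 3 := by ring
  · exact sq_le_sq' (by linarith [(abs_le.1 (dirWt_erase_sub Q j hi)).1])
      (abs_le.1 (dirWt_erase_sub Q j hi)).2
  · rw [dirWt_erase, dirWt_univ, sub_zero]
    have := abs_le.1 (abs_share_le j k)
    exact sq_le_sq' (by linarith) (by linarith)

theorem cardWt_sub_sq_le_one (i : ℕ) (M M' : Finset Color) :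
    (cardWt i M - cardWt i M') ^ 2 ≤ 1 := by
  unfold cardWt
  split_ifs <;> norm_num

/-- About `2 * lam ≤ 1` new unit lists are expected per step, the meaning of `lam_le`. If unit lists
exist, one of them is removed and the square does not grow in first order; if none exists, only a
bounded number is created apart from the deviation. -/
theorem bmean_unit_le (H : HitProb r₂ r₃ hr) (Q : LevelStep p ρ r₂ r₃ R R' μ lam Cb Cb' N l)
    (hs : ¬ s.Contradiction) (hl : s.left.card = l) {v : Fin N} (hv : v ∈ s.shortest) {k : Color}
    (hk : k ∈ s.avail v) :
    bmean (fun w => hr k (s.avail w)) (s.left.erase v)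
        (fun A => stat (cardWt 1) (s.hit v k A) ^ 2) ≤
      stat (cardWt 1) s ^ 2 + p * (100 * ρ ^ 4) * (energy R Cb s + 1) + 3 * ρ ^ 4 := by
  have hρ := Q.ρ_ge
  have hp := Q.p_nonneg
  set F := energy R Cb s with hFd
  have hF0 : 0 ≤ F := energy_nonneg _ _ _
  set G := Real.sqrt F with hGd
  have hG : 0 ≤ G := Real.sqrt_nonneg _
  have hF : G ^ 2 = F := Real.sq_sqrt hF0
  have hvl := (mem_shortest_iff.1 hv).1
  have hvar := bmean_stat_sq_le (hr := hr k) (k := k) (φ := cardWt 1) (D := 1) hp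
    (hitProb_var_le H Q zero_le_one (fun i _ => cardWt_sub_sq_le_one _ _ _) (cardWt_sub_sq_le_one _ _ _))
    zero_le_one s hvl 0
  simp only [sub_zero] at hvar
  rw [stat_hitProb H hs] at hvar
  simp only [cardWt_singleton, cardWt_erase, cardWt_univ] at hvar
  norm_num at hvar
  refine hvar.trans ?_
  have i1 := abs_le.1 (abs_cnt_erase_sub_le Q hs hl hG hF (k + 1))
  have i2 := abs_le.1 (abs_cnt_erase_sub_le Q hs hl hG hF (k + 2))
  have hlam := Q.lam_eq
  have hlam' := Q.lam_le
  have g2 := (energy_bounds R Cb s hG hF).2.1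
  set m := r₂ * ((cnt s (Finset.univ.erase (k + 1)) : ℝ) + cnt s (Finset.univ.erase (k + 2))) with hm
  have hm0 : 0 ≤ m := mul_nonneg Q.r₂_nonneg (by positivity)
  have hm1 : m ≤ 1 + 6 * (ρ * (p * G)) := by
    have e1 : m ≤ r₂ * (2 * ((l - Cb) / 3) + 2 * ((ρ + 2) * G)) :=
      mul_le_mul_of_nonneg_left (by linarith) Q.r₂_nonneg
    have e2 : r₂ * ((ρ + 2) * G) ≤ p * ((ρ + 2) * G) :=
      mul_le_mul_of_nonneg_right Q.r₂_le (by positivity)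
    have e3 : p * ((ρ + 2) * G) ≤ 3 * (ρ * (p * G)) := by
      have : 0 ≤ (ρ - 1) * (p * G) := mul_nonneg (by linarith) (mul_nonneg hp hG)
      nlinarith
    nlinarith
  have hρ4 : ρ ≤ ρ ^ 4 := by simpa using pow_le_pow_right₀ hρ (show 1 ≤ 4 by norm_num)
  have hρ24 : ρ ^ 2 ≤ ρ ^ 4 := pow_le_pow_right₀ hρ (by norm_num)
  have hpF : 0 ≤ p * F := mul_nonneg hp hF0
  have hbig : (6 * (ρ * (p * G))) ^ 2 ≤ 36 * (ρ ^ 4 * (p * F)) := by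
    calc _ = 36 * ρ ^ 2 * (p * p) * F := by rw [← hF]; ring
      _ ≤ 36 * ρ ^ 4 * (p * 1) * F := by
          have := Q.p_le
          gcongr
      _ = _ := by ring
  have hv2 : p * N ≤ ρ ^ 4 := Q.pN.trans hρ4
  have hh0 : 0 ≤ hr k (s.avail v) := H.nonneg _ _
  have htarget : 0 ≤ p * ρ ^ 4 := by positivity
  have htarget' : p * (100 * ρ ^ 4) * (F + 1) = 100 * (ρ ^ 4 * (p * F)) + 100 * (p * ρ ^ 4) := by
    ring
  have htarget2 : 0 ≤ ρ ^ 4 * (p * F) := by positivity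
  have hone : 1 ≤ ρ ^ 4 := one_le_pow₀ hρ
  by_cases hu : ∀ i, cnt s {i} = 0
  · have hC : stat (cardWt 1) s = 0 := by rw [stat_cardWt_one hs k, hu, hu, hu]; simp
    have h1 : cardWt 1 (s.avail v) = 0 := by
      rw [cardWt, if_neg]
      intro h
      obtain ⟨i, hi⟩ := Finset.card_eq_one.1 h
      have : 0 < cnt s {i} := Finset.card_pos.2 ⟨v, Finset.mem_filter.2 ⟨hvl, hi⟩⟩
      exact this.ne' (hu i)
    have hd : hr k (s.avail v) * (cardWt 1 ((s.avail v).erase k) - cardWt 1 (s.avail v)) ∈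
        Set.Icc (0 : ℝ) 1 := by
      have h2 : cardWt 1 ((s.avail v).erase k) ∈ Set.Icc (0 : ℝ) 1 := by
        unfold cardWt; split_ifs <;> norm_num
      rw [h1, sub_zero]
      exact ⟨mul_nonneg hh0 h2.1, mul_le_one₀ (H.le_one _ _) h2.1 h2.2⟩
    rw [hC]
    set d := hr k (s.avail v) * (cardWt 1 ((s.avail v).erase k) - cardWt 1 (s.avail v)) with hdd
    rw [h1]
    have hY : 0 ≤ 6 * (ρ * (p * G)) := by positivity
    have hsq : (0 + m - 0 - d) ^ 2 ≤ (1 + 6 * (ρ * (p * G))) ^ 2 :=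
      sq_le_sq' (by linarith [hd.2]) (by linarith [hd.1])
    have hsq2 : (1 + 6 * (ρ * (p * G))) ^ 2 ≤ 2 + 2 * (6 * (ρ * (p * G))) ^ 2 := by
      linarith [sq_nonneg (1 - 6 * (ρ * (p * G)))]
    linarith
  · obtain ⟨i, hi⟩ := avail_of_mem_shortest hs hu hv
    rw [hi, Finset.mem_singleton] at hk
    subst hk
    have hC1 : 1 ≤ stat (cardWt 1) s := by
      have h0 : ∀ w ∈ s.left, 0 ≤ cardWt 1 (s.avail w) := fun w _ => by
        unfold cardWt; split_ifs <;> norm_num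
      have := Finset.single_le_sum h0 hvl
      rw [hi, cardWt_singleton, if_pos rfl] at this
      exact this
    rw [hi, H.unit, cardWt_singleton]
    set C := stat (cardWt 1) s
    have g3 := (abs_le.1 g2).2
    have hX : 0 ≤ ρ * (p * G) := mul_nonneg (by linarith) (mul_nonneg hp hG)
    have hsq : (C + m - 1) ^ 2 ≤ (C + 6 * (ρ * (p * G))) ^ 2 :=
      sq_le_sq' (by linarith) (by linarith)
    have hcr : C * (ρ * (p * G)) ≤ ρ ^ 4 * (p * F) := by
      calc C * (ρ * (p * G)) ≤ G * (ρ * (p * G)) := mul_le_mul_of_nonneg_right g3 hX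
        _ = ρ * (p * F) := by rw [← hF]; ring
        _ ≤ _ := mul_le_mul_of_nonneg_right hρ4 hpF
    have hsq2 : (C + 6 * (ρ * (p * G))) ^ 2 =
      C ^ 2 + 12 * (C * (ρ * (p * G))) + (6 * (ρ * (p * G))) ^ 2 := by ring
    norm_num
    linarith

/-- Hits contract the deviation by `1 - r₃`. If the selected list is full, then all lists are, their
number is at least `Cb`, and the removal brings it down by one; the error is bounded. -/
theorem bmean_full_le (H : HitProb r₂ r₃ hr) (Q : LevelStep p ρ r₂ r₃ R R' μ lam Cb Cb' N l)
    (hs : ¬ s.Contradiction) (hl : s.left.card = l) {v : Fin N} (hv : v ∈ s.shortest) {k : Color}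
    (hk : k ∈ s.avail v) :
    bmean (fun w => hr k (s.avail w)) (s.left.erase v)
        (fun A => (stat (cardWt 3) (s.hit v k A) - Cb') ^ 2) ≤
      (stat (cardWt 3) s - Cb) ^ 2 + 2 * ρ ^ 4 := by
  have hρ := Q.ρ_ge
  have hp := Q.p_nonneg
  have hvl := (mem_shortest_iff.1 hv).1
  have hvar := bmean_stat_sq_le (hr := hr k) (k := k) (φ := cardWt 3) (D := 1) hp
    (hitProb_var_le H Q zero_le_one (fun i _ => cardWt_sub_sq_le_one _ _ _) (cardWt_sub_sq_le_one _ _ _))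
    zero_le_one s hvl Cb'
  refine hvar.trans ?_
  rw [stat_hitProb H hs, Q.Cb'_eq, stat_cardWt_three hs]
  simp only [cardWt_singleton, cardWt_erase, cardWt_univ]
  norm_num
  have hρ4 : ρ ≤ ρ ^ 4 := by simpa using pow_le_pow_right₀ hρ (show 1 ≤ 4 by norm_num)
  have hv2 : p * N ≤ ρ ^ 4 := Q.pN.trans hρ4
  have h0 := Q.r₃_nonneg
  have h1 : r₃ ≤ 1 := Q.r₃_le.trans Q.p_le
  set C : ℝ := (cnt s Finset.univ : ℝ) with hC
  have hsq : ∀ x : ℝ, ((1 - r₃) * x) ^ 2 ≤ x ^ 2 := by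
    intro x
    rw [mul_pow]
    exact mul_le_of_le_one_left (sq_nonneg _) (pow_le_one₀ (by linarith) (by linarith))
  by_cases h3 : (s.avail v).card = 3
  · have hall : ∀ w ∈ s.left, s.avail w = Finset.univ := fun w hw => by
      have := (mem_shortest_iff.1 hv).2 w hw
      rw [h3] at this
      exact Finset.card_eq_iff_eq_univ _ |>.1 (le_antisymm (card_avail_le s w) this)
    have hCl : C = l := by
      rw [hC, ← hl, cnt, Finset.filter_true_of_mem hall]
    have e1 : s.avail v = Finset.univ := hall v hvl
    have e2 : cardWt 3 ((Finset.univ : Finset Color).erase k) = 0 := by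
      rw [cardWt_erase]; norm_num
    rw [e1, H.triple, e2, cardWt_univ]
    norm_num
    have hU : 0 ≤ C - Cb := by rw [hCl]; linarith [Q.Cb_le]
    have e3 : C + -(r₃ * C) - 1 + r₃ - (1 - r₃) * Cb = (1 - r₃) * (C - Cb - 1) := by ring
    rw [e3]
    have hone : 1 ≤ ρ ^ 4 := one_le_pow₀ hρ
    nlinarith [hsq (C - Cb - 1)]
  · have e2 : cardWt 3 (s.avail v) = 0 := by rw [cardWt, if_neg h3]
    have e4 : cardWt 3 ((s.avail v).erase k) = 0 := by
      rw [cardWt, if_neg]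
      rw [Finset.card_erase_of_mem hk]
      have := card_avail_le s v
      omega
    rw [e2, e4]
    have e3 : C + -(r₃ * C) - 0 - hr k (s.avail v) * (0 - 0) - (1 - r₃) * Cb =
      (1 - r₃) * (C - Cb) := by ring
    rw [e3]
    nlinarith [hsq (C - Cb), one_le_pow₀ hρ (n := 4)]

/-- The expected change of the energy by a single step. -/
theorem bmean_energy_le (H : HitProb r₂ r₃ hr) (Q : LevelStep p ρ r₂ r₃ R R' μ lam Cb Cb' N l)
    (hs : ¬ s.Contradiction) (hl : s.left.card = l) {v : Fin N} (hv : v ∈ s.shortest) {k : Color}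
    (hk : k ∈ s.avail v) :
    bmean (fun w => hr k (s.avail w)) (s.left.erase v) (fun A => energy R' Cb' (s.hit v k A)) ≤
      energy R Cb s + 2 * ∑ j, stat (dirWt R j) s * (R * share j k - dirWt R j (s.avail v)) +
        p * (1300 * ρ ^ 4) * (energy R Cb s + 1) + 29 * ρ ^ 4 := by
  have hvl := (mem_shortest_iff.1 hv).1
  have h0 := bmean_dir_le H Q hs hl hvl k 0
  have h1 := bmean_dir_le H Q hs hl hvl k 1
  have h2 := bmean_dir_le H Q hs hl hvl k 2
  have h3 := bmean_unit_le H Q hs hl hv hk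
  have h4 := bmean_full_le H Q hs hl hv hk
  have e : energy R Cb s = stat (dirWt R 0) s ^ 2 + stat (dirWt R 1) s ^ 2 +
    stat (dirWt R 2) s ^ 2 + stat (cardWt 1) s ^ 2 + (stat (cardWt 3) s - Cb) ^ 2 := by
    rw [energy, Fin.sum_univ_three]
  have e' : bmean (fun w => hr k (s.avail w)) (s.left.erase v)
      (fun A => energy R' Cb' (s.hit v k A)) =
      bmean (fun w => hr k (s.avail w)) (s.left.erase v)
        (fun A => stat (dirWt R' 0) (s.hit v k A) ^ 2) +
      bmean (fun w => hr k (s.avail w)) (s.left.erase v)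
        (fun A => stat (dirWt R' 1) (s.hit v k A) ^ 2) +
      bmean (fun w => hr k (s.avail w)) (s.left.erase v)
        (fun A => stat (dirWt R' 2) (s.hit v k A) ^ 2) +
      bmean (fun w => hr k (s.avail w)) (s.left.erase v)
        (fun A => stat (cardWt 1) (s.hit v k A) ^ 2) +
      bmean (fun w => hr k (s.avail w)) (s.left.erase v)
        (fun A => (stat (cardWt 3) (s.hit v k A) - Cb') ^ 2) := by
    rw [← bmean_add, ← bmean_add, ← bmean_add, ← bmean_add]
    refine bmean_congr fun A _ => ?_
    rw [energy, Fin.sum_univ_three]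
  rw [e', Fin.sum_univ_three]
  set F := energy R Cb s
  linarith

end Dpll

/-! ### Negative feedback of the random choice of the vertex. -/

namespace Dpll

variable {N : ℕ}

variable {p ρ r₂ r₃ R R' μ lam Cb Cb' : ℝ} {l : ℕ} {hr : Color → Finset Color → ℝ} {s : Residual N}

/-- On average the branching does not increase an existing imbalance. -/
theorem avg_cross_nonpos (hs : ¬ s.Contradiction) (hR : 0 ≤ R) :
    avg s.shortest (fun v => avg (s.avail v) fun k =>
      ∑ j, stat (dirWt R j) s * (R * share j k - dirWt R j (s.avail v))) ≤ 0 := by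
  by_cases hu : ∀ i, cnt s {i} = 0
  -- At a list without colour `i` the two available colours have the mean share `-(1 / 2) * share j
  -- i`, which gives the factor `-(1 + R / 2)`; at a full list everything cancels.
  · have hpt : ∀ v ∈ s.shortest, avg (s.avail v) (fun k =>
        ∑ j, stat (dirWt R j) s * (R * share j k - dirWt R j (s.avail v))) =
        -(1 + R / 2) * ∑ j, stat (dirWt R j) s * dirWt R j (s.avail v) := by
      intro v hv
      have hvl := (mem_shortest_iff.1 hv).1
      rcases list_cases (s.avail v) with e | ⟨i, e⟩ | ⟨i, e⟩ | e
      · exact absurd ⟨v, hvl, e⟩ hs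
      · have : 0 < cnt s {i} := Finset.card_pos.2 ⟨v, Finset.mem_filter.2 ⟨hvl, e⟩⟩
        exact absurd (hu i) this.ne'
      · rw [e, avg, card_erase_color, sum_erase_color, ← Finset.sum_add_distrib, Finset.sum_div,
          Finset.mul_sum]
        refine Finset.sum_congr rfl fun j _ => ?_
        rw [dirWt_erase]
        have := share_sum j i
        linear_combination (norm := (push_cast; ring)) (stat (dirWt R j) s * R / 2) * this
      · rw [e, avg, Finset.sum_comm]
        have : ∀ j, ∑ k : Color, stat (dirWt R j) s * (R * share j k - dirWt R j Finset.univ) = 0 := by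
          intro j
          rw [dirWt_univ, Fin.sum_univ_three]
          have := share_sum j 0
          rw [zero_add, zero_add] at this
          linear_combination (stat (dirWt R j) s * R) * this
        rw [Finset.sum_eq_zero fun j _ => this j]
        simp [dirWt_univ]
    -- Without unit lists, a vertex that is not selected has a full list, to which `dirWt` gives the
    -- value zero. So the selected vertices carry the whole statistic, and the average becomes minus
    -- a sum of squares.
    have hz : ∀ j, ∑ v ∈ s.shortest, dirWt R j (s.avail v) = stat (dirWt R j) s := by
      intro j
      refine Finset.sum_subset s.shortest_subset fun w hw hw' => ?_
      rw [mem_shortest_iff] at hw'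
      push Not at hw'
      obtain ⟨u, hu1, hu2⟩ := hw' hw
      have h1 : 2 ≤ (s.avail u).card := by
        have := card_avail_pos hs hu1
        rcases Nat.lt_or_ge (s.avail u).card 2 with h | h
        · obtain ⟨i, hi⟩ := Finset.card_eq_one.1 (by omega : (s.avail u).card = 1)
          have : 0 < cnt s {i} := Finset.card_pos.2 ⟨u, Finset.mem_filter.2 ⟨hu1, hi⟩⟩
          exact absurd (hu i) this.ne'
        · exact h
      rw [dirWt, if_neg (by omega), if_neg (by omega)]
    refine (avg_mono fun v hv => (hpt v hv).le).trans ?_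
    rw [avg_const_mul, avg, Finset.sum_comm]
    simp only [← Finset.mul_sum, hz]
    refine mul_nonpos_of_nonpos_of_nonneg (by linarith) (div_nonneg ?_ (Nat.cast_nonneg _))
    exact Finset.sum_nonneg fun j _ => mul_self_nonneg _
  -- A unit list has only its own colour, and the two terms cancel.
  · have hpt : ∀ v ∈ s.shortest, avg (s.avail v) (fun k =>
        ∑ j, stat (dirWt R j) s * (R * share j k - dirWt R j (s.avail v))) = 0 := by
      intro v hv
      obtain ⟨i, hi⟩ := avail_of_mem_shortest hs hu hv
      rw [hi, avg]
      simp [dirWt_singleton]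
    refine (avg_mono fun v hv => (hpt v hv).le).trans ?_
    simp [avg]

theorem avail_nonempty (hs : ¬ s.Contradiction) {v : Fin N} (hv : v ∈ s.left) :
    (s.avail v).Nonempty := Finset.nonempty_iff_ne_empty.2 fun h => hs ⟨v, hv, h⟩

/-- The expected change of the energy at a node of the tree. -/
theorem avg_bmean_energy_le (H : HitProb r₂ r₃ hr)
    (Q : LevelStep p ρ r₂ r₃ R R' μ lam Cb Cb' N l)
    (hs : ¬ s.Contradiction) (hl : s.left.card = l) (hl0 : s.left.Nonempty) :
    avg s.shortest (fun v => avg (s.avail v) fun k =>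
      bmean (fun w => hr k (s.avail w)) (s.left.erase v) (fun A => energy R' Cb' (s.hit v k A))) ≤
      energy R Cb s + p * (1300 * ρ ^ 4) * (energy R Cb s + 1) + 29 * ρ ^ 4 := by
  have h1 : ∀ v ∈ s.shortest, avg (s.avail v) (fun k =>
      bmean (fun w => hr k (s.avail w)) (s.left.erase v) (fun A => energy R' Cb' (s.hit v k A))) ≤
      2 * avg (s.avail v) (fun k =>
        ∑ j, stat (dirWt R j) s * (R * share j k - dirWt R j (s.avail v))) +
      (energy R Cb s + p * (1300 * ρ ^ 4) * (energy R Cb s + 1) + 29 * ρ ^ 4) := by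
    intro v hv
    rw [← avg_const_mul, ← avg_const (avail_nonempty hs (s.shortest_subset hv))
      (energy R Cb s + p * (1300 * ρ ^ 4) * (energy R Cb s + 1) + 29 * ρ ^ 4), ← avg_add]
    refine avg_mono fun k hk => (bmean_energy_le H Q hs hl hv hk).trans (le_of_eq (by ring))
  refine (avg_mono h1).trans ?_
  rw [avg_add, avg_const_mul, avg_const (s.shortest_nonempty hl0)]
  linarith [avg_cross_nonpos (R := R) hs Q.R_nonneg]

end Dpll

/-! ### Exact list weights by level and the balanced trajectory. -/

namespace Dpll

/-- The weight per colour of the lists of at most two colours, `n` levels above the end. -/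
noncomputable def baseWt (p : ℝ) (n : ℕ) : ℝ := (1 - p / 3) ^ n / 2

/-- The weight of a list of all three colours, `n` levels above the end. -/
noncomputable def fullWt (p : ℝ) (n : ℕ) : ℝ := (3 * (1 - p / 3) ^ n - (1 - p) ^ n) / 2

/-- The weight of a list, `n` levels above the end. -/
noncomputable def levelWt (p : ℝ) (n : ℕ) (M : Finset Color) : ℝ :=
  if M.card = 3 then fullWt p n else M.card * baseWt p n

section weights

variable {p : ℝ}

theorem levelWt_singleton (p : ℝ) (n : ℕ) (j : Color) : levelWt p n {j} = baseWt p n := by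
  simp [levelWt]

theorem levelWt_erase (p : ℝ) (n : ℕ) (j : Color) :
    levelWt p n (Finset.univ.erase j) = 2 * baseWt p n := by
  simp [levelWt]

theorem levelWt_univ (p : ℝ) (n : ℕ) : levelWt p n Finset.univ = fullWt p n := by simp [levelWt]

theorem levelWt_empty (p : ℝ) (n : ℕ) : levelWt p n ∅ = 0 := by simp [levelWt]

theorem baseWt_pos (h1 : p < 1) (n : ℕ) : 0 < baseWt p n := by
  have : 0 < 1 - p / 3 := by linarith
  unfold baseWt; positivity

theorem pow_le_fullWt (h0 : 0 ≤ p) (h1 : p < 1) (n : ℕ) : (1 - p / 3) ^ n ≤ fullWt p n := by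
  have : (1 - p) ^ n ≤ (1 - p / 3) ^ n := pow_le_pow_left₀ (by linarith) (by linarith) n
  unfold fullWt; linarith

theorem fullWt_pos (h0 : 0 ≤ p) (h1 : p < 1) (n : ℕ) : 0 < fullWt p n :=
  (pow_pos (by linarith) n).trans_le (pow_le_fullWt h0 h1 n)

/-- A full list is hit by every colour and becomes a list of two colours, of weight `(1 - p / 3) ^
n`. -/
theorem fullWt_succ (p : ℝ) (n : ℕ) :
    fullWt p (n + 1) = (1 - p) * fullWt p n + p * (1 - p / 3) ^ n := by
  unfold fullWt; ring

theorem baseWt_succ (p : ℝ) (n : ℕ) : baseWt p (n + 1) = (1 - p / 3) * baseWt p n := by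
  unfold baseWt; ring

theorem two_mul_baseWt (p : ℝ) (n : ℕ) : 2 * baseWt p n = (1 - p / 3) ^ n := by
  unfold baseWt; ring

theorem fullWt_le_one (h0 : 0 ≤ p) (h1 : p < 1) (n : ℕ) : fullWt p n ≤ 1 := by
  induction n with
  | zero => norm_num [fullWt]
  | succ n ih =>
    rw [fullWt_succ]
    have : (1 - p / 3) ^ n ≤ 1 := pow_le_one₀ (by linarith) (by linarith)
    nlinarith

theorem fullWt_le_baseWt (h1 : p < 1) (n : ℕ) : fullWt p n ≤ 3 * baseWt p n := by
  have : 0 ≤ (1 - p) ^ n := pow_nonneg (by linarith) n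
  unfold fullWt baseWt; linarith

theorem levelWt_nonneg (h0 : 0 ≤ p) (h1 : p < 1) (n : ℕ) (M : Finset Color) : 0 ≤ levelWt p n M := by
  have h2 := fullWt_pos h0 h1 n
  have h3 := baseWt_pos h1 n
  unfold levelWt
  split_ifs <;> positivity

theorem levelWt_pos (h0 : 0 ≤ p) (h1 : p < 1) (n : ℕ) (M : Finset Color) (hM : M ≠ ∅) :
    0 < levelWt p n M := by
  have h2 := fullWt_pos h0 h1 n
  have h3 := baseWt_pos h1 n
  have h4 : 0 < M.card := Finset.card_pos.2 (Finset.nonempty_iff_ne_empty.2 hM)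
  unfold levelWt
  split_ifs <;> positivity

theorem levelWt_le (h1 : p < 1) (n : ℕ) (M : Finset Color) :
    levelWt p n M ≤ M.card * baseWt p n := by
  unfold levelWt
  split_ifs with h
  · rw [h]; exact fullWt_le_baseWt h1 n
  · exact le_rfl

theorem levelWt_zero_le_one (p : ℝ) (M : Finset Color) : levelWt p 0 M ≤ 1 := by
  rcases list_cases M with rfl | ⟨j, rfl⟩ | ⟨j, rfl⟩ | rfl
  · rw [levelWt_empty]; norm_num
  · rw [levelWt_singleton]; norm_num [baseWt]
  · rw [levelWt_erase]; norm_num [baseWt]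
  · rw [levelWt_univ]; norm_num [fullWt]

/-- Since the empty list has weight zero, the tilted law never hits `{k}`: contradictions are
conditioned away. A hit halves the weight of a list of two colours, which gives `p / (2 - p)`. -/
theorem hitProb_tiltProb (h0 : 0 ≤ p) (h1 : p < 1) (n : ℕ) :
    HitProb (p / (2 - p)) (p * (1 - p / 3) ^ n / fullWt p (n + 1)) (tiltProb p (levelWt p n)) where
  nonneg k M := by
    have a1 := mul_nonneg h0 (levelWt_nonneg h0 h1 n (M.erase k))
    have a2 := mul_nonneg (by linarith : 0 ≤ 1 - p) (levelWt_nonneg h0 h1 n M)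
    exact div_nonneg a1 (add_nonneg a1 a2)
  le_one k M := by
    have a1 := mul_nonneg h0 (levelWt_nonneg h0 h1 n (M.erase k))
    have a2 := mul_nonneg (by linarith : 0 ≤ 1 - p) (levelWt_nonneg h0 h1 n M)
    exact div_le_one_of_le₀ (by linarith) (add_nonneg a1 a2)
  unit k := by
    rw [tiltProb, show ({k} : Finset Color).erase k = ∅ by simp, levelWt_empty]
    simp
  pair k j h := by
    obtain ⟨i, hi⟩ := exists_erase_erase h
    have hy := (baseWt_pos h1 n).ne'
    have : (2 : ℝ) - p ≠ 0 := by linarith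
    rw [tiltProb, hi, levelWt_singleton, levelWt_erase,
      show p * baseWt p n + (1 - p) * (2 * baseWt p n) = (2 - p) * baseWt p n by ring,
      mul_div_mul_right _ _ hy]
  triple k := by
    rw [tiltProb, levelWt_erase, levelWt_univ, two_mul_baseWt, fullWt_succ, add_comm]

/-- The main part of the change of the weights, if the colour `k` is given to a vertex. -/
noncomputable def pull (k : Color) (M : Finset Color) : ℝ :=
  if M.card = 1 then (if k ∈ M then 1 else 0) - 1 / 3
  else if M.card = 2 then (if k ∈ M then 1 / 6 else -(1 / 3)) else 0

theorem pull_singleton (k l : Color) : pull k {l} = share k l := by simp [pull, share]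

theorem pull_erase (k l : Color) : pull k (Finset.univ.erase l) = -(1 / 2) * share k l := by
  rw [pull, card_erase_color, if_neg (by norm_num), if_pos rfl, share]
  by_cases h : k = l
  · simp [h]; norm_num
  · simp [h]; norm_num

theorem pull_univ (k : Color) : pull k Finset.univ = 0 := by simp [pull]

theorem pull_nonneg {k : Color} {M : Finset Color} (h : k ∈ M) : 0 ≤ pull k M := by
  unfold pull
  split_ifs <;> norm_num

theorem exp_neg_sub_sq_le {x : ℝ} (h0 : 0 ≤ x) (h1 : x ≤ 1 / 2) :
    Real.exp (-x - 2 * x ^ 2) ≤ 1 - x := by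
  have h2 : 0 < 1 - x := by linarith
  refine (Real.le_log_iff_exp_le h2).1 (le_trans ?_ (Real.one_sub_inv_le_log_of_pos h2))
  rw [le_sub_iff_add_le, ← le_sub_iff_add_le', inv_le_iff_one_le_mul₀ h2]
  nlinarith [mul_nonneg (mul_nonneg h0 h0) (sub_nonneg.2 h1)]

/-- Averaged over the three colours, a step changes the weight of level `n` exactly into that of
level `n + 1`. For an individual colour the ratio is `1 - u` against `1 - p / 3`, with `u = p` for
`{k}`, `u = p / 2` for a two-colour list containing `k`, and `u = 0` for nonempty lists without `k`;
`pull` is the first-order difference. -/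
theorem levelWt_step_ge (h0 : 0 ≤ p) (h1 : p ≤ 1 / 2) (n : ℕ) (k : Color) (M : Finset Color) :
    levelWt p (n + 1) M * Real.exp (-(p * pull k M) - 2 * p ^ 2) ≤
      p * levelWt p n (M.erase k) + (1 - p) * levelWt p n M := by
  have hp1 : p < 1 := by linarith
  have hy := baseWt_pos hp1 n
  have ha : 1 - p / 3 ≤ Real.exp (-(p / 3)) := by
    have := Real.add_one_le_exp (-(p / 3)); linarith
  have hne : ∀ x : ℝ, 0 < Real.exp x := Real.exp_pos
  have key : ∀ u : ℝ, 0 ≤ u → u ≤ p → (1 - p / 3) * Real.exp (-(u - p / 3) - 2 * p ^ 2) ≤ 1 - u := by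
    intro u hu hup
    calc (1 - p / 3) * Real.exp (-(u - p / 3) - 2 * p ^ 2) ≤
          Real.exp (-(p / 3)) * Real.exp (-(u - p / 3) - 2 * p ^ 2) :=
            mul_le_mul_of_nonneg_right ha (hne _).le
      _ = Real.exp (-u - 2 * p ^ 2) := by rw [← Real.exp_add]; ring_nf
      _ ≤ Real.exp (-u - 2 * u ^ 2) := Real.exp_le_exp.2 (by nlinarith)
      _ ≤ 1 - u := exp_neg_sub_sq_le hu (by linarith)
  rcases list_cases M with rfl | ⟨j, rfl⟩ | ⟨j, rfl⟩ | rfl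
  · simp [levelWt_empty]
  · by_cases h : k = j
    · subst h
      rw [levelWt_singleton, levelWt_singleton, pull_singleton, baseWt_succ,
        show ({k} : Finset Color).erase k = ∅ by simp, levelWt_empty, share, if_pos rfl]
      have := mul_le_mul_of_nonneg_left (key p h0 le_rfl) hy.le
      rw [show p * ((1 : ℝ) - 1 / 3) = p - p / 3 by ring]
      linarith
    · rw [Finset.erase_eq_of_notMem (by simpa using h), levelWt_singleton, levelWt_singleton,
        pull_singleton, baseWt_succ, share, if_neg h]
      have := mul_le_mul_of_nonneg_left (key 0 le_rfl h0) hy.le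
      rw [show p * ((0 : ℝ) - 1 / 3) = 0 - p / 3 by ring]
      linarith
  · by_cases h : k = j
    · subst h
      rw [Finset.erase_idem, levelWt_erase, levelWt_erase, pull_erase, baseWt_succ, share, if_pos rfl]
      have := mul_le_mul_of_nonneg_left (key 0 le_rfl h0) hy.le
      rw [show p * (-(1 / 2) * ((1 : ℝ) - 1 / 3)) = 0 - p / 3 by ring]
      linarith
    · obtain ⟨i, hi⟩ := exists_erase_erase (Ne.symm h)
      rw [hi, levelWt_erase, levelWt_erase, levelWt_singleton, pull_erase, baseWt_succ, share,
        if_neg h]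
      have := mul_le_mul_of_nonneg_left (key (p / 2) (by linarith) (by linarith)) hy.le
      rw [show p * (-(1 / 2) * ((0 : ℝ) - 1 / 3)) = p / 2 - p / 3 by ring]
      linarith
  · rw [levelWt_erase, levelWt_univ, levelWt_univ, pull_univ, two_mul_baseWt, mul_zero, neg_zero,
      zero_sub]
    have : fullWt p (n + 1) * Real.exp (-(2 * p ^ 2)) ≤ fullWt p (n + 1) * 1 :=
      mul_le_mul_of_nonneg_left (Real.exp_le_one_iff.2 (by nlinarith)) (fullWt_pos h0 hp1 _).le
    rw [fullWt_succ] at *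
    linarith

end weights

/-- The number of lists of three colours, `n` levels above the end, in the balanced case. -/
noncomputable def fullNum (N : ℕ) (p : ℝ) (T n : ℕ) : ℝ :=
  N * (1 - p) ^ T / fullWt p T * (fullWt p n / (1 - p) ^ n)

/-- The number of lists of three colours hit at a level, in the balanced case. -/
noncomputable def fullRate (N : ℕ) (p : ℝ) (T n : ℕ) : ℝ :=
  p * (N * (1 - p) ^ T / fullWt p T) / (1 - p / 3) * ((1 - p / 3) / (1 - p)) ^ n

/-- The number of lists of two colours of each kind that are hit at a level, in the balanced case. -/
noncomputable def pairRate (N : ℕ) (p : ℝ) (m T n : ℕ) : ℝ :=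
  p / (2 - p) * ((((m + n : ℕ) : ℝ) - fullNum N p T n) / 3)

/-- The weight of the lists of a single colour in the balance of the colours. -/
noncomputable def unitWt (N : ℕ) (p : ℝ) (m T n : ℕ) : ℝ :=
  (fullRate N p T n + pairRate N p m T n) / (1 + pairRate N p m T n)

section rates

variable {N m T n : ℕ} {c : ℝ}

/-- A range of the parameters in which the procedure stays balanced. -/
structure Balanced (c : ℝ) (N m T : ℕ) : Prop where
  c_ge : 13 ≤ c
  N_eq : m + T = N
  N_ge : 50 * c ≤ N
  T_le : c ^ 2 * T ≤ 27 / 10 * N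

theorem Balanced.N_pos (B : Balanced c N m T) : (0 : ℝ) < N := by linarith [B.c_ge, B.N_ge]

theorem Balanced.p_le (B : Balanced c N m T) : c / N ≤ 1 / 50 := by
  rw [div_le_iff₀ B.N_pos]; linarith [B.N_ge]

theorem Balanced.p_nonneg (B : Balanced c N m T) : 0 ≤ c / N := div_nonneg (by linarith [B.c_ge]) B.N_pos.le

theorem Balanced.pN (B : Balanced c N m T) : c / N * N = c := div_mul_cancel₀ _ B.N_pos.ne'

theorem Balanced.pT (B : Balanced c N m T) : c / N * T ≤ 1 / 2 := by
  have h1 := B.T_le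
  have h2 := B.c_ge
  have h3 : c * (c * T) ≤ c * (N / 2) := by nlinarith [B.N_pos]
  have h4 : c * T ≤ N / 2 := le_of_mul_le_mul_left h3 (by linarith)
  rw [div_mul_eq_mul_div, div_le_iff₀ B.N_pos]; linarith

theorem Balanced.fullNum_top (B : Balanced c N m T) : fullNum N (c / N) T T = N := by
  have h1 := B.p_nonneg
  have h2 := B.p_le
  have h3 : (1 - c / N) ^ T ≠ 0 := (pow_pos (by linarith) T).ne'
  have h4 := (fullWt_pos h1 (by linarith) T).ne'
  unfold fullNum
  generalize fullWt (c / N) T = z at *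
  field_simp

theorem Balanced.fullNum_succ (B : Balanced c N m T) (n : ℕ) : fullNum N (c / N) T (n + 1) =
    fullNum N (c / N) T n + fullRate N (c / N) T (n + 1) := by
  have h1 := B.p_nonneg
  have h2 := B.p_le
  have h3 : (1 - c / N) ≠ 0 := by linarith
  have h5 : (1 - c / N / 3) ≠ 0 := by linarith
  unfold fullNum fullRate
  rw [fullWt_succ]
  generalize (N * (1 - c / N) ^ T / fullWt (c / N) T) = b
  generalize fullWt (c / N) n = z
  rw [div_pow]
  generalize 1 - c / N / 3 = a at *
  generalize 1 - c / N = q at *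
  generalize c / N = p at *
  field_simp
  ring

theorem Balanced.fullRate_eq (B : Balanced c N m T) (n : ℕ) : fullRate N (c / N) T (n + 1) =
    c / N * (1 - c / N / 3) ^ n / fullWt (c / N) (n + 1) * fullNum N (c / N) T (n + 1) := by
  have h1 := B.p_nonneg
  have h2 := B.p_le
  have h3 : (1 - c / N) ≠ 0 := by linarith
  have h5 : (1 - c / N / 3) ≠ 0 := by linarith
  have h4 := (fullWt_pos h1 (by linarith) (n + 1)).ne'
  unfold fullNum fullRate
  generalize (N * (1 - c / N) ^ T / fullWt (c / N) T) = b
  generalize fullWt (c / N) (n + 1) = z at *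
  rw [div_pow]
  generalize 1 - c / N / 3 = a at *
  generalize 1 - c / N = q at *
  generalize c / N = p at *
  field_simp
  ring

theorem Balanced.fullRate_mono (B : Balanced c N m T) {n n' : ℕ} (h : n ≤ n') :
    fullRate N (c / N) T n ≤ fullRate N (c / N) T n' := by
  have h1 := B.p_nonneg
  have h2 := B.p_le
  have h3 : 0 < 1 - c / N := by linarith
  have h5 : 0 < 1 - c / N / 3 := by linarith
  have h4 := fullWt_pos h1 (by linarith) T
  unfold fullRate
  refine mul_le_mul_of_nonneg_left (pow_le_pow_right₀ ?_ h) (by positivity)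
  rw [one_le_div h3]; linarith

theorem Balanced.fullRate_le (B : Balanced c N m T) (h : n ≤ T) : fullRate N (c / N) T n ≤ 11 / 10 * c := by
  have h1 := B.p_nonneg
  have h2 := B.p_le
  have h3 : 0 < 1 - c / N := by linarith
  have h5 : 0 < 1 - c / N / 3 := by linarith
  have h4 := pow_le_fullWt h1 (by linarith) T
  have h6 := fullWt_pos h1 (by linarith) T
  refine (B.fullRate_mono h).trans ?_
  have e : fullRate N (c / N) T T = c / (1 - c / N / 3) * ((1 - c / N / 3) ^ T / fullWt (c / N) T) := by
    have e1 : c / N * (N * (1 - c / N) ^ T / fullWt (c / N) T) =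
        c * ((1 - c / N) ^ T / fullWt (c / N) T) := by
      rw [← mul_div_assoc, ← mul_assoc, B.pN, mul_div_assoc]
    have h7 : (1 - c / N) ^ T ≠ 0 := (pow_pos h3 T).ne'
    rw [fullRate, e1, div_pow]
    generalize fullWt (c / N) T = z at *
    generalize 1 - c / N / 3 = a at *
    generalize 1 - c / N = q at *
    field_simp
  have h7 : (1 - c / N / 3) ^ T / fullWt (c / N) T ≤ 1 := div_le_one_of_le₀ h4 h6.le
  have h8 : c / (1 - c / N / 3) ≤ 11 / 10 * c := by
    rw [div_le_iff₀ h5]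
    nlinarith [B.c_ge]
  have h9 : 0 ≤ c / (1 - c / N / 3) := div_nonneg (by linarith [B.c_ge]) h5.le
  rw [e]
  exact (mul_le_of_le_one_right h9 h7).trans h8

/-- Each level removes one vertex but at least one full list, so along the balanced trajectory the
number of short lists never becomes negative (`fullNum_bounds`). -/
theorem Balanced.one_le_fullRate (B : Balanced c N m T) (n : ℕ) : 1 ≤ fullRate N (c / N) T n := by
  have h1 := B.p_nonneg
  have h2 := B.p_le
  have h3 : 0 < 1 - c / N := by linarith
  have h5 : 0 < 1 - c / N / 3 := by linarith
  have h6 := fullWt_pos h1 (by linarith) T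
  refine le_trans ?_ (B.fullRate_mono (Nat.zero_le n))
  rw [fullRate, pow_zero, mul_one, ← mul_div_assoc, ← mul_assoc, B.pN, div_div, one_le_div (by positivity)]
  have h7 := one_add_mul_le_pow (a := -(c / N)) (by linarith) T
  have h8 := B.pT
  have h9 := fullWt_le_one h1 (by linarith) T
  have h10 : (1 : ℝ) / 2 ≤ (1 - c / N) ^ T := by
    rw [← sub_eq_add_neg] at h7; linarith
  have := B.c_ge
  nlinarith

theorem Balanced.fullNum_bounds (B : Balanced c N m T) {d : ℕ} (hd : d ≤ T) :
    0 ≤ ((m + (T - d) : ℕ) : ℝ) - fullNum N (c / N) T (T - d) ∧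
      ((m + (T - d) : ℕ) : ℝ) - fullNum N (c / N) T (T - d) ≤ d * (11 / 10 * c) := by
  induction d with
  | zero =>
    rw [Nat.sub_zero, B.N_eq, B.fullNum_top]
    simp
  | succ d ih =>
    have h1 := ih (by omega)
    obtain ⟨n, hn⟩ : ∃ n, T - d = n + 1 := ⟨T - d - 1, by omega⟩
    rw [hn, B.fullNum_succ] at h1
    rw [show T - (d + 1) = n by omega]
    have h2 := B.one_le_fullRate (n + 1)
    have h3 := B.fullRate_le (n := n + 1) (by omega)
    push_cast at h1 ⊢
    constructor <;> linarith

theorem Balanced.fullNum_le (B : Balanced c N m T) (h : n ≤ T) : fullNum N (c / N) T n ≤ ((m + n : ℕ) : ℝ) := by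
  have := (B.fullNum_bounds (d := T - n) (by omega)).1
  rw [show T - (T - n) = n by omega] at this
  linarith

theorem Balanced.pairRate_nonneg (B : Balanced c N m T) (h : n ≤ T) : 0 ≤ pairRate N (c / N) m T n := by
  have h1 := B.p_nonneg
  have h2 := B.p_le
  exact mul_nonneg (div_nonneg h1 (by linarith)) (by linarith [B.fullNum_le h])

/-- This is where `27 / 10` comes from: the short lists number at most `11 / 10 * c * T`, and `27 /
10 * (11 / 10) / 3 = 0.99` is half of `2 - 1 / 50`, while `p ≤ 1 / 50`. -/
theorem Balanced.pairRate_le (B : Balanced c N m T) (h : n ≤ T) : pairRate N (c / N) m T n ≤ 1 / 2 := by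
  have h1 := B.p_nonneg
  have h2 := B.p_le
  have h3 := (B.fullNum_bounds (d := T - n) (by omega)).2
  rw [show T - (T - n) = n by omega] at h3
  have h4 : ((T - n : ℕ) : ℝ) ≤ T := by exact_mod_cast Nat.sub_le T n
  have hc := B.c_ge
  have h5 : ((m + n : ℕ) : ℝ) - fullNum N (c / N) T n ≤ T * (11 / 10 * c) :=
    h3.trans (mul_le_mul_of_nonneg_right h4 (by linarith))
  have h6 : c / N * (T * (11 / 10 * c)) ≤ 297 / 100 := by
    have : c / N * (T * (11 / 10 * c)) = 11 / 10 * (c ^ 2 * T) / N := by ring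
    rw [this, div_le_iff₀ B.N_pos]
    linarith [B.T_le]
  rw [pairRate, div_mul_eq_mul_div, div_le_iff₀ (by linarith)]
  have := mul_le_mul_of_nonneg_left h5 h1
  linarith

theorem Balanced.fullRate_pred (B : Balanced c N m T) (n : ℕ) : fullRate N (c / N) T n =
    fullRate N (c / N) T (n + 1) * ((1 - c / N) / (1 - c / N / 3)) := by
  have h1 := B.p_nonneg
  have h2 := B.p_le
  have h3 : (1 - c / N) ≠ 0 := by linarith
  have h5 : (1 - c / N / 3) ≠ 0 := by linarith
  rw [fullRate, fullRate, pow_succ]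
  generalize ((1 - c / N / 3) / (1 - c / N)) ^ n = x
  generalize c / N * (N * (1 - c / N) ^ T / fullWt (c / N) T) = b
  generalize 1 - c / N / 3 = a at *
  generalize 1 - c / N = q at *
  field_simp

theorem Balanced.unitWt_nonneg (B : Balanced c N m T) (h : n ≤ T) : 0 ≤ unitWt N (c / N) m T n :=
  div_nonneg (by linarith [B.pairRate_nonneg h, B.one_le_fullRate n])
    (by linarith [B.pairRate_nonneg h])

theorem Balanced.unitWt_le (B : Balanced c N m T) (h : n ≤ T) : unitWt N (c / N) m T n ≤ 2 * c := by
  have h1 := B.pairRate_nonneg h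
  have h2 := B.fullRate_le h
  have h3 := B.c_ge
  rw [unitWt, div_le_iff₀ (by linarith)]
  nlinarith

theorem abs_ratio_sub_le {x y u v : ℝ} (hu : 0 ≤ u) (hv : 0 ≤ v) :
    |(x + u) / (1 + u) - (y + v) / (1 + v)| ≤ |x - y| + |y - 1| * |v - u| := by
  have h1 : (x + u) / (1 + u) - (y + v) / (1 + v) =
      (x - y) / (1 + u) + (y - 1) * (v - u) / ((1 + u) * (1 + v)) := by
    field_simp; ring
  rw [h1]
  refine (abs_add_le _ _).trans (add_le_add ?_ ?_)
  · rw [abs_div, abs_of_nonneg (by linarith : 0 ≤ 1 + u)]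
    exact div_le_self (abs_nonneg _) (by linarith)
  · rw [abs_div, abs_mul, abs_of_nonneg (by positivity : 0 ≤ (1 + u) * (1 + v))]
    exact div_le_self (by positivity) (by nlinarith)

theorem Balanced.abs_unitWt_sub_le (B : Balanced c N m T) (h : n + 1 ≤ T) :
    |unitWt N (c / N) m T n - unitWt N (c / N) m T (n + 1)| ≤ c / N * (2 * c) ^ 2 := by
  have h1 := B.p_nonneg
  have h2 := B.p_le
  have hc := B.c_ge
  have hμ := B.one_le_fullRate (n + 1)
  have hμ' := B.fullRate_le h
  refine (abs_ratio_sub_le (B.pairRate_nonneg (by omega)) (B.pairRate_nonneg h)).trans ?_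
  have e1 : pairRate N (c / N) m T (n + 1) - pairRate N (c / N) m T n =
      c / N / (2 - c / N) * ((1 - fullRate N (c / N) T (n + 1)) / 3) := by
    rw [pairRate, pairRate, B.fullNum_succ]
    push_cast
    ring
  have h5 : 0 < 1 - c / N / 3 := by linarith
  have e2 : fullRate N (c / N) T n - fullRate N (c / N) T (n + 1) =
      -(fullRate N (c / N) T (n + 1) * (c / N * (2 / 3) / (1 - c / N / 3))) := by
    rw [B.fullRate_pred]
    generalize fullRate N (c / N) T (n + 1) = μ
    generalize c / N = p at *
    have h6 : 3 - p ≠ 0 := by linarith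
    rw [show 1 - p / 3 = (3 - p) / 3 by ring]
    field_simp
    ring
  set μ := fullRate N (c / N) T (n + 1)
  set p := c / N
  have b1 : p * (2 / 3) / (1 - p / 3) ≤ p * (7 / 10) := by
    rw [div_le_iff₀ h5]; nlinarith
  have b2 : |fullRate N p T n - μ| ≤ 11 / 10 * c * (p * (7 / 10)) := by
    rw [e2, abs_neg, abs_of_nonneg (by positivity)]
    exact mul_le_mul hμ' b1 (by positivity) (by linarith)
  have b3 : |μ - 1| ≤ 11 / 10 * c := by rw [abs_of_nonneg (by linarith)]; linarith
  have b4 : |pairRate N p m T (n + 1) - pairRate N p m T n| ≤ p * (11 / 10 * c / 3) := by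
    rw [e1, abs_mul, abs_of_nonneg (div_nonneg h1 (by linarith))]
    refine mul_le_mul (div_le_self h1 (by linarith)) ?_ (abs_nonneg _) h1
    rw [abs_div, abs_of_pos (by norm_num : (0 : ℝ) < 3), abs_sub_comm]
    exact div_le_div_of_nonneg_right b3 (by norm_num)
  have b5 := mul_le_mul b3 b4 (abs_nonneg _) (by linarith)
  have b6 : p * c ≤ p * c ^ 2 := mul_le_mul_of_nonneg_left (by nlinarith) h1
  nlinarith

theorem Balanced.levelStep (B : Balanced c N m T) (h : n + 1 ≤ T) :
    LevelStep (c / N) (2 * c) (c / N / (2 - c / N))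
      (c / N * (1 - c / N / 3) ^ n / fullWt (c / N) (n + 1))
      (unitWt N (c / N) m T (n + 1)) (unitWt N (c / N) m T n)
      (fullRate N (c / N) T (n + 1)) (pairRate N (c / N) m T (n + 1))
      (fullNum N (c / N) T (n + 1)) (fullNum N (c / N) T n) N (m + (n + 1)) := by
  have h1 := B.p_nonneg
  have h2 := B.p_le
  have hc := B.c_ge
  have hl := B.pairRate_nonneg h
  have hz := fullWt_pos h1 (by linarith) (n + 1)
  have ha : 0 < 1 - c / N / 3 := by linarith
  have hq : (1 - c / N) ≠ 0 := by linarith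
  have hle : (1 - c / N / 3) ^ n ≤ fullWt (c / N) (n + 1) := by
    rw [fullWt_succ]
    nlinarith [pow_le_fullWt h1 (by linarith : c / N < 1) n]
  refine ⟨h1, by linarith, by linarith, by rw [B.pN]; linarith, div_nonneg h1 (by linarith),
    div_le_self h1 (by linarith), by positivity, ?_, B.unitWt_nonneg h, B.unitWt_le h,
    B.unitWt_nonneg (by omega), B.unitWt_le (by omega), B.abs_unitWt_sub_le h, ?_, rfl, hl,
    B.pairRate_le h, B.fullRate_eq n, ?_, B.fullNum_le h⟩
  · rw [mul_div_assoc]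
    exact mul_le_of_le_one_right h1 (div_le_one_of_le₀ hle hz.le)
  · rw [unitWt, div_mul_cancel₀ _ (by linarith)]
  · have := B.fullNum_succ n
    have h3 := B.fullRate_eq n
    linarith

end rates

end Dpll

/-! ### Lower bound for the alive nodes by induction over the levels. -/

namespace Dpll

variable {N : ℕ}

theorem stat_pull {s : Residual N} (hs : ¬ s.Contradiction) (R : ℝ) (k : Color) :
    stat (pull k) s = (1 + R / 2) * (cnt s {k} * share k k + cnt s {k + 1} * share k (k + 1) +
      cnt s {k + 2} * share k (k + 2)) - stat (dirWt R k) s / 2 := by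
  rw [stat_dirWt hs R k k, stat_eq hs _ k]
  simp only [pull_singleton, pull_erase, pull_univ]
  ring

theorem stat_pull_le {ρ R Cb : ℝ} {s : Residual N} (hs : ¬ s.Contradiction) (hρ : 1 ≤ ρ)
    (hR0 : 0 ≤ R) (hR : R ≤ ρ) (k : Color) :
    stat (pull k) s ≤ 2 * ρ * Real.sqrt (energy R Cb s) := by
  set G := Real.sqrt (energy R Cb s) with hG
  have hG0 : 0 ≤ G := Real.sqrt_nonneg _
  obtain ⟨g1, g2, -⟩ := energy_bounds R Cb s hG0 (Real.sq_sqrt (energy_nonneg _ _ _))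
  rw [stat_cardWt_one hs k] at g2
  have h1 := abs_weighted_share_le (Nat.cast_nonneg _) (Nat.cast_nonneg _) (Nat.cast_nonneg _) g2
    (abs_share_le k k) (abs_share_le k (k + 1)) (abs_share_le k (k + 2))
  rw [stat_pull hs R k]
  have h2 := mul_le_mul_of_nonneg_left (abs_le.1 h1).2 (by linarith : 0 ≤ 1 + R / 2)
  have h3 := (abs_le.1 (g1 k)).1
  nlinarith

/-- Trades the square root for a linear term; with `x = η * N` the constant part is a small loss per
level and the energy gets a coefficient of order `1 / N`. -/
theorem sqrt_le_add_div {F x : ℝ} (hF : 0 ≤ F) (hx : 0 < x) : Real.sqrt F ≤ x + F / x := by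
  rw [Real.sqrt_le_left (by positivity)]
  have h1 : x * (F / x) = F := mul_div_cancel₀ _ hx.ne'
  nlinarith [sq_nonneg x, sq_nonneg (F / x)]

/-- The weighted number of the instances that arise from `s` by giving `k` to `v`. -/
theorem prod_levelWt_ge {p ρ R Cb η : ℝ} {s : Residual N} (hs : ¬ s.Contradiction) (hp0 : 0 ≤ p)
    (hp1 : p ≤ 1 / 2) (hpN : p * N ≤ ρ) (hρ : 1 ≤ ρ) (hR0 : 0 ≤ R) (hR : R ≤ ρ) (hη : 0 < η)
    (hN : 0 < N) (n : ℕ) {v : Fin N} (hv : v ∈ s.left) {k : Color} (hk : k ∈ s.avail v) :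
    (∏ w ∈ s.left.erase v, levelWt p (n + 1) (s.avail w)) *
        Real.exp (-(2 * ρ ^ 2 * η + 2 * p * ρ + 2 * ρ * p / (η * N) * energy R Cb s)) ≤
      ∏ w ∈ s.left.erase v, (p * levelWt p n ((s.avail w).erase k) + (1 - p) * levelWt p n (s.avail w)) := by
  have hN' : (0 : ℝ) < N := by exact_mod_cast hN
  have h1 : ∏ w ∈ s.left.erase v,
      (levelWt p (n + 1) (s.avail w) * Real.exp (-(p * pull k (s.avail w)) - 2 * p ^ 2)) ≤
      ∏ w ∈ s.left.erase v,
        (p * levelWt p n ((s.avail w).erase k) + (1 - p) * levelWt p n (s.avail w)) :=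
    Finset.prod_le_prod (fun w _ => mul_nonneg (levelWt_nonneg hp0 (by linarith) _ _)
      (Real.exp_pos _).le) fun w _ => levelWt_step_ge hp0 hp1 n k _
  refine le_trans ?_ h1
  rw [Finset.prod_mul_distrib, ← Real.exp_sum]
  refine mul_le_mul_of_nonneg_left (Real.exp_le_exp.2 ?_)
    (Finset.prod_nonneg fun w _ => levelWt_nonneg hp0 (by linarith) _ _)
  rw [Finset.sum_sub_distrib, Finset.sum_neg_distrib, ← Finset.mul_sum, Finset.sum_const, nsmul_eq_mul]
  have h2 : ∑ w ∈ s.left.erase v, pull k (s.avail w) ≤ stat (pull k) s := by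
    rw [stat, ← Finset.add_sum_erase _ _ hv]
    linarith [pull_nonneg hk]
  have h3 := h2.trans (stat_pull_le (Cb := Cb) hs hρ hR0 hR k)
  set F := energy R Cb s
  have hF0 : 0 ≤ F := energy_nonneg _ _ _
  have h4 := sqrt_le_add_div hF0 (mul_pos hη hN')
  have h5 : p * ∑ w ∈ s.left.erase v, pull k (s.avail w) ≤ p * (2 * ρ * (η * N + F / (η * N))) := by
    refine mul_le_mul_of_nonneg_left (h3.trans ?_) hp0
    exact mul_le_mul_of_nonneg_left h4 (by linarith)
  have h6 : ((s.left.erase v).card : ℝ) * (2 * p ^ 2) ≤ 2 * p * ρ := by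
    have : ((s.left.erase v).card : ℝ) ≤ N := by
      exact_mod_cast (by simpa using Finset.card_le_univ (s.left.erase v))
    calc _ ≤ N * (2 * p ^ 2) := mul_le_mul_of_nonneg_right this (by positivity)
      _ = 2 * p * (p * N) := by ring
      _ ≤ _ := mul_le_mul_of_nonneg_left hpN (by linarith)
  have h7 : p * (2 * ρ * (η * N + F / (η * N))) ≤ 2 * ρ ^ 2 * η + 2 * ρ * p / (η * N) * F := by
    have e : p * (2 * ρ * (η * N + F / (η * N))) =
        2 * ρ * η * (p * N) + 2 * ρ * p / (η * N) * F := by ring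
    rw [e]
    have := mul_le_mul_of_nonneg_left hpN (by positivity : 0 ≤ 2 * ρ * η)
    nlinarith
  linarith

variable {c : ℝ} {m T n : ℕ}

/-- A lower bound for the expected number of alive nodes with `m` remaining vertices. -/
def AliveBound (c : ℝ) (N m T n : ℕ) (κ γ A : ℝ) : Prop :=
  ∀ s : Residual N, ¬ s.Contradiction → s.left.card = m + n →
    κ * listWt (levelWt (c / N) n) s *
      Real.exp (-γ - A * energy (unitWt N (c / N) m T n) (fullNum N (c / N) T n) s) ≤
    mean (c / N) (aliveAt m) s

theorem AliveBound.zero (B : Balanced c N m T) : AliveBound c N m T 0 1 0 0 := by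
  intro s hs hl
  have h1 := B.p_nonneg
  have h2 := B.p_le
  rw [add_zero] at hl
  have h3 : listWt (levelWt (c / N) 0) s ≤ 1 :=
    Finset.prod_le_one (fun _ _ => levelWt_nonneg h1 (by linarith) _ _)
      fun _ _ => levelWt_zero_le_one _ _
  have h4 : aliveAt m s = 1 := by rw [aliveAt, if_pos ⟨hl, hs⟩]
  rw [mean_of_alive hs, h4, zero_mul, neg_zero, sub_zero, Real.exp_zero, one_mul, mul_one]
  have h5 : 0 ≤ (∑ v ∈ s.shortest, ∑ k ∈ s.avail v,
      step (c / N) s v k (mean (c / N) (aliveAt m))) / s.shortest.card := by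
    refine div_nonneg (Finset.sum_nonneg fun v _ => Finset.sum_nonneg fun k _ => ?_)
      (Nat.cast_nonneg _)
    exact step_nonneg h1 (by linarith) fun A _ => mean_nonneg h1 (by linarith) (aliveAt_nonneg m) _
  linarith

theorem sum_eq_card_mul_avg {α : Type*} {S : Finset α} (hS : S.Nonempty) (f : α → ℝ) :
    ∑ x ∈ S, f x = S.card * avg S f := by
  have : (S.card : ℝ) ≠ 0 := by exact_mod_cast hS.card_pos.ne'
  rw [avg, mul_div_cancel₀ _ this]

/-- The contribution of a colour of the selected vertex. -/
theorem le_step_of_aliveBound (B : Balanced c N m T) {κ γ A η : ℝ} (hκ : 0 < κ)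
    (hη : 0 < η) (hn : n + 1 ≤ T) (h : AliveBound c N m T n κ γ A) {s : Residual N}
    (hs : ¬ s.Contradiction) (hl : s.left.card = m + (n + 1)) {v : Fin N} (hv : v ∈ s.left)
    {k : Color} (hk : k ∈ s.avail v) :
    κ * (∏ w ∈ s.left.erase v, levelWt (c / N) (n + 1) (s.avail w)) *
      Real.exp (-(2 * (2 * c) ^ 2 * η + 2 * (c / N) * (2 * c) + 2 * (2 * c) * (c / N) / (η * N) *
          energy (unitWt N (c / N) m T (n + 1)) (fullNum N (c / N) T (n + 1)) s) - γ -
        A * bmean (fun w => tiltProb (c / N) (levelWt (c / N) n) k (s.avail w)) (s.left.erase v)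
          (fun E => energy (unitWt N (c / N) m T n) (fullNum N (c / N) T n) (s.hit v k E))) ≤
      step (c / N) s v k (mean (c / N) (aliveAt m)) := by
  have h1 := B.p_nonneg
  have h2 := B.p_le
  have hc := B.c_ge
  have hN : 0 < N := by exact_mod_cast B.N_pos
  set p := c / N with hp
  set R := unitWt N p m T n
  set Cb := fullNum N p T n
  set X := bmean (fun w => tiltProb p (levelWt p n) k (s.avail w)) (s.left.erase v)
    (fun E => energy R Cb (s.hit v k E)) with hX
  have h3 : step p s v k (fun s' => κ * (listWt (levelWt p n) s' *
      Real.exp (-γ - A * energy R Cb s'))) ≤ step p s v k (mean p (aliveAt m)) := by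
    refine step_le_step h1 (by linarith) fun E _ => ?_
    by_cases hd : (s.hit v k E).Contradiction
    · rw [listWt_eq_zero (levelWt_empty p n) hd, zero_mul, mul_zero]
      exact mean_nonneg h1 (by linarith) (aliveAt_nonneg m) _
    · rw [← mul_assoc]
      refine h _ hd ?_
      rw [Residual.hit_left, Finset.card_erase_of_mem hv, hl]
      omega
  refine le_trans ?_ h3
  rw [step_const_mul]
  have h4 := le_step_listWt_exp h1 (by linarith) (levelWt_nonneg h1 (by linarith) n)
    (fun M hM => levelWt_pos h1 (by linarith) n M hM) hs v k (fun s' => -γ - A * energy R Cb s')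
  have e1 : bmean (fun w => tiltProb p (levelWt p n) k (s.avail w)) (s.left.erase v)
      (fun E => -γ - A * energy R Cb (s.hit v k E)) = -γ - A * X := by
    have := bmean_add (r := fun w => tiltProb p (levelWt p n) k (s.avail w)) (S := s.left.erase v)
      (fun _ => -γ) (fun E => -A * energy R Cb (s.hit v k E))
    rw [bmean_const, bmean_const_mul] at this
    rw [show -γ - A * X = -γ + -A * X by ring, ← this]
    exact bmean_congr fun E _ => by ring
  rw [e1] at h4
  have h5 := prod_levelWt_ge (p := p) (ρ := 2 * c) (R := unitWt N p m T (n + 1))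
    (Cb := fullNum N p T (n + 1)) (η := η) hs h1 (by linarith) (by rw [hp, B.pN]; linarith)
    (by linarith) (B.unitWt_nonneg hn) (B.unitWt_le hn) hη hN n hv hk
  rw [mul_assoc]
  refine mul_le_mul_of_nonneg_left (le_trans ?_ h4) hκ.le
  rw [show ∀ a b d : ℝ, -a - b - d = -a + (-b - d) by intros; ring, Real.exp_add, ← mul_assoc]
  exact mul_le_mul_of_nonneg_right h5 (Real.exp_pos _).le

/-- The weight of the selected list is at most its number of colours times `baseWt`, and that number
of branches is summed; this explains the division of `κ` by `baseWt`. Jensen's inequality moves the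
averages over colours and vertices into the exponent, where `avg_bmean_energy_le` bounds the drift.
-/
theorem AliveBound.succ (B : Balanced c N m T) {κ γ γ' A A' η : ℝ} (hκ : 0 < κ) (hA : 0 ≤ A)
    (hη : 0 < η) (hn : n + 1 ≤ T) (h : AliveBound c N m T n κ γ A)
    (hγ : γ + (2 * (2 * c) ^ 2 * η + 2 * (c / N) * (2 * c)) +
      A * (c / N * (1300 * (2 * c) ^ 4) + 29 * (2 * c) ^ 4) ≤ γ')
    (hA' : A * (1 + c / N * (1300 * (2 * c) ^ 4)) + 2 * (2 * c) * (c / N) / (η * N) ≤ A') :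
    AliveBound c N m T (n + 1) (κ / baseWt (c / N) (n + 1)) γ' A' := by
  intro s hs hl
  have h1 := B.p_nonneg
  have h2 := B.p_le
  have hc := B.c_ge
  have hl0 : s.left.Nonempty := Finset.card_pos.1 (by omega)
  have hstep := fun (v : Fin N) (hv : v ∈ s.shortest) (k : Color) (hk : k ∈ s.avail v) =>
    le_step_of_aliveBound B hκ hη hn h hs hl (s.shortest_subset hv) hk
  have hdrift := avg_bmean_energy_le (hitProb_tiltProb h1 (by linarith) n) (B.levelStep hn) hs hl hl0
  set p := c / N with hp
  set F := energy (unitWt N p m T (n + 1)) (fullNum N p T (n + 1)) s with hF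
  have hF0 : 0 ≤ F := energy_nonneg _ _ _
  set X : Fin N → Color → ℝ := fun v k =>
    bmean (fun w => tiltProb p (levelWt p n) k (s.avail w)) (s.left.erase v)
      (fun E => energy (unitWt N p m T n) (fullNum N p T n) (s.hit v k E)) with hX
  set D := 2 * (2 * c) ^ 2 * η + 2 * p * (2 * c) + 2 * (2 * c) * p / (η * N) * F with hD
  have hy := baseWt_pos (p := p) (by linarith) (n + 1)
  set L := listWt (levelWt p (n + 1)) s with hLdef
  have hL0 : 0 ≤ L := listWt_nonneg (levelWt_nonneg h1 (by linarith) _) s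
  -- Jensen over the colours of `v`; the averages cannot be separated earlier because the drift is
  -- controlled only jointly.
  have hvert : ∀ v ∈ s.shortest, κ / baseWt p (n + 1) * L *
      Real.exp (-D - γ - A * avg (s.avail v) (X v)) ≤
      ∑ k ∈ s.avail v, step p s v k (mean p (aliveAt m)) := by
    intro v hv
    have hvl := s.shortest_subset hv
    have hne := avail_nonempty hs hvl
    have hLv : L = levelWt p (n + 1) (s.avail v) *
        ∏ w ∈ s.left.erase v, levelWt p (n + 1) (s.avail w) :=
      (Finset.mul_prod_erase _ _ hvl).symm
    set P := ∏ w ∈ s.left.erase v, levelWt p (n + 1) (s.avail w) with hP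
    have hP0 : 0 ≤ P := Finset.prod_nonneg fun w _ => levelWt_nonneg h1 (by linarith) _ _
    have e1 : Real.exp (-D - γ - A * avg (s.avail v) (X v)) ≤
        avg (s.avail v) fun k => Real.exp (-D - γ - A * X v k) := by
      have := exp_avg_le hne (fun k => (-D - γ) + -A * X v k)
      rw [avg_add, avg_const hne, avg_const_mul] at this
      simpa only [neg_mul, ← sub_eq_add_neg] using this
    calc κ / baseWt p (n + 1) * L * Real.exp (-D - γ - A * avg (s.avail v) (X v))
        ≤ κ / baseWt p (n + 1) * (((s.avail v).card * baseWt p (n + 1)) * P) *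
          avg (s.avail v) (fun k => Real.exp (-D - γ - A * X v k)) := by
          rw [hLv]
          refine mul_le_mul ?_ e1 (Real.exp_pos _).le ?_
          · refine mul_le_mul_of_nonneg_left ?_ (div_nonneg hκ.le hy.le)
            exact mul_le_mul_of_nonneg_right (levelWt_le (by linarith) _ _) hP0
          · positivity
      _ = (s.avail v).card * avg (s.avail v)
            (fun k => κ * P * Real.exp (-D - γ - A * X v k)) := by
          rw [avg_const_mul]
          field_simp
      _ = ∑ k ∈ s.avail v, κ * P * Real.exp (-D - γ - A * X v k) :=
          (sum_eq_card_mul_avg hne _).symm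
      _ ≤ _ := Finset.sum_le_sum fun k hk => hstep v hv k hk
  have hshort := s.shortest_nonempty hl0
  -- Jensen over the selected vertices, then the joint drift.
  have e2 : Real.exp (-γ' - A' * F) ≤ avg s.shortest fun v =>
      Real.exp (-D - γ - A * avg (s.avail v) (X v)) := by
    have := exp_avg_le hshort (fun v => (-D - γ) + -A * avg (s.avail v) (X v))
    rw [avg_add, avg_const hshort, avg_const_mul] at this
    simp only [neg_mul, ← sub_eq_add_neg] at this
    refine le_trans (Real.exp_le_exp.2 ?_) this
    have a1 := mul_le_mul_of_nonneg_left hdrift hA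
    have a2 := mul_le_mul_of_nonneg_right hA' hF0
    linarith
  calc κ / baseWt p (n + 1) * L * Real.exp (-γ' - A' * F) ≤
      κ / baseWt p (n + 1) * L * avg s.shortest fun v =>
        Real.exp (-D - γ - A * avg (s.avail v) (X v)) :=
        mul_le_mul_of_nonneg_left e2 (mul_nonneg (div_nonneg hκ.le hy.le) hL0)
    _ = avg s.shortest fun v => κ / baseWt p (n + 1) * L *
        Real.exp (-D - γ - A * avg (s.avail v) (X v)) := (avg_const_mul _ _).symm
    _ ≤ avg s.shortest fun v => ∑ k ∈ s.avail v, step p s v k (mean p (aliveAt m)) :=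
        avg_mono hvert
    _ ≤ mean p (aliveAt m) s := by
        rw [mean_of_alive hs]
        exact le_add_of_nonneg_left (aliveAt_nonneg m s)

end Dpll

/-! ### Evaluation of the lower bound and location of the optimal height. -/

namespace Dpll

variable {N : ℕ} {c η : ℝ} {m T n : ℕ}

/-- The rate at which the coefficient of the energy grows. -/
noncomputable def energyRate (c : ℝ) : ℝ := 1300 * (2 * c) ^ 4

/-- The coefficient of the energy, up to the factor `c / N`. -/
noncomputable def energyCoeff (c η : ℝ) : ℝ := 4 * c / η * Real.exp (c * energyRate c)

/-- The loss at a level, up to the factor `c / N`. -/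
noncomputable def levelLoss (c η : ℝ) : ℝ :=
  4 * c + energyCoeff c η * (energyRate c + 29 * (2 * c) ^ 4)

/-- The energy coefficient receives `4 * c * p / (η * N)` per level and is multiplied by at most
`exp (c * energyRate c)` in total, so it stays of order `1 / N`. Hence a level loses `8 * c ^ 2 * η`
and a term of order `1 / N`. -/
theorem aliveBound (B : Balanced c N m T) (hη : 0 < η) (hn : n ≤ T) :
    AliveBound c N m T n (∏ i ∈ Finset.range n, (baseWt (c / N) (i + 1))⁻¹)
      (n * (8 * c ^ 2 * η + c / N * levelLoss c η))
      (4 * c * (c / N) / (η * N) * n * (1 + c / N * energyRate c) ^ n) := by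
  have h1 := B.p_nonneg
  have h2 := B.p_le
  have hc := B.c_ge
  have hN := B.N_pos
  have hK : 0 ≤ energyRate c := by unfold energyRate; positivity
  induction n with
  | zero => simpa using AliveBound.zero B
  | succ n ih =>
    have hn' : (n : ℝ) ≤ N := by
      have : n ≤ N := by have := B.N_eq; omega
      exact_mod_cast this
    set α := 4 * c * (c / N) / (η * N) with hα
    have hα0 : 0 ≤ α := by positivity
    set g := 1 + c / N * energyRate c with hg
    have hg1 : 1 ≤ g := by have := mul_nonneg h1 hK; linarith
    have hA0 : 0 ≤ α * n * g ^ n := by positivity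
    have hA : α * n * g ^ n ≤ c / N * energyCoeff c η := by
      have e1 : g ^ n ≤ Real.exp (c * energyRate c) := by
        calc g ^ n ≤ Real.exp (c / N * energyRate c) ^ n := by
              refine pow_le_pow_left₀ (by linarith) ?_ n
              have := Real.add_one_le_exp (c / N * energyRate c)
              linarith
          _ = Real.exp (n * (c / N * energyRate c)) := (Real.exp_nat_mul _ n).symm
          _ ≤ Real.exp (c * energyRate c) := by
              refine Real.exp_le_exp.2 ?_
              calc n * (c / N * energyRate c) ≤ N * (c / N * energyRate c) :=
                    mul_le_mul_of_nonneg_right hn' (mul_nonneg h1 hK)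
                _ = c / N * N * energyRate c := by ring
                _ = _ := by rw [B.pN]
      calc α * n * g ^ n ≤ α * N * Real.exp (c * energyRate c) := by gcongr
        _ = _ := by rw [hα, energyCoeff]; field_simp
    have := AliveBound.succ B (A' := α * ((n + 1 : ℕ) : ℝ) * g ^ (n + 1))
      (γ' := ((n + 1 : ℕ) : ℝ) * (8 * c ^ 2 * η + c / N * levelLoss c η)) (η := η)
      (Finset.prod_pos fun i _ => inv_pos.2 (baseWt_pos (by linarith) _)) hA0 hη hn (ih (by omega))
      ?_ ?_
    · rw [Finset.prod_range_succ, ← div_eq_mul_inv]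
      exact this
    · have e2 : α * n * g ^ n * (c / N * (1300 * (2 * c) ^ 4) + 29 * (2 * c) ^ 4) ≤
          c / N * energyCoeff c η * (energyRate c + 29 * (2 * c) ^ 4) := by
        have e3 : c / N * (1300 * (2 * c) ^ 4) ≤ energyRate c :=
          mul_le_of_le_one_left hK (by linarith)
        have e4 : 0 ≤ c / N * (1300 * (2 * c) ^ 4) := mul_nonneg h1 hK
        exact mul_le_mul hA (by linarith) (by positivity) (hA0.trans hA)
      have e5 : c / N * levelLoss c η = 2 * (c / N) * (2 * c) +
          c / N * energyCoeff c η * (energyRate c + 29 * (2 * c) ^ 4) := by unfold levelLoss; ring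
      push_cast
      linarith
    · have e1 : 2 * (2 * c) * (c / N) / (η * N) = α := by rw [hα]; ring
      have e2 : 1 + c / N * (1300 * (2 * c) ^ 4) = g := rfl
      have e3 : α ≤ α * g ^ (n + 1) := le_mul_of_one_le_right hα0 (one_le_pow₀ hg1)
      rw [e1, e2]
      push_cast
      have : α * n * g ^ n * g = α * n * g ^ (n + 1) := by ring
      rw [this]
      linarith

/-- Each factor is at least `2 * exp (p * i / 3)`, with `i` running from `1` to `n`; the sum of the
`i` exceeds `n ^ 2 / 2`. -/
theorem prod_baseWt_inv_ge {p : ℝ} (h0 : 0 ≤ p) (h1 : p < 1) (n : ℕ) :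
    Real.exp (n * Real.log 2 + p * n ^ 2 / 6) ≤
      ∏ i ∈ Finset.range n, (baseWt p (i + 1))⁻¹ := by
  induction n with
  | zero => simp
  | succ n ih =>
    rw [Finset.prod_range_succ]
    have e : (((n + 1 : ℕ) : ℝ)) * Real.log 2 + p * ((n + 1 : ℕ) : ℝ) ^ 2 / 6 =
        (n * Real.log 2 + p * n ^ 2 / 6) + (Real.log 2 + p * (2 * n + 1) / 6) := by
      push_cast; ring
    rw [e, Real.exp_add]
    refine mul_le_mul ih ?_ (Real.exp_pos _).le ((Real.exp_pos _).le.trans ih)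
    have h2 : (1 - p / 3) ^ (n + 1) ≤ Real.exp (-(p * (n + 1) / 3)) := by
      have : 1 - p / 3 ≤ Real.exp (-(p / 3)) := by
        have := Real.add_one_le_exp (-(p / 3)); linarith
      refine (pow_le_pow_left₀ (by linarith) this (n + 1)).trans (le_of_eq ?_)
      rw [← Real.exp_nat_mul]
      push_cast
      ring_nf
    rw [le_inv_comm₀ (Real.exp_pos _) (baseWt_pos h1 _), ← Real.exp_neg, neg_add, Real.exp_add,
      Real.exp_neg, Real.exp_log (by norm_num), baseWt]
    have h3 : Real.exp (-(p * (n + 1) / 3)) ≤ Real.exp (-(p * (2 * n + 1) / 6)) :=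
      Real.exp_le_exp.2 (by linarith)
    linarith

/-- Only `(1 - p / 3) ^ T` needs a second-order lower bound, with error `d`. The power `(1 - p) ^ T`
is subtracted and may be bounded by an exponential; doubling the error to `2 * d` keeps the
inequality. -/
theorem fullWt_ge {p : ℝ} (h0 : 0 ≤ p) (h1 : p ≤ 1 / 50) (hT : p * T ≤ 1 / 2) :
    tripleWt (p * T / 3) * Real.exp (-(4 / 9 * (T * p ^ 2))) ≤ fullWt p T := by
  set d := 2 / 9 * (T * p ^ 2) with hd
  have hd0 : 0 ≤ d := by positivity
  have hd1 : d ≤ 1 / 2 := by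
    have : d = 2 / 9 * p * (p * T) := by rw [hd]; ring
    rw [this]
    have := mul_nonneg h0 (Nat.cast_nonneg T : (0 : ℝ) ≤ T)
    nlinarith
  have ha : Real.exp (-(p * T / 3)) * Real.exp (-d) ≤ (1 - p / 3) ^ T := by
    have := pow_le_pow_left₀ (Real.exp_pos _).le
      (exp_neg_sub_sq_le (x := p / 3) (by linarith) (by linarith)) T
    refine le_trans (le_of_eq ?_) this
    rw [← Real.exp_nat_mul, ← Real.exp_add, hd]
    ring_nf
  have hq : (1 - p) ^ T ≤ Real.exp (-(3 * (p * T / 3))) := by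
    have : 1 - p ≤ Real.exp (-p) := by have := Real.add_one_le_exp (-p); linarith
    refine (pow_le_pow_left₀ (by linarith) this T).trans (le_of_eq ?_)
    rw [← Real.exp_nat_mul]
    ring_nf
  have e1 : Real.exp (-(4 / 9 * (T * p ^ 2))) = Real.exp (-d) * Real.exp (-d) := by
    rw [← Real.exp_add, hd]; ring_nf
  have hx : 1 / 2 ≤ Real.exp (-d) := by have := Real.add_one_le_exp (-d); linarith
  have hx1 : Real.exp (-d) ≤ 1 := Real.exp_le_one_iff.2 (by linarith)
  have hE : Real.exp (-(3 * (p * T / 3))) ≤ Real.exp (-(p * T / 3)) :=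
    Real.exp_le_exp.2 (by have := mul_nonneg h0 (Nat.cast_nonneg T : (0 : ℝ) ≤ T); linarith)
  have hE0 := Real.exp_pos (-(3 * (p * T / 3)))
  rw [tripleWt, e1, fullWt]
  generalize Real.exp (-d) = x at *
  generalize Real.exp (-(3 * (p * T / 3))) = E₃ at *
  generalize Real.exp (-(p * T / 3)) = E₁ at *
  have key : 0 ≤ (1 - x) * (3 * E₁ * x - E₃ * (1 + x)) := by
    refine mul_nonneg (by linarith) ?_
    have : E₃ * (1 + x) ≤ E₁ * (1 + x) := mul_le_mul_of_nonneg_right hE (by linarith)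
    nlinarith
  nlinarith

theorem exponent_eq_log_tripleWt {c t : ℝ} (hc : 0 ≤ c) (ht : 0 ≤ t) :
    exponent c t = t * Real.log 2 + c * t ^ 2 / 6 + Real.log (tripleWt (c * t / 3)) := by
  have h1 : 0 ≤ c * t / 3 := by positivity
  have h2 := exp_neg_two_mul_le h1
  rw [tripleWt_eq, Real.log_mul (Real.exp_pos _).ne' (by linarith), Real.log_exp,
    Real.log_div (by linarith) (by norm_num), exponent,
    show 2 * (c * t / 3) = 2 * c * t / 3 by ring]
  ring

theorem energy_initial (R : ℝ) : energy R N (Residual.initial N) = 0 := by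
  have h : ∀ φ, stat φ (Residual.initial N) = N * φ Finset.univ := by
    intro φ; simp [stat, Residual.initial]
  simp [energy, h, dirWt_univ, cardWt_univ]

/-- The expected number of alive nodes with `m` remaining vertices. -/
theorem mean_aliveAt_ge (B : Balanced c N m T) (hη : 0 < η) :
    Real.exp (N * (exponent c (T / N) - 8 * c ^ 2 * η) - c * (1 + levelLoss c η)) ≤
      mean (c / N) (aliveAt m) (Residual.initial N) := by
  have h1 := B.p_nonneg
  have h2 := B.p_le
  have hc := B.c_ge
  have hN := B.N_pos
  have hl : (Residual.initial N).left.card = m + T := by rw [B.N_eq]; simp [Residual.initial]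
  have h3 := aliveBound B hη le_rfl (Residual.initial N) not_contradiction_initial hl
  rw [B.fullNum_top, energy_initial, mul_zero, sub_zero] at h3
  have h4 : listWt (levelWt (c / N) T) (Residual.initial N) = fullWt (c / N) T ^ N := by
    simp [listWt, Residual.initial, levelWt_univ]
  rw [h4] at h3
  refine le_trans ?_ h3
  have hTN : (T : ℝ) ≤ N := by have := B.N_eq; exact_mod_cast (by omega : T ≤ N)
  have hloss : 0 ≤ levelLoss c η := by
    unfold levelLoss energyCoeff energyRate; positivity
  have hτ : c / N * T / 3 = c * (T / N) / 3 := by ring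
  have h5 := prod_baseWt_inv_ge h1 (by linarith) T
  have h6 := pow_le_pow_left₀ (mul_nonneg (tripleWt_pos (by positivity)).le (Real.exp_pos _).le)
    (fullWt_ge h1 h2 B.pT) N
  have h7 : tripleWt (c * (T / N) / 3) = Real.exp (Real.log (tripleWt (c * (T / N) / 3))) :=
    (Real.exp_log (tripleWt_pos (by positivity))).symm
  rw [hτ, h7, ← Real.exp_add, ← Real.exp_nat_mul] at h6
  refine le_trans ?_ (mul_le_mul_of_nonneg_right (mul_le_mul h5 h6 (Real.exp_pos _).le
    ((Real.exp_pos _).le.trans h5)) (Real.exp_pos _).le)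
  rw [← Real.exp_add, ← Real.exp_add]
  refine Real.exp_le_exp.2 ?_
  rw [exponent_eq_log_tripleWt (by linarith) (by positivity)]
  have e1 : N * (T / N * Real.log 2) = T * Real.log 2 := by field_simp
  have e2 : N * (c * (T / N : ℝ) ^ 2 / 6) = c / N * T ^ 2 / 6 := by field_simp
  have e3 : N * (4 / 9 * (T * (c / N) ^ 2)) ≤ c := by
    have : N * (4 / 9 * (T * (c / N) ^ 2)) = 4 / 9 * (c / N * T) * (c / N * N) := by ring
    rw [this, B.pN]
    nlinarith [B.pT]
  have e4 : T * (8 * c ^ 2 * η) ≤ N * (8 * c ^ 2 * η) :=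
    mul_le_mul_of_nonneg_right hTN (by positivity)
  have e5 : T * (c / N * levelLoss c η) ≤ c * levelLoss c η := by
    rw [← mul_assoc]
    refine mul_le_mul_of_nonneg_right ?_ hloss
    calc T * (c / N) ≤ N * (c / N) := mul_le_mul_of_nonneg_right hTN h1
      _ = c := by rw [mul_comm, B.pN]
  generalize Real.log (tripleWt (c * (T / N) / 3)) = L at *
  linarith

theorem exponent_eq_rate {c t : ℝ} (hc : 0 < c) (ht : 0 ≤ t) :
    exponent c t = 3 / c * rate 0 c (c * t / 3) := by
  rw [exponent_eq_log_tripleWt hc.le ht, rate]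
  field_simp
  ring

/-- With `x = 9 / (10 * c)` the product `c * lossRate x` is at least `0.9 * (1 - x) / (1 + x)`,
which exceeds `log 2 + x` because `x ≤ 9 / 130`. -/
theorem slope_neg {c : ℝ} (hc : 13 ≤ c) : slope 0 c (9 / 10 / c) < 0 := by
  have hc0 : 0 < c := by linarith
  set x := 9 / 10 / c with hx
  have hx0 : 0 < x := by positivity
  have hx1 : x ≤ 9 / 130 := by rw [hx, div_le_iff₀ hc0]; linarith
  have hcx : c * x = 9 / 10 := by rw [hx]; field_simp
  have h1 : Real.exp (-(2 * x)) ≤ 1 - 2 * x + 2 * x ^ 2 := by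
    have := Real.quadratic_le_exp_of_nonneg (x := 2 * x) (by linarith)
    rw [Real.exp_neg, inv_le_comm₀ (Real.exp_pos _) (by nlinarith)]
    refine le_trans ?_ this
    rw [inv_le_iff_one_le_mul₀ (by nlinarith)]
    nlinarith [sq_nonneg (x ^ 2)]
  set e := Real.exp (-(2 * x)) with he
  have he1 : e ≤ 1 := exp_neg_two_mul_le hx0.le
  have h2 : (x - x ^ 2) / (1 + x) ≤ lossRate x := by
    rw [lossRate, ← he, one_sub_div (by linarith), div_le_div_iff₀ (by linarith) (by linarith)]
    nlinarith
  have h3 : 9 / 10 * (1 - x) / (1 + x) ≤ c * lossRate x := by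
    have e1 : 9 / 10 * (1 - x) / (1 + x) = c * ((x - x ^ 2) / (1 + x)) := by
      rw [← hcx]; ring
    rw [e1]
    exact mul_le_mul_of_nonneg_left h2 hc0.le
  have h4 : Real.log 2 < 6932 / 10000 := by have := Real.log_two_lt_d9; linarith
  have h5 : 6932 / 10000 + x < 9 / 10 * (1 - x) / (1 + x) := by
    rw [lt_div_iff₀ (by linarith)]
    nlinarith
  rw [slope]
  linarith

/-- The supremum is attained at a small height. -/
theorem exists_small_exponent_eq_omegaH {c : ℝ} (hc : 263 / 20 ≤ c) :
    ∃ t, 0 < t ∧ t < 1 ∧ c ^ 2 * t ≤ 27 / 10 ∧ exponent c t = omegaH c := by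
  have hc0 : 0 < c := by linarith
  obtain ⟨⟨t, ht, h⟩, -⟩ := isGreatest_omegaH hc
  refine ⟨t, ht.1, ht.2, ?_, h⟩
  -- Otherwise the maximizer `θ` of `rate` lies beyond `9 / (10 * c)`. The slope is convex, negative
  -- at `9 / (10 * c)` and zero at `θ`, hence negative in between, so `rate` would be smaller at `θ`
  -- than at `9 / (10 * c)`.
  by_contra hcon
  push Not at hcon
  have hmax : ∀ θ ∈ Set.Ioo 0 (c / 3), rate 0 c θ ≤ rate 0 c (c * t / 3) := by
    intro θ hθ
    have hs : 3 * θ / c ∈ Set.Icc (0 : ℝ) 1 :=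
      ⟨div_nonneg (by linarith [hθ.1]) hc0.le, by rw [div_le_one hc0]; linarith [hθ.2]⟩
    have h1 := exponent_le_omegaH hc0 hs
    rw [← h, exponent_eq_rate hc0 hs.1, exponent_eq_rate hc0 ht.1.le,
      show c * (3 * θ / c) / 3 = θ by field_simp] at h1
    exact le_of_mul_le_mul_left h1 (by positivity)
  set θ := c * t / 3 with hθ
  have hθ0 : 0 < θ := by have := ht.1; positivity
  have hθ1 : θ < c / 3 := by rw [hθ]; nlinarith [ht.2]
  have hlt : 9 / 10 / c < θ := by
    rw [hθ, div_lt_iff₀ hc0]; nlinarith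
  have hz : slope 0 c θ = 0 := by
    have hloc : IsLocalMax (rate 0 c) θ :=
      Filter.eventually_of_mem (Ioo_mem_nhds hθ0 hθ1) hmax
    exact hloc.hasDerivAt_eq_zero (hasDerivAt_rate 0 c hθ0.le)
  have h1 : 0 < 9 / 10 / c := by positivity
  obtain ⟨ξ, hξ, hξ'⟩ := exists_hasDerivAt_eq_slope (rate 0 c) (slope 0 c) hlt
    (fun x hx => (hasDerivAt_rate 0 c (h1.le.trans hx.1)).continuousAt.continuousWithinAt)
    (fun x hx => hasDerivAt_rate 0 c (h1.le.trans hx.1.le))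
  have h2 := hmax (9 / 10 / c) ⟨h1, hlt.trans hθ1⟩
  have h3 : 0 ≤ slope 0 c ξ := by
    rw [hξ']; exact div_nonneg (by linarith) (by linarith)
  have hs := slope_neg (c := c) (by linarith)
  have hconv := (convexOn_slope 0 hc0.le).2 (Set.mem_Ici.2 h1.le) (Set.mem_Ici.2 hθ0.le)
    (div_nonneg (by linarith [hξ.2]) (by linarith) : 0 ≤ (θ - ξ) / (θ - 9 / 10 / c))
    (div_nonneg (by linarith [hξ.1]) (by linarith) : 0 ≤ (ξ - 9 / 10 / c) / (θ - 9 / 10 / c))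
    (by rw [← add_div, div_eq_one_iff_eq (by linarith)]; ring)
  have e1 : (θ - ξ) / (θ - 9 / 10 / c) * (9 / 10 / c) + (ξ - 9 / 10 / c) / (θ - 9 / 10 / c) * θ = ξ := by
    have : θ - 9 / 10 / c ≠ 0 := by linarith
    generalize 9 / 10 / c = y at *
    field_simp
    ring
  simp only [smul_eq_mul] at hconv
  rw [e1, hz, mul_zero, add_zero] at hconv
  have : (θ - ξ) / (θ - 9 / 10 / c) * slope 0 c (9 / 10 / c) < 0 :=
    mul_neg_of_pos_of_neg (div_pos (by linarith [hξ.2]) (by linarith)) hs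
  linarith

end Dpll

/-! ### The lower bound for the number of leaves and the conclusion. -/

namespace Dpll

open MeasureTheory Filter Asymptotics
open scoped ENNReal Topology

/-- The lower bound for the expected number of alive nodes at the optimal height. -/
theorem exists_mean_aliveAt_ge {c : ℝ} (hc : 263 / 20 ≤ c) {ε : ℝ} (hε : 0 < ε) :
    ∀ᶠ N : ℕ in atTop, ∃ m : ℕ,
      Real.exp (N * (omegaH c - ε)) ≤ mean (c / N) (aliveAt m) (Residual.initial N) := by
  have hc0 : 0 < c := by linarith
  obtain ⟨t, ht0, ht1, htc, ht⟩ := exists_small_exponent_eq_omegaH hc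
  have hcont : ContinuousAt (exponent c) t :=
    (exponent_continuousOn c hc0).continuousAt (Icc_mem_nhds ht0 ht1)
  have hlim : Tendsto (fun N : ℕ => ((⌊t * N⌋₊ : ℕ) : ℝ) / N) atTop (𝓝 t) :=
    (tendsto_nat_floor_mul_div_atTop ht0.le).comp tendsto_natCast_atTop_atTop
  have hexp : ∀ᶠ N : ℕ in atTop, omegaH c - ε / 4 < exponent c (((⌊t * N⌋₊ : ℕ) : ℝ) / N) :=
    (hcont.tendsto.comp hlim).eventually (lt_mem_nhds (by rw [ht]; linarith))
  set η := ε / (32 * c ^ 2) with hη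
  have hη0 : 0 < η := by positivity
  have e1 : 8 * c ^ 2 * η = ε / 4 := by rw [hη]; field_simp; norm_num
  filter_upwards [hexp, eventually_natCast_ge (50 * c),
    eventually_natCast_ge (c * (1 + levelLoss c η) / (ε / 4))] with N h1 h2 h3
  have hN : (0 : ℝ) < N := by linarith
  set T := ⌊t * N⌋₊ with hT
  have hT1 : (T : ℝ) ≤ t * N := Nat.floor_le (by positivity)
  have hTN : T ≤ N := by
    have : (T : ℝ) ≤ N := hT1.trans (by nlinarith)
    exact_mod_cast this
  have B : Balanced c N (N - T) T := ⟨by linarith, by omega, h2, by nlinarith [sq_nonneg c]⟩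
  refine ⟨N - T, le_trans (Real.exp_le_exp.2 ?_) (mean_aliveAt_ge B hη0)⟩
  rw [div_le_iff₀ (by positivity)] at h3
  rw [e1]
  have h4 := mul_lt_mul_of_pos_left h1 hN
  nlinarith

/-- The expected number of proper colourings is small. -/
theorem mean_aliveAt_zero_le {N : ℕ} {p : ℝ} (h0 : 0 ≤ p) (h1 : p ≤ 1) :
    mean p (aliveAt 0) (Residual.initial N) ≤
      3 ^ N * Real.exp (-(p * ((N : ℝ) ^ 2 / 6 - N / 2))) := by
  refine (mean_mono h0 h1 aliveAt_zero_le _).trans ?_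
  have := mean_decisionAt_le (N := N) h0 h1 (m := 0) (e := (N : ℝ) ^ 2 / 6 - N / 2)
    (by push_cast; ring_nf; rfl)
  simpa using this

/-- The lower bound for the expected number of leaves of the search tree. -/
theorem expected_leaves_lower {c : ℝ} (hc : 263 / 20 ≤ c)
    (hω : 2 * Real.log 3 < omegaH c + c / 6) {ε : ℝ} (hε : 0 < ε) :
    ∀ᶠ N : ℕ in atTop, ∀ ord : ColorOrder N,
      ENNReal.ofReal (Real.exp (N * (omegaH c - ε))) ≤ expected Outcome.leaves c N ord := by
  have hc0 : 0 < c := by linarith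
  set δ := min ε ((omegaH c + c / 6 - 2 * Real.log 3) / 2) with hδ
  have hδ0 : 0 < δ := lt_min hε (by linarith)
  have hδε : δ ≤ ε := min_le_left _ _
  have hδω : 2 * δ ≤ omegaH c + c / 6 - 2 * Real.log 3 := by
    have : δ ≤ _ := min_le_right _ _
    linarith
  filter_upwards [exists_mean_aliveAt_ge hc (half_pos hδ0), eventually_natCast_ge c,
    eventually_natCast_ge 1, eventually_natCast_ge ((c / 2 + Real.log 2) / (δ / 2))]
    with N hm hNc hN1 hN2 ord
  obtain ⟨m, hm⟩ := hm
  have hN : (0 : ℝ) < N := by linarith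
  have hN0 : 0 < N := by exact_mod_cast hN
  refine le_trans (ENNReal.ofReal_le_ofReal ?_) (le_expected_leaves c ord m)
  rw [edgeProb_eq hc0.le hN0 hNc]
  have h1 := mean_aliveAt_zero_le (N := N) (p := c / N) (by positivity) (by rwa [div_le_one hN])
  have h3 : (3 : ℝ) ^ N = Real.exp (N * Real.log 3) := by
    rw [Real.exp_nat_mul, Real.exp_log (by norm_num)]
  have h2 := mul_le_mul_of_nonneg_left h1 (by positivity : (0 : ℝ) ≤ 3 ^ N)
  rw [h3, ← Real.exp_add, ← Real.exp_add] at h2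
  rw [h3]
  have e1 : c / N * ((N : ℝ) ^ 2 / 6 - N / 2) = c / 6 * N - c / 2 := by field_simp
  rw [e1] at h2
  rw [div_le_iff₀ (by positivity)] at hN2
  have hlog2 := Real.log_nonneg (by norm_num : (1 : ℝ) ≤ 2)
  have key : ∀ x y : ℝ, y + Real.log 2 ≤ x → Real.exp y ≤ 1 / 2 * Real.exp x := by
    intro x y h
    have := Real.exp_le_exp.2 h
    rw [Real.exp_add, Real.exp_log (by norm_num)] at this
    linarith
  -- The colourable graphs cost at most half of the main term, since `δ` is at most half of the gap
  -- `omegaH c + c / 6 - 2 * log 3`; the other half of the main term exceeds the asserted bound.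
  have h4 := key (N * (omegaH c - δ / 2))
    (N * Real.log 3 + (N * Real.log 3 + -(c / 6 * N - c / 2))) (by nlinarith)
  have h5 := key (N * (omegaH c - δ / 2)) (N * (omegaH c - ε)) (by nlinarith)
  linarith

/-- The remainder is the logarithm of `a N` minus `N * ω`. The bounds for `ε = 1` make `a N`
eventually finite and positive, so that the logarithm can be undone. -/
theorem isExpRate_of_bounds {a : ℕ → ℝ≥0∞} {ω : ℝ}
    (hl : ∀ ε : ℝ, 0 < ε → ∀ᶠ N : ℕ in atTop, ENNReal.ofReal (Real.exp (N * (ω - ε))) ≤ a N)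
    (hu : ∀ ε : ℝ, 0 < ε → ∀ᶠ N : ℕ in atTop, a N ≤ ENNReal.ofReal (Real.exp (N * (ω + ε)))) :
    IsExpRate a ω := by
  have hbd : ∀ ε : ℝ, 0 < ε → ∀ᶠ N : ℕ in atTop, a N ≠ ⊤ ∧
      Real.exp (N * (ω - ε)) ≤ (a N).toReal ∧ (a N).toReal ≤ Real.exp (N * (ω + ε)) := by
    intro ε hε
    filter_upwards [hl ε hε, hu ε hε] with N h1 h2
    have h3 : a N ≠ ⊤ := ne_top_of_le_ne_top ENNReal.ofReal_ne_top h2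
    exact ⟨h3, (ENNReal.ofReal_le_iff_le_toReal h3).1 h1,
      ENNReal.toReal_le_of_le_ofReal (Real.exp_pos _).le h2⟩
  refine ⟨fun N => Real.log (a N).toReal - N * ω, ?_, ?_⟩
  · rw [isLittleO_iff]
    intro ε hε
    filter_upwards [hbd ε hε] with N h
    obtain ⟨-, h1, h2⟩ := h
    have h0 : 0 < (a N).toReal := (Real.exp_pos _).trans_le h1
    have h3 := (Real.le_log_iff_exp_le h0).2 h1
    have h4 := (Real.log_le_iff_le_exp h0).2 h2
    rw [Real.norm_eq_abs, Real.norm_eq_abs, abs_of_nonneg (Nat.cast_nonneg N : (0 : ℝ) ≤ N)]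
    refine abs_le.2 ⟨?_, ?_⟩ <;> linarith
  · filter_upwards [hbd 1 one_pos] with N h
    obtain ⟨h0, h1, -⟩ := h
    rw [add_sub_cancel, Real.exp_log ((Real.exp_pos _).trans_le h1), ENNReal.ofReal_toReal h0]

end Dpll

theorem theorem3 :
    ∃ cu : ℝ, 13.1538 ≤ cu ∧ cu < 13.1539 ∧
      (∀ c : ℝ, 0 < c → (Dpll.omegaH c + c / 6 = 2 * Real.log 3 ↔ c = cu)) ∧
      ∀ c : ℝ, cu < c →
        IsGreatest (Dpll.exponent c '' Set.Ioo 0 1) (Dpll.omegaH c) ∧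
        ∀ ord : (N : ℕ) → Dpll.ColorOrder N,
          Dpll.IsExpRate (fun N => Dpll.expected Dpll.Outcome.nodes c N (ord N))
            (Dpll.omegaH c) ∧
          Dpll.IsExpRate (fun N => Dpll.expected Dpll.Outcome.leaves c N (ord N))
            (Dpll.omegaH c) := by
  obtain ⟨cu, h1, h2, h3, h4⟩ := Dpll.exists_threshold
  refine ⟨cu, h1, h2, h3, fun c hcu => ?_⟩
  -- A convenient number below the threshold. The upper bound and the count of alive nodes need only
  -- this much; `cu < c` itself is used solely to discard the colourable graphs.
  have hc : 263 / 20 ≤ c := by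
    norm_num at h1
    linarith
  refine ⟨Dpll.isGreatest_omegaH hc, fun ord => ⟨?_, ?_⟩⟩
  · refine Dpll.isExpRate_of_bounds (fun ε hε => ?_) fun ε hε => ?_
    · filter_upwards [Dpll.expected_leaves_lower hc (h4 c hcu) hε] with N h
      exact (h (ord N)).trans (Dpll.expected_leaves_le_nodes c (ord N))
    · filter_upwards [Dpll.expected_nodes_upper hc hε] with N h
      exact h (ord N)
  · refine Dpll.isExpRate_of_bounds (fun ε hε => ?_) fun ε hε => ?_
    · filter_upwards [Dpll.expected_leaves_lower hc (h4 c hcu) hε] with N h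
      exact h (ord N)
    · filter_upwards [Dpll.expected_nodes_upper hc hε] with N h
      exact (Dpll.expected_leaves_le_nodes c (ord N)).trans (h (ord N))
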